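/- **Setting.** Let $\mathscr{M}=(\mathscr{M},\otimes,I)$ be a symmetric closed monoidal model category (complete and cocomplete, satisfying the pushout-product and unit axioms) in which every object is cofibrant; "set" means small set, for the universe for which $\mathscr{M}$ is locally small and (co)complete. For a set $X$, let $\mathcal{S}_X$ be the strict semi-2-category with set of objects $X$ whose 1-morphisms $A\to B$ are the chains $s=(E_0,\dots,E_n)$, $n\ge 1$, of elements of $X$ with $E_0=A$, $E_n=B$, composed by concatenation, and whose 2-morphisms $t\to s$ are the operations which delete letters of $t$, other than the two end letters, so as to obtain $s$ (two operations are equal if they keep the same positions). Let $\mathcal{K}_X=\prod_{(A,B)\in X^2}\mathrm{Hom}[\mathcal{S}_X(A,B)^{op},\mathscr{M}]$, and let $\mathscr{M}_{\mathcal{S}}(X)$ be the category of Pre-Co-Segal categories on $X$: lax morphisms $\mathcal{F}:(\mathcal{S}_X)^{2\text{-}op}\to\mathscr{M}$, that is objects $\mathcal{F}$ of $\mathcal{K}_X$ with natural and associative laxity maps $\mathcal{F}(s)\otimes\mathcal{F}(t)\to\mathcal{F}(s\cdot t)$ (no units), and natural transformations compatible with the laxity maps. Let $\mathcal{U}:\mathscr{M}_{\mathcal{S}}(X)\to\mathcal{K}_X$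 be the forgetful functor. Fibrations and weak equivalences in $\mathcal{K}_X$ and $\mathscr{M}_{\mathcal{S}}(X)$ are the levelwise ones, and cofibrations are the maps with the left lifting property against maps that are both. A function $f:X\to Y$ induces functors $f^\star:\mathscr{M}_{\mathcal{S}}(Y)\to\mathscr{M}_{\mathcal{S}}(X)$ and $f^\star:\mathcal{K}_Y\to\mathcal{K}_X$. Let $\mathscr{M}_{\mathcal{S}}(\mathrm{Set})$ be the category of pairs $(X,\mathcal{F})$ with $\mathcal{F}\in\mathscr{M}_{\mathcal{S}}(X)$, a morphism $(X,\mathcal{F})\to(Y,\mathcal{G})$ being a pair $(f,\sigma)$ of a function $f:X\to Y$ and a morphism $\sigma:\mathcal{F}\to f^\star\mathcal{G}$ of $\mathscr{M}_{\mathcal{S}}(X)$; define $\mathcal{K}_{\mathrm{Set}}$ likewise from the $\mathcal{K}_X$. **Theorem.** The functors $\mathcal{U}$ and $f^\star$ have left adjoints $\Gamma$ and $f_!$; the three classes above are model structures on every $\mathscr{M}_{\mathcal{S}}(X)$ and every $\mathcal{K}_X$ (the projective structures); and the following holds. 1. The category $\mathscr{M}_{\mathcal{S}}(\mathrm{Set})$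 is complete and cocomplete and has a model structure (fibered over $\mathrm{Set}$ with its minimal model structure, in which the weak equivalences are the bijections and all maps are fibrations and cofibrations) in which $(f,\sigma):(X,\mathcal{F})\to(Y,\mathcal{G})$ is * a weak equivalence iff $f$ is a bijection and $\sigma:\mathcal{F}\to f^\star\mathcal{G}$ is a weak equivalence of $\mathscr{M}_{\mathcal{S}}(X)$; * a cofibration iff the adjoint map $\widetilde\sigma:f_!\mathcal{F}\to\mathcal{G}$ is a cofibration of $\mathscr{M}_{\mathcal{S}}(Y)$; * a fibration iff $\sigma:\mathcal{F}\to f^\star\mathcal{G}$ is a fibration of $\mathscr{M}_{\mathcal{S}}(X)$. The same holds with $\mathcal{K}$ in place of $\mathscr{M}_{\mathcal{S}}$. 2. For $n\ge1$ let $s_n=(0,1,\dots,n)$, a chain on $\{0,\dots,n\}$; let $\delta(s_n,-):\mathscr{M}\to\mathcal{K}_{\{0,\dots,n\}}$ be the left adjoint of evaluation at $s_n$, so that $\delta(s_n,B)(t)=\coprod_{\mathrm{Hom}(t,s_n)}B$, and put $h(C_n;-)=\Gamma\,\delta(s_n,-)$. For a set $I$ of maps of $\mathscr{M}$ let $h(C_\bullet;I)=\{h(C_n;q):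 n\ge1,\ q\in I\}$. Let $I,J$ be sets of maps of $\mathscr{M}$ such that the trivial fibrations (respectively fibrations) of $\mathscr{M}$ are the maps with the right lifting property against $I$ (respectively $J$). Then in $\mathscr{M}_{\mathcal{S}}(\mathrm{Set})$: * the fibrations are the maps with the right lifting property against the set $h(C_\bullet;J)$; * $(f,\sigma)$ has the right lifting property against $h(C_\bullet;I)$ iff $\sigma$ is a trivial fibration of $\mathscr{M}_{\mathcal{S}}(X)$ ($f$ being arbitrary); * the trivial fibrations are the maps with the right lifting property against the set consisting of $h(C_\bullet;I)$ together with the two maps $\varnothing\to\{*\}$ and $\{0,1\}\to\{*\}$ between discrete objects, where the discrete object on a set $X$ is the initial object of $\mathscr{M}_{\mathcal{S}}(X)$. The same holds for $\mathcal{K}_{\mathrm{Set}}$, with $\delta(s_n,-)$ in place of $h(C_n;-)$ and the initial object of $\mathcal{K}_X$ in place of that of $\mathscr{M}_{\mathcal{S}}(X)$. 3. If $\mathscr{M}$ is locally presentable, then so are $\mathscr{M}_{\mathcal{S}}(\mathrm{Set})$ and $\mathcal{K}_{\mathrm{Set}}$. If moreover $\mathscr{M}$ is cofibrantly generated by $I$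 and $J$ (so that $\mathscr{M}$ is combinatorial), then the sets in 2 permit the small object argument; hence the model structures in 1 are cofibrantly generated by them, and are combinatorial. -/

import Mathlib

open CategoryTheory Limits MonoidalCategory HomotopicalAlgebra Opposite

universe v u

namespace CoSegal

/-! ### Chains: the semi-2-category attached to the coarse category on a set -/

/-- A 1-morphism from `A` to `B` in the strict semi-2-category attached to the coarse category on
the set `X`: a chain `(E₀, …, Eₙ)` of elements of `X` with `n ≥ 1`, `E₀ = A`, `Eₙ = B`.
The endpoints are not fixed in the type: `Chain X` collects the 1-morphisms for all pairs. -/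
structure Chain (X : Type v) : Type v where
  /-- the length `n` of the chain -/
  deg : ℕ
  deg_pos : 0 < deg
  /-- the letters `E₀, …, Eₙ` -/
  pt : Fin (deg + 1) → X

namespace Chain

variable {X Y Z : Type v}

/-- A 2-morphism `t ⟶ s`: an operation that deletes some letters of `t`, keeping the two end
letters, with result `s`. It is recorded by the positions `pos` in `t` of the letters that are
kept. (There is none if the end letters of `t` and `s` differ, so the category `Chain X` is the
disjoint union of the categories of 1-morphisms from `A` to `B`.) -/
@[ext]
structure Hom (t s : Chain X) where
  /-- position in `t` of the `i`-th letter of `s` -/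
  pos : Fin (s.deg + 1) → Fin (t.deg + 1)
  strictMono : StrictMono pos
  pos_zero : pos 0 = 0
  pos_last : pos (Fin.last s.deg) = Fin.last t.deg
  pt_pos : ∀ i, t.pt (pos i) = s.pt i

instance : Category (Chain X) where
  Hom := Hom
  id t := ⟨id, strictMono_id, rfl, rfl, fun _ => rfl⟩
  comp a b :=
    { pos := a.pos ∘ b.pos
      strictMono := a.strictMono.comp b.strictMono
      pos_zero := by simp [b.pos_zero, a.pos_zero]
      pos_last := by simp [b.pos_last, a.pos_last]
      pt_pos := fun i => by simp [a.pt_pos, b.pt_pos] }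

/-- The strict morphism of semi-2-categories induced by a function `f : X → Y`. -/
def map (f : X → Y) : Chain X ⥤ Chain Y where
  obj t := ⟨t.deg, t.deg_pos, f ∘ t.pt⟩
  map {t s} a :=
    { pos := Hom.pos (t := t) (s := s) a
      strictMono := Hom.strictMono (t := t) (s := s) a
      pos_zero := Hom.pos_zero (t := t) (s := s) a
      pos_last := Hom.pos_last (t := t) (s := s) a
      pt_pos := fun i => congrArg f (Hom.pt_pos (t := t) (s := s) a i) }

/-- `IsConcat s t u` says that the last letter of `s` is the first letter of `t` and that `u` is
the composite 1-morphism, that is the concatenation of `s` and `t` along this common letter. -/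
structure IsConcat (s t u : Chain X) : Prop where
  deg_eq : u.deg = s.deg + t.deg
  left : ∀ (i : Fin (s.deg + 1)) (k : Fin (u.deg + 1)), (k : ℕ) = i → u.pt k = s.pt i
  right : ∀ (j : Fin (t.deg + 1)) (k : Fin (u.deg + 1)), (k : ℕ) = s.deg + j → u.pt k = t.pt j

/-- For concatenations `u` of `s, t` and `u'` of `s', t'`, `IsHComp a b c` says that the
2-morphism `c : u ⟶ u'` is the horizontal composite of `a : s ⟶ s'` and `b : t ⟶ t'`. -/
structure IsHComp {s t u s' t' u' : Chain X} (a : s ⟶ s') (b : t ⟶ t') (c : u ⟶ u') : Prop where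
  left : ∀ (i : Fin (s'.deg + 1)) (k : Fin (u'.deg + 1)), (k : ℕ) = i →
    (Hom.pos c k : ℕ) = Hom.pos a i
  right : ∀ (j : Fin (t'.deg + 1)) (k : Fin (u'.deg + 1)), (k : ℕ) = s'.deg + j →
    (Hom.pos c k : ℕ) = s.deg + Hom.pos b j

lemma IsConcat.map (f : X → Y) {s t u : Chain X} (h : IsConcat s t u) :
    IsConcat ((Chain.map f).obj s) ((Chain.map f).obj t) ((Chain.map f).obj u) :=
  ⟨h.deg_eq, fun i k e => congrArg f (h.left i k e), fun j k e => congrArg f (h.right j k e)⟩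

lemma IsHComp.map (f : X → Y) {s t u s' t' u' : Chain X} {a : s ⟶ s'} {b : t ⟶ t'} {c : u ⟶ u'}
    (h : IsHComp a b c) :
    IsHComp ((Chain.map f).map a) ((Chain.map f).map b) ((Chain.map f).map c) :=
  ⟨h.left, h.right⟩

instance (t s : Chain X) : Finite (t ⟶ s) :=
  Finite.of_injective (fun a : t ⟶ s => Hom.pos a) (fun _ _ h => Hom.ext h)

/-- The chain `(0, 1, …, n)` of length `n ≥ 1` on the set `{0, …, n}`. -/
def std (n : ℕ) (hn : 0 < n) : Chain (ULift.{v} (Fin (n + 1))) := ⟨n, hn, ULift.up⟩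

end Chain

variable (M : Type u) [Category.{v} M]

/-! ### Diagrams without laxity maps -/

/-- The category `𝒦_X`, the product over all pairs `(A, B)` of the categories of contravariant
functors to `M` on the category of 1-morphisms from `A` to `B`; that is, presheaves on the
disjoint union `Chain X` of these categories. -/
abbrev KDiag (X : Type v) := (Chain X)ᵒᵖ ⥤ M

/-- The inverse image functor `f^⋆ : 𝒦_Y ⥤ 𝒦_X`. -/
abbrev kPullback {X Y : Type v} (f : X → Y) : KDiag M Y ⥤ KDiag M X :=
  (Functor.whiskeringLeft _ _ M).obj (Chain.map f).op

/-- The category `𝒦_Set`: objects are pairs `(X, F)` with `X` a set and `F` in `𝒦_X`. -/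
structure KSet where
  base : Type v
  fiber : KDiag M base

namespace KSet

variable {M}

/-- Morphisms `(X, F) ⟶ (Y, G)` are pairs of a function `f : X → Y` and a morphism
`F ⟶ f^⋆ G` of `𝒦_X`. -/
structure Hom (F G : KSet M) where
  base : F.base → G.base
  fiber : F.fiber ⟶ (kPullback M base).obj G.fiber

instance : Category (KSet M) where
  Hom := Hom
  id F := ⟨id, 𝟙 F.fiber⟩
  comp σ τ := ⟨τ.base ∘ σ.base, σ.fiber ≫ (kPullback M σ.base).map τ.fiber⟩
  id_comp σ := by
    change Hom.mk _ _ = Hom.mk _ _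
    congr 1
    ext s
    exact Category.id_comp _
  comp_id σ := by
    change Hom.mk _ _ = Hom.mk _ _
    congr 1
    ext s
    exact Category.comp_id _
  assoc σ τ ρ := by
    congr 1
    ext s
    exact Category.assoc _ _ _

end KSet

/-! ### Pre-Co-Segal categories -/

section PreCat

variable [MonoidalCategory M]

/-- A pre-Co-Segal category with set of objects `X`: a lax morphism to `M` from the 2-opposite of
the semi-2-category of chains on `X`. It consists of the functors `s ↦ F s`, contravariant in the
2-morphisms, and of laxity maps `F s ⊗ F t ⟶ F u`, one for each composite `u` of 1-morphisms `s`
and `t`, natural in `s` and `t` and associative. There are no identity 1-morphisms, hence no unit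
data. -/
structure PreCat (X : Type v) where
  diag : KDiag M X
  lax {s t u : Chain X} (h : Chain.IsConcat s t u) :
    diag.obj (op s) ⊗ diag.obj (op t) ⟶ diag.obj (op u)
  lax_natural {s t u s' t' u' : Chain X} (h : Chain.IsConcat s t u) (h' : Chain.IsConcat s' t' u')
    (a : s ⟶ s') (b : t ⟶ t') (c : u ⟶ u') (H : Chain.IsHComp a b c) :
    (diag.map a.op ⊗ₘ diag.map b.op) ≫ lax h = lax h' ≫ diag.map c.op
  lax_assoc {r s t rs st u : Chain X} (h₁ : Chain.IsConcat r s rs) (h₂ : Chain.IsConcat rs t u)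
    (h₃ : Chain.IsConcat s t st) (h₄ : Chain.IsConcat r st u) :
    (lax h₁ ▷ diag.obj (op t)) ≫ lax h₂ =
      (α_ (diag.obj (op r)) (diag.obj (op s)) (diag.obj (op t))).hom ≫
        (diag.obj (op r) ◁ lax h₃) ≫ lax h₄

namespace PreCat

variable {M} {X Y Z : Type v}

/-- Morphisms with fixed set of objects: natural transformations compatible with the laxity
maps. -/
@[ext]
structure Hom (F G : PreCat M X) where
  trans : F.diag ⟶ G.diag
  comm {s t u : Chain X} (h : Chain.IsConcat s t u) :
    F.lax h ≫ trans.app (op u) = (trans.app (op s) ⊗ₘ trans.app (op t)) ≫ G.lax h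

instance : Category (PreCat M X) where
  Hom := Hom
  id F := ⟨𝟙 F.diag, fun h => by simp⟩
  comp σ τ := ⟨σ.trans ≫ τ.trans, fun h => by
    rw [NatTrans.comp_app, ← Category.assoc, σ.comm h, Category.assoc, τ.comm h,
      ← Category.assoc]
    simp⟩
  id_comp σ := Hom.ext (Category.id_comp σ.trans)
  comp_id σ := Hom.ext (Category.comp_id σ.trans)
  assoc σ τ ρ := Hom.ext (Category.assoc σ.trans τ.trans ρ.trans)

end PreCat

/-- The functor `𝒰 : M_𝒮(X) ⥤ 𝒦_X` that forgets the laxity maps. -/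
def forgetLax (X : Type v) : PreCat M X ⥤ KDiag M X where
  obj F := F.diag
  map σ := PreCat.Hom.trans σ

/-- The inverse image functor `f^⋆ : M_𝒮(Y) ⥤ M_𝒮(X)`. -/
def pullback {X Y : Type v} (f : X → Y) : PreCat M Y ⥤ PreCat M X where
  obj G :=
    { diag := (kPullback M f).obj G.diag
      lax := fun h => G.lax (h.map f)
      lax_natural := fun h h' _ _ _ H => G.lax_natural (h.map f) (h'.map f) _ _ _ (H.map f)
      lax_assoc := fun h₁ h₂ h₃ h₄ =>
        G.lax_assoc (h₁.map f) (h₂.map f) (h₃.map f) (h₄.map f) }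
  map σ := ⟨(kPullback M f).map σ.trans, fun h => σ.comm (h.map f)⟩

/-- The category `M_𝒮(Set)` of pre-Co-Segal categories with varying sets of objects: objects are
pairs `(X, F)` with `X` a set and `F` in `M_𝒮(X)`. -/
structure MSet where
  base : Type v
  fiber : PreCat M base

namespace MSet

variable {M}

/-- Morphisms `(X, F) ⟶ (Y, G)` are pairs of a function `f : X → Y` and a morphism
`F ⟶ f^⋆ G` of `M_𝒮(X)`. -/
structure Hom (F G : MSet M) where
  base : F.base → G.base
  fiber : F.fiber ⟶ (pullback M base).obj G.fiber

instance : Category (MSet M) where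
  Hom := Hom
  id F := ⟨id, 𝟙 F.fiber⟩
  comp σ τ := ⟨τ.base ∘ σ.base, σ.fiber ≫ (pullback M σ.base).map τ.fiber⟩
  id_comp σ := by
    change Hom.mk _ _ = Hom.mk _ _
    congr 1
    refine PreCat.Hom.ext ?_
    ext s
    exact Category.id_comp _
  comp_id σ := by
    change Hom.mk _ _ = Hom.mk _ _
    congr 1
    refine PreCat.Hom.ext ?_
    ext s
    exact Category.comp_id _
  assoc σ τ ρ := by
    congr 1
    refine PreCat.Hom.ext ?_
    ext s
    exact Category.assoc _ _ _

end MSet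

/-- The functor `𝒰 : M_𝒮(Set) ⥤ 𝒦_Set` that forgets the laxity maps. -/
def forgetLaxSet : MSet M ⥤ KSet M where
  obj F := ⟨F.base, F.fiber.diag⟩
  map σ := ⟨MSet.Hom.base σ, (forgetLax M _).map (MSet.Hom.fiber σ)⟩

end PreCat

/-! ### The inclusions of the fibres over `Set` -/

/-- The inclusion of the fibre `𝒦_X` in `𝒦_Set`. -/
def kFiberInclusion (X : Type v) : KDiag M X ⥤ KSet M where
  obj F := ⟨X, F⟩
  map σ := ⟨id, σ⟩
  map_id _ := rfl
  map_comp _ _ := rfl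

/-- The inclusion of the fibre `M_𝒮(X)` in `M_𝒮(Set)`. -/
def fiberInclusion [MonoidalCategory M] (X : Type v) : PreCat M X ⥤ MSet M where
  obj F := ⟨X, F⟩
  map σ := ⟨id, σ⟩
  map_id _ := rfl
  map_comp _ _ := rfl

/-! ### Classes of morphisms -/

section Classes

variable [ModelCategory M]

/-- Weak equivalences of `𝒦_X`: levelwise weak equivalences. -/
abbrev kWeq (X : Type v) : MorphismProperty (KDiag M X) :=
  (weakEquivalences M).functorCategory (Chain X)ᵒᵖ

/-- Fibrations of the projective structure on `𝒦_X`: levelwise fibrations. -/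
abbrev kFib (X : Type v) : MorphismProperty (KDiag M X) :=
  (fibrations M).functorCategory (Chain X)ᵒᵖ

/-- Cofibrations of the projective structure on `𝒦_X`. -/
abbrev kCof (X : Type v) : MorphismProperty (KDiag M X) := (kFib M X ⊓ kWeq M X).llp

/-- Weak equivalences of `𝒦_Set`: pairs `(f, σ)` with `f` a bijection (a weak equivalence of the
minimal model structure on `Set`) and `σ : F ⟶ f^⋆ G` a weak equivalence of the fibre. -/
def kSetWeq : MorphismProperty (KSet M) :=
  fun F _ σ => Function.Bijective (KSet.Hom.base σ) ∧ kWeq M F.base (KSet.Hom.fiber σ)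

/-- Fibrations of `𝒦_Set`: pairs `(f, σ)` with `f` arbitrary (all functions are fibrations in the
minimal model structure on `Set`) and `σ : F ⟶ f^⋆ G` a fibration of the fibre. -/
def kSetFib : MorphismProperty (KSet M) :=
  fun F _ σ => kFib M F.base (KSet.Hom.fiber σ)

/-- Cofibrations of `𝒦_Set`: pairs `(f, σ)` with `f` arbitrary and the adjoint map `f_! F ⟶ G` of
`σ` a cofibration of the fibre. -/
def kSetCof [∀ {X Y : Type v} (f : X → Y), (kPullback M f).IsRightAdjoint] :
    MorphismProperty (KSet M) :=
  fun F G σ => kCof M G.base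
    (((Adjunction.ofIsRightAdjoint (kPullback M (KSet.Hom.base σ))).homEquiv F.fiber G.fiber).symm
      (KSet.Hom.fiber σ))

variable [MonoidalCategory M]

/-- Weak equivalences of `M_𝒮(X)`. -/
abbrev weq (X : Type v) : MorphismProperty (PreCat M X) := (kWeq M X).inverseImage (forgetLax M X)

/-- Fibrations of the projective structure on `M_𝒮(X)`. -/
abbrev fib (X : Type v) : MorphismProperty (PreCat M X) := (kFib M X).inverseImage (forgetLax M X)

/-- Cofibrations of the projective structure on `M_𝒮(X)`. -/
abbrev cof (X : Type v) : MorphismProperty (PreCat M X) := (fib M X ⊓ weq M X).llp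

/-- Weak equivalences of `M_𝒮(Set)`: pairs `(f, σ)` with `f` a bijection (a weak equivalence of
the minimal model structure on `Set`) and `σ : F ⟶ f^⋆ G` a weak equivalence of the fibre. -/
def setWeq : MorphismProperty (MSet M) :=
  fun F _ σ => Function.Bijective (MSet.Hom.base σ) ∧ weq M F.base (MSet.Hom.fiber σ)

/-- Fibrations of `M_𝒮(Set)`: pairs `(f, σ)` with `f` arbitrary and `σ : F ⟶ f^⋆ G` a fibration of
the fibre. -/
def setFib : MorphismProperty (MSet M) :=
  fun F _ σ => fib M F.base (MSet.Hom.fiber σ)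

/-- Cofibrations of `M_𝒮(Set)`: pairs `(f, σ)` with `f` arbitrary and the adjoint map `f_! F ⟶ G`
of `σ` a cofibration of the fibre. -/
def setCof [∀ {X Y : Type v} (f : X → Y), (pullback M f).IsRightAdjoint] :
    MorphismProperty (MSet M) :=
  fun F G σ => cof M G.base
    (((Adjunction.ofIsRightAdjoint (pullback M (MSet.Hom.base σ))).homEquiv F.fiber G.fiber).symm
      (MSet.Hom.fiber σ))

end Classes

/-! ### The generating sets -/

section Generators

variable [HasColimits M]

instance (X : Type v) (a b : (Chain X)ᵒᵖ) : HasCoproductsOfShape (a ⟶ b) M :=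
  have : Finite (a ⟶ b) := Finite.of_equiv _ (opEquiv a b).symm
  inferInstance

/-- The functor `δ(s_n, -) : M ⥤ 𝒦_{{0, …, n}}`, left adjoint to the evaluation at the chain
`s_n = (0, 1, …, n)`: its value at `B` sends `t` to the coproduct of copies of `B` indexed by the
2-morphisms `t ⟶ s_n`. In particular it is initial at the chains that do not run from `0` to
`n`. -/
noncomputable abbrev delta (n : ℕ) (hn : 0 < n) : M ⥤ KDiag M (ULift.{v} (Fin (n + 1))) :=
  evaluationLeftAdjoint M (op (Chain.std n hn))

/-- The maps `δ(s_n, q)` of `𝒦_Set` for `n ≥ 1` and `q` in `I`. -/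
def deltaGen (I : MorphismProperty M) : MorphismProperty (KSet M) :=
  ⨆ n : { n : ℕ // 0 < n }, I.strictMap (delta M n.1 n.2 ⋙ kFiberInclusion M _)

/-- The object of `𝒦_Set` with set of objects `X` and all values initial. -/
noncomputable abbrev kDisc (X : Type v) : KSet M := ⟨X, ⊥_ (KDiag M X)⟩

/-- The map between discrete objects induced by a function. -/
noncomputable abbrev kDiscMap {X Y : Type v} (f : X → Y) : kDisc M X ⟶ kDisc M Y :=
  KSet.Hom.mk f (initial.to _)

/-- The two maps `∅ ⟶ {∗}` and `{0, 1} ⟶ {∗}` between discrete objects of `𝒦_Set`. -/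
inductive kObjGen : MorphismProperty (KSet M)
  | zero : kObjGen (kDiscMap M (fun _ : PEmpty.{v + 1} => PUnit.unit.{v + 1}))
  | two : kObjGen (kDiscMap M (fun _ : ULift.{v} Bool => PUnit.unit.{v + 1}))

variable [MonoidalCategory M] [∀ X : Type v, (forgetLax M X).IsRightAdjoint]

/-- The free functor `Γ : 𝒦_X ⥤ M_𝒮(X)`, left adjoint to `𝒰`. -/
noncomputable abbrev free (X : Type v) : KDiag M X ⥤ PreCat M X := (forgetLax M X).leftAdjoint

/-- The functor `h(C_n; -) = Γ δ(s_n, -)`, with values in `M_𝒮(Set)`. -/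
noncomputable abbrev h (n : ℕ) (hn : 0 < n) : M ⥤ MSet M :=
  delta M n hn ⋙ free M _ ⋙ fiberInclusion M _

/-- The set of maps `h(C_n; I)`: the maps `h(C_n; q)` for `n ≥ 1` and `q` in `I`. -/
def hGen (I : MorphismProperty M) : MorphismProperty (MSet M) :=
  ⨆ n : { n : ℕ // 0 < n }, I.strictMap (h M n.1 n.2)

/-- The discrete pre-Co-Segal category on the set `X`: the initial object of `M_𝒮(X)`, presented
as the free object on the initial object of `𝒦_X`. -/
noncomputable abbrev disc (X : Type v) : MSet M := ⟨X, (free M X).obj (⊥_ (KDiag M X))⟩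

/-- The map between discrete pre-Co-Segal categories induced by a function. -/
noncomputable abbrev discMap {X Y : Type v} (f : X → Y) : disc M X ⟶ disc M Y :=
  MSet.Hom.mk f
    (((Adjunction.ofIsRightAdjoint (forgetLax M X)).homEquiv _ _).symm (initial.to _))

/-- The two maps `∅ ⟶ {∗}` and `{0, 1} ⟶ {∗}` between discrete pre-Co-Segal categories. -/
inductive objGen : MorphismProperty (MSet M)
  | zero : objGen (discMap M (fun _ : PEmpty.{v + 1} => PUnit.unit.{v + 1}))
  | two : objGen (discMap M (fun _ : ULift.{v} Bool => PUnit.unit.{v + 1}))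

end Generators

/-! ### Model categorical notions -/

/-- The pushout-product axiom and the unit axiom: a (closed) monoidal model category. -/
structure IsMonoidalModelCategory [MonoidalCategory M] [ModelCategory M] : Prop where
  cofibration_pushoutProduct (i j : Arrow M) (hi : cofibrations M i.hom)
    (hj : cofibrations M j.hom) :
    cofibrations M ((MonoidalCategory.Arrow.pushoutProduct.obj i).obj j).hom
  trivialCofibration_pushoutProduct_left (i j : Arrow M) (hi : trivialCofibrations M i.hom)
    (hj : cofibrations M j.hom) :
    trivialCofibrations M ((MonoidalCategory.Arrow.pushoutProduct.obj i).obj j).hom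
  trivialCofibration_pushoutProduct_right (i j : Arrow M) (hi : cofibrations M i.hom)
    (hj : trivialCofibrations M j.hom) :
    trivialCofibrations M ((MonoidalCategory.Arrow.pushoutProduct.obj i).obj j).hom
  unit_left {Q : M} (q : Q ⟶ 𝟙_ M) (hQ : IsCofibrant Q) (hq : weakEquivalences M q) (A : M)
    (hA : IsCofibrant A) : weakEquivalences M (q ▷ A)
  unit_right {Q : M} (q : Q ⟶ 𝟙_ M) (hQ : IsCofibrant Q) (hq : weakEquivalences M q) (A : M)
    (hA : IsCofibrant A) : weakEquivalences M (A ◁ q)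

section

variable {C : Type*} [Category.{v} C]

/-- `W`, `Cof` and `Fib` are the weak equivalences, cofibrations and fibrations of a model
structure on the complete and cocomplete category `C`. -/
structure IsModelStructure (W Cof Fib : MorphismProperty C) : Prop where
  hasLimits : HasLimits C
  hasColimits : HasColimits C
  exists_modelCategory : ∃ _ : ModelCategory C,
    weakEquivalences C = W ∧ cofibrations C = Cof ∧ fibrations C = Fib

/-- `I` and `J` are (small) sets of maps that detect the trivial fibrations, respectively the
fibrations, by the right lifting property. -/
structure AreGenerating (W Fib I J : MorphismProperty C) : Prop where
  isSmall_I : MorphismProperty.IsSmall.{v} I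
  isSmall_J : MorphismProperty.IsSmall.{v} J
  trivialFib_eq : Fib ⊓ W = I.rlp
  fib_eq : Fib = J.rlp

/-- Cofibrant generation by `I` (generating cofibrations) and `J` (generating trivial
cofibrations), which both permit the small object argument. -/
structure IsCofibrantlyGeneratedBy (W Fib I J : MorphismProperty C) : Prop extends
    AreGenerating W Fib I J where
  smallObject_I : MorphismProperty.HasSmallObjectArgument.{v} I
  smallObject_J : MorphismProperty.HasSmallObjectArgument.{v} J

end

end CoSegal

/-!
# Model structures on pre-Co-Segal categories

**Adjoints.** The free pre-Co-Segal category `Γ Z` on a diagram `Z` is the coproduct, over the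
number of letters, of the convolution powers of `Z` (`freePreCatHomEquiv`). The forgetful functor `𝒰
: M_𝒮(X) ⥤ 𝒦_X` preserves sifted colimits, because the tensor product preserves colimits in each
variable (`isColimitTensorCocone`). So `𝒰` is monadic, `M_𝒮(X)` has all limits and colimits, and the
left adjoints `f_!` on diagrams lift to pre-Co-Segal categories (`isRightAdjoint_pullback`).

**The fibres.** A model structure is obtained from the two factorizations and from acyclicity: the
maps with the left lifting property against the fibrations have to be weak equivalences
(`IsModelStructure.of_factorizations`). The factorizations need no smallness in `M`. They are
constructed by induction on the length of chains, since the only 2-morphisms between chains of equal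
length are identities, and the laxity maps into a chain come from shorter chains. The step from
length `n` to `n + 1` is a universal extension along maps out of the values at the chains of length
`n` (`FreeExtension`). Truncations are pre-Co-Segal categories too, and mapping into them shows that
such an extension changes nothing at shorter chains and has the prescribed values at length `n`
(`isIso_incl`, `isIso_cell`, `hasFactorization_levelwise`).

Acyclicity of `f : F ⟶ E` in `M_𝒮(X)` is proved by lifting against a suitable fibration, chosen for
each chain `u` and each fibration `p : A ⟶ B` of `M`. The values of `F` at the initial segments of
`u` form a right module over the restriction of `F` to the positions of `u`, an enriched
semicategory. The objects of maps out of this module, more precisely of pairs of maps compatible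
with `f` and `p`, form a left module, and so give an action on an endomorphism semicategory
(`endPair`, `pairMod`). The coextension of that semicategory is a pre-Co-Segal category on `X`
(`coext`). Its projection to the corresponding object for maps to `B` alone is a levelwise
fibration, because tensoring with an object, which is cofibrant, preserves trivial cofibrations
(`hasLiftingProperty_endPairProj`). A lift of `f` against this projection contains a lift of the
value of `f` at `u` against `p` (`exists_lift_of_pair`), so that this value is a trivial cofibration
(`IsMonoidalModelCategory.llp_fib_le_weq`).

**The total categories.** Both `M_𝒮(Set)` and `𝒦_Set` are categories fibred over sets, with
cartesian and opcartesian maps (`SetFibration`). Limits and colimits are formed in a fibre after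
changing the set of objects, and model structures on the fibres glue to the total category, where
the weak equivalences lie over bijections and the fibrations over arbitrary functions
(`IsFibredModel.isModelStructure_total`). Every chain of length `n` is the image of `s_n` under a
unique function from `{0, …, n}`, so lifting against the maps `δ(s_n, q)` is lifting against `q` at
all chains (`rlp_deltaGen_iff`), and `rlp_hGen_iff` transfers this to `M_𝒮(Set)` by adjunction. The
maps `∅ ⟶ {∗}` and `{0, 1} ⟶ {∗}` detect surjectivity and injectivity on objects
(`rlp_kObjGen_iff`).

**Local presentability.** A colimit in `𝒦_Set` is a left Kan extension from the total category of
the chains of the diagram (`Tot.isLeftKanExtension`). When the colimit is filtered, the lifts of a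
chain to the stages of the diagram are final among the chains over it (`Lift.final_toTot`), so the
values of the colimit are filtered colimits over the lifts. Hence `δ(s_n, A)` is presentable when
`A` is, and these objects together with the discrete object on a point form a strong generator
(`isStrongGenerator_kSetGenerator`). Two chains that are concatenated can be lifted to the same
stage, so the forgetful functor `M_𝒮(Set) ⥤ 𝒦_Set` preserves filtered colimits
(`preservesColimit_forgetLaxSet`), and the free functor carries the strong generator over. In a
locally presentable category every small set of maps permits the small object argument
(`hasSmallObjectArgument_of_isLocallyPresentable`).
-/

set_option linter.unusedSectionVars false

namespace CoSegal

/-! ### Model structures from weak factorization systems -/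

section General

variable {C : Type*} [Category.{v} C]

/-- A class of weak equivalences and a class of fibrations determine a model structure as soon as
the two factorizations exist and the maps with the left lifting property against the fibrations
are weak equivalences. -/
theorem IsModelStructure.of_factorizations [HasLimits C] [HasColimits C]
    (W Fib : MorphismProperty C)
    [W.HasTwoOutOfThreeProperty] [Fib.IsStableUnderRetracts] [(Fib ⊓ W).IsStableUnderRetracts]
    [(Fib ⊓ W).llp.HasFactorization (Fib ⊓ W)] [Fib.llp.HasFactorization Fib]
    (hW : Fib.llp ≤ W) : IsModelStructure W (Fib ⊓ W).llp Fib := by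
  have htriv : (Fib ⊓ W).llp ⊓ W = Fib.llp := by
    refine le_antisymm ?_ (le_inf (MorphismProperty.antitone_llp inf_le_left) hW)
    intro A B i hi
    have hf := MorphismProperty.factorizationData Fib.llp Fib i
    have hp : (Fib ⊓ W) hf.p := ⟨hf.hp, W.of_precomp hf.i hf.p (hW _ hf.hi) (by
      rw [hf.fac]; exact hi.2)⟩
    have := hi.1 _ hp
    have sq : CommSq hf.i i hf.p (𝟙 B) := ⟨by simp⟩
    have : RetractArrow i hf.i :=
      { i := Arrow.homMk (𝟙 A) sq.lift (by simp)
        r := Arrow.homMk (𝟙 A) hf.p (by simp) }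
    exact MorphismProperty.of_retract this hf.hi
  refine ⟨inferInstance, inferInstance, ?_⟩
  let : CategoryWithWeakEquivalences C := ⟨W⟩
  let : CategoryWithFibrations C := ⟨Fib⟩
  let : CategoryWithCofibrations C := ⟨(Fib ⊓ W).llp⟩
  have : (weakEquivalences C).HasTwoOutOfThreeProperty :=
    inferInstanceAs W.HasTwoOutOfThreeProperty
  have : MorphismProperty.IsWeakFactorizationSystem (cofibrations C) (trivialFibrations C) := by
    change MorphismProperty.IsWeakFactorizationSystem (Fib ⊓ W).llp (Fib ⊓ W)
    exact .mk' _ _ fun i p hi hp => hi p hp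
  have : MorphismProperty.IsWeakFactorizationSystem (trivialCofibrations C) (fibrations C) := by
    change MorphismProperty.IsWeakFactorizationSystem ((Fib ⊓ W).llp ⊓ W) Fib
    rw [htriv]
    exact .mk' _ _ fun i p hi hp => hi p hp
  exact ⟨ModelCategory.mk' C, rfl, rfl, rfl⟩

/-- In a locally presentable category, all small sets of maps permit the small object argument. -/
theorem hasSmallObjectArgument_of_isLocallyPresentable [IsLocallyPresentable.{v} C]
    (I : MorphismProperty C) [MorphismProperty.IsSmall.{v} I] :
    MorphismProperty.HasSmallObjectArgument.{v} I := by
  obtain ⟨κ₀, _, _⟩ := IsLocallyPresentable.exists_cardinal.{v} C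
  have hc : HasColimitsOfSize.{v, v} C := IsCardinalLocallyPresentable.toHasColimitsOfSize κ₀
  have h (i : Shrink.{v} I.toSet) : ∃ (κ : Cardinal.{v}) (_ : Fact κ.IsRegular),
      IsCardinalPresentable ((equivShrink _).symm i).1.left κ := by
    have : IsPresentable.{v} ((equivShrink _).symm i).1.left := inferInstance
    obtain ⟨κ, hκ, h⟩ := this
    exact ⟨κ, hκ, h⟩
  choose κ hκ hp using h
  obtain ⟨κ', hκ', h'⟩ := HasCardinalLT.exists_regular_cardinal.{v}
    (Σ i : Shrink.{v} I.toSet, (κ i).ord.ToType)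
  have : Fact κ'.IsRegular := ⟨hκ'⟩
  have : Nonempty κ'.ord.ToType := by simpa using hκ'.ne_zero
  let := WellFoundedLT.toOrderBot κ'.ord.ToType
  have hle (i) : κ i ≤ κ' := by
    refine le_trans ?_ ((hasCardinalLT_iff_cardinal_mk_lt _ _).1 h').le
    have := Cardinal.mk_le_of_injective
      (f := fun x : (κ i).ord.ToType => (⟨i, x⟩ : Σ i : Shrink.{v} I.toSet, (κ i).ord.ToType))
      (fun _ _ h => by simpa using h)
    simpa using this
  refine ⟨κ', inferInstance, inferInstance,
    { preservesColimit := fun {A B X Y} i hi f hf => ?_ }⟩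
  have hA : IsCardinalPresentable A κ' := by
    have h1 := hp (equivShrink _ ⟨Arrow.mk i, hi⟩)
    rw [Equiv.symm_apply_apply] at h1
    change IsCardinalPresentable A _ at h1
    exact isCardinalPresentable_of_le A (hle (equivShrink _ ⟨Arrow.mk i, hi⟩))
  have := preservesColimitsOfShape_of_isCardinalPresentable A κ' κ'.ord.ToType
  infer_instance

end General

/-! ### Tensoring with an object of a monoidal model category -/

section Monoidal

variable {M : Type u} [Category.{v} M] [MonoidalCategory M] [SymmetricCategory M]
  [MonoidalClosed M]

instance (A : M) : (tensorRight A).IsLeftAdjoint :=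
  Functor.isLeftAdjoint_of_iso (BraidedCategory.tensorLeftIsoTensorRight A)

variable [ModelCategory M]

variable [HasColimits M]

/-- Tensoring on the left with a cofibrant object preserves trivial cofibrations. -/
lemma IsMonoidalModelCategory.trivialCofibrations_whiskerLeft (hM : IsMonoidalModelCategory M)
    (A : M) [hA : IsCofibrant A] {B C : M} (j : B ⟶ C) (hj : trivialCofibrations M j) :
    trivialCofibrations M (A ◁ j) := by
  have h := hM.trivialCofibration_pushoutProduct_right (Arrow.mk (initial.to A)) (Arrow.mk j)
    hA.mem hj
  let sq := Functor.PushoutObjObj.ofHasPushout (curriedTensor M) (initial.to A) j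
  have h0 (B : M) : IsInitial ((⊥_ M) ⊗ B) := initialIsInitial.isInitialObj (tensorRight B)
  have : IsIso ((⊥_ M) ◁ j) := ⟨(h0 C).to _, (h0 B).hom_ext _ _, (h0 C).hom_ext _ _⟩
  have : IsIso sq.inl := MorphismProperty.of_isPushout (P := .isomorphisms M) sq.isPushout this
  have e : A ◁ j = sq.inl ≫ sq.ι := by simp
  rw [e]
  exact (MorphismProperty.cancel_left_of_respectsIso _ _ _).2 h

/-- Tensoring on the right with a cofibrant object preserves trivial cofibrations. -/
lemma IsMonoidalModelCategory.trivialCofibrations_whiskerRight (hM : IsMonoidalModelCategory M)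
    (A : M) [hA : IsCofibrant A] {B C : M} (j : B ⟶ C) (hj : trivialCofibrations M j) :
    trivialCofibrations M (j ▷ A) := by
  have h := hM.trivialCofibration_pushoutProduct_left (Arrow.mk j) (Arrow.mk (initial.to A))
    hj hA.mem
  let sq := Functor.PushoutObjObj.ofHasPushout (curriedTensor M) j (initial.to A)
  have h0 (B : M) : IsInitial (B ⊗ (⊥_ M)) := initialIsInitial.isInitialObj (tensorLeft B)
  have : IsIso (j ▷ (⊥_ M)) := ⟨(h0 C).to _, (h0 B).hom_ext _ _, (h0 C).hom_ext _ _⟩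
  have : IsIso sq.inr := MorphismProperty.of_isPushout (P := .isomorphisms M) sq.isPushout.flip this
  have e : j ▷ A = sq.inr ≫ sq.ι := by simp
  rw [e]
  exact (MorphismProperty.cancel_left_of_respectsIso _ _ _).2 h

end Monoidal

/-! ### Combinatorics of chains -/

namespace Chain

variable {X : Type v}

@[ext]
lemma hom_ext {t s : Chain X} {a b : t ⟶ s} (h : ∀ i, (Hom.pos a i : ℕ) = Hom.pos b i) : a = b :=
  Hom.ext (funext fun i => Fin.ext (h i))

/-- Two chains with the same letters are equal. -/
lemma ext_of_pt {s t : Chain X} (hd : s.deg = t.deg)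
    (hp : ∀ (i : Fin (s.deg + 1)) (j : Fin (t.deg + 1)), (i : ℕ) = j → s.pt i = t.pt j) :
    s = t := by
  obtain ⟨n, hn, p⟩ := s
  obtain ⟨m, hm, q⟩ := t
  obtain rfl : n = m := hd
  obtain rfl : p = q := funext fun i => hp i i rfl
  rfl

lemma deg_le {t s : Chain X} (a : t ⟶ s) : s.deg ≤ t.deg := by
  have := Fintype.card_le_of_injective _ (Hom.strictMono a).injective
  simpa using this

lemma pos_val_zero {t s : Chain X} (a : t ⟶ s) (i : Fin (s.deg + 1)) (hi : (i : ℕ) = 0) :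
    (Hom.pos a i : ℕ) = 0 := by
  obtain rfl : i = 0 := Fin.ext hi
  rw [Hom.pos_zero a]; rfl

lemma pos_val_last {t s : Chain X} (a : t ⟶ s) (i : Fin (s.deg + 1)) (hi : (i : ℕ) = s.deg) :
    (Hom.pos a i : ℕ) = t.deg := by
  obtain rfl : i = Fin.last _ := Fin.ext hi
  rw [Hom.pos_last a]; rfl

/-- A 2-morphism between chains of the same length deletes no letter. -/
lemma pos_eq_of_deg_eq {t s : Chain X} (a : t ⟶ s) (h : t.deg = s.deg) (i : Fin (s.deg + 1)) :
    (Hom.pos a i : ℕ) = i := by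
  obtain ⟨n, hn, p⟩ := t
  obtain ⟨m, hm, q⟩ := s
  obtain rfl : n = m := h
  have := (Hom.strictMono a)
  have h2 : Hom.pos a = id := by
    have := Subsingleton.elim (StrictMono.orderIsoOfSurjective (Hom.pos a) this
      (Finite.surjective_of_injective this.injective)) (OrderIso.refl (Fin (n + 1)))
    exact funext fun i => congrArg (fun e => e i) this
  rw [h2]; rfl

lemma eq_of_deg_eq {t s : Chain X} (a : t ⟶ s) (h : t.deg = s.deg) : t = s :=
  ext_of_pt h fun i j hij => by
    rw [← Hom.pt_pos a j]
    congr 1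
    exact Fin.ext (by rw [pos_eq_of_deg_eq a h, hij])

lemma eq_id {t : Chain X} (a : t ⟶ t) : a = 𝟙 t :=
  hom_ext fun i => pos_eq_of_deg_eq a rfl i

/-- The part of a chain between two positions. -/
def seg (u : Chain X) (i j : ℕ) (hij : i < j) (hj : j ≤ u.deg) : Chain X :=
  ⟨j - i, by omega, fun k => u.pt ⟨i + k, by omega⟩⟩

namespace IsConcat

lemma deg_left_lt {s t u : Chain X} (h : IsConcat s t u) : s.deg < u.deg := by
  have := t.deg_pos
  have := h.deg_eq
  omega

lemma deg_right_lt {s t u : Chain X} (h : IsConcat s t u) : t.deg < u.deg := by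
  have := s.deg_pos
  have := h.deg_eq
  omega

lemma left_val {s t u : Chain X} (h : IsConcat s t u) (i : Fin (s.deg + 1)) :
    u.pt ⟨i, by have := h.deg_eq; omega⟩ = s.pt i := h.left i _ rfl

lemma right_val {s t u : Chain X} (h : IsConcat s t u) (j : Fin (t.deg + 1)) :
    u.pt ⟨s.deg + j, by have := h.deg_eq; omega⟩ = t.pt j := h.right j _ rfl

lemma unique {s t u u' : Chain X} (h : IsConcat s t u) (h' : IsConcat s t u') : u = u' := by
  have e := h.deg_eq
  have e' := h'.deg_eq
  refine ext_of_pt (by omega) fun i j hij => ?_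
  by_cases hi : (i : ℕ) < s.deg + 1
  · rw [h.left ⟨i, hi⟩ i rfl, h'.left ⟨i, hi⟩ j hij.symm]
  · have h1 : (i : ℕ) - s.deg < t.deg + 1 := by omega
    rw [h.right ⟨i - s.deg, h1⟩ i (by simp; omega), h'.right ⟨i - s.deg, h1⟩ j (by simp; omega)]

lemma left_eq {s t s' t' u : Chain X} (h : IsConcat s t u) (h' : IsConcat s' t' u)
    (hd : s.deg = s'.deg) : s = s' :=
  ext_of_pt hd fun i j hij => by
    rw [← h.left_val i, ← h'.left_val j]
    simp [hij]

lemma right_eq {s t s' t' u : Chain X} (h : IsConcat s t u) (h' : IsConcat s' t' u)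
    (hd : s.deg = s'.deg) : t = t' :=
  ext_of_pt (by have := h.deg_eq; have := h'.deg_eq; omega) fun i j hij => by
    rw [← h.right_val i, ← h'.right_val j]
    simp [hij, hd]

lemma seg (u : Chain X) {i j k : ℕ} (hij : i < j) (hjk : j < k) (hk : k ≤ u.deg) :
    IsConcat (u.seg i j hij (by omega)) (u.seg j k hjk hk) (u.seg i k (by omega) hk) where
  deg_eq := by simp only [Chain.seg]; omega
  left a b e := by simp only [Chain.seg]; congr 2; omega
  right a b e := by simp only [Chain.seg] at *; congr 2; omega

/-- A chain is the concatenation of its two parts at an inner position. -/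
lemma cut (u : Chain X) {m : ℕ} (h0 : 0 < m) (h1 : m < u.deg) :
    IsConcat (u.seg 0 m h0 h1.le) (u.seg m u.deg h1 le_rfl) u where
  deg_eq := by simp only [Chain.seg]; omega
  left a b e := congrArg u.pt (Fin.ext (by simp [e]))
  right a b e := congrArg u.pt (Fin.ext (by simp [e, Chain.seg]))

lemma assoc {a b s t u : Chain X} (h : IsConcat a b s) (h' : IsConcat s t u) :
    ∃ w, IsConcat b t w ∧ IsConcat a w u := by
  have e := h.deg_eq
  have e' := h'.deg_eq
  have := a.deg_pos
  have := b.deg_pos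
  have := t.deg_pos
  refine ⟨u.seg a.deg u.deg (by omega) le_rfl, ⟨?_, fun i k hk => ?_, fun i k hk => ?_⟩, ?_⟩
  · simp only [Chain.seg]; omega
  · rw [← h.right_val, ← h'.left_val]
    simp [Chain.seg, hk]
  · rw [← h'.right_val]
    simp only [Chain.seg]
    congr 2
    omega
  · refine ⟨by simp only [Chain.seg]; omega, fun i k hk => ?_, fun i k hk => ?_⟩
    · rw [← h.left_val, ← h'.left_val]
      simp [← hk]
    · simp [Chain.seg, ← hk]

end IsConcat

namespace IsHComp

lemma id {s t u : Chain X} (_ : IsConcat s t u) : IsHComp (𝟙 s) (𝟙 t) (𝟙 u) :=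
  ⟨fun _ _ e => e, fun _ _ e => e⟩

lemma comp {s t u s' t' u' s'' t'' u'' : Chain X} {a : s ⟶ s'} {b : t ⟶ t'} {c : u ⟶ u'}
    {a' : s' ⟶ s''} {b' : t' ⟶ t''} {c' : u' ⟶ u''} (H : IsHComp a b c) (H' : IsHComp a' b' c') :
    IsHComp (a ≫ a') (b ≫ b') (c ≫ c') :=
  ⟨fun i k e => H.left _ _ (H'.left i k e), fun j k e => H.right _ _ (H'.right j k e)⟩

lemma left_unique {s t u s' t' u' : Chain X} {a a' : s ⟶ s'} {b b' : t ⟶ t'} {c : u ⟶ u'}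
    (h' : IsConcat s' t' u') (H : IsHComp a b c) (H' : IsHComp a' b' c) : a = a' :=
  hom_ext fun i => by
    have := h'.deg_eq
    rw [← H.left i ⟨i, by omega⟩ rfl, ← H'.left i ⟨i, by omega⟩ rfl]

lemma right_unique {s t u s' t' u' : Chain X} {a a' : s ⟶ s'} {b b' : t ⟶ t'} {c : u ⟶ u'}
    (h' : IsConcat s' t' u') (H : IsHComp a b c) (H' : IsHComp a' b' c) : b = b' :=
  hom_ext fun i => by
    have := h'.deg_eq
    have e1 := H.right i ⟨s'.deg + i, by omega⟩ rfl
    have e2 := H'.right i ⟨s'.deg + i, by omega⟩ rfl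
    omega

lemma deg_left {s t u s' t' u' : Chain X} {a : s ⟶ s'} {b : t ⟶ t'} {c : u ⟶ u'}
    (h' : IsConcat s' t' u') (H : IsHComp a b c) :
    (Hom.pos c ⟨s'.deg, by have := h'.deg_eq; omega⟩ : ℕ) = s.deg := by
  rw [H.left (Fin.last _) _ rfl, pos_val_last a _ rfl]

/-- Every 2-morphism to a concatenation is a horizontal composite. -/
lemma exists_cut {s' t' u u' : Chain X} (h' : IsConcat s' t' u') (c : u ⟶ u') :
    ∃ (s t : Chain X) (_ : IsConcat s t u) (a : s ⟶ s') (b : t ⟶ t'), IsHComp a b c := by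
  have e := h'.deg_eq
  have p1 := s'.deg_pos
  have p2 := t'.deg_pos
  have mono {i j : ℕ} (hi : i < u'.deg + 1) (hj : j < u'.deg + 1) (h : i < j) :
      (Hom.pos c ⟨i, hi⟩ : ℕ) < Hom.pos c ⟨j, hj⟩ := Hom.strictMono c h
  have mono' {i j : ℕ} (hi : i < u'.deg + 1) (hj : j < u'.deg + 1) (h : i ≤ j) :
      (Hom.pos c ⟨i, hi⟩ : ℕ) ≤ Hom.pos c ⟨j, hj⟩ := (Hom.strictMono c).monotone h
  obtain ⟨m, hm⟩ : ∃ m, m = (Hom.pos c ⟨s'.deg, by omega⟩ : ℕ) := ⟨_, rfl⟩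
  have m0 : 0 < m := by
    rw [hm]
    have := mono (i := 0) (j := s'.deg) (by omega) (by omega) p1
    omega
  have m1 : m < u.deg := by
    rw [hm]
    have := mono (i := s'.deg) (j := u'.deg) (by omega) (by omega) (by omega)
    omega
  refine ⟨_, _, IsConcat.cut u m0 m1,
    { pos := fun i => ⟨Hom.pos c ⟨i, by omega⟩, by
        have := mono' (i := i) (j := s'.deg) (by omega) (by omega) (by omega)
        simp only [Chain.seg]; omega⟩
      strictMono := fun i j hij => mono _ _ hij
      pos_zero := Fin.ext (pos_val_zero c _ rfl)
      pos_last := Fin.ext (by simp [Chain.seg, hm])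
      pt_pos := fun i => by
        rw [← h'.left_val i, ← Hom.pt_pos c]
        simp [Chain.seg] },
    { pos := fun i => ⟨Hom.pos c ⟨s'.deg + i, by omega⟩ - m, by
        simp only [Chain.seg]; omega⟩
      strictMono := fun i j hij => by
        have h1 := mono' (i := s'.deg) (j := s'.deg + i) (by omega) (by omega) (by omega)
        have h2 := mono (i := s'.deg + i) (j := s'.deg + j) (by omega) (by omega) (by omega)
        refine Fin.lt_def.2 ?_
        simp only
        omega
      pos_zero := Fin.ext (by simp [hm])
      pos_last := Fin.ext (by
        have := pos_val_last c ⟨s'.deg + t'.deg, by omega⟩ (by simp; omega)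
        simp [Chain.seg, this])
      pt_pos := fun i => by
        have h1 := mono' (i := s'.deg) (j := s'.deg + i) (by omega) (by omega) (by omega)
        rw [← h'.right_val i, ← Hom.pt_pos c]
        refine congrArg u.pt (Fin.ext ?_)
        change m + ((Hom.pos c ⟨s'.deg + i, by omega⟩ : ℕ) - m) = Hom.pos c ⟨s'.deg + i, by omega⟩
        omega }, ?_, ?_⟩
  · rintro i k hk
    simp only
    congr 3
    exact Fin.ext hk
  · rintro i ⟨k, hk0⟩ hk
    have h1 := mono' (i := s'.deg) (j := s'.deg + i) (by omega) (by omega) (by omega)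
    have hk' : k = s'.deg + i := hk
    subst hk'
    change (Hom.pos c ⟨s'.deg + i, by omega⟩ : ℕ) =
      (m - 0) + ((Hom.pos c ⟨s'.deg + i, by omega⟩ : ℕ) - m)
    omega

/-- Horizontal composites exist. -/
lemma exists_hcomp {s t u s' t' u' : Chain X} (h : IsConcat s t u) (h' : IsConcat s' t' u')
    (a : s ⟶ s') (b : t ⟶ t') : ∃ c : u ⟶ u', IsHComp a b c := by
  have e := h.deg_eq
  have e' := h'.deg_eq
  have ha0 := pos_val_last a (Fin.last _) rfl
  have hb0 := pos_val_zero b 0 rfl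
  let f (k : ℕ) (hk : k < u'.deg + 1) : Fin (u.deg + 1) :=
    if hk' : k < s'.deg + 1 then ⟨Hom.pos a ⟨k, hk'⟩, by omega⟩
    else ⟨s.deg + Hom.pos b ⟨k - s'.deg, by omega⟩, by omega⟩
  have f1 (k : ℕ) (hk : k < u'.deg + 1) (hk' : k < s'.deg + 1) :
      (f k hk : ℕ) = Hom.pos a ⟨k, hk'⟩ := by
    simp only [f, dif_pos hk']
  have f2 (k : ℕ) (hk : k < u'.deg + 1) (hk' : ¬ k < s'.deg) :
      (f k hk : ℕ) = s.deg + Hom.pos b ⟨k - s'.deg, by omega⟩ := by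
    by_cases h1 : k = s'.deg
    · subst h1
      rw [f1 _ hk (by omega), pos_val_last a _ rfl, pos_val_zero b _ (by simp)]
      rfl
    · have h2 : ¬ k < s'.deg + 1 := by omega
      simp only [f, dif_neg h2]
  refine ⟨⟨fun k => f k k.2, fun i j hij => ?_, ?_, ?_, fun k => ?_⟩, fun i k hk => ?_,
    fun i k hk => ?_⟩
  · refine Fin.lt_def.2 ?_
    have hij' : (i : ℕ) < j := hij
    by_cases hj : (j : ℕ) < s'.deg + 1
    · rw [f1 i i.2 (by omega), f1 j j.2 hj]
      exact Hom.strictMono a (show (⟨i, by omega⟩ : Fin (s'.deg + 1)) < ⟨j, hj⟩ from hij)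
    · by_cases hi : (i : ℕ) < s'.deg
      · rw [f1 i i.2 (by omega), f2 j j.2 (by omega)]
        have := Hom.strictMono a (show (⟨i, by omega⟩ : Fin (s'.deg + 1)) < Fin.last _ from hi)
        rw [Fin.lt_def, ha0] at this
        omega
      · rw [f2 i i.2 hi, f2 j j.2 (by omega)]
        have := Hom.strictMono b (show (⟨i - s'.deg, by omega⟩ : Fin (t'.deg + 1)) <
          ⟨j - s'.deg, by omega⟩ from Fin.lt_def.2 (by simp; omega))
        rw [Fin.lt_def] at this
        omega
  · exact Fin.ext ((f1 0 (by omega) (by simp)).trans (pos_val_zero a _ rfl))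
  · refine Fin.ext ((f2 u'.deg (by omega) ?_).trans ?_)
    · simp; omega
    · rw [pos_val_last b _ (by simp; omega)]
      simp [e]
  · by_cases hk : (k : ℕ) < s'.deg + 1
    · rw [h'.left ⟨k, hk⟩ k rfl, ← Hom.pt_pos a, h.left _ _ (f1 k k.2 hk)]
    · rw [h'.right ⟨k - s'.deg, by omega⟩ k (by simp; omega), ← Hom.pt_pos b,
        h.right _ _ (f2 k k.2 (by omega))]
  · rw [f1 k k.2 (by omega)]
    congr 3
  · rw [f2 k k.2 (by omega)]
    congr 4
    simp [hk]

/-- Horizontal composition is associative. -/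
lemma assoc {r s t rs st u r' s' t' rs' st' u' : Chain X}
    {a : r ⟶ r'} {b : s ⟶ s'} {c : t ⟶ t'} {ab : rs ⟶ rs'} {bc : st ⟶ st'} {d : u ⟶ u'}
    (h₁ : IsConcat r s rs) (h₃' : IsConcat s' t' st') (h₁' : IsConcat r' s' rs')
    (H₁ : IsHComp a b ab) (H₂ : IsHComp ab c d) (H₃ : IsHComp b c bc) : IsHComp a bc d := by
  have e := h₁'.deg_eq
  have e' := h₃'.deg_eq
  refine ⟨fun i k hk => ?_, fun j k hk => ?_⟩
  · rw [H₂.left ⟨i, by omega⟩ k hk, H₁.left i _ rfl]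
  · by_cases hj : (j : ℕ) < s'.deg + 1
    · rw [H₂.left ⟨k, by omega⟩ k rfl, H₁.right ⟨j, hj⟩ _ hk, H₃.left ⟨j, hj⟩ j rfl]
    · rw [H₂.right ⟨j - s'.deg, by omega⟩ k (by simp; omega),
        H₃.right ⟨j - s'.deg, by omega⟩ j (by simp; omega), h₁.deg_eq, add_assoc]

end IsHComp

end Chain

/-! ### The free pre-Co-Segal category on a diagram -/

section Free

variable {M : Type u} [Category.{v} M] [MonoidalCategory M] {X : Type v}

/-- A way of writing the chain `u` as a concatenation. -/
structure Chain.Cut (u : Chain X) : Type v where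
  left : Chain X
  right : Chain X
  isConcat : Chain.IsConcat left right u

/-- A way of writing the 2-morphism `c : u ⟶ u'` as a horizontal composite, for a given way of
writing `u'` as a concatenation. -/
structure Chain.CutLift {s' t' u u' : Chain X} (c : u ⟶ u') where
  left : Chain X
  right : Chain X
  isConcat : Chain.IsConcat left right u
  homLeft : left ⟶ s'
  homRight : right ⟶ t'
  isHComp : Chain.IsHComp homLeft homRight c

/-- A choice of a horizontal decomposition. -/
noncomputable def Chain.Cut.lift {u u' : Chain X} (d : u'.Cut) (c : u ⟶ u') :
    Chain.CutLift (s' := d.left) (t' := d.right) c :=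
  have : Nonempty (Chain.CutLift (s' := d.left) (t' := d.right) c) :=
    have ⟨s, t, h, a, b, H⟩ := Chain.IsHComp.exists_cut d.isConcat c
    ⟨⟨s, t, h, a, b, H⟩⟩
  Classical.arbitrary _

/-- Families of maps `P s ⊗ Q t ⟶ R (s · t)` natural in `s` and `t`. -/
structure Bilin (P Q R : KDiag M X) where
  app {s t u : Chain X} (h : Chain.IsConcat s t u) :
    P.obj (op s) ⊗ Q.obj (op t) ⟶ R.obj (op u)
  natural {s t u s' t' u' : Chain X} (h : Chain.IsConcat s t u) (h' : Chain.IsConcat s' t' u')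
    (a : s ⟶ s') (b : t ⟶ t') (c : u ⟶ u') (H : Chain.IsHComp a b c) :
    (P.map a.op ⊗ₘ Q.map b.op) ≫ app h = app h' ≫ R.map c.op

section Distrib

variable [MonoidalClosed M]

/-- Maps out of `A ⊗ ∐ f` are families of maps out of the objects `A ⊗ f j`. -/
noncomputable def tensorSigmaDesc {J : Type*} {A B : M} {f : J → M} [HasCoproduct f]
    (g : ∀ j, A ⊗ f j ⟶ B) : A ⊗ ∐ f ⟶ B :=
  MonoidalClosed.uncurry (Sigma.desc fun j => MonoidalClosed.curry (g j))

@[simp]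
lemma whiskerLeft_ι_tensorSigmaDesc {J : Type*} {A B : M} {f : J → M} [HasCoproduct f]
    (g : ∀ j, A ⊗ f j ⟶ B) (j : J) : A ◁ Sigma.ι f j ≫ tensorSigmaDesc g = g j := by
  rw [tensorSigmaDesc, ← MonoidalClosed.uncurry_natural_left, Sigma.ι_desc,
    MonoidalClosed.uncurry_curry]

lemma tensorSigma_hom_ext {J : Type*} {A B : M} {f : J → M} [HasCoproduct f]
    {g g' : A ⊗ ∐ f ⟶ B} (h : ∀ j, A ◁ Sigma.ι f j ≫ g = A ◁ Sigma.ι f j ≫ g') : g = g' := by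
  refine MonoidalClosed.curry_injective (Sigma.hom_ext _ _ fun j => ?_)
  rw [← MonoidalClosed.curry_natural_left, ← MonoidalClosed.curry_natural_left, h]

variable [SymmetricCategory M]

/-- Maps out of `∐ f ⊗ A` are families of maps out of the objects `f j ⊗ A`. -/
noncomputable def sigmaTensorDesc {J : Type*} {A B : M} {f : J → M} [HasCoproduct f]
    (g : ∀ j, f j ⊗ A ⟶ B) : (∐ f) ⊗ A ⟶ B :=
  (β_ _ _).hom ≫ tensorSigmaDesc fun j => (β_ _ _).hom ≫ g j

@[simp]
lemma whiskerRight_ι_sigmaTensorDesc {J : Type*} {A B : M} {f : J → M} [HasCoproduct f]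
    (g : ∀ j, f j ⊗ A ⟶ B) (j : J) : Sigma.ι f j ▷ A ≫ sigmaTensorDesc g = g j := by
  rw [sigmaTensorDesc, BraidedCategory.braiding_naturality_left_assoc,
    whiskerLeft_ι_tensorSigmaDesc, SymmetricCategory.symmetry_assoc]

lemma sigmaTensor_hom_ext {J : Type*} {A B : M} {f : J → M} [HasCoproduct f]
    {g g' : (∐ f) ⊗ A ⟶ B} (h : ∀ j, Sigma.ι f j ▷ A ≫ g = Sigma.ι f j ▷ A ≫ g') : g = g' := by
  rw [← cancel_epi (β_ A (∐ f)).hom]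
  refine tensorSigma_hom_ext fun j => ?_
  rw [BraidedCategory.braiding_naturality_right_assoc,
    BraidedCategory.braiding_naturality_right_assoc, h]

end Distrib

variable [HasColimits M]

/-- The underlying object of the convolution product at a chain. -/
noncomputable abbrev starObj (P Q : KDiag M X) (u : Chain X) : M :=
  ∐ fun c : u.Cut => P.obj (op c.left) ⊗ Q.obj (op c.right)

/-- The inclusion of a summand in the convolution product. -/
noncomputable def starι (P Q : KDiag M X) {s t u : Chain X} (h : Chain.IsConcat s t u) :
    P.obj (op s) ⊗ Q.obj (op t) ⟶ starObj P Q u :=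
  Sigma.ι (fun c : u.Cut => P.obj (op c.left) ⊗ Q.obj (op c.right)) ⟨s, t, h⟩

lemma starObj_hom_ext {P Q : KDiag M X} {u : Chain X} {B : M} {f g : starObj P Q u ⟶ B}
    (w : ∀ {s t : Chain X} (h : Chain.IsConcat s t u), starι P Q h ≫ f = starι P Q h ≫ g) :
    f = g :=
  Sigma.hom_ext _ _ fun c => w c.isConcat

lemma tensorHom_starι_eq (P Q : KDiag M X) {s t u s' t' u' : Chain X} (h : Chain.IsConcat s t u)
    (h' : Chain.IsConcat s' t' u') {a : s ⟶ s'} {b : t ⟶ t'} {c : u ⟶ u'}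
    (H : Chain.IsHComp a b c) (e : Chain.CutLift (s' := s') (t' := t') c) :
    (P.map e.homLeft.op ⊗ₘ Q.map e.homRight.op) ≫ starι P Q e.isConcat =
      (P.map a.op ⊗ₘ Q.map b.op) ≫ starι P Q h := by
  obtain ⟨s₁, t₁, h₁, a₁, b₁, H₁⟩ := e
  have hd : s₁.deg = s.deg := by
    rw [← Chain.IsHComp.deg_left h' H, ← Chain.IsHComp.deg_left h' H₁]
  obtain rfl := Chain.IsConcat.left_eq h₁ h hd
  obtain rfl := Chain.IsConcat.right_eq h₁ h hd
  obtain rfl := Chain.IsHComp.left_unique h' H₁ H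
  obtain rfl := Chain.IsHComp.right_unique h' H₁ H
  rfl

/-- The functoriality of the convolution product with respect to a 2-morphism. -/
noncomputable def starMap (P Q : KDiag M X) {u u' : Chain X} (c : u ⟶ u') :
    starObj P Q u' ⟶ starObj P Q u :=
  Sigma.desc fun d =>
    (P.map (d.lift c).homLeft.op ⊗ₘ Q.map (d.lift c).homRight.op) ≫ starι P Q (d.lift c).isConcat

lemma starι_map (P Q : KDiag M X) {s t u s' t' u' : Chain X} (h : Chain.IsConcat s t u)
    (h' : Chain.IsConcat s' t' u') {a : s ⟶ s'} {b : t ⟶ t'} {c : u ⟶ u'}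
    (H : Chain.IsHComp a b c) :
    starι P Q h' ≫ starMap P Q c = (P.map a.op ⊗ₘ Q.map b.op) ≫ starι P Q h := by
  rw [starMap, starι, Sigma.ι_desc]
  exact tensorHom_starι_eq P Q h h' H _

/-- The convolution product of diagrams: its value at `u` is the coproduct of the `P s ⊗ Q t`
over all ways of writing `u` as a concatenation of `s` and `t`. -/
noncomputable def star (P Q : KDiag M X) : KDiag M X where
  obj u := starObj P Q u.unop
  map c := starMap P Q c.unop
  map_id u := starObj_hom_ext fun h => by
    rw [unop_id, starι_map P Q h h (Chain.IsHComp.id h)]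
    simp
  map_comp {u u' u''} c d := starObj_hom_ext fun h => by
    obtain ⟨s, t, h₁, a, b, H⟩ := Chain.IsHComp.exists_cut h c.unop
    obtain ⟨s₂, t₂, h₂, a', b', H'⟩ := Chain.IsHComp.exists_cut h₁ d.unop
    rw [unop_comp, starι_map P Q h₂ h (H'.comp H), ← Category.assoc, starι_map P Q h₁ h H,
      Category.assoc, starι_map P Q h₂ h₁ H']
    simp

/-- The map out of the convolution product induced by a natural family. -/
noncomputable def Bilin.desc {P Q R : KDiag M X} (β : Bilin P Q R) : star P Q ⟶ R where
  app u := Sigma.desc fun c => β.app c.isConcat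
  naturality u' u c := starObj_hom_ext fun h => by
    obtain ⟨s, t, h₁, a, b, H⟩ := Chain.IsHComp.exists_cut h c.unop
    change starι P Q h ≫ starMap P Q c.unop ≫ _ = starι P Q h ≫ _ ≫ _
    rw [← Category.assoc, starι_map P Q h₁ h H, starι, starι, Category.assoc, Sigma.ι_desc,
      Sigma.ι_desc_assoc, β.natural h₁ h a b c.unop H, Quiver.Hom.op_unop]

@[simp]
lemma Bilin.ι_desc {P Q R : KDiag M X} (β : Bilin P Q R) {s t u : Chain X}
    (h : Chain.IsConcat s t u) : starι P Q h ≫ β.desc.app (op u) = β.app h :=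
  Sigma.ι_desc _ _

variable (Z : KDiag M X)

/-- The part of the free object made of the words with `k + 1` letters. -/
noncomputable def words : ℕ → KDiag M X
  | 0 => Z
  | k + 1 => star Z (words k)

/-- The words made of a first letter and a word with `k + 1` letters. -/
noncomputable def consι (k : ℕ) {s t u : Chain X} (h : Chain.IsConcat s t u) :
    Z.obj (op s) ⊗ (words Z k).obj (op t) ⟶ (words Z (k + 1)).obj (op u) :=
  starι Z (words Z k) h

variable {Z} in
lemma words_succ_hom_ext {k : ℕ} {u : Chain X} {B : M} {f g : (words Z (k + 1)).obj (op u) ⟶ B}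
    (w : ∀ {s t : Chain X} (h : Chain.IsConcat s t u), consι Z k h ≫ f = consι Z k h ≫ g) :
    f = g :=
  starObj_hom_ext w

lemma consι_naturality (k : ℕ) {s t u s' t' u' : Chain X} (h : Chain.IsConcat s t u)
    (h' : Chain.IsConcat s' t' u') {a : s ⟶ s'} {b : t ⟶ t'} {c : u ⟶ u'}
    (H : Chain.IsHComp a b c) :
    consι Z k h' ≫ (words Z (k + 1)).map c.op =
      (Z.map a.op ⊗ₘ (words Z k).map b.op) ≫ consι Z k h :=
  starι_map Z (words Z k) h h' H

/-- The underlying diagram of the free pre-Co-Segal category: the coproduct of the words of all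
lengths. -/
noncomputable def freeDiag : KDiag M X where
  obj u := ∐ fun k => (words Z k).obj u
  map c := Limits.Sigma.map fun k => (words Z k).map c
  map_id u := Sigma.hom_ext _ _ fun k => by simp
  map_comp c d := Sigma.hom_ext _ _ fun k => by simp

/-- The inclusion of the words with `k + 1` letters. -/
noncomputable def wordsι (k : ℕ) : words Z k ⟶ freeDiag Z where
  app u := Sigma.ι (fun k => (words Z k).obj u) k
  naturality u u' c := by simp [freeDiag]

variable {Z}

lemma freeDiag_hom_ext {u : (Chain X)ᵒᵖ} {B : M} {f g : (freeDiag Z).obj u ⟶ B}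
    (h : ∀ k, (wordsι Z k).app u ≫ f = (wordsι Z k).app u ≫ g) : f = g :=
  Sigma.hom_ext _ _ h

variable [MonoidalClosed M]

lemma tensor_freeDiag_hom_ext {u : (Chain X)ᵒᵖ} {A B : M} {f g : A ⊗ (freeDiag Z).obj u ⟶ B}
    (h : ∀ k, A ◁ (wordsι Z k).app u ≫ f = A ◁ (wordsι Z k).app u ≫ g) : f = g :=
  tensorSigma_hom_ext h

variable [SymmetricCategory M]

lemma freeDiag_tensor_hom_ext {u : (Chain X)ᵒᵖ} {A B : M} {f g : (freeDiag Z).obj u ⊗ A ⟶ B}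
    (h : ∀ k, (wordsι Z k).app u ▷ A ≫ f = (wordsι Z k).app u ▷ A ≫ g) : f = g :=
  sigmaTensor_hom_ext h

lemma words_succ_tensor_hom_ext {k : ℕ} {u : Chain X} {A B : M}
    {f g : (words Z (k + 1)).obj (op u) ⊗ A ⟶ B}
    (w : ∀ {s t : Chain X} (h : Chain.IsConcat s t u),
      consι Z k h ▷ A ≫ f = consι Z k h ▷ A ≫ g) : f = g :=
  sigmaTensor_hom_ext fun c => w c.isConcat

variable (Z)

/-- Multiplication by a letter on the left. -/
noncomputable def letterMulApp {s t u : Chain X} (h : Chain.IsConcat s t u) :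
    Z.obj (op s) ⊗ (freeDiag Z).obj (op t) ⟶ (freeDiag Z).obj (op u) :=
  tensorSigmaDesc fun k => consι Z k h ≫ (wordsι Z (k + 1)).app (op u)

@[simp]
lemma whiskerLeft_ι_letterMulApp {s t u : Chain X} (h : Chain.IsConcat s t u) (k : ℕ) :
    Z.obj (op s) ◁ (wordsι Z k).app (op t) ≫ letterMulApp Z h =
      consι Z k h ≫ (wordsι Z (k + 1)).app (op u) :=
  whiskerLeft_ι_tensorSigmaDesc _ _

/-- Multiplication by a letter on the left, as a natural family. -/
noncomputable def letterMul : Bilin Z (freeDiag Z) (freeDiag Z) where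
  app h := letterMulApp Z h
  natural h h' a b c H := by
    refine tensor_freeDiag_hom_ext fun k => ?_
    rw [reassoc_of% @whiskerLeft_ι_letterMulApp]
    have e1 := (wordsι Z k).naturality b.op
    have e2 := (wordsι Z (k + 1)).naturality c.op
    rw [← e2, reassoc_of% consι_naturality Z k h h' H, MonoidalCategory.tensorHom_def',
      MonoidalCategory.tensorHom_def']
    simp only [Category.assoc]
    rw [← MonoidalCategory.whiskerLeft_comp_assoc, ← e1,
      MonoidalCategory.whiskerLeft_comp_assoc, whisker_exchange_assoc,
      whiskerLeft_ι_letterMulApp, whisker_exchange_assoc]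

/-- Multiplication by a word on the left. -/
noncomputable def wordMulApp : ∀ (k : ℕ) {s t u : Chain X} (_ : Chain.IsConcat s t u),
    (words Z k).obj (op s) ⊗ (freeDiag Z).obj (op t) ⟶ (freeDiag Z).obj (op u)
  | 0, _, _, _, h => letterMulApp Z h
  | k + 1, _, _, _, h => sigmaTensorDesc fun c =>
      (α_ _ _ _).hom ≫ (Z.obj (op c.left) ◁ wordMulApp k (c.isConcat.assoc h).choose_spec.1) ≫
        letterMulApp Z (c.isConcat.assoc h).choose_spec.2

lemma ι_wordMulApp_succ (k : ℕ) {a b s t u w : Chain X} (h : Chain.IsConcat a b s)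
    (h' : Chain.IsConcat s t u) (h₁ : Chain.IsConcat b t w) (h₂ : Chain.IsConcat a w u) :
    consι Z k h ▷ (freeDiag Z).obj (op t) ≫ wordMulApp Z (k + 1) h' =
      (α_ _ _ _).hom ≫ (Z.obj (op a) ◁ wordMulApp Z k h₁) ≫ letterMulApp Z h₂ := by
  obtain rfl := h₁.unique (h.assoc h').choose_spec.1
  exact whiskerRight_ι_sigmaTensorDesc _ (⟨a, b, h⟩ : s.Cut)

lemma wordMulApp_natural (k : ℕ) {s t u s' t' u' : Chain X} (h : Chain.IsConcat s t u)
    (h' : Chain.IsConcat s' t' u')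
    (a : s ⟶ s') (b : t ⟶ t') (c : u ⟶ u') (H : Chain.IsHComp a b c) :
    ((words Z k).map a.op ⊗ₘ (freeDiag Z).map b.op) ≫ wordMulApp Z k h =
      wordMulApp Z k h' ≫ (freeDiag Z).map c.op := by
  induction k generalizing s t u s' t' u' with
  | zero => exact (letterMul Z).natural h h' a b c H
  | succ k ih =>
    refine words_succ_tensor_hom_ext fun {p' q'} d' => ?_
    obtain ⟨p, q, d, x, y, K⟩ := Chain.IsHComp.exists_cut d' a
    obtain ⟨w, h₁, h₂⟩ := d.assoc h
    obtain ⟨w', h₁', h₂'⟩ := d'.assoc h'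
    obtain ⟨z, L⟩ := Chain.IsHComp.exists_hcomp h₁ h₁' y b
    have L' := Chain.IsHComp.assoc d h₁' d' K H L
    have e := (letterMul Z).natural h₂ h₂' x z c L'
    have e' := ih h₁ h₁' y b z L
    change _ ≫ letterMulApp Z h₂ = letterMulApp Z h₂' ≫ _ at e
    rw [reassoc_of% ι_wordMulApp_succ Z k d' h' h₁' h₂', ← e, ← id_tensorHom,
      tensorHom_comp_tensorHom_assoc, ← e', Category.id_comp, MonoidalCategory.tensorHom_def,
      Category.assoc,
      ← comp_whiskerRight_assoc, consι_naturality Z k d d' K, comp_whiskerRight_assoc,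
      ← whisker_exchange_assoc, ι_wordMulApp_succ Z k d h h₁ h₂, ← tensorHom_id, ← id_tensorHom,
      ← id_tensorHom]
    simp [MonoidalCategory.tensorHom_def]

/-- The multiplication of the free pre-Co-Segal category. -/
noncomputable def freeMul {s t u : Chain X} (h : Chain.IsConcat s t u) :
    (freeDiag Z).obj (op s) ⊗ (freeDiag Z).obj (op t) ⟶ (freeDiag Z).obj (op u) :=
  sigmaTensorDesc fun k => wordMulApp Z k h

@[simp]
lemma ι_freeMul {s t u : Chain X} (h : Chain.IsConcat s t u) (k : ℕ) :
    (wordsι Z k).app (op s) ▷ _ ≫ freeMul Z h = wordMulApp Z k h :=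
  whiskerRight_ι_sigmaTensorDesc _ _

/-- The associativity law when the first factor is a letter. -/
lemma letterMulApp_assoc {r s t rs st u : Chain X} (h₁ : Chain.IsConcat r s rs)
    (h₂ : Chain.IsConcat rs t u) (h₃ : Chain.IsConcat s t st) (h₄ : Chain.IsConcat r st u) :
    (letterMulApp Z h₁ ▷ (freeDiag Z).obj (op t)) ≫ freeMul Z h₂ =
      (α_ _ _ _).hom ≫ (Z.obj (op r) ◁ freeMul Z h₃) ≫ letterMulApp Z h₄ := by
  rw [← cancel_epi (α_ _ _ _).inv]
  refine MonoidalClosed.curry_injective (freeDiag_tensor_hom_ext fun l => ?_)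
  rw [← MonoidalClosed.curry_natural_left, ← MonoidalClosed.curry_natural_left]
  congr 1
  rw [associator_inv_naturality_middle_assoc, ← comp_whiskerRight_assoc,
    whiskerLeft_ι_letterMulApp, comp_whiskerRight_assoc, ι_freeMul,
    ι_wordMulApp_succ Z l h₁ h₂ h₃ h₄, Iso.inv_hom_id_assoc, Iso.inv_hom_id_assoc,
    ← MonoidalCategory.whiskerLeft_comp_assoc, ι_freeMul]

/-- The associativity law when the first factor is a word, by induction on the number of its
letters. -/
lemma wordMulApp_assoc (k : ℕ) {r s t rs st u : Chain X} (h₁ : Chain.IsConcat r s rs)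
    (h₂ : Chain.IsConcat rs t u) (h₃ : Chain.IsConcat s t st) (h₄ : Chain.IsConcat r st u) :
    (wordMulApp Z k h₁ ▷ (freeDiag Z).obj (op t)) ≫ freeMul Z h₂ =
      (α_ _ _ _).hom ≫ ((words Z k).obj (op r) ◁ freeMul Z h₃) ≫ wordMulApp Z k h₄ := by
  induction k generalizing r s t rs st u with
  | zero => exact letterMulApp_assoc Z h₁ h₂ h₃ h₄
  | succ k ih =>
    rw [← cancel_epi (α_ _ _ _).inv]
    refine words_succ_tensor_hom_ext fun {a b} d => ?_
    obtain ⟨bs, c₁, c₂⟩ := d.assoc h₁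
    obtain ⟨bst, c₃, c₄⟩ := c₂.assoc h₂
    obtain ⟨st', c₅, c₆⟩ := c₁.assoc c₃
    obtain rfl := c₅.unique h₃
    rw [associator_inv_naturality_left_assoc, ← comp_whiskerRight_assoc,
      ι_wordMulApp_succ Z k d h₁ c₁ c₂, Iso.inv_hom_id_assoc, ← whisker_exchange_assoc,
      ι_wordMulApp_succ Z k d h₄ c₆ c₄]
    simp only [comp_whiskerRight, Category.assoc]
    rw [letterMulApp_assoc Z c₂ h₂ c₃ c₄, associator_naturality_middle_assoc,
      ← MonoidalCategory.whiskerLeft_comp_assoc, ih c₁ c₃ c₅ c₆]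
    simp

/-- The free pre-Co-Segal category on a diagram. -/
noncomputable def freePreCat : PreCat M X where
  diag := freeDiag Z
  lax h := freeMul Z h
  lax_natural h h' a b c H := by
    refine freeDiag_tensor_hom_ext fun k => ?_
    have e := (wordsι Z k).naturality a.op
    have e' := wordMulApp_natural Z k h h' a b c H
    rw [reassoc_of% @ι_freeMul, ← e', MonoidalCategory.tensorHom_def,
      MonoidalCategory.tensorHom_def, Category.assoc, Category.assoc, ← comp_whiskerRight_assoc,
      ← e, comp_whiskerRight_assoc, ← whisker_exchange_assoc, ι_freeMul]
  lax_assoc h₁ h₂ h₃ h₄ := by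
    rw [← cancel_epi (α_ _ _ _).inv]
    refine freeDiag_tensor_hom_ext fun k => ?_
    rw [associator_inv_naturality_left_assoc, ← comp_whiskerRight_assoc, ι_freeMul,
      wordMulApp_assoc Z k h₁ h₂ h₃ h₄, Iso.inv_hom_id_assoc, Iso.inv_hom_id_assoc,
      ← whisker_exchange_assoc, ι_freeMul]

/-- The inclusion of the letters. -/
noncomputable def letterι : Z ⟶ freeDiag Z := wordsι Z 0

lemma letter_freeMul {s t u : Chain X} (h : Chain.IsConcat s t u) (k : ℕ) :
    ((letterι Z).app (op s) ⊗ₘ (wordsι Z k).app (op t)) ≫ freeMul Z h =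
      consι Z k h ≫ (wordsι Z (k + 1)).app (op u) := by
  rw [tensorHom_def', Category.assoc]
  exact (congrArg (Z.obj (op s) ◁ (wordsι Z k).app (op t) ≫ ·) (ι_freeMul Z h 0)).trans
    (whiskerLeft_ι_letterMulApp Z h k)

variable {Z}

/-- The extension of a map `φ` from the letters to the words with `k + 1` letters. -/
noncomputable def wordsLift {G : PreCat M X} (φ : Z ⟶ G.diag) : ∀ k, words Z k ⟶ G.diag
  | 0 => φ
  | k + 1 => Bilin.desc
    { app := fun {s t _} h => (φ.app (op s) ⊗ₘ (wordsLift φ k).app (op t)) ≫ G.lax h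
      natural := fun h h' a b c H => by
        rw [tensorHom_comp_tensorHom_assoc, NatTrans.naturality, NatTrans.naturality,
          ← tensorHom_comp_tensorHom_assoc, G.lax_natural h h' a b c H, Category.assoc] }

lemma consι_wordsLift {G : PreCat M X} (φ : Z ⟶ G.diag) (k : ℕ) {s t u : Chain X}
    (h : Chain.IsConcat s t u) : consι Z k h ≫ (wordsLift φ (k + 1)).app (op u) =
      (φ.app (op s) ⊗ₘ (wordsLift φ k).app (op t)) ≫ G.lax h :=
  Bilin.ι_desc _ h

/-- The extension of a map from the letters to all words. -/
noncomputable def freeDiagLift {G : PreCat M X} (φ : Z ⟶ G.diag) : freeDiag Z ⟶ G.diag where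
  app u := Sigma.desc fun k => (wordsLift φ k).app u
  naturality u u' c := Sigma.hom_ext _ _ fun k => by simp [freeDiag]

@[simp]
lemma wordsι_freeDiagLift {G : PreCat M X} (φ : Z ⟶ G.diag) (k : ℕ) (u : (Chain X)ᵒᵖ) :
    (wordsι Z k).app u ≫ (freeDiagLift φ).app u = (wordsLift φ k).app u :=
  Sigma.ι_desc _ _

lemma letterMulApp_freeDiagLift {G : PreCat M X} (φ : Z ⟶ G.diag) {s t u : Chain X}
    (h : Chain.IsConcat s t u) : letterMulApp Z h ≫ (freeDiagLift φ).app (op u) =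
      (φ.app (op s) ⊗ₘ (freeDiagLift φ).app (op t)) ≫ G.lax h := by
  refine tensor_freeDiag_hom_ext fun k => ?_
  rw [reassoc_of% @whiskerLeft_ι_letterMulApp, wordsι_freeDiagLift, consι_wordsLift,
    tensorHom_def', tensorHom_def', Category.assoc, Category.assoc,
    ← MonoidalCategory.whiskerLeft_comp_assoc, wordsι_freeDiagLift]

lemma wordMulApp_freeDiagLift {G : PreCat M X} (φ : Z ⟶ G.diag) (k : ℕ) {s t u : Chain X}
    (h : Chain.IsConcat s t u) : wordMulApp Z k h ≫ (freeDiagLift φ).app (op u) =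
      ((wordsLift φ k).app (op s) ⊗ₘ (freeDiagLift φ).app (op t)) ≫ G.lax h := by
  induction k generalizing s t u with
  | zero => exact letterMulApp_freeDiagLift φ h
  | succ k ih =>
    refine words_succ_tensor_hom_ext fun {a b} d => ?_
    obtain ⟨bt, c₁, c₂⟩ := d.assoc h
    rw [reassoc_of% ι_wordMulApp_succ Z k d h c₁ c₂, letterMulApp_freeDiagLift,
      MonoidalCategory.tensorHom_def ((wordsLift φ (k + 1)).app _), Category.assoc,
      ← comp_whiskerRight_assoc, consι_wordsLift, comp_whiskerRight_assoc,
      ← whisker_exchange_assoc, G.lax_assoc d h c₁ c₂, ← MonoidalCategory.tensorHom_def_assoc,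
      associator_naturality_assoc, ← id_tensorHom, tensorHom_comp_tensorHom_assoc, ih c₁,
      ← id_tensorHom, tensorHom_comp_tensorHom_assoc, Category.id_comp, Category.comp_id]

lemma freeMul_freeDiagLift {G : PreCat M X} (φ : Z ⟶ G.diag) {s t u : Chain X}
    (h : Chain.IsConcat s t u) : freeMul Z h ≫ (freeDiagLift φ).app (op u) =
      ((freeDiagLift φ).app (op s) ⊗ₘ (freeDiagLift φ).app (op t)) ≫ G.lax h := by
  refine freeDiag_tensor_hom_ext fun k => ?_
  rw [reassoc_of% @ι_freeMul, wordMulApp_freeDiagLift,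
    MonoidalCategory.tensorHom_def, MonoidalCategory.tensorHom_def, Category.assoc,
    Category.assoc, ← comp_whiskerRight_assoc, wordsι_freeDiagLift]

/-- The morphism from the free pre-Co-Segal category that extends a map of diagrams. -/
noncomputable def freePreCatLift {G : PreCat M X} (φ : Z ⟶ G.diag) : freePreCat Z ⟶ G where
  trans := freeDiagLift φ
  comm h := freeMul_freeDiagLift φ h

/-- The values of a multiplicative map on words are determined by its values on letters. -/
lemma consι_wordsι_comp {G : PreCat M X} (ρ : freeDiag Z ⟶ G.diag) (k : ℕ) {s t u : Chain X}
    (h : Chain.IsConcat s t u) (hρ : freeMul Z h ≫ ρ.app (op u) =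
      (ρ.app (op s) ⊗ₘ ρ.app (op t)) ≫ G.lax h) :
    consι Z k h ≫ (wordsι Z (k + 1) ≫ ρ).app (op u) =
      ((letterι Z ≫ ρ).app _ ⊗ₘ (wordsι Z k ≫ ρ).app _) ≫ G.lax h := by
  rw [NatTrans.comp_app, NatTrans.comp_app, NatTrans.comp_app,
    ← tensorHom_comp_tensorHom_assoc, ← hρ, reassoc_of% letter_freeMul Z h k]

lemma freePreCat_hom_ext {G : PreCat M X} {σ τ : freePreCat Z ⟶ G}
    (h : letterι Z ≫ σ.trans = letterι Z ≫ τ.trans) : σ = τ := by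
  have key (k : ℕ) : wordsι Z k ≫ σ.trans = wordsι Z k ≫ τ.trans := by
    induction k with
    | zero => exact h
    | succ k ih =>
      ext ⟨u⟩
      refine words_succ_hom_ext fun c => ?_
      refine (consι_wordsι_comp σ.trans k c (σ.comm c)).trans ?_
      refine Eq.trans ?_ (consι_wordsι_comp τ.trans k c (τ.comm c)).symm
      exact congrArg₂ (fun α β => (NatTrans.app α _ ⊗ₘ NatTrans.app β _) ≫ G.lax c) h ih
  refine PreCat.Hom.ext ?_
  ext u
  exact freeDiag_hom_ext fun k => congrArg (fun α => NatTrans.app α u) (key k)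

/-- The universal property of the free pre-Co-Segal category. -/
noncomputable def freePreCatHomEquiv (Z : KDiag M X) (G : PreCat M X) :
    (freePreCat Z ⟶ G) ≃ (Z ⟶ (forgetLax M X).obj G) where
  toFun σ := letterι Z ≫ σ.trans
  invFun φ := freePreCatLift φ
  left_inv σ := freePreCat_hom_ext (by ext u; exact wordsι_freeDiagLift _ 0 u)
  right_inv φ := by ext u; exact wordsι_freeDiagLift _ 0 u

instance isRightAdjoint_forgetLax (X : Type v) : (forgetLax M X).IsRightAdjoint :=
  (Adjunction.adjunctionOfEquivLeft (freePreCatHomEquiv (M := M) (X := X))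
    fun _ _ _ τ σ => (Category.assoc (letterι _) σ.trans τ.trans).symm).isRightAdjoint

end Free

/-! ### Sifted colimits of pre-Co-Segal categories -/

section Sifted

open WalkingReflexivePair in
/-- The category that parametrizes reflexive pairs is sifted. -/
instance isSifted_walkingReflexivePair : IsSifted WalkingReflexivePair where
  nonempty := ⟨one⟩
  out := by
    rintro ⟨a, b⟩
    have hzz : ∀ f : Hom zero zero, f = Hom.id zero := by intro f; cases f; rfl
    have hoz : ∀ f : Hom one zero, f = .left ∨ f = .right := by
      intro f; cases f <;> simp
    let S (f : a ⟶ zero) (g : b ⟶ zero) : StructuredArrow (a, b) (Functor.diag _) :=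
      StructuredArrow.mk (Y := zero) (Prod.mkHom f g)
    let T (f : a ⟶ one) (g : b ⟶ one) : StructuredArrow (a, b) (Functor.diag _) :=
      StructuredArrow.mk (Y := one) (Prod.mkHom f g)
    have hl (f : a ⟶ one) (g : b ⟶ one) : Zigzag (T f g) (S (f ≫ .left) (g ≫ .left)) :=
      Zigzag.of_hom (StructuredArrow.homMk .left rfl)
    have hr (f : a ⟶ one) (g : b ⟶ one) : Zigzag (T f g) (S (f ≫ .right) (g ≫ .right)) :=
      Zigzag.of_hom (StructuredArrow.homMk .right rfl)
    have h1 (f : a ⟶ one) (g : b ⟶ one) :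
        Zigzag (S (f ≫ .left) (g ≫ .left)) (S (f ≫ .right) (g ≫ .right)) :=
      (hl f g).symm.trans (hr f g)
    have hS (f f' : a ⟶ zero) (g g' : b ⟶ zero) : Zigzag (S f g) (S f' g') := by
      cases a with
      | zero =>
        obtain rfl := hzz f
        obtain rfl := hzz f'
        cases b with
        | zero =>
          obtain rfl := hzz g
          obtain rfl := hzz g'
          exact Zigzag.refl _
        | one =>
          have := h1 .reflexion (𝟙 _)
          obtain rfl | rfl := hoz g <;> obtain rfl | rfl := hoz g' <;>
            first | exact Zigzag.refl _ | exact this | exact this.symm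
      | one =>
        cases b with
        | zero =>
          obtain rfl := hzz g
          obtain rfl := hzz g'
          have := h1 (𝟙 _) .reflexion
          obtain rfl | rfl := hoz f <;> obtain rfl | rfl := hoz f' <;>
            first | exact Zigzag.refl _ | exact this | exact this.symm
        | one =>
          have k : ∀ (f : one ⟶ zero) (g : one ⟶ zero), Zigzag (S .left .left) (S f g) := by
            have k0 : Zigzag (S .left .left) (S .right .right) := h1 (𝟙 _) (𝟙 _)
            have k1 : Zigzag (S .left .left) (S .right .left) := h1 (𝟙 _) (.left ≫ .reflexion)
            have k2 : Zigzag (S .left .left) (S .left .right) := h1 (.left ≫ .reflexion) (𝟙 _)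
            intro f g
            obtain rfl | rfl := hoz f <;> obtain rfl | rfl := hoz g <;>
              first | exact Zigzag.refl _ | assumption
          exact (k f g).symm.trans (k f' g')
    have hST (j : StructuredArrow (a, b) (Functor.diag _)) : ∃ f g, Zigzag j (S f g) := by
      obtain ⟨⟨⟨⟩⟩, c, ⟨f, g⟩⟩ := j
      cases c with
      | zero => exact ⟨f, g, Zigzag.refl _⟩
      | one => exact ⟨_, _, hl f g⟩
    have : Nonempty (StructuredArrow (a, b) (Functor.diag WalkingReflexivePair)) := by
      cases a <;> cases b
      exacts [⟨S (𝟙 _) (𝟙 _)⟩, ⟨S (𝟙 _) .left⟩, ⟨S .left (𝟙 _)⟩, ⟨S .left .left⟩]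
    refine zigzag_isConnected fun j j' => ?_
    obtain ⟨f, g, h⟩ := hST j
    obtain ⟨f', g', h'⟩ := hST j'
    exact h.trans ((hS f f' g g').trans h'.symm)

/-- A form of the reflexive monadicity theorem. -/
theorem nonempty_monadicRightAdjoint {C D : Type*} [Category.{v} C] [Category.{v} D] (G : C ⥤ D)
    [G.IsRightAdjoint] [G.ReflectsIsomorphisms] [HasColimitsOfShape WalkingReflexivePair C]
    [PreservesColimitsOfShape WalkingReflexivePair G] : Nonempty (MonadicRightAdjoint G) := by
  have : HasReflexiveCoequalizers C := hasReflexiveCoequalizers_iff.1 inferInstance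
  have : Monad.PreservesColimitOfIsReflexivePair G := ⟨fun A B f g _ => by
    let e : WalkingParallelPair.inclusionWalkingReflexivePair ⋙
        reflexivePair f g (commonSection f g) (section_comp_left f g)
          (section_comp_right f g) ≅ parallelPair f g :=
      diagramIsoParallelPair _ ≪≫ parallelPair.eqOfHomEq rfl rfl
    exact preservesColimit_of_iso_diagram G e⟩
  exact ⟨Monad.monadicOfHasPreservesReflexiveCoequalizersOfReflectsIsomorphisms
    (Adjunction.ofIsRightAdjoint G)⟩

variable {M : Type u} [Category.{v} M] [MonoidalCategory M] {X : Type v}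
  {J : Type*} [Category* J]

/-- The levelwise tensor product of two diagrams. -/
def tensorDiag (F G : J ⥤ M) : J ⥤ M where
  obj j := F.obj j ⊗ G.obj j
  map f := F.map f ⊗ₘ G.map f

/-- The tensor product of two cocones. -/
def tensorCocone {F G : J ⥤ M} (c : Cocone F) (c' : Cocone G) : Cocone (tensorDiag F G) where
  pt := c.pt ⊗ c'.pt
  ι := { app := fun j => c.ι.app j ⊗ₘ c'.ι.app j
         naturality := fun i j f => by
           rw [← c.w f, ← c'.w f, ← tensorHom_comp_tensorHom]
           exact (Category.comp_id _).symm }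

/-- Maps compatible with multiplications transport associativity. -/
lemma comp_assoc {A₁ A₂ A₃ A₁₂ A₂₃ A₁₂₃ B₁ B₂ B₃ B₁₂ B₂₃ B₁₂₃ : M} {x₁ : A₁ ⟶ B₁} {x₂ : A₂ ⟶ B₂}
    {x₃ : A₃ ⟶ B₃} {x₁₂ : A₁₂ ⟶ B₁₂} {x₂₃ : A₂₃ ⟶ B₂₃} {x₁₂₃ : A₁₂₃ ⟶ B₁₂₃}
    {m₁ : A₁ ⊗ A₂ ⟶ A₁₂} {m₂ : A₁₂ ⊗ A₃ ⟶ A₁₂₃} {m₃ : A₂ ⊗ A₃ ⟶ A₂₃} {m₄ : A₁ ⊗ A₂₃ ⟶ A₁₂₃}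
    {n₁ : B₁ ⊗ B₂ ⟶ B₁₂} {n₂ : B₁₂ ⊗ B₃ ⟶ B₁₂₃} {n₃ : B₂ ⊗ B₃ ⟶ B₂₃} {n₄ : B₁ ⊗ B₂₃ ⟶ B₁₂₃}
    (h₁ : (x₁ ⊗ₘ x₂) ≫ n₁ = m₁ ≫ x₁₂) (h₂ : (x₁₂ ⊗ₘ x₃) ≫ n₂ = m₂ ≫ x₁₂₃)
    (h₃ : (x₂ ⊗ₘ x₃) ≫ n₃ = m₃ ≫ x₂₃) (h₄ : (x₁ ⊗ₘ x₂₃) ≫ n₄ = m₄ ≫ x₁₂₃)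
    (h : (m₁ ▷ A₃) ≫ m₂ = (α_ A₁ A₂ A₃).hom ≫ (A₁ ◁ m₃) ≫ m₄) :
    ((x₁ ⊗ₘ x₂) ⊗ₘ x₃) ≫ (n₁ ▷ B₃) ≫ n₂ =
      ((x₁ ⊗ₘ x₂) ⊗ₘ x₃) ≫ (α_ B₁ B₂ B₃).hom ≫ (B₁ ◁ n₃) ≫ n₄ := by
  have e₁ : (x₁ ⊗ₘ x₂) ≫ n₁ ⊗ₘ x₃ = m₁ ▷ A₃ ≫ (x₁₂ ⊗ₘ x₃) := by
    rw [h₁, ← tensorHom_id, tensorHom_comp_tensorHom, Category.id_comp]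
  have e₃ : x₁ ⊗ₘ (x₂ ⊗ₘ x₃) ≫ n₃ = A₁ ◁ m₃ ≫ (x₁ ⊗ₘ x₂₃) := by
    rw [h₃, ← id_tensorHom, tensorHom_comp_tensorHom, Category.id_comp]
  rw [associator_naturality_assoc, ← tensorHom_id, ← id_tensorHom,
    tensorHom_comp_tensorHom_assoc, tensorHom_comp_tensorHom_assoc, Category.comp_id,
    Category.comp_id, e₁, e₃, Category.assoc, Category.assoc, h₂, h₄, ← Category.assoc, h]
  simp only [Category.assoc]

variable [SymmetricCategory M] [MonoidalClosed M]

/-- The tensor product, which preserves colimits in both variables, preserves sifted colimits. -/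
noncomputable def isColimitTensorCocone [IsSiftedOrEmpty J] {F G : J ⥤ M} {c : Cocone F}
    {c' : Cocone G} (hc : IsColimit c) (hc' : IsColimit c') : IsColimit (tensorCocone c c') :=
  have (A : M) : PreservesColimit G ((curriedTensor M).obj A) :=
    inferInstanceAs (PreservesColimit G (tensorLeft A))
  have (A : M) : PreservesColimit F ((curriedTensor M).flip.obj A) :=
    inferInstanceAs (PreservesColimit F (tensorRight A))
  have h := (Functor.Final.isColimitWhiskerEquiv (Functor.diag J) _).symm
    (isColimitOfPreserves₂ (curriedTensor M) hc hc')
  let e : tensorDiag F G ≅ Functor.diag J ⋙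
      Functor.uncurry.obj (((Functor.whiskeringLeft₂ M).obj F).obj G |>.obj (curriedTensor M)) :=
    NatIso.ofComponents (fun j => Iso.refl _) fun f => by
      refine (Category.comp_id _).trans (Eq.trans ?_ (Category.id_comp _).symm)
      exact MonoidalCategory.tensorHom_def _ _
  IsColimit.ofIsoColimit ((IsColimit.precomposeHomEquiv e _).symm h)
    (Cocone.ext (Iso.refl _) fun j => by
      refine (Category.comp_id _).trans ((Category.id_comp _).trans ?_)
      exact (MonoidalCategory.tensorHom_def _ _).symm)

section

variable {F : PreCat M X} {P : KDiag M X} {γ : F.diag ⟶ P}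
  {ℓ : ∀ {s t u : Chain X}, Chain.IsConcat s t u → (P.obj (op s) ⊗ P.obj (op t) ⟶ P.obj (op u))}

/-- Maps compatible with multiplications transport naturality. -/
lemma comp_lax_natural
    (hγ : ∀ {s t u : Chain X} (h : Chain.IsConcat s t u),
      (γ.app (op s) ⊗ₘ γ.app (op t)) ≫ ℓ h = F.lax h ≫ γ.app (op u))
    {s t u s' t' u' : Chain X} (h : Chain.IsConcat s t u) (h' : Chain.IsConcat s' t' u')
    (a : s ⟶ s') (b : t ⟶ t') (d : u ⟶ u') (H : Chain.IsHComp a b d) :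
    (γ.app (op s') ⊗ₘ γ.app (op t')) ≫ (P.map a.op ⊗ₘ P.map b.op) ≫ ℓ h =
      (γ.app (op s') ⊗ₘ γ.app (op t')) ≫ ℓ h' ≫ P.map d.op := by
  rw [reassoc_of% hγ h', tensorHom_comp_tensorHom_assoc, ← γ.naturality, ← γ.naturality,
    ← tensorHom_comp_tensorHom_assoc, hγ h, ← γ.naturality, ← Category.assoc, ← Category.assoc,
    F.lax_natural h h' a b d H]

lemma comp_lax_assoc
    (hγ : ∀ {s t u : Chain X} (h : Chain.IsConcat s t u),
      (γ.app (op s) ⊗ₘ γ.app (op t)) ≫ ℓ h = F.lax h ≫ γ.app (op u))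
    {r s t rs st u : Chain X} (h₁ : Chain.IsConcat r s rs) (h₂ : Chain.IsConcat rs t u)
    (h₃ : Chain.IsConcat s t st) (h₄ : Chain.IsConcat r st u) :
    ((γ.app (op r) ⊗ₘ γ.app (op s)) ⊗ₘ γ.app (op t)) ≫ (ℓ h₁ ▷ P.obj (op t)) ≫ ℓ h₂ =
      ((γ.app (op r) ⊗ₘ γ.app (op s)) ⊗ₘ γ.app (op t)) ≫
        (α_ (P.obj (op r)) (P.obj (op s)) (P.obj (op t))).hom ≫
        (P.obj (op r) ◁ ℓ h₃) ≫ ℓ h₄ :=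
  comp_assoc (hγ h₁) (hγ h₂) (hγ h₃) (hγ h₄) (F.lax_assoc h₁ h₂ h₃ h₄)

/-- Compatibility with multiplications passes to the second of two maps. -/
lemma comp_lax_comm {G : PreCat M X} {δ : P ⟶ G.diag}
    (hγ : ∀ {s t u : Chain X} (h : Chain.IsConcat s t u),
      (γ.app (op s) ⊗ₘ γ.app (op t)) ≫ ℓ h = F.lax h ≫ γ.app (op u)) (σ : F ⟶ G)
    (hσ : γ ≫ δ = σ.trans) {s t u : Chain X} (h : Chain.IsConcat s t u) :
    (γ.app (op s) ⊗ₘ γ.app (op t)) ≫ ℓ h ≫ δ.app (op u) =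
      (γ.app (op s) ⊗ₘ γ.app (op t)) ≫ (δ.app (op s) ⊗ₘ δ.app (op t)) ≫ G.lax h := by
  have e := σ.comm h
  rw [← hσ, NatTrans.comp_app, NatTrans.comp_app, NatTrans.comp_app,
    ← tensorHom_comp_tensorHom_assoc] at e
  rw [← e, reassoc_of% hγ h]

end

section

variable [IsSiftedOrEmpty J] {D : J ⥤ PreCat M X} {c : Cocone (D ⋙ forgetLax M X)}
  (hc : ∀ u, IsColimit (((evaluation (Chain X)ᵒᵖ M).obj u).mapCocone c))

/-- The laxity maps of a levelwise sifted colimit. -/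
noncomputable def siftedLax {s t u : Chain X} (h : Chain.IsConcat s t u) :
    c.pt.obj (op s) ⊗ c.pt.obj (op t) ⟶ c.pt.obj (op u) :=
  (isColimitTensorCocone (hc (op s)) (hc (op t))).desc ⟨c.pt.obj (op u),
    { app := fun j => (D.obj j).lax h ≫ (c.ι.app j).app (op u)
      naturality := fun i j f => by
        have e := congrArg (fun α => NatTrans.app α (op u)) (c.w f)
        refine Eq.trans ?_ (Category.comp_id _).symm
        rw [← e]
        exact ((Category.assoc _ _ _).symm.trans
          (congrArg (· ≫ (c.ι.app j).app (op u)) ((D.map f).comm h)).symm).trans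
            (Category.assoc _ _ _) }⟩

lemma ι_siftedLax {s t u : Chain X} (h : Chain.IsConcat s t u) (j : J) :
    ((c.ι.app j).app (op s) ⊗ₘ (c.ι.app j).app (op t)) ≫ siftedLax hc h =
      (D.obj j).lax h ≫ (c.ι.app j).app (op u) :=
  (isColimitTensorCocone (hc (op s)) (hc (op t))).fac _ j

/-- A levelwise sifted colimit of pre-Co-Segal categories. -/
noncomputable def siftedColimit : PreCat M X where
  diag := c.pt
  lax h := siftedLax hc h
  lax_natural {s t u s' t' u'} h h' a b d H := by
    refine (isColimitTensorCocone (hc (op s')) (hc (op t'))).hom_ext fun j => ?_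
    exact comp_lax_natural (F := D.obj j) (γ := c.ι.app j) (fun h => ι_siftedLax hc h j)
      h h' a b d H
  lax_assoc {r s t rs st u} h₁ h₂ h₃ h₄ := by
    refine (isColimitTensorCocone (isColimitTensorCocone (hc (op r)) (hc (op s)))
      (hc (op t))).hom_ext fun j => ?_
    exact comp_lax_assoc (F := D.obj j) (γ := c.ι.app j) (fun h => ι_siftedLax hc h j)
      h₁ h₂ h₃ h₄

/-- The colimit cocone with point `siftedColimit`. -/
noncomputable def siftedCocone : Cocone D where
  pt := siftedColimit hc
  ι :=
    { app := fun j => ⟨c.ι.app j, fun h => (ι_siftedLax hc h j).symm⟩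
      naturality := fun _ _ f => PreCat.Hom.ext (c.ι.naturality f) }

/-- The cocone `siftedCocone` is a colimit cocone. -/
noncomputable def isColimitSiftedCocone : IsColimit (siftedCocone hc) :=
  have hc' : IsColimit c := evaluationJointlyReflectsColimits c hc
  { desc := fun s => ⟨hc'.desc ((forgetLax M X).mapCocone s), fun {s₁ t₁ u₁} h => by
      refine (isColimitTensorCocone (hc (op s₁)) (hc (op t₁))).hom_ext fun j => ?_
      exact comp_lax_comm (F := D.obj j) (γ := c.ι.app j) (fun h => ι_siftedLax hc h j)
        (s.ι.app j) (hc'.fac ((forgetLax M X).mapCocone s) j) h⟩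
    fac := fun s j => PreCat.Hom.ext (hc'.fac ((forgetLax M X).mapCocone s) j)
    uniq := fun s m hm => PreCat.Hom.ext (hc'.uniq ((forgetLax M X).mapCocone s) m.trans
      fun j => congrArg PreCat.Hom.trans (hm j)) }

end

instance preservesColimitsOfShape_forgetLax [IsSiftedOrEmpty J] [HasColimitsOfShape J M] :
    PreservesColimitsOfShape J (forgetLax M X) where
  preservesColimit {D} :=
    have hc := fun u => isColimitOfPreserves ((evaluation (Chain X)ᵒᵖ M).obj u)
      (colimit.isColimit (D ⋙ forgetLax M X))
    preservesColimit_of_preserves_colimit_cocone (isColimitSiftedCocone hc)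
      (colimit.isColimit (D ⋙ forgetLax M X))

lemma hasColimitsOfShape_preCat [IsSiftedOrEmpty J] [HasColimitsOfShape J M] :
    HasColimitsOfShape J (PreCat M X) where
  has_colimit D :=
    have hc := fun u => isColimitOfPreserves ((evaluation (Chain X)ᵒᵖ M).obj u)
      (colimit.isColimit (D ⋙ forgetLax M X))
    ⟨⟨⟨_, isColimitSiftedCocone hc⟩⟩⟩

/-- The inverse of a bijective morphism is compatible with the laxity maps. -/
lemma PreCat.Hom.comm_of_inverse {F G : PreCat M X} (f : F ⟶ G) (g : G.diag ⟶ F.diag)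
    (hfg : f.trans ≫ g = 𝟙 _) (hgf : g ≫ f.trans = 𝟙 _) {s t u : Chain X}
    (h : Chain.IsConcat s t u) :
    G.lax h ≫ g.app (op u) = (g.app (op s) ⊗ₘ g.app (op t)) ≫ F.lax h := by
  have e (s) : f.trans.app s ≫ g.app s = 𝟙 _ := congrArg (fun α => NatTrans.app α s) hfg
  have e' (s) : g.app s ≫ f.trans.app s = 𝟙 _ := congrArg (fun α => NatTrans.app α s) hgf
  have h1 := f.comm h
  rw [← Category.comp_id (F.lax h), ← e (op u), reassoc_of% h1, tensorHom_comp_tensorHom_assoc,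
    e', e', id_tensorHom_id, Category.id_comp]

instance reflectsIsomorphisms_forgetLax : (forgetLax M X).ReflectsIsomorphisms where
  reflects {F G} f _ :=
    let g : (forgetLax M X).obj G ⟶ (forgetLax M X).obj F := inv ((forgetLax M X).map f)
    have h₁ : (forgetLax M X).map f ≫ g = 𝟙 _ := IsIso.hom_inv_id ((forgetLax M X).map f)
    have h₂ : g ≫ (forgetLax M X).map f = 𝟙 _ := IsIso.inv_hom_id ((forgetLax M X).map f)
    ⟨⟨⟨g, fun h => PreCat.Hom.comm_of_inverse f g h₁ h₂ h⟩,
      PreCat.Hom.ext h₁, PreCat.Hom.ext h₂⟩⟩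

variable [HasColimits M]

instance : HasColimitsOfShape WalkingReflexivePair (PreCat M X) :=
  have : HasColimitsOfShape WalkingReflexivePair M :=
    hasReflexiveCoequalizers_iff.2 inferInstance
  hasColimitsOfShape_preCat

instance : HasReflexiveCoequalizers (PreCat M X) :=
  hasReflexiveCoequalizers_iff.1 inferInstance

/-- The category of pre-Co-Segal categories is monadic over the category of diagrams. -/
lemma nonempty_monadicRightAdjoint_forgetLax : Nonempty (MonadicRightAdjoint (forgetLax M X)) :=
  nonempty_monadicRightAdjoint _

instance hasLimits_preCat [HasLimits M] : HasLimits (PreCat M X) :=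
  have ⟨_⟩ := nonempty_monadicRightAdjoint_forgetLax (M := M) (X := X)
  have := monadicCreatesLimits.{v, v} (forgetLax M X)
  hasLimits_of_hasLimits_createsLimits (forgetLax M X)

instance hasColimits_preCat : HasColimits (PreCat M X) where
  has_colimits_of_shape J _ := by
    let V := (Functor.whiskeringRight J _ _).obj (forgetLax M X)
    have : V.IsRightAdjoint :=
      (Adjunction.whiskerRight J (Adjunction.ofIsRightAdjoint (forgetLax M X))).isRightAdjoint
    obtain ⟨_⟩ := nonempty_monadicRightAdjoint V
    have : (Functor.const J : KDiag M X ⥤ _).IsRightAdjoint :=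
      hasColimitsOfShape_iff_isRightAdjoint_const.1 inferInstance
    have := isRightAdjoint_square_lift_monadic (Functor.const J) V (forgetLax M X)
      (Functor.const J) (NatIso.ofComponents fun F => NatIso.ofComponents fun j => Iso.refl _)
    exact hasColimitsOfShape_iff_isRightAdjoint_const.2 this

instance isRightAdjoint_kPullback {X Y : Type v} (f : X → Y) : (kPullback M f).IsRightAdjoint :=
  have := hasColimitsOfSizeShrink.{0, v, v, v} M
  ((Chain.map f).op.lanAdjunction M).isRightAdjoint

instance isRightAdjoint_pullback {X Y : Type v} (f : X → Y) : (pullback M f).IsRightAdjoint :=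
  have ⟨_⟩ := nonempty_monadicRightAdjoint_forgetLax (M := M) (X := X)
  isRightAdjoint_square_lift_monadic (pullback M f) (forgetLax M X) (forgetLax M Y)
    (kPullback M f) (Iso.refl _)

end Sifted

/-! ### Truncated diagrams -/

section Trunc

variable {M : Type u} [Category.{v} M] {X : Type v}

/-- A constructor for maps of diagrams. -/
def KDiag.homMk {F G : KDiag M X} (app : ∀ s : Chain X, F.obj (op s) ⟶ G.obj (op s))
    (nat : ∀ {t s : Chain X} (a : t ⟶ s), F.map a.op ≫ app t = app s ≫ G.map a.op) : F ⟶ G where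
  app s := app s.unop
  naturality _ _ a := nat a.unop

/-- The index set of the product that defines the value at `s` of a truncated diagram. -/
inductive TruncIndex (n : ℕ) (s : Chain X) : Type v
  | low (h : s.deg < n) : TruncIndex n s
  | cell (u : Chain X) (hu : u.deg = n) (e : u ⟶ s) : TruncIndex n s

/-- The factors of the product that defines the value at `s` of a truncated diagram. -/
def TruncIndex.obj (n : ℕ) (E : KDiag M X) (Z : Chain X → M) {s : Chain X} : TruncIndex n s → M
  | low _ => E.obj (op s)
  | cell u _ _ => Z u

variable [HasLimits M] (n : ℕ) (E E' : KDiag M X) (Z : Chain X → M)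

/-- The value at `s` of the diagram `trunc n E Z`. -/
noncomputable def truncObj (s : Chain X) : M := ∏ᶜ (TruncIndex.obj n E Z : TruncIndex n s → M)

namespace truncObj

variable {n E E' Z} {s : Chain X}

/-- The projection to the value of the given diagram at a chain of length less than `n`. -/
noncomputable def fst (h : s.deg < n) : truncObj n E Z s ⟶ E.obj (op s) :=
  Pi.π (TruncIndex.obj n E Z) (TruncIndex.low h)

/-- The projection to an object attached to a chain of length `n`. -/
noncomputable def snd {u : Chain X} (hu : u.deg = n) (e : u ⟶ s) : truncObj n E Z s ⟶ Z u :=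
  Pi.π (TruncIndex.obj n E Z) (TruncIndex.cell u hu e)

/-- The map to the value of a truncated diagram with given components. -/
noncomputable def lift {B : M} (f : s.deg < n → (B ⟶ E.obj (op s)))
    (g : ∀ {u : Chain X} (_ : u.deg = n) (_ : u ⟶ s), B ⟶ Z u) : B ⟶ truncObj n E Z s :=
  Pi.lift fun
    | TruncIndex.low h => f h
    | TruncIndex.cell _ hu e => g hu e

@[simp]
lemma lift_fst {B : M} (f : s.deg < n → (B ⟶ E.obj (op s)))
    (g : ∀ {u : Chain X} (_ : u.deg = n) (_ : u ⟶ s), B ⟶ Z u) (h : s.deg < n) :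
    lift (E := E) f g ≫ fst h = f h :=
  limit.lift_π _ (Discrete.mk (TruncIndex.low h))

@[simp]
lemma lift_snd {B : M} (f : s.deg < n → (B ⟶ E.obj (op s)))
    (g : ∀ {u : Chain X} (_ : u.deg = n) (_ : u ⟶ s), B ⟶ Z u) {u : Chain X} (hu : u.deg = n)
    (e : u ⟶ s) : lift (E := E) f g ≫ snd hu e = g hu e :=
  limit.lift_π _ (Discrete.mk (TruncIndex.cell u hu e))

lemma hom_ext {B : M} {f g : B ⟶ truncObj n E Z s} (h₁ : ∀ h, f ≫ fst h = g ≫ fst h)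
    (h₂ : ∀ {u : Chain X} (hu : u.deg = n) (e : u ⟶ s), f ≫ snd hu e = g ≫ snd hu e) : f = g :=
  Pi.hom_ext _ _ fun
    | TruncIndex.low h => h₁ h
    | TruncIndex.cell _ hu e => h₂ hu e

end truncObj

open truncObj

/-- A diagram that has the value `Z u` at the chains `u` of length `n`, and the value `E s` as a
factor at the shorter chains `s`. -/
noncomputable def trunc : KDiag M X where
  obj s := truncObj n E Z s.unop
  map {s t} a := lift (fun h => fst ((Chain.deg_le a.unop).trans_lt h) ≫ E.map a)
    fun hu e => snd hu (e ≫ a.unop)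
  map_id s := hom_ext (fun h => by simp) fun hu e => by simp
  map_comp a b := hom_ext (fun h => by simp [reassoc_of% @lift_fst])
    fun hu e => by simp

variable {n E Z} {s : Chain X}

/-- The projection to the value of the given diagram at a chain of length less than `n`. -/
noncomputable def truncFst (h : s.deg < n) : (trunc n E Z).obj (op s) ⟶ E.obj (op s) := fst h

/-- The projection to an object attached to a chain of length `n`. -/
noncomputable def truncSnd {u : Chain X} (hu : u.deg = n) (e : u ⟶ s) :
    (trunc n E Z).obj (op s) ⟶ Z u :=
  snd hu e

/-- The map to the value of a truncated diagram with given components. -/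
noncomputable def truncLift {B : M} (f : s.deg < n → (B ⟶ E.obj (op s)))
    (g : ∀ {u : Chain X} (_ : u.deg = n) (_ : u ⟶ s), B ⟶ Z u) : B ⟶ (trunc n E Z).obj (op s) :=
  lift f g

@[simp]
lemma truncLift_fst {B : M} (f : s.deg < n → (B ⟶ E.obj (op s)))
    (g : ∀ {u : Chain X} (_ : u.deg = n) (_ : u ⟶ s), B ⟶ Z u) (h : s.deg < n) :
    truncLift (E := E) f g ≫ truncFst h = f h :=
  lift_fst _ _ _

@[simp]
lemma truncLift_snd {B : M} (f : s.deg < n → (B ⟶ E.obj (op s)))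
    (g : ∀ {u : Chain X} (_ : u.deg = n) (_ : u ⟶ s), B ⟶ Z u) {u : Chain X} (hu : u.deg = n)
    (e : u ⟶ s) : truncLift (E := E) f g ≫ truncSnd hu e = g hu e :=
  lift_snd _ _ _ _

lemma trunc_hom_ext {B : M} {f g : B ⟶ (trunc n E Z).obj (op s)}
    (h₁ : ∀ h, f ≫ truncFst h = g ≫ truncFst h)
    (h₂ : ∀ {u : Chain X} (hu : u.deg = n) (e : u ⟶ s), f ≫ truncSnd hu e = g ≫ truncSnd hu e) :
    f = g :=
  truncObj.hom_ext h₁ h₂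

@[simp]
lemma trunc_map_fst {t : Chain X} (a : t ⟶ s) (h : t.deg < n) :
    (trunc n E Z).map a.op ≫ truncFst h =
      truncFst ((Chain.deg_le a).trans_lt h) ≫ E.map a.op :=
  lift_fst _ _ _

@[simp]
lemma trunc_map_snd {t u : Chain X} (a : t ⟶ s) (hu : u.deg = n) (e : u ⟶ t) :
    (trunc n E Z).map a.op ≫ truncSnd hu e = truncSnd hu (e ≫ a) :=
  lift_snd _ _ _ _

variable (n) {E'}

/-- The canonical map from a diagram `E` to a truncated diagram. -/
noncomputable def toTrunc (l : ∀ u, E.obj (op u) ⟶ Z u) : E ⟶ trunc n E Z :=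
  KDiag.homMk (fun s => truncLift (fun _ => 𝟙 _) fun {u} _ e => E.map e.op ≫ l u) fun {t s} a =>
    trunc_hom_ext (fun h => by simp [reassoc_of% @truncLift_fst]) fun {u} hu e => by simp

@[simp]
lemma toTrunc_fst (l : ∀ u, E.obj (op u) ⟶ Z u) (h : s.deg < n) :
    (toTrunc n l).app (op s) ≫ truncFst h = 𝟙 _ :=
  lift_fst _ _ _

@[simp]
lemma toTrunc_snd (l : ∀ u, E.obj (op u) ⟶ Z u) {u : Chain X} (hu : u.deg = n) (e : u ⟶ s) :
    (toTrunc n l).app (op s) ≫ truncSnd hu e = E.map e.op ≫ l u :=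
  lift_snd _ _ _ _

/-- The functoriality of truncated diagrams. -/
noncomputable def truncMap (α : E ⟶ E') {Z' : Chain X → M}
    (z : ∀ u : Chain X, u.deg = n → (Z u ⟶ Z' u)) : trunc n E Z ⟶ trunc n E' Z' :=
  KDiag.homMk (fun s => truncLift (fun h => truncFst h ≫ α.app _) fun {u} hu e =>
      truncSnd hu e ≫ z u hu) fun {t s} a =>
    trunc_hom_ext (fun h => by
      simp [reassoc_of% @truncLift_fst, reassoc_of% @trunc_map_fst (M := M)]) fun {u} hu e => by
      simp [reassoc_of% @trunc_map_snd (M := M)]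

@[simp]
lemma truncMap_fst (α : E ⟶ E') {Z' : Chain X → M} (z : ∀ u : Chain X, u.deg = n → (Z u ⟶ Z' u))
    (h : s.deg < n) :
    (truncMap n α z).app (op s) ≫ truncFst h = truncFst h ≫ α.app (op s) :=
  lift_fst _ _ _

@[simp]
lemma truncMap_snd (α : E ⟶ E') {Z' : Chain X → M} (z : ∀ u : Chain X, u.deg = n → (Z u ⟶ Z' u))
    {u : Chain X} (hu : u.deg = n) (e : u ⟶ s) :
    (truncMap n α z).app (op s) ≫ truncSnd hu e = truncSnd hu e ≫ z u hu :=
  lift_snd _ _ _ _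

variable (Z) in
/-- The map from `Z u` to the value at `u` of a truncated diagram. Its components are identities,
since a 2-morphism between chains of length `n` is an identity. -/
noncomputable def cellToTrunc (u : Chain X) (hu : u.deg = n) : Z u ⟶ (trunc n E Z).obj (op u) :=
  truncLift (fun h => (h.ne hu).elim) fun hv e =>
    eqToHom (congrArg Z (Chain.eq_of_deg_eq e (hv.trans hu.symm)).symm)

@[simp]
lemma cellToTrunc_snd (u : Chain X) (hu : u.deg = n) (e : u ⟶ u) :
    cellToTrunc n Z u hu ≫ truncSnd (E := E) hu e = 𝟙 _ :=
  lift_snd _ _ _ _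

lemma comp_cellToTrunc (l : ∀ u, E.obj (op u) ⟶ Z u) (u : Chain X) (hu : u.deg = n) :
    l u ≫ cellToTrunc n Z u hu = (toTrunc n l).app (op u) := by
  refine trunc_hom_ext (fun h => (h.ne hu).elim) fun {w} hw e => ?_
  obtain rfl := Chain.eq_of_deg_eq e (hw.trans hu.symm)
  obtain rfl := Chain.eq_id e
  rw [Category.assoc, cellToTrunc_snd, toTrunc_snd]
  simp

lemma cellToTrunc_truncMap (α : E ⟶ E') (z : ∀ u : Chain X, u.deg = n → (Z u ⟶ E'.obj (op u)))
    (u : Chain X) (hu : u.deg = n) :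
    cellToTrunc n Z u hu ≫ (truncMap n α (Z' := fun u => E'.obj (op u)) z).app (op u) =
      z u hu ≫ (toTrunc n fun _ => 𝟙 _).app (op u) := by
  refine trunc_hom_ext (fun h => (h.ne hu).elim) fun {w} hw e => ?_
  obtain rfl := Chain.eq_of_deg_eq e (hw.trans hu.symm)
  obtain rfl := Chain.eq_id e
  rw [Category.assoc, truncMap_snd, ← Category.assoc, cellToTrunc_snd, Category.assoc, toTrunc_snd]
  simp

lemma toTrunc_truncMap (l : ∀ u, E.obj (op u) ⟶ Z u) (α : E ⟶ E')
    (z : ∀ u : Chain X, u.deg = n → (Z u ⟶ E'.obj (op u)))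
    (hz : ∀ u hu, l u ≫ z u hu = α.app (op u)) :
    toTrunc n l ≫ truncMap n α (Z' := fun u => E'.obj (op u)) z =
      α ≫ toTrunc n fun _ => 𝟙 _ := by
  ext ⟨s⟩
  rw [NatTrans.comp_app, NatTrans.comp_app]
  refine trunc_hom_ext (fun h => ?_) fun {u} hu e => ?_
  · rw [Category.assoc, truncMap_fst, reassoc_of% @toTrunc_fst, Category.assoc, toTrunc_fst]
    simp
  · rw [Category.assoc, truncMap_snd, reassoc_of% @toTrunc_snd, Category.assoc, toTrunc_snd, hz]
    simp

section PreCat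

variable [MonoidalCategory M]

/-- The associativity of the laxity maps, for generalized elements. -/
lemma PreCat.tensorHom_lax_assoc (E : PreCat M X) {r s t rs st w : Chain X}
    (h₁ : Chain.IsConcat r s rs) (h₂ : Chain.IsConcat rs t w) (h₃ : Chain.IsConcat s t st)
    (h₄ : Chain.IsConcat r st w) {A B D : M} (f : A ⟶ E.diag.obj (op r))
    (g : B ⟶ E.diag.obj (op s)) (k : D ⟶ E.diag.obj (op t)) :
    ((f ⊗ₘ g) ≫ E.lax h₁ ⊗ₘ k) ≫ E.lax h₂ =
      (α_ A B D).hom ≫ (f ⊗ₘ (g ⊗ₘ k) ≫ E.lax h₃) ≫ E.lax h₄ := by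
  have e₁ : ((f ⊗ₘ g) ≫ E.lax h₁ ⊗ₘ k) = ((f ⊗ₘ g) ⊗ₘ k) ≫ (E.lax h₁ ▷ _) := by
    rw [← tensorHom_id, tensorHom_comp_tensorHom, Category.comp_id]
  have e₂ : (f ⊗ₘ (g ⊗ₘ k) ≫ E.lax h₃) = (f ⊗ₘ (g ⊗ₘ k)) ≫ (_ ◁ E.lax h₃) := by
    rw [← id_tensorHom, tensorHom_comp_tensorHom, Category.comp_id]
  rw [e₁, e₂, Category.assoc, E.lax_assoc h₁ h₂ h₃ h₄, associator_naturality_assoc,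
    Category.assoc]

/-- The laxity maps of a truncated pre-Co-Segal category. -/
noncomputable def truncLax (E : PreCat M X) (l : ∀ u, E.diag.obj (op u) ⟶ Z u) {s t w : Chain X}
    (h : Chain.IsConcat s t w) :
    (trunc n E.diag Z).obj (op s) ⊗ (trunc n E.diag Z).obj (op t) ⟶
      (trunc n E.diag Z).obj (op w) :=
  truncLift
    (fun hw => (truncFst (h.deg_left_lt.trans hw) ⊗ₘ truncFst (h.deg_right_lt.trans hw)) ≫ E.lax h)
    fun {u} hu e => (truncFst (h.deg_left_lt.trans_le ((Chain.deg_le e).trans hu.le)) ⊗ₘ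
      truncFst (h.deg_right_lt.trans_le ((Chain.deg_le e).trans hu.le))) ≫
        E.lax h ≫ E.diag.map e.op ≫ l u

@[simp]
lemma truncLax_fst (E : PreCat M X) (l : ∀ u, E.diag.obj (op u) ⟶ Z u) {s t w : Chain X}
    (h : Chain.IsConcat s t w) (hw : w.deg < n) : truncLax n E l h ≫ truncFst hw =
      (truncFst (h.deg_left_lt.trans hw) ⊗ₘ truncFst (h.deg_right_lt.trans hw)) ≫ E.lax h :=
  truncLift_fst _ _ _

@[simp]
lemma truncLax_snd (E : PreCat M X) (l : ∀ u, E.diag.obj (op u) ⟶ Z u) {s t w u : Chain X}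
    (h : Chain.IsConcat s t w) (hu : u.deg = n) (e : u ⟶ w) :
    truncLax n E l h ≫ truncSnd hu e =
      (truncFst (h.deg_left_lt.trans_le ((Chain.deg_le e).trans hu.le)) ⊗ₘ
        truncFst (h.deg_right_lt.trans_le ((Chain.deg_le e).trans hu.le))) ≫
          E.lax h ≫ E.diag.map e.op ≫ l u :=
  truncLift_snd _ _ _ _

/-- The structure of a pre-Co-Segal category on a truncated diagram. -/
noncomputable def truncPreCat (E : PreCat M X) (l : ∀ u, E.diag.obj (op u) ⟶ Z u) :
    PreCat M X where
  diag := trunc n E.diag Z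
  lax h := truncLax n E l h
  lax_natural h h' a b c H := by
    refine trunc_hom_ext (fun hw => ?_) fun {u} hu e => ?_
    · simp only [Category.assoc, truncLax_fst, trunc_map_fst, reassoc_of% @truncLax_fst,
        tensorHom_comp_tensorHom_assoc]
      rw [← tensorHom_comp_tensorHom_assoc, E.lax_natural h h' a b c H]
    · simp only [Category.assoc, truncLax_snd, trunc_map_snd,
        tensorHom_comp_tensorHom_assoc, trunc_map_fst]
      rw [← tensorHom_comp_tensorHom_assoc, ← Category.assoc (E.diag.map a.op ⊗ₘ _),
        E.lax_natural h h' a b c H]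
      simp
  lax_assoc {r s t rs st w} h₁ h₂ h₃ h₄ := by
    refine trunc_hom_ext (fun hw => ?_) fun {u} hu e => ?_
    · have hrs := h₂.deg_left_lt.trans hw
      have hst := h₄.deg_right_lt.trans hw
      simp only [Category.assoc, truncLax_fst]
      rw [← tensorHom_id, ← id_tensorHom, tensorHom_comp_tensorHom_assoc,
        tensorHom_comp_tensorHom_assoc, truncLax_fst, truncLax_fst, Category.id_comp,
        Category.id_comp]
      exact E.tensorHom_lax_assoc h₁ h₂ h₃ h₄ _ _ _
    · have hw : w.deg ≤ n := (Chain.deg_le e).trans hu.le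
      have hrs := h₂.deg_left_lt.trans_le hw
      have hst := h₄.deg_right_lt.trans_le hw
      simp only [Category.assoc, truncLax_snd]
      rw [← tensorHom_id, ← id_tensorHom, tensorHom_comp_tensorHom_assoc,
        tensorHom_comp_tensorHom_assoc, truncLax_fst, truncLax_fst, Category.id_comp,
        Category.id_comp, reassoc_of% E.tensorHom_lax_assoc h₁ h₂ h₃ h₄]

/-- The canonical map to a truncated pre-Co-Segal category. -/
noncomputable def toTruncPreCat (E : PreCat M X) (l : ∀ u, E.diag.obj (op u) ⟶ Z u) :
    E ⟶ truncPreCat n E l where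
  trans := toTrunc n l
  comm {s t w} h := by
    suffices e : E.lax h ≫ (toTrunc n l).app (op w) =
      ((toTrunc n l).app (op s) ⊗ₘ (toTrunc n l).app (op t)) ≫ truncLax n E l h from e
    refine trunc_hom_ext (fun hw => ?_) fun {u} hu e => ?_
    · rw [Category.assoc, Category.assoc, truncLax_fst, toTrunc_fst,
        tensorHom_comp_tensorHom_assoc, toTrunc_fst, toTrunc_fst]
      simp
    · rw [Category.assoc, Category.assoc, truncLax_snd, toTrunc_snd,
        tensorHom_comp_tensorHom_assoc, toTrunc_fst, toTrunc_fst]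
      simp

/-- The functoriality of truncated pre-Co-Segal categories. -/
noncomputable def truncPreCatMap {E E' : PreCat M X} (α : E ⟶ E')
    (l : ∀ u, E.diag.obj (op u) ⟶ Z u) (z : ∀ u : Chain X, u.deg = n → (Z u ⟶ E'.diag.obj (op u)))
    (hz : ∀ u hu, l u ≫ z u hu = α.trans.app (op u)) :
    truncPreCat n E l ⟶ truncPreCat n E' fun _ => 𝟙 _ where
  trans := truncMap n α.trans z
  comm {s t w} h := by
    suffices e : truncLax n E l h ≫ (truncMap n α.trans z).app (op w) =
      ((truncMap n α.trans z).app (op s) ⊗ₘ (truncMap n α.trans z).app (op t)) ≫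
        truncLax n E' (fun _ => 𝟙 _) h from e
    refine trunc_hom_ext (fun hw => ?_) fun {u} hu e => ?_
    · rw [Category.assoc, Category.assoc, truncLax_fst, truncMap_fst,
        tensorHom_comp_tensorHom_assoc, truncMap_fst, truncMap_fst, reassoc_of% @truncLax_fst,
        α.comm, tensorHom_comp_tensorHom_assoc]
    · rw [Category.assoc, Category.assoc, truncLax_snd, truncMap_snd,
        tensorHom_comp_tensorHom_assoc, truncMap_fst, truncMap_fst, reassoc_of% @truncLax_snd,
        hz, ← tensorHom_comp_tensorHom_assoc, ← reassoc_of% α.comm h, α.trans.naturality]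
      simp

end PreCat

end Trunc

/-! ### Factorizations by induction on the length of chains -/

section Factorization

variable {M : Type u} [Category.{v} M] {X : Type v} [HasLimits M]
  {C : Type*} [Category.{v} C] (U : C ⥤ KDiag M X)

/-- The truncated diagrams lift, with their functoriality, along the functor `U`. -/
structure HasTrunc (n : ℕ) where
  /-- the lift of the truncated diagram -/
  obj (E : C) (Z : Chain X → M) (l : ∀ u, (U.obj E).obj (op u) ⟶ Z u) : C
  iso (E : C) (Z : Chain X → M) (l : ∀ u, (U.obj E).obj (op u) ⟶ Z u) :
    U.obj (obj E Z l) ≅ trunc n (U.obj E) Z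
  unit (E : C) (Z : Chain X → M) (l : ∀ u, (U.obj E).obj (op u) ⟶ Z u) : E ⟶ obj E Z l
  map_unit (E : C) (Z : Chain X → M) (l : ∀ u, (U.obj E).obj (op u) ⟶ Z u) :
    U.map (unit E Z l) ≫ (iso E Z l).hom = toTrunc n l
  map {E E' : C} (α : E ⟶ E') (Z : Chain X → M) (l : ∀ u, (U.obj E).obj (op u) ⟶ Z u)
    (z : ∀ u : Chain X, u.deg = n → (Z u ⟶ (U.obj E').obj (op u)))
    (hz : ∀ u hu, l u ≫ z u hu = (U.map α).app (op u)) :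
    obj E Z l ⟶ obj E' _ fun _ => 𝟙 _
  map_map {E E' : C} (α : E ⟶ E') (Z : Chain X → M) (l : ∀ u, (U.obj E).obj (op u) ⟶ Z u)
    (z : ∀ u : Chain X, u.deg = n → (Z u ⟶ (U.obj E').obj (op u)))
    (hz : ∀ u hu, l u ≫ z u hu = (U.map α).app (op u)) :
    U.map (map α Z l z hz) ≫ (iso E' _ fun _ => 𝟙 _).hom =
      (iso E Z l).hom ≫ truncMap n (U.map α) z

/-- The universal extension of an object `E` along maps out of its values at the chains of
length `n`. -/
structure FreeExtension (n : ℕ) (E : C) (Z : Chain X → M)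
    (l : ∀ u, (U.obj E).obj (op u) ⟶ Z u) where
  /-- the extension -/
  obj : C
  incl : E ⟶ obj
  cell (u : Chain X) (hu : u.deg = n) : Z u ⟶ (U.obj obj).obj (op u)
  comm (u : Chain X) (hu : u.deg = n) : l u ≫ cell u hu = (U.map incl).app (op u)
  exists_desc {H : C} (f : E ⟶ H) (g : ∀ u : Chain X, u.deg = n → (Z u ⟶ (U.obj H).obj (op u)))
    (hg : ∀ u hu, l u ≫ g u hu = (U.map f).app (op u)) :
    ∃ d : obj ⟶ H, incl ≫ d = f ∧ ∀ u hu, cell u hu ≫ (U.map d).app (op u) = g u hu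
  hom_ext {H : C} {f g : obj ⟶ H} (h : incl ≫ f = incl ≫ g)
    (h' : ∀ u hu, cell u hu ≫ (U.map f).app (op u) = cell u hu ≫ (U.map g).app (op u)) : f = g

section Existence

variable [U.IsRightAdjoint] [HasColimits M] [HasColimits C]

/-- Universal extensions exist: they are pushouts of coproducts of free maps. -/
lemma nonempty_freeExtension (n : ℕ) (E : C) (Z : Chain X → M)
    (l : ∀ u, (U.obj E).obj (op u) ⟶ Z u) : Nonempty (FreeExtension U n E Z l) := by
  let R (u : Chain X) : C ⥤ M := U ⋙ (evaluation _ _).obj (op u)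
  have hR (u) : (R u).IsRightAdjoint :=
    have : ((evaluation (Chain X)ᵒᵖ M).obj (op u)).IsRightAdjoint :=
      (evaluationAdjunctionRight M (op u)).isRightAdjoint
    inferInstanceAs (U ⋙ (evaluation _ _).obj (op u)).IsRightAdjoint
  let adj (u) := Adjunction.ofIsRightAdjoint (R u)
  let ι := { u : Chain X // u.deg = n }
  let P (u : Chain X) : (R u).obj E ⟶ Z u := l u
  let S (u : ι) : C := (R u.1).leftAdjoint.obj ((R u.1).obj E)
  let S' (u : ι) : C := (R u.1).leftAdjoint.obj (Z u.1)
  let a (u : ι) : S u ⟶ S' u := (R u.1).leftAdjoint.map (P u.1)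
  let e (u : ι) : S u ⟶ E := ((adj u.1).homEquiv _ E).symm (𝟙 _)
  let A : ∐ S ⟶ E := Sigma.desc e
  let B : ∐ S ⟶ ∐ S' := Limits.Sigma.map a
  have hι (u : ι) : Sigma.ι S u ≫ A = e u := Sigma.ι_desc _ _
  have hB (u : ι) : Sigma.ι S u ≫ B = a u ≫ Sigma.ι S' u := Sigma.ι_map _ _
  let z (u : ι) : Z u.1 ⟶ (R u.1).obj (pushout A B) :=
    (adj u.1).homEquiv _ _ (Sigma.ι S' u ≫ pushout.inr A B)
  have hz (u : ι) {H : C} (d : pushout A B ⟶ H) : z u ≫ (R u.1).map d =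
      (adj u.1).homEquiv _ _ (Sigma.ι S' u ≫ pushout.inr A B ≫ d) := by
    rw [← Category.assoc (Sigma.ι S' u)]
    exact (Adjunction.homEquiv_naturality_right _ _ _).symm
  have hP (u : ι) : P u.1 ≫ z u = (R u.1).map (pushout.inl A B) := by
    refine (Adjunction.homEquiv_naturality_left _ _ _).symm.trans ?_
    refine (congrArg ((adj u.1).homEquiv _ _)
      (?_ : a u ≫ Sigma.ι S' u ≫ pushout.inr A B = e u ≫ pushout.inl A B)).trans ?_
    · rw [← hι u, Category.assoc, pushout.condition, reassoc_of% hB u]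
    · refine (Adjunction.homEquiv_naturality_right _ _ _).trans ?_
      rw [Equiv.apply_symm_apply, Category.id_comp]
  refine ⟨⟨pushout A B, pushout.inl A B, fun u hu => z ⟨u, hu⟩, fun u hu => hP ⟨u, hu⟩,
    fun {H} f g hg => ?_, fun {H} f g h h' => ?_⟩⟩
  · let g' (u : ι) : Z u.1 ⟶ (R u.1).obj H := g u.1 u.2
    have hg' (u : ι) : P u.1 ≫ g' u = (R u.1).map f := hg u.1 u.2
    let k (u : ι) : S' u ⟶ H := ((adj u.1).homEquiv _ _).symm (g' u)
    have hk (u : ι) : e u ≫ f = a u ≫ k u := by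
      refine (Adjunction.homEquiv_naturality_right_symm _ _ _).symm.trans ?_
      refine Eq.trans ?_ (Adjunction.homEquiv_naturality_left_symm _ _ _)
      rw [hg', Category.id_comp]
    let d := pushout.desc f (Sigma.desc k)
      (Sigma.hom_ext _ _ fun u => by
        rw [reassoc_of% hι u, reassoc_of% hB u, Sigma.ι_desc, hk])
    refine ⟨d, pushout.inl_desc _ _ _, fun u hu => ?_⟩
    change z ⟨u, hu⟩ ≫ (R u).map d = _
    rw [hz ⟨u, hu⟩, pushout.inr_desc, Sigma.ι_desc]
    exact Equiv.apply_symm_apply _ _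
  · refine pushout.hom_ext h (Sigma.hom_ext _ _ fun u => ((adj u.1).homEquiv _ _).injective ?_)
    rw [← hz, ← hz]
    exact h' u.1 u.2

end Existence

namespace FreeExtension

variable {U} {n : ℕ} {E : C} {Z : Chain X → M} {l : ∀ u, (U.obj E).obj (op u) ⟶ Z u}
  (D : FreeExtension U n E Z l)

/-- The inclusion in a universal extension has the left lifting property against the levelwise
`R`-maps if the attached maps have the left lifting property against the `R`-maps. -/
lemma llp_incl {R : MorphismProperty M} (hl : ∀ u, R.llp (l u)) :
    ((R.functorCategory (Chain X)ᵒᵖ).inverseImage U).llp D.incl := by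
  intro A B q hq
  refine ⟨fun {a b} sq => ?_⟩
  have h (u : Chain X) (hu : u.deg = n) : CommSq ((U.map a).app (op u)) (l u)
      ((U.map q).app (op u)) (D.cell u hu ≫ (U.map b).app (op u)) := ⟨by
    rw [← NatTrans.comp_app, ← U.map_comp, sq.w, U.map_comp, NatTrans.comp_app, ← D.comm u hu,
      Category.assoc]⟩
  have h' (u : Chain X) : HasLiftingProperty (l u) ((U.map q).app (op u)) := hl u _ (hq (op u))
  obtain ⟨d, h₁, h₂⟩ := D.exists_desc a (fun u hu => (h u hu).lift) fun u hu => (h u hu).fac_left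
  refine ⟨⟨⟨d, h₁, D.hom_ext ?_ fun u hu => ?_⟩⟩⟩
  · rw [reassoc_of% h₁, sq.w]
  · rw [U.map_comp, NatTrans.comp_app, reassoc_of% h₂ u hu, (h u hu).fac_right]

variable [U.Faithful]

/-- The map from the universal extension to the truncation is a partial inverse. -/
lemma exists_retraction (T : HasTrunc U n) : ∃ θ : U.obj D.obj ⟶ trunc n (U.obj E) Z,
    U.map D.incl ≫ θ = toTrunc n l ∧
    (∀ u hu, D.cell u hu ≫ θ.app (op u) = cellToTrunc n Z u hu) ∧
    θ ≫ truncMap n (U.map D.incl) D.cell = toTrunc n fun _ => 𝟙 _ := by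
  have hc (u : Chain X) (hu : u.deg = n) : l u ≫ cellToTrunc n Z u hu ≫
      (T.iso E Z l).inv.app (op u) = (U.map (T.unit E Z l)).app (op u) := by
    rw [← Category.assoc, comp_cellToTrunc, ← T.map_unit, ← NatTrans.comp_app, Category.assoc,
      Iso.hom_inv_id, Category.comp_id]
  obtain ⟨t, h₁, h₂⟩ := D.exists_desc (T.unit E Z l) _ hc
  have e₁ : U.map D.incl ≫ U.map t ≫ (T.iso E Z l).hom = toTrunc n l := by
    rw [← Category.assoc, ← U.map_comp, h₁, T.map_unit]
  have e₂ (u : Chain X) (hu : u.deg = n) :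
      D.cell u hu ≫ (U.map t ≫ (T.iso E Z l).hom).app (op u) = cellToTrunc n Z u hu := by
    rw [NatTrans.comp_app, ← Category.assoc, h₂, Category.assoc, ← NatTrans.comp_app,
      Iso.inv_hom_id, NatTrans.id_app, Category.comp_id]
  refine ⟨U.map t ≫ (T.iso E Z l).hom, e₁, e₂, ?_⟩
  have hm := T.map_map D.incl Z l D.cell D.comm
  have ht := T.map_unit D.obj _ fun _ => 𝟙 _
  have key : t ≫ T.map D.incl Z l D.cell D.comm = T.unit D.obj _ fun _ => 𝟙 _ := by
    refine D.hom_ext (U.map_injective ?_) fun u hu => ?_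
    · rw [← cancel_mono (T.iso D.obj _ fun _ => 𝟙 _).hom]
      simp only [U.map_comp, Category.assoc, hm, ht]
      rw [← toTrunc_truncMap n l (U.map D.incl) D.cell D.comm, ← e₁]
      simp only [Category.assoc]
    · rw [← cancel_mono ((T.iso D.obj _ fun _ => 𝟙 _).hom.app (op u)), Category.assoc,
        Category.assoc, ← NatTrans.comp_app, ← NatTrans.comp_app, ht, U.map_comp, Category.assoc,
        hm, ← Category.assoc (U.map t), NatTrans.comp_app, ← Category.assoc, e₂,
        cellToTrunc_truncMap]
  rw [Category.assoc, ← hm, ← Category.assoc, ← U.map_comp, key, ht]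

/-- A universal extension does not change the values at the shorter chains. -/
lemma isIso_incl (T : HasTrunc U n) (s : Chain X) (hs : s.deg < n) :
    IsIso ((U.map D.incl).app (op s)) := by
  obtain ⟨θ, h₁, -, h₂⟩ := D.exists_retraction T
  refine ⟨θ.app (op s) ≫ truncFst hs, ?_, ?_⟩
  · rw [← Category.assoc, ← NatTrans.comp_app, h₁, toTrunc_fst]
  · rw [Category.assoc, ← truncMap_fst n (U.map D.incl) D.cell, ← Category.assoc,
      ← NatTrans.comp_app, h₂, toTrunc_fst]

/-- A universal extension has the prescribed values at the chains of length `n`. -/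
lemma isIso_cell (T : HasTrunc U n) (u : Chain X) (hu : u.deg = n) : IsIso (D.cell u hu) := by
  obtain ⟨θ, -, h₁, h₂⟩ := D.exists_retraction T
  refine ⟨θ.app (op u) ≫ truncSnd hu (𝟙 u), ?_, ?_⟩
  · rw [← Category.assoc, h₁, cellToTrunc_snd]
  · rw [Category.assoc, ← truncMap_snd n (U.map D.incl) D.cell, ← Category.assoc,
      ← NatTrans.comp_app, h₂, toTrunc_snd]
    simp

end FreeExtension

variable [U.Faithful] [U.IsRightAdjoint] [HasColimits M] [HasColimits C]
  (R : MorphismProperty M) [R.RespectsIso] [R.llp.HasFactorization R]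

/-- The inductive step: a factorization that is good at the chains of length `n` and that does not
change the values at the shorter chains. -/
lemma exists_extension {n : ℕ} (T : HasTrunc U n) {E G : C} (p : E ⟶ G) :
    ∃ (E' : C) (i : E ⟶ E') (p' : E' ⟶ G), i ≫ p' = p ∧
      ((R.functorCategory (Chain X)ᵒᵖ).inverseImage U).llp i ∧
      (∀ s : Chain X, s.deg < n → IsIso ((U.map i).app (op s))) ∧
      ∀ u : Chain X, u.deg = n → R ((U.map p').app (op u)) := by
  let h (u : Chain X) := MorphismProperty.factorizationData R.llp R ((U.map p).app (op u))
  obtain ⟨D⟩ := nonempty_freeExtension U n E (fun u => (h u).Z) fun u => (h u).i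
  obtain ⟨p', h₁, h₂⟩ := D.exists_desc p (fun u _ => (h u).p) fun u _ => (h u).fac
  refine ⟨D.obj, D.incl, p', h₁, D.llp_incl fun u => (h u).hi, D.isIso_incl T, fun u hu => ?_⟩
  have := D.isIso_cell T u hu
  rw [← R.cancel_left_of_respectsIso (D.cell u hu), h₂]
  exact (h u).hp

/-- Factorizations into a map with the left lifting property against the levelwise `R`-maps and a
levelwise `R`-map, from such factorizations in `M`. -/
theorem hasFactorization_levelwise (T : ∀ n, HasTrunc U n) [HasColimitsOfShape ℕ C]
    [PreservesColimitsOfShape ℕ U] [HasColimitsOfShape ℕ M] :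
    ((R.functorCategory (Chain X)ᵒᵖ).inverseImage U).llp.HasFactorization
      ((R.functorCategory (Chain X)ᵒᵖ).inverseImage U) where
  nonempty_mapFactorizationData {F G} φ := by
    choose E' i p' hfac hllp hiso hR using fun n (S : Over G) =>
      exists_extension U R (T n) S.hom
    let seq : ℕ → Over G := fun n => Nat.rec (Over.mk φ) (fun n S => Over.mk (p' n S)) n
    let f (n : ℕ) : (seq n).left ⟶ (seq (n + 1)).left := i n (seq n)
    let K : ℕ ⥤ C := Functor.ofSequence f
    have hK (n : ℕ) : K.map (homOfLE (Nat.le_add_right n 1)) = i n (seq n) :=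
      Functor.ofSequence_map_homOfLE_succ f n
    let cG : Cocone K := ⟨G, NatTrans.ofSequence (fun n => (seq n).hom) fun n => by
      rw [hK]
      exact (hfac n (seq n)).trans (Category.comp_id _).symm⟩
    let p : colimit K ⟶ G := colimit.desc K cG
    have hp (n : ℕ) : colimit.ι K n ≫ p = (seq n).hom := colimit.ι_desc cG n
    refine ⟨⟨colimit K, colimit.ι K 0, p, hp 0, ?_, ?_⟩⟩
    · intro A B q hq
      refine HasLiftingProperty.transfiniteComposition.hasLiftingProperty_ι_app_bot
        (colimit.isColimit K) fun n _ => ?_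
      have := hllp n (seq n) q hq
      rw [← hK] at this
      exact this
    · rintro ⟨u⟩
      let V : C ⥤ M := U ⋙ (evaluation _ _).obj (op u)
      have hV (n : ℕ) (hn : u.deg + 1 ≤ n) :
          IsIso ((K ⋙ V).map (homOfLE (Nat.le_add_right n 1))) := by
        have := hiso n (seq n) u hn
        change IsIso (V.map (K.map _))
        rw [hK]
        exact this
      have hc : (K ⋙ V).IsEventuallyConstantFrom (u.deg + 1) := by
        intro j a
        obtain ⟨k, rfl⟩ := Nat.exists_eq_add_of_le (leOfHom a)
        induction k with
        | zero =>
          obtain rfl : a = 𝟙 _ := Subsingleton.elim _ _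
          infer_instance
        | succ k ih =>
          obtain rfl : a = homOfLE (Nat.le_add_right _ k) ≫
            homOfLE (Nat.le_add_right (u.deg + 1 + k) 1) := Subsingleton.elim _ _
          have := ih (homOfLE (Nat.le_add_right _ k))
          have := hV (u.deg + 1 + k) (Nat.le_add_right _ k)
          rw [Functor.map_comp]
          infer_instance
      have : IsIso (V.map (colimit.ι K (u.deg + 1))) :=
        hc.isIso_ι_of_isColimit (isColimitOfPreserves V (colimit.isColimit K))
      change R (V.map p)
      rw [← R.cancel_left_of_respectsIso (V.map (colimit.ι K (u.deg + 1))), ← V.map_comp, hp]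
      exact hR u.deg (seq u.deg) u rfl

end Factorization

section Instances

variable {M : Type u} [Category.{v} M] {X : Type v} [HasLimits M]

/-- Truncations of diagrams. -/
noncomputable def hasTruncId (n : ℕ) : HasTrunc (𝟭 (KDiag M X)) n where
  obj E Z _ := trunc n E Z
  iso _ _ _ := Iso.refl _
  unit _ _ l := toTrunc n l
  map_unit _ _ _ := Category.comp_id _
  map α _ _ z _ := truncMap n α z
  map_map _ _ _ _ _ := (Category.comp_id _).trans (Category.id_comp _).symm

instance [MonoidalCategory M] : (forgetLax M X).Faithful where
  map_injective h := PreCat.Hom.ext h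

/-- Truncations of pre-Co-Segal categories. -/
noncomputable def hasTruncForgetLax [MonoidalCategory M] (n : ℕ) :
    HasTrunc (forgetLax M X) n where
  obj E _ l := truncPreCat n E l
  iso _ _ _ := Iso.refl _
  unit E _ l := toTruncPreCat n E l
  map_unit _ _ _ := Category.comp_id _
  map α _ l z hz := truncPreCatMap n α l z hz
  map_map _ _ _ _ _ := (Category.comp_id _).trans (Category.id_comp _).symm

end Instances

/-! ### Objects of compatible pairs of maps -/

section PairObj

variable {M : Type u} [Category.{v} M] [HasLimits M] {L₁ L₂ : M ⥤ M} [L₁.IsLeftAdjoint]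
  [L₂.IsLeftAdjoint] (τ : L₁ ⟶ L₂) {A B : M} (p : A ⟶ B)

/-- The object representing the pairs of maps `L₁ T ⟶ A` and `L₂ T ⟶ B` that are compatible
with `τ` and `p`. -/
noncomputable def pairObj : M :=
  Limits.pullback
    ((Adjunction.ofIsLeftAdjoint L₁).homEquiv (L₁.rightAdjoint.obj A) B
      ((Adjunction.ofIsLeftAdjoint L₁).counit.app A ≫ p))
    ((Adjunction.ofIsLeftAdjoint L₁).homEquiv (L₂.rightAdjoint.obj B) B
      (τ.app _ ≫ (Adjunction.ofIsLeftAdjoint L₂).counit.app B))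

namespace pairObj

/-- The transpose of the first universal map. -/
noncomputable def fst : pairObj τ p ⟶ L₁.rightAdjoint.obj A := pullback.fst _ _

/-- The transpose of the second universal map. -/
noncomputable def snd : pairObj τ p ⟶ L₂.rightAdjoint.obj B := pullback.snd _ _

/-- The first universal map. -/
noncomputable def ev₁ : L₁.obj (pairObj τ p) ⟶ A :=
  ((Adjunction.ofIsLeftAdjoint L₁).homEquiv _ _).symm (fst τ p)

/-- The second universal map. -/
noncomputable def ev₂ : L₂.obj (pairObj τ p) ⟶ B :=
  ((Adjunction.ofIsLeftAdjoint L₂).homEquiv _ _).symm (snd τ p)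

lemma condition : fst τ p ≫ (Adjunction.ofIsLeftAdjoint L₁).homEquiv (L₁.rightAdjoint.obj A) B
      ((Adjunction.ofIsLeftAdjoint L₁).counit.app A ≫ p) =
    snd τ p ≫ (Adjunction.ofIsLeftAdjoint L₁).homEquiv (L₂.rightAdjoint.obj B) B
      (τ.app _ ≫ (Adjunction.ofIsLeftAdjoint L₂).counit.app B) := pullback.condition

lemma ev_comm : ev₁ τ p ≫ p = τ.app _ ≫ ev₂ τ p := by
  have h := congrArg ((Adjunction.ofIsLeftAdjoint L₁).homEquiv _ _).symm (condition τ p)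
  rw [Adjunction.homEquiv_naturality_left_symm, Adjunction.homEquiv_naturality_left_symm,
    Equiv.symm_apply_apply, Equiv.symm_apply_apply, NatTrans.naturality_assoc] at h
  rw [ev₁, ev₂, Adjunction.homEquiv_counit, Adjunction.homEquiv_counit, Category.assoc]
  exact h

variable {τ p}

/-- The map to `pairObj` given by a compatible pair of maps. -/
noncomputable def lift {T : M} (a : L₁.obj T ⟶ A) (b : L₂.obj T ⟶ B) (h : a ≫ p = τ.app T ≫ b) :
    T ⟶ pairObj τ p :=
  pullback.lift ((Adjunction.ofIsLeftAdjoint L₁).homEquiv _ _ a)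
    ((Adjunction.ofIsLeftAdjoint L₂).homEquiv _ _ b) (by
      rw [← Adjunction.homEquiv_naturality_left, ← Adjunction.homEquiv_naturality_left,
        NatTrans.naturality_assoc]
      congr 1
      have h₁ := ((Adjunction.ofIsLeftAdjoint L₁).homEquiv _ _).symm_apply_apply a
      have h₂ := ((Adjunction.ofIsLeftAdjoint L₂).homEquiv _ _).symm_apply_apply b
      rw [Adjunction.homEquiv_counit] at h₁ h₂
      rw [h₂, ← h, ← Category.assoc, h₁])

lemma lift_fst {T : M} (a : L₁.obj T ⟶ A) (b : L₂.obj T ⟶ B) (h : a ≫ p = τ.app T ≫ b) :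
    lift a b h ≫ fst τ p = (Adjunction.ofIsLeftAdjoint L₁).homEquiv _ _ a :=
  pullback.lift_fst _ _ _

lemma lift_snd {T : M} (a : L₁.obj T ⟶ A) (b : L₂.obj T ⟶ B) (h : a ≫ p = τ.app T ≫ b) :
    lift a b h ≫ snd τ p = (Adjunction.ofIsLeftAdjoint L₂).homEquiv _ _ b :=
  pullback.lift_snd _ _ _

lemma lift_ev₁ {T : M} (a : L₁.obj T ⟶ A) (b : L₂.obj T ⟶ B) (h : a ≫ p = τ.app T ≫ b) :
    L₁.map (lift a b h) ≫ ev₁ τ p = a := by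
  rw [ev₁, ← Adjunction.homEquiv_naturality_left_symm, lift_fst, Equiv.symm_apply_apply]

lemma lift_ev₂ {T : M} (a : L₁.obj T ⟶ A) (b : L₂.obj T ⟶ B) (h : a ≫ p = τ.app T ≫ b) :
    L₂.map (lift a b h) ≫ ev₂ τ p = b := by
  rw [ev₂, ← Adjunction.homEquiv_naturality_left_symm, lift_snd, Equiv.symm_apply_apply]

lemma hom_ext {T : M} {f g : T ⟶ pairObj τ p} (h₁ : L₁.map f ≫ ev₁ τ p = L₁.map g ≫ ev₁ τ p)
    (h₂ : L₂.map f ≫ ev₂ τ p = L₂.map g ≫ ev₂ τ p) : f = g := by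
  rw [ev₁, ← Adjunction.homEquiv_naturality_left_symm,
    ← Adjunction.homEquiv_naturality_left_symm] at h₁
  rw [ev₂, ← Adjunction.homEquiv_naturality_left_symm,
    ← Adjunction.homEquiv_naturality_left_symm] at h₂
  exact pullback.hom_ext (Equiv.injective _ h₁) (Equiv.injective _ h₂)

variable (τ p)

/-- The map that forgets the first component of a pair. -/
noncomputable def proj {τ' : L₂ ⟶ L₂} (h : τ' = 𝟙 L₂) : pairObj τ p ⟶ pairObj τ' (𝟙 B) :=
  lift (ev₂ τ p) (ev₂ τ p) (by subst h; exact (Category.comp_id _).trans (Category.id_comp _).symm)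

/-- In an object of pairs of equal maps, both universal maps agree. -/
lemma ev₁_eq_ev₂ {τ' : L₂ ⟶ L₂} (h : τ' = 𝟙 L₂) : ev₁ τ' (𝟙 B) = ev₂ τ' (𝟙 B) := by
  have := ev_comm τ' (𝟙 B)
  subst h
  exact (Category.comp_id _).symm.trans (this.trans (Category.id_comp _))

lemma hom_ext_id {τ' : L₂ ⟶ L₂} (h : τ' = 𝟙 L₂) {T : M} {f g : T ⟶ pairObj τ' (𝟙 B)}
    (h₂ : L₂.map f ≫ ev₂ τ' (𝟙 B) = L₂.map g ≫ ev₂ τ' (𝟙 B)) : f = g :=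
  hom_ext (by rwa [ev₁_eq_ev₂ h]) h₂

lemma proj_ev₂ {τ' : L₂ ⟶ L₂} (h : τ' = 𝟙 L₂) :
    L₂.map (proj τ p h) ≫ ev₂ τ' (𝟙 B) = ev₂ τ p := lift_ev₂ _ _ _

/-- Lifting against `proj` amounts to lifting against `p`. -/
lemma hasLiftingProperty_proj {τ' : L₂ ⟶ L₂} (h : τ' = 𝟙 L₂) {S T : M} (c : S ⟶ T)
    [HasLiftingProperty (L₁.map c) p] : HasLiftingProperty c (proj τ p h) where
  sq_hasLift {f g} sq := by
    have hg : L₂.map c ≫ L₂.map g ≫ ev₂ τ' (𝟙 B) = L₂.map f ≫ ev₂ τ p := by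
      rw [← Functor.map_comp_assoc, ← sq.w, Functor.map_comp_assoc, proj_ev₂]
    have sq' : CommSq (L₁.map f ≫ ev₁ τ p) (L₁.map c) p
        (τ.app T ≫ L₂.map g ≫ ev₂ τ' (𝟙 B)) := ⟨by
      rw [Category.assoc, ev_comm, NatTrans.naturality_assoc, NatTrans.naturality_assoc, hg]⟩
    refine ⟨⟨⟨lift sq'.lift (L₂.map g ≫ ev₂ τ' (𝟙 B)) sq'.fac_right, hom_ext ?_ ?_,
      hom_ext_id h ?_⟩⟩⟩
    · rw [Functor.map_comp, Category.assoc, lift_ev₁, sq'.fac_left]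
    · rw [Functor.map_comp, Category.assoc, lift_ev₂, hg]
    · rw [Functor.map_comp, Category.assoc, proj_ev₂, lift_ev₂]

end pairObj

end PairObj

/-! ### Enriched semicategories on an ordered set -/

section SemiCat

variable (M : Type u) [Category.{v} M] [MonoidalCategory M]

/-- A category without identities enriched in `M`, with a morphism object for each pair `i < j` of
elements of `ι`. -/
structure SemiCat (ι : Type) [Preorder ι] where
  /-- the object of morphisms -/
  hom (i j : ι) (h : i < j) : M
  comp {i j k : ι} (h : i < j) (h' : j < k) : hom i j h ⊗ hom j k h' ⟶ hom i k (h.trans h')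
  assoc {i j k l : ι} (h : i < j) (h' : j < k) (h'' : k < l) :
    comp h h' ▷ hom k l h'' ≫ comp (h.trans h') h'' =
      (α_ _ _ _).hom ≫ hom i j h ◁ comp h' h'' ≫ comp h (h'.trans h'')

variable {M}

namespace SemiCat

variable {ι : Type} [Preorder ι]

/-- Morphisms of enriched semicategories that are the identity on the elements of `ι`. -/
structure Hom (K D : SemiCat M ι) where
  /-- the maps on the objects of morphisms -/
  app (i j : ι) (h : i < j) : K.hom i j h ⟶ D.hom i j h
  comm {i j k : ι} (h : i < j) (h' : j < k) : K.comp h h' ≫ app i k (h.trans h') =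
    (app i j h ⊗ₘ app j k h') ≫ D.comp h h'

/-- A right module over an enriched semicategory. -/
structure RMod (K : SemiCat M ι) where
  /-- the underlying family of objects -/
  obj : ι → M
  act {i j : ι} (h : i < j) : obj i ⊗ K.hom i j h ⟶ obj j
  assoc {i j k : ι} (h : i < j) (h' : j < k) :
    act h ▷ K.hom j k h' ≫ act h' = (α_ _ _ _).hom ≫ obj i ◁ K.comp h h' ≫ act (h.trans h')

/-- A left module over an enriched semicategory. -/
structure LMod (K : SemiCat M ι) where
  /-- the underlying family of objects -/
  obj : ι → M
  act {i j : ι} (h : i < j) : K.hom i j h ⊗ obj j ⟶ obj i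
  assoc {i j k : ι} (h : i < j) (h' : j < k) :
    K.comp h h' ▷ obj k ≫ act (h.trans h') = (α_ _ _ _).hom ≫ K.hom i j h ◁ act h' ≫ act h

variable {K K' : SemiCat M ι}

/-- Restriction of modules. -/
abbrev RMod.res (P : RMod K') (g : Hom K K') : RMod K where
  obj := P.obj
  act {i j} h := P.obj i ◁ g.app i j h ≫ P.act h
  assoc {i j k} h h' := by
    have := g.comm h h'
    rw [MonoidalCategory.comp_whiskerRight, Category.assoc, ← whisker_exchange_assoc, P.assoc,
      ← MonoidalCategory.whiskerLeft_comp_assoc, this, MonoidalCategory.tensorHom_def]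
    simp

end SemiCat

end SemiCat

/-! ### Endomorphism semicategories -/

section PairHom

variable {M : Type u} [Category.{v} M] [MonoidalCategory M]

/-- The natural transformation `P ⊗ - ⟶ P' ⊗ -` induced by a map `P ⟶ P'`. -/
def tensorLeftTrans {P P' : M} (r : P ⟶ P') : tensorLeft P ⟶ tensorLeft P' where
  app T := r ▷ T
  naturality _ _ f := whisker_exchange r f

/-- The natural transformation `- ⊗ Q ⟶ - ⊗ Q'` induced by a map `Q ⟶ Q'`. -/
def tensorRightTrans {Q Q' : M} (r : Q ⟶ Q') : tensorRight Q ⟶ tensorRight Q' where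
  app T := T ◁ r
  naturality _ _ f := (whisker_exchange f r).symm

lemma tensorLeftTrans_id (P : M) : tensorLeftTrans (𝟙 P) = 𝟙 _ :=
  NatTrans.ext (funext fun T => MonoidalCategory.id_whiskerRight P T)

lemma tensorRightTrans_id (P : M) : tensorRightTrans (𝟙 P) = 𝟙 _ :=
  NatTrans.ext (funext fun T => MonoidalCategory.whiskerLeft_id T P)

variable [SymmetricCategory M] [MonoidalClosed M] [HasLimits M]

/-- The object representing the compatible pairs of maps `P ⊗ T ⟶ A` and `P' ⊗ T ⟶ B`. -/
noncomputable abbrev lpair {P P' A B : M} (r : P ⟶ P') (p : A ⟶ B) : M :=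
  pairObj (tensorLeftTrans r) p

/-- The object representing the compatible pairs of maps `T ⊗ Q ⟶ A` and `T ⊗ Q' ⟶ B`. -/
noncomputable abbrev rpair {Q Q' A B : M} (r : Q ⟶ Q') (p : A ⟶ B) : M :=
  pairObj (tensorRightTrans r) p

namespace lpair

variable {P P' A B : M} (r : P ⟶ P') (p : A ⟶ B)

/-- The first universal map. -/
noncomputable def ev₁ : P ⊗ lpair r p ⟶ A := pairObj.ev₁ (tensorLeftTrans r) p

/-- The second universal map. -/
noncomputable def ev₂ : P' ⊗ lpair r p ⟶ B := pairObj.ev₂ (tensorLeftTrans r) p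

lemma ev_comm : ev₁ r p ≫ p = r ▷ lpair r p ≫ ev₂ r p := pairObj.ev_comm (tensorLeftTrans r) p

variable {r p}

/-- The map to `lpair` given by a compatible pair of maps. -/
noncomputable def lift {T : M} (a : P ⊗ T ⟶ A) (b : P' ⊗ T ⟶ B) (h : a ≫ p = r ▷ T ≫ b) :
    T ⟶ lpair r p := pairObj.lift (τ := tensorLeftTrans r) a b h

lemma lift_ev₁ {T : M} (a : P ⊗ T ⟶ A) (b : P' ⊗ T ⟶ B) (h : a ≫ p = r ▷ T ≫ b) :
    P ◁ lift a b h ≫ ev₁ r p = a := pairObj.lift_ev₁ (τ := tensorLeftTrans r) a b h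

lemma lift_ev₂ {T : M} (a : P ⊗ T ⟶ A) (b : P' ⊗ T ⟶ B) (h : a ≫ p = r ▷ T ≫ b) :
    P' ◁ lift a b h ≫ ev₂ r p = b := pairObj.lift_ev₂ (τ := tensorLeftTrans r) a b h

lemma hom_ext {T : M} {f g : T ⟶ lpair r p} (h₁ : P ◁ f ≫ ev₁ r p = P ◁ g ≫ ev₁ r p)
    (h₂ : P' ◁ f ≫ ev₂ r p = P' ◁ g ≫ ev₂ r p) : f = g := pairObj.hom_ext h₁ h₂

variable (r p)

/-- The map that forgets the first component of a pair. -/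
noncomputable def proj : lpair r p ⟶ lpair (𝟙 P') (𝟙 B) :=
  pairObj.proj (tensorLeftTrans r) p (tensorLeftTrans_id P')

lemma hom_ext_id {T : M} {f g : T ⟶ lpair (𝟙 P) (𝟙 A)}
    (h : P ◁ f ≫ ev₂ (𝟙 P) (𝟙 A) = P ◁ g ≫ ev₂ (𝟙 P) (𝟙 A)) : f = g :=
  pairObj.hom_ext_id (tensorLeftTrans_id P) h

lemma proj_ev₂ : P' ◁ proj r p ≫ ev₂ _ _ = ev₂ r p :=
  pairObj.proj_ev₂ (tensorLeftTrans r) p (tensorLeftTrans_id P')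

end lpair

namespace rpair

variable {Q Q' A B : M} (r : Q ⟶ Q') (p : A ⟶ B)

/-- The first universal map. -/
noncomputable def ev₁ : rpair r p ⊗ Q ⟶ A := pairObj.ev₁ (tensorRightTrans r) p

/-- The second universal map. -/
noncomputable def ev₂ : rpair r p ⊗ Q' ⟶ B := pairObj.ev₂ (tensorRightTrans r) p

lemma ev_comm : ev₁ r p ≫ p = rpair r p ◁ r ≫ ev₂ r p := pairObj.ev_comm (tensorRightTrans r) p

variable {r p}

/-- The map to `rpair` given by a compatible pair of maps. -/
noncomputable def lift {T : M} (a : T ⊗ Q ⟶ A) (b : T ⊗ Q' ⟶ B) (h : a ≫ p = T ◁ r ≫ b) :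
    T ⟶ rpair r p := pairObj.lift (τ := tensorRightTrans r) a b h

lemma lift_ev₁ {T : M} (a : T ⊗ Q ⟶ A) (b : T ⊗ Q' ⟶ B) (h : a ≫ p = T ◁ r ≫ b) :
    lift a b h ▷ Q ≫ ev₁ r p = a := pairObj.lift_ev₁ (τ := tensorRightTrans r) a b h

lemma lift_ev₂ {T : M} (a : T ⊗ Q ⟶ A) (b : T ⊗ Q' ⟶ B) (h : a ≫ p = T ◁ r ≫ b) :
    lift a b h ▷ Q' ≫ ev₂ r p = b := pairObj.lift_ev₂ (τ := tensorRightTrans r) a b h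

lemma hom_ext {T : M} {f g : T ⟶ rpair r p} (h₁ : f ▷ Q ≫ ev₁ r p = g ▷ Q ≫ ev₁ r p)
    (h₂ : f ▷ Q' ≫ ev₂ r p = g ▷ Q' ≫ ev₂ r p) : f = g := pairObj.hom_ext h₁ h₂

variable (r p)

/-- The map that forgets the first component of a pair. -/
noncomputable def proj : rpair r p ⟶ rpair (𝟙 Q') (𝟙 B) :=
  pairObj.proj (tensorRightTrans r) p (tensorRightTrans_id Q')

lemma hom_ext_id {T : M} {f g : T ⟶ rpair (𝟙 Q) (𝟙 A)}
    (h : f ▷ Q ≫ ev₂ (𝟙 Q) (𝟙 A) = g ▷ Q ≫ ev₂ (𝟙 Q) (𝟙 A)) : f = g :=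
  pairObj.hom_ext_id (tensorRightTrans_id Q) h

lemma proj_ev₂ : proj r p ▷ Q' ≫ ev₂ _ _ = ev₂ r p :=
  pairObj.proj_ev₂ (tensorRightTrans r) p (tensorRightTrans_id Q')

lemma comp_proj_ev₂ {T : M} (x : T ⟶ rpair r p) :
    (x ≫ proj r p) ▷ Q' ≫ ev₂ _ _ = x ▷ Q' ≫ ev₂ r p := by
  rw [MonoidalCategory.comp_whiskerRight, Category.assoc, proj_ev₂]

variable {r p} in
lemma comp_proj_eq {S T : M} (f : S ⟶ T) (x : S ⟶ rpair r p) (y : T ⟶ rpair (𝟙 Q') (𝟙 B))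
    (h : x ▷ Q' ≫ ev₂ r p = f ▷ Q' ≫ y ▷ Q' ≫ ev₂ _ _) : x ≫ proj r p = f ≫ y := by
  refine hom_ext_id ?_
  rw [MonoidalCategory.comp_whiskerRight, Category.assoc, proj_ev₂, h,
    MonoidalCategory.comp_whiskerRight, Category.assoc]

end rpair

namespace SemiCat

variable {ι : Type} [Preorder ι]

/-- The endomorphism semicategory of a family of maps `q i : Q i ⟶ N i`: a map from `T` to its
object of morphisms from `i` to `j` is a pair of maps `T ⊗ Q j ⟶ Q i` and `T ⊗ N j ⟶ N i`
compatible with `q`. -/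
noncomputable def endPair {Q N : ι → M} (q : ∀ i, Q i ⟶ N i) : SemiCat M ι where
  hom i j _ := rpair (q j) (q i)
  comp {i j k} _ _ := rpair.lift
    ((α_ _ _ _).hom ≫ rpair (q j) (q i) ◁ rpair.ev₁ (q k) (q j) ≫ rpair.ev₁ (q j) (q i))
    ((α_ _ _ _).hom ≫ rpair (q j) (q i) ◁ rpair.ev₂ (q k) (q j) ≫ rpair.ev₂ (q j) (q i)) (by
      simp only [Category.assoc, rpair.ev_comm]
      rw [← MonoidalCategory.whiskerLeft_comp_assoc, rpair.ev_comm]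
      simp)
  assoc {i j k l} _ _ _ := by
    refine rpair.hom_ext ?_ ?_
    · simp only [MonoidalCategory.comp_whiskerRight, Category.assoc, rpair.lift_ev₁]
      rw [associator_naturality_left_assoc, ← whisker_exchange_assoc, rpair.lift_ev₁,
        associator_naturality_middle_assoc, ← MonoidalCategory.whiskerLeft_comp_assoc,
        rpair.lift_ev₁]
      simp
    · simp only [MonoidalCategory.comp_whiskerRight, Category.assoc, rpair.lift_ev₂]
      rw [associator_naturality_left_assoc, ← whisker_exchange_assoc, rpair.lift_ev₂,
        associator_naturality_middle_assoc, ← MonoidalCategory.whiskerLeft_comp_assoc,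
        rpair.lift_ev₂]
      simp

/-- The projection from the endomorphism semicategory of a family of maps to that of the family of
their targets. -/
noncomputable def endPairProj {Q N : ι → M} (q : ∀ i, Q i ⟶ N i) :
    Hom (endPair q) (endPair fun i => 𝟙 (N i)) where
  app i j _ := rpair.proj (q j) (q i)
  comm {i j k} _ _ := by
    refine rpair.hom_ext_id ?_
    simp only [endPair, MonoidalCategory.comp_whiskerRight, Category.assoc, rpair.proj_ev₂,
      rpair.lift_ev₂]
    rw [MonoidalCategory.tensorHom_def, MonoidalCategory.comp_whiskerRight, Category.assoc,
      associator_naturality_middle_assoc, ← MonoidalCategory.whiskerLeft_comp_assoc,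
      rpair.proj_ev₂, associator_naturality_left_assoc, ← whisker_exchange_assoc, rpair.proj_ev₂]

variable {K K' : SemiCat M ι}

section

variable (Q N : LMod K) (q : ∀ i, Q.obj i ⟶ N.obj i)
  (hq : ∀ {i j} (h : i < j), Q.act h ≫ q i = K.hom i j h ◁ q j ≫ N.act h)

/-- The components of the action given by a linear map of left modules. -/
noncomputable def LMod.toEndPairApp {i j : ι} (h : i < j) : K.hom i j h ⟶ rpair (q j) (q i) :=
  rpair.lift (Q.act h) (N.act h) (hq h)

lemma LMod.toEndPairApp_ev₁ {i j : ι} (h : i < j) :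
    LMod.toEndPairApp Q N q hq h ▷ Q.obj j ≫ rpair.ev₁ _ _ = Q.act h := rpair.lift_ev₁ _ _ _

lemma LMod.toEndPairApp_ev₂ {i j : ι} (h : i < j) :
    LMod.toEndPairApp Q N q hq h ▷ N.obj j ≫ rpair.ev₂ _ _ = N.act h := rpair.lift_ev₂ _ _ _

/-- A linear map of left modules is an action on its endomorphism semicategory. -/
noncomputable def LMod.toEndPair : Hom K (endPair q) where
  app i j h := LMod.toEndPairApp Q N q hq h
  comm {i j k} h h' := by
    refine rpair.hom_ext ?_ ?_
    · simp only [endPair, MonoidalCategory.comp_whiskerRight, Category.assoc, rpair.lift_ev₁,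
        LMod.toEndPairApp_ev₁]
      rw [MonoidalCategory.tensorHom_def, MonoidalCategory.comp_whiskerRight, Category.assoc,
        associator_naturality_middle_assoc, ← MonoidalCategory.whiskerLeft_comp_assoc,
        LMod.toEndPairApp_ev₁, associator_naturality_left_assoc, ← whisker_exchange_assoc,
        LMod.toEndPairApp_ev₁, Q.assoc]
    · simp only [endPair, MonoidalCategory.comp_whiskerRight, Category.assoc, rpair.lift_ev₂,
        LMod.toEndPairApp_ev₂]
      rw [MonoidalCategory.tensorHom_def, MonoidalCategory.comp_whiskerRight, Category.assoc,
        associator_naturality_middle_assoc, ← MonoidalCategory.whiskerLeft_comp_assoc,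
        LMod.toEndPairApp_ev₂, associator_naturality_left_assoc, ← whisker_exchange_assoc,
        LMod.toEndPairApp_ev₂, N.assoc]

end

namespace RMod

variable (P : RMod K)

/-- The action of an enriched semicategory on the maps out of a right module. -/
def coact {i j : ι} (h : i < j) {Z A : M} (e : P.obj j ⊗ Z ⟶ A) :
    P.obj i ⊗ (K.hom i j h ⊗ Z) ⟶ A :=
  (α_ _ _ _).inv ≫ P.act h ▷ Z ≫ e

lemma coact_comp {i j : ι} (h : i < j) {Z A A' : M} (e : P.obj j ⊗ Z ⟶ A) (f : A ⟶ A') :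
    P.coact h e ≫ f = P.coact h (e ≫ f) := by
  simp [coact]

lemma whiskerLeft_coact {i j : ι} (h : i < j) {Z Z' A : M} (f : Z ⟶ Z')
    (e : P.obj j ⊗ Z' ⟶ A) :
    P.obj i ◁ K.hom i j h ◁ f ≫ P.coact h e = P.coact h (P.obj j ◁ f ≫ e) := by
  rw [coact, coact, associator_inv_naturality_right_assoc, whisker_exchange_assoc]

lemma coact_coact {i j k : ι} (h : i < j) (h' : j < k) {Z A : M} (e : P.obj k ⊗ Z ⟶ A) :
    P.obj i ◁ K.comp h h' ▷ Z ≫ P.coact (h.trans h') e =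
      P.obj i ◁ (α_ _ _ _).hom ≫ P.coact h (P.coact h' e) := by
  rw [coact, coact, coact, associator_inv_naturality_middle_assoc,
    ← MonoidalCategory.comp_whiskerRight_assoc]
  have := P.assoc h h'
  rw [← cancel_epi (α_ _ _ _).inv, Iso.inv_hom_id_assoc] at this
  rw [← this]
  simp only [MonoidalCategory.comp_whiskerRight, Category.assoc,
    associator_inv_naturality_left_assoc]
  simp only [← Category.assoc]
  congr 3
  monoidal

section

variable (P P' : RMod K) (r : ∀ i, P.obj i ⟶ P'.obj i)
  (hr : ∀ {i j} (h : i < j), P.act h ≫ r j = r i ▷ K.hom i j h ≫ P'.act h)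
  {A B : M} (p : A ⟶ B)

/-- The action on the representing objects of the pairs of compatible maps. -/
noncomputable def pairAct {i j : ι} (h : i < j) : K.hom i j h ⊗ lpair (r j) p ⟶ lpair (r i) p :=
  lpair.lift (P.coact h (lpair.ev₁ (r j) p)) (P'.coact h (lpair.ev₂ (r j) p)) (by
    rw [coact_comp, lpair.ev_comm]
    simp only [coact, ← MonoidalCategory.comp_whiskerRight_assoc, hr h]
    simp)

lemma pairAct_ev₁ {i j : ι} (h : i < j) : P.obj i ◁ pairAct P P' r hr p h ≫ lpair.ev₁ _ _ =
    P.coact h (lpair.ev₁ (r j) p) := lpair.lift_ev₁ _ _ _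

lemma pairAct_ev₂ {i j : ι} (h : i < j) : P'.obj i ◁ pairAct P P' r hr p h ≫ lpair.ev₂ _ _ =
    P'.coact h (lpair.ev₂ (r j) p) := lpair.lift_ev₂ _ _ _

/-- For a linear map of right modules and a map `p`, the representing objects of the pairs of
compatible maps form a left module. -/
noncomputable def pairMod : LMod K where
  obj i := lpair (r i) p
  act h := pairAct P P' r hr p h
  assoc {i j k} h h' := by
    refine lpair.hom_ext ?_ ?_
    · simp only [MonoidalCategory.whiskerLeft_comp, Category.assoc, pairAct_ev₁]
      rw [coact_coact, whiskerLeft_coact, pairAct_ev₁]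
    · simp only [MonoidalCategory.whiskerLeft_comp, Category.assoc, pairAct_ev₂]
      rw [coact_coact, whiskerLeft_coact, pairAct_ev₂]

/-- The action on the objects of maps out of a right module. -/
noncomputable def dualAct (B : M) {i j : ι} (h : i < j) :
    K.hom i j h ⊗ lpair (𝟙 (P.obj j)) (𝟙 B) ⟶ lpair (𝟙 (P.obj i)) (𝟙 B) :=
  pairAct P P (fun i => 𝟙 (P.obj i)) (by simp) (𝟙 B) h

lemma dualAct_ev₂ (B : M) {i j : ι} (h : i < j) : P.obj i ◁ P.dualAct B h ≫ lpair.ev₂ _ _ =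
    P.coact h (lpair.ev₂ _ _) := pairAct_ev₂ P P (fun i => 𝟙 (P.obj i)) (by simp) (𝟙 B) h

/-- The left module of maps out of a right module. -/
noncomputable def dualMod (B : M) : LMod K where
  obj i := lpair (𝟙 (P.obj i)) (𝟙 B)
  act h := P.dualAct B h
  assoc h h' := (pairMod P P (fun i => 𝟙 (P.obj i)) (by simp) (𝟙 B)).assoc h h'

lemma pairAct_proj {i j : ι} (h : i < j) :
    pairAct P P' r hr p h ≫ lpair.proj (r i) p =
      K.hom i j h ◁ lpair.proj (r j) p ≫ P'.dualAct B h := by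
  refine lpair.hom_ext_id ?_
  rw [MonoidalCategory.whiskerLeft_comp, Category.assoc, MonoidalCategory.whiskerLeft_comp,
    Category.assoc, lpair.proj_ev₂, pairAct_ev₂, dualAct_ev₂, whiskerLeft_coact, lpair.proj_ev₂]

end

lemma dualAct_res (P : RMod K') (g : Hom K K') (B : M) {i j : ι} (h : i < j) :
    (P.res g).dualAct B h = g.app i j h ▷ lpair (𝟙 (P.obj j)) (𝟙 B) ≫ P.dualAct B h := by
  refine lpair.hom_ext_id ?_
  rw [MonoidalCategory.whiskerLeft_comp, Category.assoc]
  refine (dualAct_ev₂ (P.res g) B h).trans ?_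
  refine Eq.trans ?_ (congrArg (P.obj i ◁ g.app i j h ▷ lpair (𝟙 (P.obj j)) (𝟙 B) ≫ ·)
    (dualAct_ev₂ P B h)).symm
  simp [coact]

end RMod

end SemiCat

end PairHom

/-! ### Restriction to the positions of a chain and coextension -/

section Coext

variable {M : Type u} [Category.{v} M] [MonoidalCategory M] {X : Type v}

/-- The restriction of a pre-Co-Segal category to the positions of a chain `u`. -/
def PreCat.res (F : PreCat M X) (u : Chain X) : SemiCat M (Fin (u.deg + 1)) where
  hom i j h := F.diag.obj (op (u.seg i j h (by omega)))
  comp {i j k} h h' := F.lax (Chain.IsConcat.seg u h h' (by omega))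
  assoc {i j k l} h h' h'' := F.lax_assoc _ _ _ _

/-- The map induced on restrictions. -/
def PreCat.resMap {F E : PreCat M X} (φ : F ⟶ E) (u : Chain X) :
    SemiCat.Hom (F.res u) (E.res u) where
  app _ _ _ := (PreCat.Hom.trans φ).app _
  comm _ _ := PreCat.Hom.comm φ _

/-- The increasing sequences of positions in the chain `u`, starting at `i` and ending at `j`, whose
letters form the chain `s`. -/
structure Chain.Pos (u s : Chain X) where
  (i j : Fin (u.deg + 1))
  /-- the sequence of positions -/
  w : Fin (s.deg + 1) → Fin (u.deg + 1)
  strictMono : StrictMono w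
  w_zero : w 0 = i
  w_last : w (Fin.last s.deg) = j
  pt_w : ∀ k, u.pt (w k) = s.pt k

namespace Chain.Pos

variable {u : Chain X}

instance (s : Chain X) : Finite (Pos u s) :=
  Finite.of_injective (fun w : Pos u s => w.w) (by
    rintro ⟨i, j, w, _, rfl, rfl, _⟩ ⟨i', j', w', _, rfl, rfl, _⟩ h
    obtain rfl : w = w' := h
    rfl)

lemma lt {s : Chain X} (w : Pos u s) : w.i < w.j := by
  rw [← w.w_zero, ← w.w_last]
  exact w.strictMono s.deg_pos

lemma le {s : Chain X} (w : Pos u s) (k) : w.i ≤ w.w k := by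
  rw [← w.w_zero]
  exact w.strictMono.monotone (Fin.zero_le _)

lemma le' {s : Chain X} (w : Pos u s) (k) : w.w k ≤ w.j := by
  rw [← w.w_last]
  exact w.strictMono.monotone (Fin.le_last _)

/-- The 2-morphism that keeps the given positions. -/
def hom {s : Chain X} (w : Pos u s) : u.seg w.i w.j w.lt (by omega) ⟶ s where
  pos k := ⟨w.w k - w.i, by
    have := w.le' k
    simp only [seg]
    omega⟩
  strictMono k l h := by
    have h₁ := w.le k
    have h₂ := w.strictMono h
    refine Fin.lt_def.2 ?_
    simp only
    omega
  pos_zero := Fin.ext (by simp [w.w_zero])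
  pos_last := Fin.ext (by simp [w.w_last, seg])
  pt_pos k := by
    rw [← w.pt_w]
    have := w.le k
    refine congrArg u.pt (Fin.ext ?_)
    change (w.i : ℕ) + ((w.w k : ℕ) - w.i) = w.w k
    omega

/-- The action of a 2-morphism on sequences of positions. -/
abbrev comp {t s : Chain X} (w : Pos u t) (a : t ⟶ s) : Pos u s where
  i := w.i
  j := w.j
  w := w.w ∘ Hom.pos a
  strictMono := w.strictMono.comp (Hom.strictMono a)
  w_zero := by
    rw [← w.w_zero, ← Hom.pos_zero a]
    rfl
  w_last := by
    rw [← w.w_last, ← Hom.pos_last a]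
    rfl
  pt_w k := (w.pt_w _).trans (Hom.pt_pos a k)

/-- The position of the letter at which a concatenation is cut. -/
def mid {s t r : Chain X} (h : IsConcat s t r) (w : Pos u r) : Fin (u.deg + 1) :=
  w.w ⟨s.deg, by have := h.deg_eq; omega⟩

/-- The initial part of a sequence of positions. -/
abbrev left {s t r : Chain X} (h : IsConcat s t r) (w : Pos u r) : Pos u s where
  i := w.i
  j := w.mid h
  w k := w.w ⟨k, by have := h.deg_eq; omega⟩
  strictMono _ _ hk := w.strictMono hk
  w_zero := w.w_zero
  w_last := rfl
  pt_w k := (w.pt_w _).trans (h.left_val k)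

/-- The final part of a sequence of positions. -/
abbrev right {s t r : Chain X} (h : IsConcat s t r) (w : Pos u r) : Pos u t where
  i := w.mid h
  j := w.j
  w k := w.w ⟨s.deg + k, by have := h.deg_eq; omega⟩
  strictMono _ _ hk := w.strictMono (Nat.add_lt_add_left hk _)
  w_zero := rfl
  w_last := by
    rw [← w.w_last]
    exact congrArg w.w (Fin.ext h.deg_eq.symm)
  pt_w k := (w.pt_w _).trans (h.right_val k)

lemma isHComp {s t r : Chain X} (h : IsConcat s t r) (w : Pos u r) :
    IsHComp (w.left h).hom (w.right h).hom w.hom where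
  left i k e := by
    exact congrArg (fun l => (Hom.pos w.hom l : ℕ))
      (Fin.ext e : k = ⟨i, by have := h.deg_eq; omega⟩)
  right j k e := by
    refine (congrArg (fun l => (Hom.pos w.hom l : ℕ))
      (Fin.ext e : k = ⟨s.deg + j, by have := h.deg_eq; omega⟩)).trans ?_
    have h₁ : (w.i : ℕ) ≤ w.mid h := w.le _
    have h₂ : w.mid h ≤ w.w ⟨s.deg + j, by have := h.deg_eq; omega⟩ :=
      w.strictMono.monotone (Fin.le_def.2 (Nat.le_add_right _ _))
    rw [Fin.le_def] at h₂
    change (w.w ⟨s.deg + j, _⟩ : ℕ) - w.i = (w.mid h - w.i) + (w.w ⟨s.deg + j, _⟩ - w.mid h)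
    omega

end Chain.Pos

variable [HasLimits M] {u : Chain X}

instance (s : Chain X) : HasProductsOfShape (Chain.Pos u s) M := inferInstance

namespace SemiCat

variable (D : SemiCat M (Fin (u.deg + 1)))

/-- The value of the coextension at a chain. -/
noncomputable def coextObj (s : Chain X) : M :=
  ∏ᶜ fun w : Chain.Pos u s => D.hom w.i w.j w.lt

/-- The projections of the value of the coextension at a chain. -/
noncomputable def coextπ {s : Chain X} (w : Chain.Pos u s) : D.coextObj s ⟶ D.hom w.i w.j w.lt :=
  Pi.π (fun w : Chain.Pos u s => D.hom w.i w.j w.lt) w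

variable {D}

/-- The map to the value of the coextension at a chain with given components. -/
noncomputable def coextLift {T : M} {s : Chain X}
    (f : ∀ w : Chain.Pos u s, T ⟶ D.hom w.i w.j w.lt) : T ⟶ D.coextObj s := Pi.lift f

@[simp] lemma coextLift_π {T : M} {s : Chain X}
    (f : ∀ w : Chain.Pos u s, T ⟶ D.hom w.i w.j w.lt) (w : Chain.Pos u s) :
    coextLift f ≫ D.coextπ w = f w := Pi.lift_π _ _

lemma coext_hom_ext {T : M} {s : Chain X} {f g : T ⟶ D.coextObj s}
    (h : ∀ w, f ≫ D.coextπ w = g ≫ D.coextπ w) : f = g := Pi.hom_ext _ _ h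

variable (D)

/-- The action of a 2-morphism on the coextension. -/
noncomputable def coextMap {t s : Chain X} (a : t ⟶ s) : D.coextObj s ⟶ D.coextObj t :=
  coextLift fun w => D.coextπ (w.comp a)

lemma coextMap_π {t s : Chain X} (a : t ⟶ s) (w : Chain.Pos u t) :
    D.coextMap a ≫ D.coextπ w = D.coextπ (w.comp a) := coextLift_π _ _

/-- The composition of components of the coextension at consecutive sequences of positions. -/
noncomputable def coextComp {s t r : Chain X} (h : Chain.IsConcat s t r) (w : Chain.Pos u r) :
    D.coextObj s ⊗ D.coextObj t ⟶ D.hom w.i w.j w.lt :=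
  (D.coextπ (w.left h) ⊗ₘ D.coextπ (w.right h)) ≫ D.comp (w.left h).lt (w.right h).lt

/-- The laxity maps of the coextension. -/
noncomputable def coextLax {s t r : Chain X} (h : Chain.IsConcat s t r) :
    D.coextObj s ⊗ D.coextObj t ⟶ D.coextObj r := coextLift fun w => D.coextComp h w

lemma coextLax_π {s t r : Chain X} (h : Chain.IsConcat s t r) (w : Chain.Pos u r) :
    D.coextLax h ≫ D.coextπ w = D.coextComp h w := coextLift_π _ _

lemma tensorHom_comp_assoc {ι : Type} [Preorder ι] (K : SemiCat M ι) {A B C : M} {i j k l : ι}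
    (h : i < j) (h' : j < k) (h'' : k < l) (f : A ⟶ K.hom i j h) (g : B ⟶ K.hom j k h')
    (e : C ⟶ K.hom k l h'') :
    (((f ⊗ₘ g) ≫ K.comp h h') ⊗ₘ e) ≫ K.comp (h.trans h') h'' =
      (α_ _ _ _).hom ≫ (f ⊗ₘ ((g ⊗ₘ e) ≫ K.comp h' h'')) ≫ K.comp h (h'.trans h'') := by
  have e₁ : ((f ⊗ₘ g) ≫ K.comp h h') ⊗ₘ e = ((f ⊗ₘ g) ⊗ₘ e) ≫ K.comp h h' ▷ _ := by
    rw [← tensorHom_id, tensorHom_comp_tensorHom, Category.comp_id]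
  have e₂ : f ⊗ₘ ((g ⊗ₘ e) ≫ K.comp h' h'') = (f ⊗ₘ (g ⊗ₘ e)) ≫ _ ◁ K.comp h' h'' := by
    rw [← id_tensorHom, tensorHom_comp_tensorHom, Category.comp_id]
  rw [e₁, e₂, Category.assoc, Category.assoc, K.assoc, associator_naturality_assoc]

/-- The composition of components does not depend on the presentation of the sequences. -/
lemma coextComp_eq {s t r : Chain X} (h : Chain.IsConcat s t r) (w : Chain.Pos u r)
    {m : Fin (u.deg + 1)} (a : Fin (s.deg + 1) → Fin (u.deg + 1))
    (b : Fin (t.deg + 1) → Fin (u.deg + 1)) (hm : w.mid h = m) (ha : (w.left h).w = a)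
    (hb : (w.right h).w = b) (a₁ a₂ a₃ a₄ b₁ b₂ b₃ b₄ c₁ c₂) :
    D.coextComp h w = (D.coextπ ⟨w.i, m, a, a₁, a₂, a₃, a₄⟩ ⊗ₘ
      D.coextπ ⟨m, w.j, b, b₁, b₂, b₃, b₄⟩) ≫ D.comp c₁ c₂ := by
  subst hm ha hb
  rfl

lemma coextComp_comp {s t r s' t' r' : Chain X} (h : Chain.IsConcat s t r)
    (h' : Chain.IsConcat s' t' r') {a : s ⟶ s'} {b : t ⟶ t'} {c : r ⟶ r'}
    (H : Chain.IsHComp a b c) (w : Chain.Pos u r) :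
    (D.coextMap a ⊗ₘ D.coextMap b) ≫ D.coextComp h w = D.coextComp h' (w.comp c) := by
  rw [D.coextComp_eq h' (w.comp c) (m := w.mid h) ((w.left h).comp a).w ((w.right h).comp b).w
    (congrArg w.w (Fin.ext (H.deg_left h')))
    (funext fun k => congrArg w.w (Fin.ext (H.left k _ rfl)))
    (funext fun k => congrArg w.w (Fin.ext (H.right k _ rfl)))
    ((w.left h).comp a).strictMono ((w.left h).comp a).w_zero
    ((w.left h).comp a).w_last ((w.left h).comp a).pt_w ((w.right h).comp b).strictMono
    ((w.right h).comp b).w_zero ((w.right h).comp b).w_last ((w.right h).comp b).pt_w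
    (w.left h).lt (w.right h).lt]
  rw [coextComp, tensorHom_comp_tensorHom_assoc, coextMap_π, coextMap_π]

lemma coextComp_assoc {r s t rs st q : Chain X} (h₁ : Chain.IsConcat r s rs)
    (h₂ : Chain.IsConcat rs t q) (h₃ : Chain.IsConcat s t st) (h₄ : Chain.IsConcat r st q)
    (w : Chain.Pos u q) : D.coextLax h₁ ▷ D.coextObj t ≫ D.coextComp h₂ w =
      (α_ _ _ _).hom ≫ D.coextObj r ◁ D.coextLax h₃ ≫ D.coextComp h₄ w := by
  have e₁ := h₁.deg_eq
  have e₂ := h₂.deg_eq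
  have e₄ := h₄.deg_eq
  let p := (w.left h₂).left h₁
  let o := (w.left h₂).right h₁
  let o' := w.right h₂
  let z : Chain.Pos u st :=
    { i := p.j
      j := w.j
      w := fun k => w.w ⟨r.deg + k, by omega⟩
      strictMono := (w.right h₄).strictMono
      w_zero := rfl
      w_last := (w.right h₄).w_last
      pt_w := (w.right h₄).pt_w }
  have hz : D.coextComp h₄ w = (D.coextπ p ⊗ₘ D.coextπ z) ≫ D.comp p.lt z.lt :=
    D.coextComp_eq h₄ w _ _ rfl rfl rfl _ _ _ _ _ _ _ _ _ _
  have hz' : D.coextComp h₃ z = (D.coextπ o ⊗ₘ D.coextπ o') ≫ D.comp o.lt o'.lt :=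
    D.coextComp_eq h₃ z o.w o'.w (congrArg w.w (Fin.ext e₁.symm)) rfl
      (funext fun k => congrArg w.w (Fin.ext (by
        change r.deg + (s.deg + (k : ℕ)) = rs.deg + k
        omega))) _ _ _ _ _ _ _ _ _ _
  have h₅ : D.coextLax h₁ ▷ D.coextObj t ≫ D.coextComp h₂ w =
      (D.coextComp h₁ (w.left h₂) ⊗ₘ D.coextπ o') ≫ D.comp (w.left h₂).lt o'.lt := by
    rw [coextComp, ← tensorHom_id, tensorHom_comp_tensorHom_assoc, coextLax_π, Category.id_comp]
  rw [h₅, hz, ← id_tensorHom, tensorHom_comp_tensorHom_assoc, coextLax_π, Category.id_comp, hz']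
  exact D.tensorHom_comp_assoc _ _ _ _ _ _

/-- The coextension of an enriched semicategory on the positions of a chain. -/
noncomputable def coext : PreCat M X where
  diag :=
    { obj s := D.coextObj s.unop
      map a := D.coextMap a.unop
      map_id _ := coext_hom_ext fun w => (D.coextMap_π _ _).trans (Category.id_comp _).symm
      map_comp a b := coext_hom_ext fun w => by
        rw [coextMap_π, Category.assoc, coextMap_π]
        exact (D.coextMap_π _ (w.comp b.unop)).symm }
  lax h := D.coextLax h
  lax_natural h h' a b c H := coext_hom_ext fun w => by
    rw [Category.assoc, Category.assoc, coextLax_π]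
    refine (D.coextComp_comp h h' H w).trans ?_
    exact ((congrArg _ (D.coextMap_π _ _)).trans (D.coextLax_π _ _)).symm
  lax_assoc h₁ h₂ h₃ h₄ := coext_hom_ext fun w => by
    simp only [Category.assoc]
    rw [coextLax_π, coextLax_π]
    exact D.coextComp_assoc h₁ h₂ h₃ h₄ w

variable {D}

section Adjunct

variable {F : PreCat M X} (φ : Hom (F.res u) D)

/-- The components of a map out of the restriction. -/
def segApp (i j : Fin (u.deg + 1)) (h : i < j) :
    F.diag.obj (op (u.seg i j h (by omega))) ⟶ D.hom i j h := φ.app i j h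

lemma lax_segApp {i j k : Fin (u.deg + 1)} (h : i < j) (h' : j < k) :
    F.lax (Chain.IsConcat.seg u h h' (by omega)) ≫ segApp φ i k (h.trans h') =
      (segApp φ i j h ⊗ₘ segApp φ j k h') ≫ D.comp h h' := φ.comm h h'

/-- The map out of the value at a chain given by a sequence of positions and a map out of the
restriction. -/
def resApp {s : Chain X} (w : Chain.Pos u s) : F.diag.obj (op s) ⟶ D.hom w.i w.j w.lt :=
  F.diag.map w.hom.op ≫ segApp φ w.i w.j w.lt

lemma map_resApp {t s : Chain X} (a : t ⟶ s) (w : Chain.Pos u t) :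
    F.diag.map a.op ≫ resApp φ w = resApp φ (w.comp a) := by
  rw [resApp, ← F.diag.map_comp_assoc]
  rfl

lemma lax_resApp {s t r : Chain X} (h : Chain.IsConcat s t r) (w : Chain.Pos u r) :
    F.lax h ≫ resApp φ w = (resApp φ (w.left h) ⊗ₘ resApp φ (w.right h)) ≫
      D.comp (w.left h).lt (w.right h).lt := by
  rw [resApp, ← reassoc_of% F.lax_natural (Chain.IsConcat.seg u (w.left h).lt (w.right h).lt
    (by omega)) h (w.left h).hom (w.right h).hom w.hom (w.isHComp h)]
  refine (congrArg _ (lax_segApp φ (w.left h).lt (w.right h).lt)).trans ?_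
  exact tensorHom_comp_tensorHom_assoc _ _ _ _ _

/-- The components of the map to the coextension that corresponds to a map out of the
restriction. -/
noncomputable def homCoextApp (s : Chain X) : F.diag.obj (op s) ⟶ D.coextObj s :=
  coextLift fun w => resApp φ w

lemma homCoextApp_π {s : Chain X} (w : Chain.Pos u s) :
    homCoextApp φ s ≫ D.coextπ w = resApp φ w := coextLift_π _ _

/-- The map to the coextension that corresponds to a map out of the restriction. -/
noncomputable def homCoext : F ⟶ D.coext where
  trans := KDiag.homMk (homCoextApp φ) fun {t s} a => by
    suffices e : F.diag.map a.op ≫ homCoextApp φ t = homCoextApp φ s ≫ D.coextMap a from e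
    refine coext_hom_ext fun w => ?_
    rw [Category.assoc, Category.assoc, coextMap_π, homCoextApp_π, map_resApp]
    exact (homCoextApp_π φ (w.comp a)).symm
  comm {s t r} h := by
    suffices e : F.lax h ≫ homCoextApp φ r =
      (homCoextApp φ s ⊗ₘ homCoextApp φ t) ≫ D.coextLax h from e
    refine coext_hom_ext fun w => ?_
    rw [Category.assoc, Category.assoc, coextLax_π, homCoextApp_π, lax_resApp, coextComp,
      tensorHom_comp_tensorHom_assoc, homCoextApp_π, homCoextApp_π]

end Adjunct

section Functoriality

variable {D' D'' : SemiCat M (Fin (u.deg + 1))} (δ : Hom D D')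

/-- The components of the coextension of a map. -/
noncomputable def coextHomApp (s : Chain X) : D.coextObj s ⟶ D'.coextObj s :=
  coextLift fun w => D.coextπ w ≫ δ.app _ _ w.lt

lemma coextHomApp_π {s : Chain X} (w : Chain.Pos u s) :
    coextHomApp δ s ≫ D'.coextπ w = D.coextπ w ≫ δ.app _ _ w.lt := coextLift_π _ _

/-- Functoriality of the coextension. -/
noncomputable def coextHom : D.coext ⟶ D'.coext where
  trans := KDiag.homMk (coextHomApp δ) fun {t s} a => by
    suffices e : D.coextMap a ≫ coextHomApp δ t = coextHomApp δ s ≫ D'.coextMap a from e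
    refine coext_hom_ext fun w => ?_
    rw [Category.assoc, Category.assoc, coextMap_π, coextHomApp_π, ← Category.assoc, coextMap_π]
    exact (coextHomApp_π δ (w.comp a)).symm
  comm {s t r} h := by
    suffices e : D.coextLax h ≫ coextHomApp δ r =
      (coextHomApp δ s ⊗ₘ coextHomApp δ t) ≫ D'.coextLax h from e
    refine coext_hom_ext fun w => ?_
    rw [Category.assoc, Category.assoc, coextLax_π, coextHomApp_π, ← Category.assoc, coextLax_π,
      coextComp, coextComp, Category.assoc, tensorHom_comp_tensorHom_assoc, coextHomApp_π,
      coextHomApp_π, ← tensorHom_comp_tensorHom_assoc, ← δ.comm]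

/-- The components of the coextension of a map lift against the maps against which the given map
does. -/
lemma hasLiftingProperty_coextHomApp (s : Chain X) {S T : M} (c : S ⟶ T)
    (h : ∀ i j hij, HasLiftingProperty c (δ.app i j hij)) :
    HasLiftingProperty c (coextHomApp δ s) where
  sq_hasLift {f g} sq := by
    have sq' (w : Chain.Pos u s) : CommSq (f ≫ D.coextπ w) c (δ.app _ _ w.lt)
        (g ≫ D'.coextπ w) := ⟨by
      rw [Category.assoc, ← coextHomApp_π, ← Category.assoc, sq.w, Category.assoc]⟩
    refine ⟨⟨⟨coextLift fun w => (sq' w).lift, coext_hom_ext fun w => ?_,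
      coext_hom_ext fun w => ?_⟩⟩⟩
    · rw [Category.assoc, coextLift_π, (sq' w).fac_left]
    · rw [Category.assoc, coextHomApp_π, ← Category.assoc, coextLift_π, (sq' w).fac_right]

/-- Naturality of the correspondence between maps out of the restriction and maps to the
coextension. -/
lemma homCoext_coextHom {F E : PreCat M X} (f : F ⟶ E) (φ : Hom (F.res u) D)
    (ψ : Hom (E.res u) D')
    (h : ∀ i j hij, segApp φ i j hij ≫ δ.app i j hij =
      (PreCat.Hom.trans f).app _ ≫ segApp ψ i j hij) :
    homCoext φ ≫ coextHom δ = f ≫ homCoext ψ := by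
  refine PreCat.Hom.ext (NatTrans.ext (funext fun s => ?_))
  suffices e : homCoextApp φ s.unop ≫ coextHomApp δ s.unop =
    (PreCat.Hom.trans f).app s ≫ homCoextApp ψ s.unop from e
  refine coext_hom_ext fun w => ?_
  rw [Category.assoc, Category.assoc, coextHomApp_π, ← Category.assoc, homCoextApp_π,
    homCoextApp_π, resApp, resApp, Category.assoc, h]
  exact NatTrans.naturality_assoc (PreCat.Hom.trans f) _ _

end Functoriality

end SemiCat

end Coext

/-! ### Maps with the left lifting property against the levelwise fibrations -/

section Acyclic

variable {M : Type u} [Category.{v} M] [MonoidalCategory M] {X : Type v}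

namespace PreCat

variable (F : PreCat M X) (u : Chain X)

/-- The values of `F` at the initial segments of a chain, with the unit as the value at the
segment of length zero. -/
def segObj : Fin (u.deg + 1) → M
  | ⟨0, _⟩ => 𝟙_ M
  | ⟨k + 1, h⟩ => F.diag.obj (op (u.seg 0 (k + 1) k.succ_pos (Nat.lt_succ_iff.1 h)))

/-- The right action of `F` on its values at the initial segments of a chain. -/
def segAct : ∀ {i j : Fin (u.deg + 1)} (h : i < j),
    F.segObj u i ⊗ (F.res u).hom i j h ⟶ F.segObj u j
  | ⟨0, _⟩, ⟨_ + 1, _⟩, _ => (λ_ _).hom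
  | ⟨k + 1, _⟩, ⟨_ + 1, _⟩, h => F.lax (Chain.IsConcat.seg u k.succ_pos h _)

/-- The values of `F` at the initial segments of a chain form a right module. -/
def segMod : (F.res u).RMod where
  obj := F.segObj u
  act := F.segAct u
  assoc {i j k} h h' := match i, j, k, h, h' with
    | ⟨0, _⟩, ⟨l + 1, _⟩, ⟨m + 1, _⟩, h, h' => by
      change (λ_ _).hom ▷ _ ≫ F.lax _ = (α_ _ _ _).hom ≫ _ ◁ F.lax _ ≫ (λ_ _).hom
      rw [leftUnitor_naturality, leftUnitor_tensor_hom_assoc,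
        Iso.hom_inv_id_assoc]
    | ⟨k + 1, _⟩, ⟨l + 1, _⟩, ⟨m + 1, _⟩, h, h' => F.lax_assoc _ _ _ _

variable {F}

/-- Functoriality of the values at initial segments. -/
def segMap {E : PreCat M X} (f : F ⟶ E) : ∀ i, F.segObj u i ⟶ E.segObj u i
  | ⟨0, _⟩ => 𝟙 _
  | ⟨_ + 1, _⟩ => (PreCat.Hom.trans f).app _

lemma segAct_segMap {E : PreCat M X} (f : F ⟶ E) {i j : Fin (u.deg + 1)} (h : i < j) :
    F.segAct u h ≫ segMap u f j = segMap u f i ▷ (F.res u).hom i j h ≫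
      ((E.segMod u).res (resMap f u)).act h := match i, j, h with
  | ⟨0, _⟩, ⟨l + 1, _⟩, h => by
    change (λ_ _).hom ≫ (PreCat.Hom.trans f).app _ = (𝟙 _ ▷ _) ≫ (_ ◁ (PreCat.Hom.trans f).app _) ≫
      (λ_ _).hom
    rw [leftUnitor_naturality, MonoidalCategory.id_whiskerRight, Category.id_comp]
  | ⟨k + 1, _⟩, ⟨l + 1, _⟩, h => by
    refine (PreCat.Hom.comm f _).trans ?_
    rw [MonoidalCategory.tensorHom_def, Category.assoc]
    rfl

end PreCat

variable [SymmetricCategory M] [MonoidalClosed M] [HasLimits M] [HasColimits M] [ModelCategory M]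

lemma IsMonoidalModelCategory.hasLiftingProperty_whiskerLeft (hM : IsMonoidalModelCategory M)
    (hcof : ∀ A : M, IsCofibrant A) (P : M) {S T A B : M} (c : S ⟶ T)
    (hc : trivialCofibrations M c) (p : A ⟶ B) (hp : fibrations M p) :
    HasLiftingProperty (P ◁ c) p := by
  have := hcof P
  have h := hM.trivialCofibrations_whiskerLeft P c hc
  rw [← fibrations_llp] at h
  exact h p hp

lemma IsMonoidalModelCategory.hasLiftingProperty_endPairProj (hM : IsMonoidalModelCategory M)
    (hcof : ∀ A : M, IsCofibrant A) {ι : Type} [Preorder ι] {P P' : ι → M}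
    (r : ∀ i, P i ⟶ P' i) {A B : M} (p : A ⟶ B) (hp : fibrations M p) {S T : M} (c : S ⟶ T)
    (hc : trivialCofibrations M c) (i j : ι) (h : i < j) :
    HasLiftingProperty c ((SemiCat.endPairProj fun i => lpair.proj (r i) p).app i j h) := by
  have := hcof (lpair (r j) p)
  have h' := hM.trivialCofibrations_whiskerRight (lpair (r j) p) c hc
  have : HasLiftingProperty (P i ◁ (c ▷ lpair (r j) p)) p :=
    hM.hasLiftingProperty_whiskerLeft hcof _ _ h' p hp
  have : HasLiftingProperty ((tensorLeft (P i)).map (c ▷ lpair (r j) p)) p := this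
  have : HasLiftingProperty (c ▷ lpair (r j) p) (lpair.proj (r i) p) :=
    pairObj.hasLiftingProperty_proj (tensorLeftTrans (r i)) p (tensorLeftTrans_id _) _
  have : HasLiftingProperty ((tensorRight (lpair (r j) p)).map c) (lpair.proj (r i) p) := this
  exact pairObj.hasLiftingProperty_proj (tensorRightTrans (lpair.proj (r j) p)) _
    (tensorRightTrans_id _) _

lemma leftUnitor_coact {K Z A : M} (e : K ⊗ Z ⟶ A) :
    (α_ (𝟙_ M) K Z).inv ≫ (λ_ K).hom ▷ Z ≫ e = (λ_ (K ⊗ Z)).hom ≫ e := by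
  simp

/-- A lift extracted from an action of its source on an object of pairs. -/
lemma exists_lift_of_pair {F E A B : M} (f : F ⟶ E) (p : A ⟶ B) {a : F ⟶ A} {b : E ⟶ B}
    (sq : a ≫ p = f ≫ b) (ξ : E ⟶ rpair (lpair.proj f p) (lpair.proj (𝟙 (𝟙_ M)) p))
    (h₁ : 𝟙_ M ◁ ((f ≫ ξ) ▷ lpair f p ≫ rpair.ev₁ _ _) ≫ lpair.ev₁ _ _ =
      (λ_ _).hom ≫ lpair.ev₁ f p)
    (h₂ : 𝟙_ M ◁ (ξ ▷ lpair (𝟙 E) (𝟙 B) ≫ rpair.ev₂ _ _) ≫ lpair.ev₂ _ _ =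
      (λ_ _).hom ≫ lpair.ev₂ (𝟙 E) (𝟙 B)) : ∃ e : E ⟶ A, f ≫ e = a ∧ e ≫ p = b := by
  -- the compatible pair `(a, b)` as a generalized element of the object of pairs
  let x : 𝟙_ M ⟶ lpair f p := lpair.lift ((ρ_ _).hom ≫ a) ((ρ_ _).hom ≫ b) (by simp [sq])
  have hx₁ : F ◁ x ≫ lpair.ev₁ f p = (ρ_ _).hom ≫ a := lpair.lift_ev₁ _ _ _
  have hx₂ : E ◁ x ≫ lpair.ev₂ f p = (ρ_ _).hom ≫ b := lpair.lift_ev₂ _ _ _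
  refine ⟨(ρ_ _).inv ≫ E ◁ x ≫ ξ ▷ _ ≫ rpair.ev₁ _ _ ≫ (λ_ _).inv ≫ lpair.ev₁ _ _, ?_, ?_⟩
  · have e₁ : (f ≫ ξ) ▷ lpair f p ≫ rpair.ev₁ _ _ ≫ (λ_ _).inv ≫ lpair.ev₁ _ _ =
        lpair.ev₁ f p := by
      rw [leftUnitor_inv_naturality_assoc, leftUnitor_inv_naturality_assoc,
        ← MonoidalCategory.whiskerLeft_comp_assoc, h₁, Iso.inv_hom_id_assoc]
    rw [rightUnitor_inv_naturality_assoc, whisker_exchange_assoc,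
      ← MonoidalCategory.comp_whiskerRight_assoc, ← whisker_exchange_assoc, e₁, hx₁,
      Iso.inv_hom_id_assoc]
  · have e₀ : lpair.ev₁ (𝟙 (𝟙_ M)) p ≫ p = 𝟙_ M ◁ lpair.proj (𝟙 (𝟙_ M)) p ≫ lpair.ev₂ _ _ := by
      rw [lpair.ev_comm, lpair.proj_ev₂, MonoidalCategory.id_whiskerRight, Category.id_comp]
    have e₂ : ξ ▷ lpair (𝟙 E) (𝟙 B) ≫ rpair.ev₂ _ _ ≫ (λ_ _).inv ≫ lpair.ev₂ _ _ =
        lpair.ev₂ (𝟙 E) (𝟙 B) := by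
      rw [leftUnitor_inv_naturality_assoc, leftUnitor_inv_naturality_assoc,
        ← MonoidalCategory.whiskerLeft_comp_assoc, h₂, Iso.inv_hom_id_assoc]
    simp only [Category.assoc]
    rw [e₀, ← leftUnitor_inv_naturality_assoc, ← Category.assoc (rpair.ev₁ _ _), rpair.ev_comm,
      Category.assoc, ← whisker_exchange_assoc, e₂, lpair.proj_ev₂, hx₂, Iso.inv_hom_id_assoc]

/-- A map of pre-Co-Segal categories with the left lifting property against the levelwise
fibrations has, at each chain, the left lifting property against the fibrations. -/
lemma IsMonoidalModelCategory.hasLiftingProperty_app_seg (hM : IsMonoidalModelCategory M)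
    (hcof : ∀ A : M, IsCofibrant A) {F E : PreCat M X} (f : F ⟶ E) (hf : (fib M X).llp f)
    (u : Chain X) (n : ℕ) (hn : n + 1 ≤ u.deg) {A B : M} (p : A ⟶ B) (hp : fibrations M p) :
    HasLiftingProperty ((PreCat.Hom.trans f).app (op (u.seg 0 (n + 1) n.succ_pos hn))) p where
  sq_hasLift {a b} sq := by
    let PF := F.segMod u
    let PE := E.segMod u
    let PE' := PE.res (PreCat.resMap f u)
    let r (i) : PF.obj i ⟶ PE'.obj i := PreCat.segMap u f i
    have hr {i j} (h : i < j) : PF.act h ≫ r j = r i ▷ _ ≫ PE'.act h := PreCat.segAct_segMap u f h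
    -- the maps `q` from the objects of pairs of maps to those of their second components
    let Q := SemiCat.RMod.pairMod PF PE' r hr p
    let NE := PE.dualMod B
    let NF := PE'.dualMod B
    let q (i) : Q.obj i ⟶ NF.obj i := lpair.proj (r i) p
    have hq {i j} (h : i < j) : Q.act h ≫ q i = (F.res u).hom i j h ◁ q j ≫ NF.act h :=
      SemiCat.RMod.pairAct_proj PF PE' r hr p h
    let φ := SemiCat.LMod.toEndPair Q NF q hq
    let ψ := SemiCat.LMod.toEndPair NE NE (fun i => 𝟙 (NE.obj i)) (by simp)
    -- a map to a coextension is an action of the restriction: `F` acts on the objects of pairs, and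
    -- `E` on those of the second components
    have sq₁ : CommSq (SemiCat.homCoext φ) f (SemiCat.coextHom (SemiCat.endPairProj q))
        (SemiCat.homCoext ψ) := ⟨SemiCat.homCoext_coextHom _ _ _ _ fun i j h => by
      refine rpair.comp_proj_eq _ (SemiCat.LMod.toEndPairApp Q NF q hq h)
        (SemiCat.LMod.toEndPairApp NE NE (fun i => 𝟙 (NE.obj i)) (by simp) h) ?_
      rw [SemiCat.LMod.toEndPairApp_ev₂]
      refine Eq.trans ?_ (congrArg _ (SemiCat.LMod.toEndPairApp_ev₂ NE NE _ (by simp) h)).symm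
      exact SemiCat.RMod.dualAct_res PE (PreCat.resMap f u) B h⟩
    have : HasLiftingProperty f (SemiCat.coextHom (SemiCat.endPairProj q)) := by
      refine hf _ fun s => ?_
      rw [← trivialCofibrations_rlp]
      intro S T c hc
      exact SemiCat.hasLiftingProperty_coextHomApp _ s.unop c fun i j h =>
        hM.hasLiftingProperty_endPairProj hcof r p hp c hc i j h
    let i₀ : Fin (u.deg + 1) := ⟨0, by omega⟩
    let j₀ : Fin (u.deg + 1) := ⟨n + 1, by omega⟩
    have h₀ : i₀ < j₀ := Fin.lt_def.2 n.succ_pos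
    let w : Chain.Pos u (u.seg 0 (n + 1) n.succ_pos hn) :=
      { i := i₀
        j := j₀
        w := fun k => ⟨k, by
          have := k.2
          simp only [Chain.seg] at this
          omega⟩
        strictMono := fun _ _ h => h
        w_zero := rfl
        w_last := rfl
        pt_w := fun k => congrArg u.pt (Fin.ext (Nat.zero_add _).symm) }
    -- keeping all positions deletes no letter
    have hw : w.hom = 𝟙 _ := Chain.eq_id _
    -- the lift, read at this sequence of positions, lets the value of `E` act on pairs
    let ξ : E.diag.obj (op (u.seg 0 (n + 1) n.succ_pos hn)) ⟶ rpair (q j₀) (q i₀) :=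
      (PreCat.Hom.trans sq₁.lift).app _ ≫ (SemiCat.endPair q).coextπ w
    have hξ : (PreCat.Hom.trans f).app (op (u.seg 0 (n + 1) n.succ_pos hn)) ≫ ξ =
        SemiCat.LMod.toEndPairApp Q NF q hq h₀ := by
      have e := congrArg (fun g => (PreCat.Hom.trans g).app (op (u.seg 0 (n + 1) n.succ_pos hn)) ≫
        (SemiCat.endPair q).coextπ w) sq₁.fac_left
      refine (Category.assoc _ _ _).symm.trans (e.trans ?_)
      refine (SemiCat.homCoextApp_π φ w).trans ?_
      rw [SemiCat.resApp, hw]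
      exact (congrArg (· ≫ _) (F.diag.map_id _)).trans (Category.id_comp _)
    have hξ' : ξ ≫ rpair.proj (q j₀) (q i₀) =
        SemiCat.LMod.toEndPairApp NE NE (fun i => 𝟙 (NE.obj i)) (by simp) h₀ := by
      have e := congrArg (fun g => (PreCat.Hom.trans g).app (op (u.seg 0 (n + 1) n.succ_pos hn)) ≫
        (SemiCat.endPair fun i => 𝟙 (NE.obj i)).coextπ w) sq₁.fac_right
      refine Eq.trans ?_ (e.trans ?_)
      · refine (Category.assoc _ _ _).trans (Eq.trans ?_ (Category.assoc _ _ _).symm)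
        exact congrArg (_ ≫ ·) (SemiCat.coextHomApp_π (SemiCat.endPairProj q) w).symm
      · refine (SemiCat.homCoextApp_π ψ w).trans ?_
        rw [SemiCat.resApp, hw]
        exact (congrArg (· ≫ _) (E.diag.map_id _)).trans (Category.id_comp _)
    obtain ⟨e, he₁, he₂⟩ := exists_lift_of_pair
      ((PreCat.Hom.trans f).app (op (u.seg 0 (n + 1) n.succ_pos hn))) p sq.w ξ
      (by
        refine (congrArg (fun z => 𝟙_ M ◁ (z ▷ lpair _ p ≫ rpair.ev₁ _ _) ≫
          lpair.ev₁ (𝟙 (𝟙_ M)) p) hξ).trans ?_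
        refine (congrArg (fun x => 𝟙_ M ◁ x ≫ lpair.ev₁ (𝟙 (𝟙_ M)) p)
          (SemiCat.LMod.toEndPairApp_ev₁ Q NF q hq h₀)).trans ?_
        refine (SemiCat.RMod.pairAct_ev₁ PF PE' r hr p h₀).trans ?_
        exact leftUnitor_coact _)
      (by
        have e : ξ ▷ NE.obj j₀ ≫ rpair.ev₂ (q j₀) (q i₀) = NE.act h₀ := by
          refine (rpair.comp_proj_ev₂ (q j₀) (q i₀) ξ).symm.trans ?_
          refine (congrArg (fun x => x ▷ NE.obj j₀ ≫ rpair.ev₂ _ _) hξ').trans ?_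
          exact SemiCat.LMod.toEndPairApp_ev₂ NE NE _ (by simp) h₀
        refine (congrArg (fun x => 𝟙_ M ◁ x ≫ lpair.ev₂ (𝟙 (𝟙_ M)) (𝟙 B)) e).trans ?_
        refine (SemiCat.RMod.dualAct_ev₂ PE B h₀).trans ?_
        exact leftUnitor_coact _)
    exact ⟨⟨⟨e, he₁, he₂⟩⟩⟩

/-- A map of pre-Co-Segal categories with the left lifting property against the levelwise
fibrations is a levelwise weak equivalence. -/
theorem IsMonoidalModelCategory.llp_fib_le_weq (hM : IsMonoidalModelCategory M)
    (hcof : ∀ A : M, IsCofibrant A) (X : Type v) : (fib M X).llp ≤ weq M X := by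
  rintro F E f hf ⟨u⟩
  obtain ⟨n, hn⟩ : ∃ n, u.deg = n + 1 := ⟨u.deg - 1, by have := u.deg_pos; omega⟩
  have hu : u = u.seg 0 (n + 1) n.succ_pos hn.ge :=
    Chain.ext_of_pt hn fun i j hij => congrArg u.pt (Fin.ext (hij.trans (Nat.zero_add _).symm))
  have h : trivialCofibrations M
      ((PreCat.Hom.trans f).app (op (u.seg 0 (n + 1) n.succ_pos hn.ge))) := by
    rw [← fibrations_llp]
    intro A B p hp
    exact hM.hasLiftingProperty_app_seg hcof f hf u n hn.ge p hp
  rw [← hu] at h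
  exact h.2

end Acyclic

/-! ### The projective model structures on the fibres -/

section Fibres

variable (M : Type u) [Category.{v} M] [HasLimits M] [HasColimits M] [ModelCategory M] (X : Type v)

variable {M} in
lemma hasLiftingProperty_piLift {J : Type*} {S T A B : M} (c : S ⟶ T) (p : A ⟶ B)
    [HasLiftingProperty c p] [HasProduct fun _ : J => A] [HasProduct fun _ : J => B] :
    HasLiftingProperty c (Pi.lift fun j => Pi.π (fun _ : J => A) j ≫ p) where
  sq_hasLift {a b} sq := by
    have sq' (j : J) : CommSq (a ≫ Pi.π (fun _ : J => A) j) c p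
        (b ≫ Pi.π (fun _ : J => B) j) := ⟨by
      rw [← Category.assoc c, ← sq.w, Category.assoc, Category.assoc, Pi.lift_π]⟩
    refine ⟨⟨⟨Pi.lift fun j => (sq' j).lift, Pi.hom_ext _ _ fun j => ?_,
      Pi.hom_ext _ _ fun j => ?_⟩⟩⟩
    · rw [Category.assoc, Pi.lift_π, (sq' j).fac_left]
    · rw [Category.assoc, Pi.lift_π, ← Category.assoc, Pi.lift_π, (sq' j).fac_right]

/-- A map of diagrams with the left lifting property against the levelwise fibrations is a
levelwise weak equivalence. -/
theorem llp_kFib_le_kWeq : (kFib M X).llp ≤ kWeq M X := by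
  rintro F E f hf u
  have h : trivialCofibrations M (f.app u) := by
    rw [← fibrations_llp]
    intro A B p hp
    have h : HasLiftingProperty f ((evaluationRightAdjoint M u).map p) := hf _ fun s => by
      rw [← trivialCofibrations_rlp] at hp ⊢
      intro S T c hc
      have := hp c hc
      exact hasLiftingProperty_piLift c p
    exact ((evaluationAdjunctionLeft M u).hasLiftingProperty_iff f p).2 h
  exact h.2

instance : (fibrations M).llp.HasFactorization (fibrations M) := by
  rw [fibrations_llp]
  infer_instance

instance : (trivialFibrations M).llp.HasFactorization (trivialFibrations M) := by
  rw [trivialFibrations_llp]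
  infer_instance

instance (W : MorphismProperty M) [W.HasTwoOutOfThreeProperty] (K : Type*) [Category K] :
    (W.functorCategory K).HasTwoOutOfThreeProperty where
  comp_mem _ _ hf hg k := W.comp_mem _ _ (hf k) (hg k)
  of_postcomp f g hg h k := W.of_postcomp (f.app k) (g.app k) (hg k) (h k)
  of_precomp f g hf h k := W.of_precomp (f.app k) (g.app k) (hf k) (h k)

lemma functorCategory_trivialFibrations (K : Type*) [Category K] :
    (trivialFibrations M).functorCategory K =
      (fibrations M).functorCategory K ⊓ (weakEquivalences M).functorCategory K := by
  ext
  exact forall_and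

instance : HasColimitsOfShape ℕ M :=
  have := hasColimitsOfSizeShrink.{0, 0, v, v} M
  inferInstance

/-- The projective model structure on diagrams. -/
theorem isModelStructure_kDiag : IsModelStructure (kWeq M X) (kCof M X) (kFib M X) := by
  have := hasColimitsOfSizeShrink.{0, 0, v, v} (KDiag M X)
  have h₁ := hasFactorization_levelwise (𝟭 (KDiag M X)) (fibrations M) hasTruncId
  have h₂ := hasFactorization_levelwise (𝟭 (KDiag M X)) (trivialFibrations M) hasTruncId
  rw [functorCategory_trivialFibrations] at h₂
  have : (kFib M X ⊓ kWeq M X).llp.HasFactorization (kFib M X ⊓ kWeq M X) := h₂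
  have : (kFib M X).llp.HasFactorization (kFib M X) := h₁
  exact IsModelStructure.of_factorizations _ _ (llp_kFib_le_kWeq M X)

variable {M X}

/-- The projective model structure on pre-Co-Segal categories. All objects of `M` are assumed to be
cofibrant only in order to have acyclicity, in the form of
`IsMonoidalModelCategory.llp_fib_le_weq`. -/
theorem isModelStructure_preCat [MonoidalCategory M] [SymmetricCategory M] [MonoidalClosed M]
    (hM : IsMonoidalModelCategory M) (hcof : ∀ A : M, IsCofibrant A) :
    IsModelStructure (weq M X) (cof M X) (fib M X) := by
  have := hasColimitsOfSizeShrink.{0, 0, v, v} (PreCat M X)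
  have : IsSifted ℕ := IsFiltered.isSifted
  have h₁ := hasFactorization_levelwise (forgetLax M X) (fibrations M) hasTruncForgetLax
  have h₂ := hasFactorization_levelwise (forgetLax M X) (trivialFibrations M) hasTruncForgetLax
  rw [functorCategory_trivialFibrations] at h₂
  have : (fib M X ⊓ weq M X).llp.HasFactorization (fib M X ⊓ weq M X) := h₂
  have : (fib M X).llp.HasFactorization (fib M X) := h₁
  exact IsModelStructure.of_factorizations _ _ (hM.llp_fib_le_weq hcof X)

end Fibres

/-! ### Categories fibred over sets -/

/-- A presentation of the category `E` as the total category of a family of categories `A X`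
indexed by sets, with inverse image functors. Every map is uniquely the composite of a map of a
fibre and a cartesian map. -/
structure SetFibration (E : Type*) [Category.{v} E] (A : Type v → Type*)
    [∀ X, Category.{v} (A X)] where
  /-- the inclusions of the fibres -/
  inc (X : Type v) : A X ⥤ E
  exists_inc_eq (e : E) : ∃ (X : Type v) (F : A X), (inc X).obj F = e
  /-- the inverse image functors -/
  pull {X Y : Type v} (f : X → Y) : A Y ⥤ A X
  /-- the cartesian maps -/
  cart {X Y : Type v} (f : X → Y) (G : A Y) : (inc X).obj ((pull f).obj G) ⟶ (inc Y).obj G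
  cart_naturality {X Y : Type v} (f : X → Y) {G G' : A Y} (ψ : G ⟶ G') :
    (inc X).map ((pull f).map ψ) ≫ cart f G' = cart f G ≫ (inc Y).map ψ
  exists_eq {X Y : Type v} {F : A X} {G : A Y} (σ : (inc X).obj F ⟶ (inc Y).obj G) :
    ∃ (f : X → Y) (φ : F ⟶ (pull f).obj G), σ = (inc X).map φ ≫ cart f G
  base_eq {X Y : Type v} {F : A X} {G : A Y} {f g : X → Y} (φ : F ⟶ (pull f).obj G)
    (ψ : F ⟶ (pull g).obj G) (h : (inc X).map φ ≫ cart f G = (inc X).map ψ ≫ cart g G) : f = g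
  eq_of_cart {X Y : Type v} {F : A X} {G : A Y} {f : X → Y} {φ ψ : F ⟶ (pull f).obj G}
    (h : (inc X).map φ ≫ cart f G = (inc X).map ψ ≫ cart f G) : φ = ψ
  /-- the inverse image along the identity -/
  pullId {X : Type v} (F : A X) : F ≅ (pull id).obj F
  pullId_cart {X : Type v} (F : A X) : (inc X).map (pullId F).hom ≫ cart id F = 𝟙 _
  /-- the inverse image along a composite -/
  pullComp {X Y Z : Type v} (f : X → Y) (g : Y → Z) (H : A Z) :
    (pull f).obj ((pull g).obj H) ≅ (pull (g ∘ f)).obj H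
  pullComp_cart {X Y Z : Type v} (f : X → Y) (g : Y → Z) (H : A Z) :
    (inc X).map (pullComp f g H).hom ≫ cart (g ∘ f) H = cart f _ ≫ cart g H

namespace SetFibration

variable {E : Type*} [Category.{v} E] {A : Type v → Type*} [∀ X, Category.{v} (A X)]
  (S : SetFibration E A) {X Y Z : Type v}

/-- The map `σ` lies over the function `f`. -/
def IsOver {F : A X} {G : A Y} (σ : (S.inc X).obj F ⟶ (S.inc Y).obj G) (f : X → Y) : Prop :=
  ∃ φ : F ⟶ (S.pull f).obj G, σ = (S.inc X).map φ ≫ S.cart f G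

variable {S}

namespace IsOver

variable {F : A X} {G : A Y} {H : A Z}

lemma exists_base (σ : (S.inc X).obj F ⟶ (S.inc Y).obj G) : ∃ f, S.IsOver σ f := S.exists_eq σ

lemma unique {σ : (S.inc X).obj F ⟶ (S.inc Y).obj G} {f g : X → Y} (hf : S.IsOver σ f)
    (hg : S.IsOver σ g) : f = g := by
  obtain ⟨φ, rfl⟩ := hf
  obtain ⟨ψ, hψ⟩ := hg
  exact S.base_eq φ ψ hψ

lemma of_fiber {F' : A X} (φ : F ⟶ F') : S.IsOver ((S.inc X).map φ) id :=
  ⟨φ ≫ (S.pullId F').hom, by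
    rw [Functor.map_comp, Category.assoc, S.pullId_cart, Category.comp_id]⟩

lemma exists_fiber {F' : A X} {σ : (S.inc X).obj F ⟶ (S.inc X).obj F'} (h : S.IsOver σ id) :
    ∃ φ, σ = (S.inc X).map φ := by
  obtain ⟨φ, rfl⟩ := h
  refine ⟨φ ≫ (S.pullId F').inv, ?_⟩
  have e : S.cart id F' = (S.inc X).map (S.pullId F').inv := by
    have := S.pullId_cart F'
    rw [← Category.id_comp (S.cart id F'), ← CategoryTheory.Functor.map_id,
      ← (S.pullId F').inv_hom_id,
      Functor.map_comp, Category.assoc, this, Category.comp_id]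
  rw [e, Functor.map_comp]

lemma of_cart (f : X → Y) (G : A Y) : S.IsOver (S.cart f G) f :=
  ⟨𝟙 _, by rw [CategoryTheory.Functor.map_id, Category.id_comp]⟩

lemma comp {σ : (S.inc X).obj F ⟶ (S.inc Y).obj G} {f : X → Y} (hσ : S.IsOver σ f)
    {τ : (S.inc Y).obj G ⟶ (S.inc Z).obj H} {g : Y → Z} (hτ : S.IsOver τ g) :
    S.IsOver (σ ≫ τ) (g ∘ f) := by
  obtain ⟨φ, rfl⟩ := hσ
  obtain ⟨ψ, rfl⟩ := hτ
  refine ⟨φ ≫ (S.pull f).map ψ ≫ (S.pullComp f g H).hom, ?_⟩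
  rw [Category.assoc, ← reassoc_of% S.cart_naturality f ψ, ← S.pullComp_cart, Functor.map_comp,
    Functor.map_comp, Category.assoc, Category.assoc]

lemma id (F : A X) : S.IsOver (𝟙 ((S.inc X).obj F)) _root_.id := by
  rw [← CategoryTheory.Functor.map_id]
  exact of_fiber _

/-- Cartesian maps are strongly cartesian: existence. -/
lemma exists_cart_fac {f : X → Y} {g : Y → Z} {σ : (S.inc X).obj F ⟶ (S.inc Z).obj H}
    (h : S.IsOver σ (g ∘ f)) : ∃ χ, S.IsOver χ f ∧ χ ≫ S.cart g H = σ := by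
  obtain ⟨φ, rfl⟩ := h
  refine ⟨(S.inc X).map (φ ≫ (S.pullComp f g H).inv) ≫ S.cart f _, ⟨_, rfl⟩, ?_⟩
  rw [Category.assoc, ← S.pullComp_cart, ← Category.assoc, ← Functor.map_comp, Category.assoc,
    Iso.inv_hom_id, Category.comp_id]

/-- Cartesian maps are strongly cartesian: uniqueness. -/
lemma cart_ext {f : X → Y} {g : Y → Z} {σ τ : (S.inc X).obj F ⟶ (S.inc Y).obj ((S.pull g).obj H)}
    (hσ : S.IsOver σ f) (hτ : S.IsOver τ f) (h : σ ≫ S.cart g H = τ ≫ S.cart g H) : σ = τ := by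
  obtain ⟨φ, rfl⟩ := hσ
  obtain ⟨ψ, rfl⟩ := hτ
  rw [Category.assoc, Category.assoc, ← S.pullComp_cart, ← Category.assoc, ← Category.assoc,
    ← Functor.map_comp, ← Functor.map_comp] at h
  have := S.eq_of_cart h
  rw [cancel_mono] at this
  rw [this]

end IsOver

lemma inc_injective {F F' : A X} {φ ψ : F ⟶ F'} (h : (S.inc X).map φ = (S.inc X).map ψ) :
    φ = ψ := by
  refine (cancel_mono (S.pullId F').hom).1 (S.eq_of_cart ?_)
  rw [Functor.map_comp, Functor.map_comp, h]

section Opcartesian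

variable (S) [hS : ∀ {X Y : Type v} (f : X → Y), (S.pull f).IsRightAdjoint]

/-- The direct image functors. -/
noncomputable abbrev push (f : X → Y) : A X ⥤ A Y := (S.pull f).leftAdjoint

/-- The opcartesian maps. -/
noncomputable def opcart (f : X → Y) (F : A X) :
    (S.inc X).obj F ⟶ (S.inc Y).obj ((S.push f).obj F) :=
  (S.inc X).map ((Adjunction.ofIsRightAdjoint (S.pull f)).unit.app F) ≫ S.cart f _

variable {S}

namespace IsOver

variable {F : A X} {G : A Y} {H : A Z}

lemma of_opcart (f : X → Y) (F : A X) : S.IsOver (S.opcart f F) f := ⟨_, rfl⟩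

/-- The decomposition of a map as an opcartesian map and a map of a fibre. -/
lemma opcart_comp_homEquiv_symm (f : X → Y) (φ : F ⟶ (S.pull f).obj G) :
    S.opcart f F ≫ (S.inc Y).map (((Adjunction.ofIsRightAdjoint (S.pull f)).homEquiv F G).symm φ) =
      (S.inc X).map φ ≫ S.cart f G := by
  rw [opcart, Category.assoc, ← S.cart_naturality, ← Category.assoc, ← Functor.map_comp,
    ← Adjunction.homEquiv_unit, Equiv.apply_symm_apply]

/-- Opcartesian maps are strongly opcartesian: existence. -/
lemma exists_opcart_fac {f : X → Y} {g : Y → Z} {σ : (S.inc X).obj F ⟶ (S.inc Z).obj H}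
    (h : S.IsOver σ (g ∘ f)) : ∃ χ, S.IsOver χ g ∧ S.opcart f F ≫ χ = σ := by
  obtain ⟨χ, ⟨φ, rfl⟩, rfl⟩ := h.exists_cart_fac
  refine ⟨(S.inc Y).map (((Adjunction.ofIsRightAdjoint (S.pull f)).homEquiv _ _).symm φ) ≫
    S.cart g H, ⟨_, rfl⟩, ?_⟩
  rw [← Category.assoc, opcart_comp_homEquiv_symm]

/-- Opcartesian maps are strongly opcartesian: uniqueness. -/
lemma opcart_ext {f : X → Y} {g : Y → Z} {σ τ : (S.inc Y).obj ((S.push f).obj F) ⟶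
    (S.inc Z).obj H} (hσ : S.IsOver σ g) (hτ : S.IsOver τ g)
    (h : S.opcart f F ≫ σ = S.opcart f F ≫ τ) : σ = τ := by
  obtain ⟨φ, rfl⟩ := hσ
  obtain ⟨ψ, rfl⟩ := hτ
  have e : S.opcart f F ≫ (S.inc Y).map φ = S.opcart f F ≫ (S.inc Y).map ψ :=
    cart_ext ((of_opcart f F).comp (of_fiber φ)) ((of_opcart f F).comp (of_fiber ψ))
      (by rw [Category.assoc, Category.assoc, h])
  rw [opcart, Category.assoc, Category.assoc, ← S.cart_naturality, ← S.cart_naturality,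
    ← Category.assoc, ← Category.assoc, ← Functor.map_comp, ← Functor.map_comp] at e
  have := S.eq_of_cart e
  rw [← Adjunction.homEquiv_unit, ← Adjunction.homEquiv_unit, Equiv.apply_eq_iff_eq] at this
  rw [this]

lemma exists_opcart_fiber {f : X → Y} {σ : (S.inc X).obj F ⟶ (S.inc Y).obj G}
    (h : S.IsOver σ f) : ∃ θ, S.opcart f F ≫ (S.inc Y).map θ = σ := by
  obtain ⟨φ, rfl⟩ := h
  exact ⟨_, opcart_comp_homEquiv_symm f φ⟩

end IsOver

end Opcartesian

/-! ### Limits and colimits in a category fibred over sets -/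

section Limits

/-- A product is the product of the inverse images over the product of the sets. -/
lemma hasProduct (S : SetFibration E A)
    [∀ {X Y : Type v} (f : X → Y), (S.pull f).IsRightAdjoint] [∀ X, HasLimits (A X)]
    {J : Type v} (e : J → E) : HasProduct e := by
  choose X F h using fun j => S.exists_inc_eq (e j)
  obtain rfl : (fun j => (S.inc (X j)).obj (F j)) = e := funext h
  let P := ∀ j, X j
  let π (j : J) (x : P) : X j := x j
  let K (j : J) : A P := (S.pull (π j)).obj (F j)
  let p (j : J) : (S.inc P).obj (∏ᶜ K) ⟶ (S.inc (X j)).obj (F j) :=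
    (S.inc P).map (Pi.π K j) ≫ S.cart (π j) (F j)
  have hp (j) : S.IsOver (p j) (π j) := ⟨_, rfl⟩
  have h₁ (T : E) (s : ∀ j, T ⟶ (S.inc (X j)).obj (F j)) :
      ∃ l : T ⟶ (S.inc P).obj (∏ᶜ K), ∀ j, l ≫ p j = s j := by
    obtain ⟨Z, H, rfl⟩ := S.exists_inc_eq T
    choose f hf using fun j => IsOver.exists_base (s j)
    let g (z : Z) : P := fun j => f j z
    choose χ hχ hχ' using fun j => IsOver.exists_cart_fac (f := g) (g := π j) (hf j)
    choose θ hθ using fun j => (hχ j).exists_opcart_fiber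
    refine ⟨S.opcart g H ≫ (S.inc P).map (Pi.lift θ), fun j => ?_⟩
    rw [Category.assoc, ← Category.assoc ((S.inc P).map _), ← Functor.map_comp, Pi.lift_π,
      ← Category.assoc, hθ, hχ']
  have h₂ {T : E} {l l' : T ⟶ (S.inc P).obj (∏ᶜ K)} (h : ∀ j, l ≫ p j = l' ≫ p j) : l = l' := by
    obtain ⟨Z, H, rfl⟩ := S.exists_inc_eq T
    obtain ⟨g, hg⟩ := IsOver.exists_base l
    obtain ⟨g', hg'⟩ := IsOver.exists_base l'
    obtain rfl : g = g' := funext fun z => funext fun j =>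
      congrFun (((hg.comp (hp j)).unique (h j ▸ hg'.comp (hp j)) : π j ∘ g = π j ∘ g')) z
    obtain ⟨θ, rfl⟩ := hg.exists_opcart_fiber
    obtain ⟨θ', rfl⟩ := hg'.exists_opcart_fiber
    congr 2
    refine Pi.hom_ext _ _ fun j => inc_injective (S := S) ?_
    refine IsOver.opcart_ext (IsOver.of_fiber _) (IsOver.of_fiber _) ?_
    refine IsOver.cart_ext (hg.comp (IsOver.of_fiber (Pi.π K j)) |> fun h => by
      rwa [Category.assoc, ← Functor.map_comp] at h)
      (hg'.comp (IsOver.of_fiber (Pi.π K j)) |> fun h => by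
        rwa [Category.assoc, ← Functor.map_comp] at h) ?_
    have := h j
    simp only [p, Category.assoc] at this
    simpa only [Functor.map_comp, Category.assoc] using this
  choose l hl using h₁
  exact ⟨⟨⟨Fan.mk _ p, Fan.IsLimit.mk _ (fun s => l s.pt s.proj) (fun s j => hl s.pt s.proj j)
    fun s m hm => h₂ fun j => (hm j).trans (hl s.pt s.proj j).symm⟩⟩⟩

/-- An equalizer is the equalizer of the restrictions to the equalizer of the functions. -/
lemma hasEqualizer (S : SetFibration E A)
    [∀ {X Y : Type v} (f : X → Y), (S.pull f).IsRightAdjoint] [∀ X, HasLimits (A X)]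
    {e e' : E} (σ τ : e ⟶ e') : HasEqualizer σ τ := by
  obtain ⟨X, F, rfl⟩ := S.exists_inc_eq e
  obtain ⟨Y, G, rfl⟩ := S.exists_inc_eq e'
  obtain ⟨f, hf⟩ := IsOver.exists_base σ
  obtain ⟨g, hg⟩ := IsOver.exists_base τ
  let ι : { x // f x = g x } → X := Subtype.val
  have hfg : f ∘ ι = g ∘ ι := funext fun x => x.2
  let c := S.cart ι F
  have hc : S.IsOver c ι := IsOver.of_cart ι F
  obtain ⟨φ, hφ⟩ := hc.comp hf
  obtain ⟨ψ, hψ⟩ : S.IsOver (c ≫ τ) (f ∘ ι) := hfg ▸ hc.comp hg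
  let m := (S.inc _).map (equalizer.ι φ ψ) ≫ c
  have hm : S.IsOver m ι := ⟨_, rfl⟩
  have w : m ≫ σ = m ≫ τ := by
    rw [Category.assoc, Category.assoc, hφ, hψ, ← Category.assoc, ← Category.assoc,
      ← Functor.map_comp, ← Functor.map_comp, equalizer.condition]
  have h₁ (T : E) (t : T ⟶ (S.inc X).obj F) (ht : t ≫ σ = t ≫ τ) : ∃ l, l ≫ m = t := by
    obtain ⟨Z, H, rfl⟩ := S.exists_inc_eq T
    obtain ⟨a, ha⟩ := IsOver.exists_base t
    have ha' : f ∘ a = g ∘ a := (ha.comp hf).unique (ht ▸ ha.comp hg)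
    let b (z : Z) : { x // f x = g x } := ⟨a z, congrFun ha' z⟩
    obtain ⟨χ, hχ, rfl⟩ := IsOver.exists_cart_fac (f := b) (g := ι) ha
    obtain ⟨θ, rfl⟩ := hχ.exists_opcart_fiber
    have e : θ ≫ φ = θ ≫ ψ := by
      refine S.eq_of_cart (IsOver.opcart_ext ⟨_, rfl⟩ ⟨_, rfl⟩ ?_)
      rw [Functor.map_comp, Functor.map_comp, Category.assoc, Category.assoc, ← hφ, ← hψ]
      simpa only [Category.assoc] using ht
    refine ⟨S.opcart b H ≫ (S.inc _).map (equalizer.lift θ e), ?_⟩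
    rw [Category.assoc, ← Category.assoc ((S.inc _).map _), ← Functor.map_comp,
      equalizer.lift_ι, Category.assoc]
  have h₂ {T : E} {l l' : T ⟶ (S.inc _).obj (equalizer φ ψ)} (h : l ≫ m = l' ≫ m) : l = l' := by
    obtain ⟨Z, H, rfl⟩ := S.exists_inc_eq T
    obtain ⟨b, hb⟩ := IsOver.exists_base l
    obtain ⟨b', hb'⟩ := IsOver.exists_base l'
    obtain rfl : b = b' := funext fun z => Subtype.ext
      (congrFun ((hb.comp hm).unique (h ▸ hb'.comp hm) : ι ∘ b = ι ∘ b') z)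
    obtain ⟨θ, rfl⟩ := hb.exists_opcart_fiber
    obtain ⟨θ', rfl⟩ := hb'.exists_opcart_fiber
    congr 2
    refine equalizer.hom_ext (inc_injective (S := S) ?_)
    refine IsOver.opcart_ext (IsOver.of_fiber _) (IsOver.of_fiber _) ?_
    refine IsOver.cart_ext (g := ι) (f := b)
      ((IsOver.of_opcart b H).comp (IsOver.of_fiber (θ ≫ equalizer.ι φ ψ)))
      ((IsOver.of_opcart b H).comp (IsOver.of_fiber (θ' ≫ equalizer.ι φ ψ))) ?_
    simpa only [m, Functor.map_comp, Category.assoc] using h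
  choose l hl using h₁
  exact ⟨⟨⟨Fork.ofι m w, Fork.IsLimit.mk _ (fun s => l s.pt s.ι s.condition)
    (fun s => hl s.pt s.ι s.condition) fun s k hk => h₂ (hk.trans (hl _ _ _).symm)⟩⟩⟩

/-- The total category is complete when the fibres are. -/
theorem hasLimits (S : SetFibration E A)
    [∀ {X Y : Type v} (f : X → Y), (S.pull f).IsRightAdjoint] [∀ X, HasLimits (A X)] :
    HasLimits E := by
  have : HasProducts.{v} E := fun J => ⟨fun K =>
    have : HasLimit (Discrete.functor (K.obj ∘ Discrete.mk)) := S.hasProduct fun j => K.obj ⟨j⟩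
    hasLimit_of_iso Discrete.natIsoFunctor.symm⟩
  have : HasEqualizers E :=
    have (e e' : E) (σ τ : e ⟶ e') := S.hasEqualizer σ τ
    hasEqualizers_of_hasLimit_parallelPair E
  exact has_limits_of_hasEqualizers_and_products

/-- A coproduct is the coproduct of the direct images over the disjoint union of the sets. -/
lemma hasCoproduct (S : SetFibration E A)
    [∀ {X Y : Type v} (f : X → Y), (S.pull f).IsRightAdjoint] [∀ X, HasColimits (A X)]
    {J : Type v} (e : J → E) : HasCoproduct e := by
  choose X F h using fun j => S.exists_inc_eq (e j)
  obtain rfl : (fun j => (S.inc (X j)).obj (F j)) = e := funext h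
  let P := Σ j, X j
  let ι (j : J) (x : X j) : P := ⟨j, x⟩
  let K (j : J) : A P := (S.push (ι j)).obj (F j)
  let p (j : J) : (S.inc (X j)).obj (F j) ⟶ (S.inc P).obj (∐ K) :=
    S.opcart (ι j) (F j) ≫ (S.inc P).map (Sigma.ι K j)
  have hp (j) : S.IsOver (p j) (ι j) := (IsOver.of_opcart _ _).comp (IsOver.of_fiber _)
  have h₁ (T : E) (s : ∀ j, (S.inc (X j)).obj (F j) ⟶ T) :
      ∃ l : (S.inc P).obj (∐ K) ⟶ T, ∀ j, p j ≫ l = s j := by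
    obtain ⟨Z, H, rfl⟩ := S.exists_inc_eq T
    choose f hf using fun j => IsOver.exists_base (s j)
    let g (z : P) : Z := f z.1 z.2
    choose χ hχ hχ' using fun j => IsOver.exists_opcart_fac (f := ι j) (g := g) (hf j)
    choose θ hθ using hχ
    refine ⟨(S.inc P).map (Sigma.desc θ) ≫ S.cart g H, fun j => ?_⟩
    rw [Category.assoc, ← Category.assoc ((S.inc P).map _), ← Functor.map_comp, Sigma.ι_desc,
      ← hθ, hχ']
  have h₂ {T : E} {l l' : (S.inc P).obj (∐ K) ⟶ T} (h : ∀ j, p j ≫ l = p j ≫ l') : l = l' := by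
    obtain ⟨Z, H, rfl⟩ := S.exists_inc_eq T
    obtain ⟨g, hg⟩ := IsOver.exists_base l
    obtain ⟨g', hg'⟩ := IsOver.exists_base l'
    obtain rfl : g = g' := funext fun z =>
      congrFun ((((hp z.1).comp hg).unique (h z.1 ▸ (hp z.1).comp hg') :
        g ∘ ι z.1 = g' ∘ ι z.1)) z.2
    obtain ⟨θ, rfl⟩ := hg
    obtain ⟨θ', rfl⟩ := hg'
    congr 2
    refine Sigma.hom_ext _ _ fun j => S.eq_of_cart (IsOver.opcart_ext ⟨_, rfl⟩ ⟨_, rfl⟩ ?_)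
    simpa only [p, Functor.map_comp, Category.assoc] using h j
  choose l hl using h₁
  exact ⟨⟨⟨Cofan.mk _ p, Cofan.IsColimit.mk _ (fun s => l s.pt s.inj) (fun s j => hl s.pt s.inj j)
    fun s m hm => h₂ fun j => (hm j).trans (hl s.pt s.inj j).symm⟩⟩⟩

/-- A coequalizer is the coequalizer of the direct images over the coequalizer of the
functions. -/
lemma hasCoequalizer (S : SetFibration E A)
    [∀ {X Y : Type v} (f : X → Y), (S.pull f).IsRightAdjoint] [∀ X, HasColimits (A X)]
    {e e' : E} (σ τ : e ⟶ e') : HasCoequalizer σ τ := by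
  obtain ⟨X, F, rfl⟩ := S.exists_inc_eq e
  obtain ⟨Y, G, rfl⟩ := S.exists_inc_eq e'
  obtain ⟨f, hf⟩ := IsOver.exists_base σ
  obtain ⟨g, hg⟩ := IsOver.exists_base τ
  let q := Function.Coequalizer.mk f g
  have hfg : q ∘ f = q ∘ g := funext fun x => Function.Coequalizer.condition f g x
  let c := S.opcart q G
  have hc : S.IsOver c q := IsOver.of_opcart q G
  obtain ⟨φ, hφ⟩ := (hf.comp hc).exists_opcart_fiber
  obtain ⟨ψ, hψ⟩ := (hfg ▸ hg.comp hc : S.IsOver (τ ≫ c) (q ∘ f)).exists_opcart_fiber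
  let m := c ≫ (S.inc _).map (coequalizer.π φ ψ)
  have hm : S.IsOver m q := hc.comp (IsOver.of_fiber _)
  have w : σ ≫ m = τ ≫ m := by
    rw [← Category.assoc, ← Category.assoc, ← hφ, ← hψ, Category.assoc, Category.assoc,
      ← Functor.map_comp, ← Functor.map_comp, coequalizer.condition]
  have h₁ (T : E) (t : (S.inc Y).obj G ⟶ T) (ht : σ ≫ t = τ ≫ t) : ∃ l, m ≫ l = t := by
    obtain ⟨Z, H, rfl⟩ := S.exists_inc_eq T
    obtain ⟨a, ha⟩ := IsOver.exists_base t
    have ha' : a ∘ f = a ∘ g := (hf.comp ha).unique (ht ▸ hg.comp ha)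
    let b := Function.Coequalizer.desc f g a ha'
    obtain ⟨χ, ⟨θ, rfl⟩, rfl⟩ := IsOver.exists_opcart_fac (f := q) (g := b) ha
    have e : φ ≫ θ = ψ ≫ θ := by
      refine S.eq_of_cart (IsOver.opcart_ext ⟨_, rfl⟩ ⟨_, rfl⟩ ?_)
      rw [Functor.map_comp, Functor.map_comp, Category.assoc, Category.assoc, ← Category.assoc,
        ← Category.assoc (S.opcart _ _), hφ, hψ]
      simpa only [Category.assoc] using ht
    refine ⟨(S.inc _).map (coequalizer.desc θ e) ≫ S.cart b H, ?_⟩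
    rw [Category.assoc, ← Category.assoc ((S.inc _).map _), ← Functor.map_comp,
      coequalizer.π_desc]
  have h₂ {T : E} {l l' : (S.inc _).obj (coequalizer φ ψ) ⟶ T} (h : m ≫ l = m ≫ l') :
      l = l' := by
    obtain ⟨Z, H, rfl⟩ := S.exists_inc_eq T
    obtain ⟨b, hb⟩ := IsOver.exists_base l
    obtain ⟨b', hb'⟩ := IsOver.exists_base l'
    obtain rfl : b = b' := (Function.Coequalizer.mk_surjective f g).injective_comp_right
      ((hm.comp hb).unique (h ▸ hm.comp hb'))
    obtain ⟨θ, rfl⟩ := hb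
    obtain ⟨θ', rfl⟩ := hb'
    congr 2
    refine coequalizer.hom_ext (S.eq_of_cart (IsOver.opcart_ext ⟨_, rfl⟩ ⟨_, rfl⟩ ?_))
    simpa only [m, c, Functor.map_comp, Category.assoc] using h
  choose l hl using h₁
  exact ⟨⟨⟨Cofork.ofπ m w, Cofork.IsColimit.mk _ (fun s => l s.pt s.π s.condition)
    (fun s => hl s.pt s.π s.condition) fun s k hk => h₂ (hk.trans (hl _ _ _).symm)⟩⟩⟩

/-- The total category is cocomplete when the fibres are and the inverse image functors have left
adjoints. -/
theorem hasColimits (S : SetFibration E A)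
    [∀ {X Y : Type v} (f : X → Y), (S.pull f).IsRightAdjoint] [∀ X, HasColimits (A X)] :
    HasColimits E := by
  have : HasCoproducts.{v} E := fun J => ⟨fun K =>
    have : HasColimit (Discrete.functor (K.obj ∘ Discrete.mk)) :=
      S.hasCoproduct fun j => K.obj ⟨j⟩
    hasColimit_of_iso Discrete.natIsoFunctor⟩
  have : HasCoequalizers E :=
    have (e e' : E) (σ τ : e ⟶ e') := S.hasCoequalizer σ τ
    hasCoequalizers_of_hasColimit_parallelPair E
  exact has_colimits_of_hasCoequalizers_and_coproducts

end Limits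

end SetFibration

/-! ### The classes of maps of a model structure -/

namespace IsModelStructure

variable {C : Type*} [Category.{v} C] {W Fib : MorphismProperty C}

lemma hasTwoOutOfThreeProperty (h : IsModelStructure W (Fib ⊓ W).llp Fib) :
    W.HasTwoOutOfThreeProperty := by
  obtain ⟨-, -, _, rfl, -, rfl⟩ := h
  infer_instance

lemma respectsIso (h : IsModelStructure W (Fib ⊓ W).llp Fib) : W.RespectsIso := by
  obtain ⟨-, -, _, rfl, -, rfl⟩ := h
  infer_instance

lemma hasFactorization_fib (h : IsModelStructure W (Fib ⊓ W).llp Fib) :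
    Fib.llp.HasFactorization Fib := by
  obtain ⟨-, -, _, rfl, -, rfl⟩ := h
  rw [fibrations_llp]
  infer_instance

lemma hasFactorization_trivialFib (h : IsModelStructure W (Fib ⊓ W).llp Fib) :
    (Fib ⊓ W).llp.HasFactorization (Fib ⊓ W) := by
  obtain ⟨-, -, _, rfl, -, rfl⟩ := h
  change (trivialFibrations C).llp.HasFactorization (trivialFibrations C)
  rw [trivialFibrations_llp]
  infer_instance

lemma llp_fib_le (h : IsModelStructure W (Fib ⊓ W).llp Fib) : Fib.llp ≤ W := by
  obtain ⟨-, -, _, rfl, -, rfl⟩ := h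
  rw [fibrations_llp]
  exact inf_le_right

lemma rlp_llp_fib (h : IsModelStructure W (Fib ⊓ W).llp Fib) : Fib.llp.rlp = Fib := by
  obtain ⟨-, -, _, rfl, -, rfl⟩ := h
  rw [fibrations_llp, trivialCofibrations_rlp]

lemma rlp_llp_trivialFib (h : IsModelStructure W (Fib ⊓ W).llp Fib) :
    (Fib ⊓ W).llp.rlp = Fib ⊓ W := by
  obtain ⟨-, -, _, rfl, -, rfl⟩ := h
  change (trivialFibrations C).llp.rlp = trivialFibrations C
  rw [trivialFibrations_llp, cofibrations_rlp]

end IsModelStructure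

namespace SetFibration

variable {E : Type*} [Category.{v} E] {A : Type v → Type*} [∀ X, Category.{v} (A X)]
  {S : SetFibration E A} {X Y Z : Type v}

/-! ### Lifting properties in a category fibred over sets -/

lemma comp_eq {F : A X} {G : A Y} {H : A Z} {f : X → Y} {g : Y → Z} (φ : F ⟶ (S.pull f).obj G)
    (ψ : G ⟶ (S.pull g).obj H) :
    ((S.inc X).map φ ≫ S.cart f G) ≫ (S.inc Y).map ψ ≫ S.cart g H =
      (S.inc X).map (φ ≫ (S.pull f).map ψ ≫ (S.pullComp f g H).hom) ≫ S.cart (g ∘ f) H := by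
  rw [Category.assoc, ← reassoc_of% S.cart_naturality f ψ, ← S.pullComp_cart, Functor.map_comp,
    Functor.map_comp, Category.assoc, Category.assoc]

/-- Lifting against a map of a fibre amounts to lifting in the fibre against all inverse images. -/
lemma hasLiftingProperty_inc_iff {B C : A Z} (j : B ⟶ C) {F : A X} {G : A Y} {f : X → Y}
    (φ : F ⟶ (S.pull f).obj G) :
    HasLiftingProperty ((S.inc Z).map j) ((S.inc X).map φ ≫ S.cart f G) ↔
      ∀ g : Z → X, HasLiftingProperty j ((S.pull g).map φ) := by
  refine ⟨fun h g => ⟨fun {a b} sq => ?_⟩, fun h => ⟨fun {a b} sq => ?_⟩⟩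
  · have sq' : CommSq ((S.inc Z).map a ≫ S.cart g F) ((S.inc Z).map j)
        ((S.inc X).map φ ≫ S.cart f G) ((S.inc Z).map b ≫ S.cart g _ ≫ S.cart f G) := ⟨by
      rw [Category.assoc, ← reassoc_of% S.cart_naturality, ← Category.assoc, ← Functor.map_comp,
        sq.w, Functor.map_comp, Category.assoc]⟩
    obtain ⟨g', hg'⟩ := IsOver.exists_base sq'.lift
    obtain rfl : g' = g := by
      have h := (IsOver.of_fiber j).comp hg'
      rw [sq'.fac_left] at h
      exact h.unique ⟨_, rfl⟩
    obtain ⟨d, hd⟩ := hg'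
    refine ⟨⟨⟨d, S.eq_of_cart ?_, S.eq_of_cart (IsOver.cart_ext (g := f) ⟨_, rfl⟩ ⟨_, rfl⟩ ?_)⟩⟩⟩
    · rw [Functor.map_comp, Category.assoc, ← hd, sq'.fac_left]
    · rw [Functor.map_comp, Category.assoc, Category.assoc, Category.assoc,
        reassoc_of% S.cart_naturality, ← Category.assoc, ← hd, sq'.fac_right]
  · obtain ⟨g, hg⟩ := IsOver.exists_base a
    obtain ⟨k, hk⟩ := IsOver.exists_base b
    have hφ : S.IsOver ((S.inc X).map φ ≫ S.cart f G) f := ⟨_, rfl⟩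
    obtain rfl : k = f ∘ g := ((IsOver.of_fiber j).comp hk).unique (sq.w ▸ hg.comp hφ)
    obtain ⟨a', rfl⟩ := hg
    obtain ⟨χ, ⟨b', rfl⟩, rfl⟩ := IsOver.exists_cart_fac (f := g) (g := f) hk
    have sq' : CommSq a' j ((S.pull g).map φ) b' := ⟨S.eq_of_cart (IsOver.cart_ext (g := f)
      ⟨_, rfl⟩ ⟨_, rfl⟩ (by
        have := sq.w
        simp only [Functor.map_comp, Category.assoc, reassoc_of% S.cart_naturality] at this ⊢
        exact this))⟩
    have := h g
    refine ⟨⟨⟨(S.inc Z).map sq'.lift ≫ S.cart g F, ?_, ?_⟩⟩⟩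
    · rw [← Category.assoc, ← Functor.map_comp, sq'.fac_left]
    · rw [Category.assoc, ← reassoc_of% S.cart_naturality, ← Category.assoc, ← Functor.map_comp,
        sq'.fac_right, Category.assoc]

/-- An initial object of a fibre maps uniquely over each function. -/
lemma IsOver.exists_of_isInitial {F : A X} (hF : IsInitial F) (f : X → Y) (G : A Y) :
    ∃ σ : (S.inc X).obj F ⟶ (S.inc Y).obj G, S.IsOver σ f := ⟨_, hF.to _, rfl⟩

lemma IsOver.ext_of_isInitial {F : A X} (hF : IsInitial F) {f : X → Y} {G : A Y}
    {σ τ : (S.inc X).obj F ⟶ (S.inc Y).obj G} (hσ : S.IsOver σ f) (hτ : S.IsOver τ f) : σ = τ := by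
  obtain ⟨φ, rfl⟩ := hσ
  obtain ⟨ψ, rfl⟩ := hτ
  rw [hF.hom_ext φ ψ]

/-- Maps over bijections have the right lifting property against maps of discrete objects. -/
lemma IsOver.hasLiftingProperty_of_isInitial {F : A X} {G : A Y} {σ : (S.inc X).obj F ⟶
    (S.inc Y).obj G} {f : X → Y} (h : S.IsOver σ f) (hf : Function.Bijective f) {Z' : Type v}
    {I : A Z} {I' : A Z'} (hI : IsInitial I) (hI' : IsInitial I')
    (d : (S.inc Z).obj I ⟶ (S.inc Z').obj I') : HasLiftingProperty d σ where
  sq_hasLift {a b} sq := by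
    obtain ⟨p, hp⟩ := exists_base a
    obtain ⟨q, hq⟩ := exists_base b
    obtain ⟨r, hr⟩ := exists_base d
    have e : f ∘ p = q ∘ r := (hp.comp h).unique (sq.w ▸ hr.comp hq)
    obtain ⟨k, hk⟩ := hf.2.hasRightInverse
    have hk' : f ∘ (k ∘ q) = q := funext fun z => hk _
    obtain ⟨l, hl⟩ := exists_of_isInitial (S := S) hI' (k ∘ q) F
    have hp' : (k ∘ q) ∘ r = p := hf.1.comp_left (by
      change (f ∘ (k ∘ q)) ∘ r = f ∘ p
      rw [hk', e])
    have h₁ : S.IsOver (d ≫ l) p := hp' ▸ hr.comp hl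
    have h₂ : S.IsOver (l ≫ σ) q := hk' ▸ hl.comp h
    exact ⟨⟨⟨l, ext_of_isInitial hI h₁ hp, ext_of_isInitial hI' h₂ hq⟩⟩⟩

/-- A map with the right lifting property against a map of discrete objects over `∅ ⟶ {∗}` lies
over a surjection. -/
lemma IsOver.surjective {F : A X} {G : A Y} {σ : (S.inc X).obj F ⟶ (S.inc Y).obj G} {f : X → Y}
    (h : S.IsOver σ f) {I : A PEmpty.{v + 1}} {I' : A PUnit.{v + 1}} (hI : IsInitial I)
    (hI' : IsInitial I') {d : (S.inc _).obj I ⟶ (S.inc _).obj I'} (hd : HasLiftingProperty d σ) :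
    Function.Surjective f := by
  intro y
  obtain ⟨a, ha⟩ := exists_of_isInitial (S := S) hI PEmpty.elim F
  obtain ⟨b, hb⟩ := exists_of_isInitial (S := S) hI' (fun _ => y) G
  obtain ⟨r, hr⟩ := exists_base d
  have sq : CommSq a d σ b := ⟨ext_of_isInitial hI (f := PEmpty.elim)
    ((funext fun x => x.elim : f ∘ PEmpty.elim = PEmpty.elim) ▸ ha.comp h)
    ((funext fun x => x.elim : (fun _ => y) ∘ r = PEmpty.elim) ▸ hr.comp hb)⟩
  obtain ⟨l, hl⟩ := exists_base sq.lift
  have e : f ∘ l = fun _ => y := (hl.comp h).unique (sq.fac_right.symm ▸ hb)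
  exact ⟨l PUnit.unit, congrFun e PUnit.unit⟩

/-- A map with the right lifting property against a map of discrete objects over
`{0, 1} ⟶ {∗}` lies over an injection. -/
lemma IsOver.injective {F : A X} {G : A Y} {σ : (S.inc X).obj F ⟶ (S.inc Y).obj G} {f : X → Y}
    (h : S.IsOver σ f) {I : A (ULift.{v} Bool)} {I' : A PUnit.{v + 1}} (hI : IsInitial I)
    (hI' : IsInitial I') {d : (S.inc _).obj I ⟶ (S.inc _).obj I'} (hd : HasLiftingProperty d σ) :
    Function.Injective f := by
  intro x x' hx
  let p (i : ULift.{v} Bool) : X := cond i.down x x'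
  obtain ⟨a, ha⟩ := exists_of_isInitial (S := S) hI p F
  obtain ⟨b, hb⟩ := exists_of_isInitial (S := S) hI' (fun _ => f x) G
  obtain ⟨r, hr⟩ := exists_base d
  have e : f ∘ p = (fun _ => f x) ∘ r := by
    funext ⟨i⟩
    cases i
    · exact hx.symm
    · rfl
  have sq : CommSq a d σ b := ⟨ext_of_isInitial hI (ha.comp h) (e ▸ hr.comp hb)⟩
  obtain ⟨l, hl⟩ := exists_base sq.lift
  have hp : l ∘ r = p := (hr.comp hl).unique (sq.fac_left.symm ▸ ha)
  exact (congrFun hp ⟨true⟩).symm.trans (congrFun hp ⟨false⟩)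

variable (S) [∀ {X Y : Type v} (f : X → Y), (S.pull f).IsRightAdjoint]

/-- Opcartesian maps have the left lifting property against maps over bijections. -/
lemma hasLiftingProperty_opcart (f : X → Y) (F : A X) {X' Y' : Type v} {F' : A X'} {G' : A Y'}
    {σ : (S.inc X').obj F' ⟶ (S.inc Y').obj G'} {g : X' → Y'} (h : S.IsOver σ g)
    (hg : Function.Bijective g) : HasLiftingProperty (S.opcart f F) σ where
  sq_hasLift {a b} sq := by
    obtain ⟨p, hp⟩ := IsOver.exists_base a
    obtain ⟨q, hq⟩ := IsOver.exists_base b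
    have e : g ∘ p = q ∘ f := (hp.comp h).unique (sq.w ▸ (IsOver.of_opcart f F).comp hq)
    obtain ⟨k, hk⟩ := hg.2.hasRightInverse
    have hk' : g ∘ (k ∘ q) = q := funext fun z => hk _
    have hp' : p = (k ∘ q) ∘ f := hg.1.comp_left (by
      change g ∘ p = (g ∘ (k ∘ q)) ∘ f
      rw [hk', e])
    obtain ⟨l, hl, hl'⟩ := IsOver.exists_opcart_fac (f := f) (g := k ∘ q) (hp' ▸ hp)
    refine ⟨⟨⟨l, hl', IsOver.opcart_ext (g := q) (hk' ▸ hl.comp h) hq ?_⟩⟩⟩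
    rw [← Category.assoc, hl', sq.w]

lemma pullId_naturality {F G : A X} (φ : F ⟶ G) :
    φ ≫ (S.pullId G).hom = (S.pullId F).hom ≫ (S.pull id).map φ := by
  refine S.eq_of_cart ?_
  rw [Functor.map_comp, Functor.map_comp, Category.assoc, Category.assoc, S.pullId_cart,
    S.cart_naturality, reassoc_of% S.pullId_cart, Category.comp_id]

/-- A map of a fibre is isomorphic to its inverse image along the identity. -/
noncomputable def pullIdArrowIso {F G : A X} (φ : F ⟶ G) :
    Arrow.mk φ ≅ Arrow.mk ((S.pull id).map φ) :=
  Arrow.isoMk (S.pullId F) (S.pullId G) (S.pullId_naturality φ).symm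

/-- The iterated inverse image of a map is isomorphic to its inverse image along the composite. -/
noncomputable def pullCompArrowIso (f : X → Y) (g : Y → Z) {F G : A Z} (φ : F ⟶ G) :
    Arrow.mk ((S.pull f).map ((S.pull g).map φ)) ≅ Arrow.mk ((S.pull (g ∘ f)).map φ) :=
  Arrow.isoMk (S.pullComp f g F) (S.pullComp f g G) (S.eq_of_cart (by
    change (S.inc X).map ((S.pullComp f g F).hom ≫ (S.pull (g ∘ f)).map φ) ≫ _ =
      (S.inc X).map ((S.pull f).map ((S.pull g).map φ) ≫ (S.pullComp f g G).hom) ≫ _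
    rw [Functor.map_comp, Functor.map_comp, Category.assoc, Category.assoc, S.cart_naturality,
      reassoc_of% S.pullComp_cart, S.pullComp_cart, reassoc_of% S.cart_naturality,
      S.cart_naturality]))

/-! ### The model structure on a category fibred over sets -/

section Model

variable (WA FA : ∀ X, MorphismProperty (A X)) (W Fib : MorphismProperty E)

/-- The class of all maps between discrete objects, the initial objects of the fibres. -/
inductive discMaps : MorphismProperty E
  | mk {X Y : Type v} {I : A X} {I' : A Y} (hI : IsInitial I) (hI' : IsInitial I')
      (d : (S.inc X).obj I ⟶ (S.inc Y).obj I') : discMaps d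

/-- The images of the maps of the fibres that belong to a given class. -/
inductive fibreMaps (P : ∀ X, MorphismProperty (A X)) : MorphismProperty E
  | mk {X : Type v} {F G : A X} (φ : F ⟶ G) (h : P X φ) : fibreMaps P ((S.inc X).map φ)

/-- The compatibility of classes of weak equivalences and fibrations of `E` with classes of weak
equivalences and fibrations of the fibres. -/
structure IsFibredModel : Prop where
  fib_iff {X Y : Type v} {F : A X} {G : A Y} (f : X → Y) (φ : F ⟶ (S.pull f).obj G) :
    Fib ((S.inc X).map φ ≫ S.cart f G) ↔ FA X φ
  weq_iff {X Y : Type v} {F : A X} {G : A Y} (f : X → Y) (φ : F ⟶ (S.pull f).obj G) :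
    W ((S.inc X).map φ ≫ S.cart f G) ↔ Function.Bijective f ∧ WA X φ
  fib_pull {X Y : Type v} {F G : A Y} (f : X → Y) (φ : F ⟶ G) (h : FA Y φ) :
    FA X ((S.pull f).map φ)
  weq_pull {X Y : Type v} {F G : A Y} (f : X → Y) (φ : F ⟶ G) (h : WA Y φ) :
    WA X ((S.pull f).map φ)
  isModelStructure (X : Type v) : IsModelStructure (WA X) (FA X ⊓ WA X).llp (FA X)

variable {S WA FA W Fib}

namespace IsFibredModel

lemma trivialFib_iff (h : S.IsFibredModel WA FA W Fib) {F : A X} {G : A Y} (f : X → Y)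
    (φ : F ⟶ (S.pull f).obj G) : (Fib ⊓ W) ((S.inc X).map φ ≫ S.cart f G) ↔
      Function.Bijective f ∧ (FA X ⊓ WA X) φ := by
  change _ ∧ _ ↔ _ ∧ _ ∧ _
  rw [h.fib_iff, h.weq_iff]
  tauto

lemma inc_map_eq {F G : A X} (φ : F ⟶ G) :
    (S.inc X).map φ = (S.inc X).map (φ ≫ (S.pullId G).hom) ≫ S.cart id G := by
  rw [Functor.map_comp, Category.assoc, S.pullId_cart, Category.comp_id]

lemma fib_eq_rlp (h : S.IsFibredModel WA FA W Fib) :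
    Fib = (S.fibreMaps fun X => (FA X).llp).rlp := by
  ext e e' σ
  obtain ⟨X, F, rfl⟩ := S.exists_inc_eq e
  obtain ⟨Y, G, rfl⟩ := S.exists_inc_eq e'
  obtain ⟨f, φ, rfl⟩ := S.exists_eq σ
  rw [h.fib_iff]
  refine ⟨fun hφ => ?_, fun hσ => ?_⟩
  · rintro _ _ _ ⟨j, hj⟩
    exact (hasLiftingProperty_inc_iff j φ).2 fun g => hj _ (h.fib_pull g φ hφ)
  · rw [← (h.isModelStructure X).rlp_llp_fib]
    intro B C j hj
    have := (hasLiftingProperty_inc_iff j φ).1 (hσ _ ⟨j, hj⟩) id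
    exact (HasLiftingProperty.iff_of_arrow_iso_right j (S.pullIdArrowIso φ)).2 this

lemma trivialFib_eq_rlp (h : S.IsFibredModel WA FA W Fib) :
    Fib ⊓ W = (S.discMaps ⊔ S.fibreMaps fun X => (FA X ⊓ WA X).llp).rlp := by
  ext e e' σ
  obtain ⟨X, F, rfl⟩ := S.exists_inc_eq e
  obtain ⟨Y, G, rfl⟩ := S.exists_inc_eq e'
  obtain ⟨f, φ, rfl⟩ := S.exists_eq σ
  rw [h.trivialFib_iff]
  refine ⟨fun ⟨hf, hφ⟩ => ?_, fun hσ => ?_⟩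
  · rintro _ _ _ (⟨hI, hI', d⟩ | ⟨j, hj⟩)
    · exact IsOver.hasLiftingProperty_of_isInitial ⟨_, rfl⟩ hf hI hI' d
    · exact (hasLiftingProperty_inc_iff j φ).2 fun g =>
        hj _ ⟨h.fib_pull g φ hφ.1, h.weq_pull g φ hφ.2⟩
  · have hA (X) := (h.isModelStructure X).hasColimits
    have hσ' : S.IsOver ((S.inc X).map φ ≫ S.cart f G) f := ⟨_, rfl⟩
    refine ⟨⟨?_, ?_⟩, ?_⟩
    · obtain ⟨d, hd⟩ := IsOver.exists_of_isInitial (S := S) (initialIsInitial (C := A _))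
        (fun _ : ULift.{v} Bool => PUnit.unit.{v + 1}) (⊥_ (A _))
      have := hσ d (Or.inl ⟨initialIsInitial, initialIsInitial, d⟩)
      exact hσ'.injective initialIsInitial initialIsInitial this
    · obtain ⟨d, hd⟩ := IsOver.exists_of_isInitial (S := S) (initialIsInitial (C := A _))
        (fun _ : PEmpty.{v + 1} => PUnit.unit.{v + 1}) (⊥_ (A _))
      have := hσ d (Or.inl ⟨initialIsInitial, initialIsInitial, d⟩)
      exact hσ'.surjective initialIsInitial initialIsInitial this
    · rw [← (h.isModelStructure X).rlp_llp_trivialFib]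
      intro B C j hj
      have := (hasLiftingProperty_inc_iff j φ).1 (hσ _ (Or.inr ⟨j, hj⟩)) id
      exact (HasLiftingProperty.iff_of_arrow_iso_right j (S.pullIdArrowIso φ)).2 this

/-- Inverse images along bijections reflect weak equivalences. -/
lemma weq_of_pull (h : S.IsFibredModel WA FA W Fib) {F G : A Y} {f : X → Y}
    (hf : Function.Bijective f) (ψ : F ⟶ G) (hψ : WA X ((S.pull f).map ψ)) : WA Y ψ := by
  obtain ⟨k, hk⟩ := hf.2.hasRightInverse
  have hk' : f ∘ k = id := funext hk
  have := (h.isModelStructure Y).respectsIso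
  have h₁ := h.weq_pull k _ hψ
  have h₂ : WA Y ((S.pull (f ∘ k)).map ψ) :=
    ((WA Y).arrow_mk_iso_iff (S.pullCompArrowIso k f ψ)).1 h₁
  rw [hk'] at h₂
  exact ((WA Y).arrow_mk_iso_iff (S.pullIdArrowIso ψ)).2 h₂

lemma hasTwoOutOfThreeProperty (h : S.IsFibredModel WA FA W Fib) :
    W.HasTwoOutOfThreeProperty := by
  have hA (X) := (h.isModelStructure X).hasTwoOutOfThreeProperty
  have hA' (X) := (h.isModelStructure X).respectsIso
  have hc {e e' e'' : E} (σ : e ⟶ e') (τ : e' ⟶ e'') (hσ : W σ) (hτ : W τ) : W (σ ≫ τ) := by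
    obtain ⟨X, F, rfl⟩ := S.exists_inc_eq e
    obtain ⟨Y, G, rfl⟩ := S.exists_inc_eq e'
    obtain ⟨Z, H, rfl⟩ := S.exists_inc_eq e''
    obtain ⟨f, φ, rfl⟩ := S.exists_eq σ
    obtain ⟨g, ψ, rfl⟩ := S.exists_eq τ
    rw [h.weq_iff] at hσ hτ
    rw [comp_eq, h.weq_iff]
    refine ⟨hτ.1.comp hσ.1, (WA X).comp_mem _ _ hσ.2 ?_⟩
    rw [(WA X).cancel_right_of_respectsIso]
    exact h.weq_pull f ψ hτ.2
  have hl {e e' e'' : E} (σ : e ⟶ e') (τ : e' ⟶ e'') (hτ : W τ) (hστ : W (σ ≫ τ)) : W σ := by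
    obtain ⟨X, F, rfl⟩ := S.exists_inc_eq e
    obtain ⟨Y, G, rfl⟩ := S.exists_inc_eq e'
    obtain ⟨Z, H, rfl⟩ := S.exists_inc_eq e''
    obtain ⟨f, φ, rfl⟩ := S.exists_eq σ
    obtain ⟨g, ψ, rfl⟩ := S.exists_eq τ
    rw [comp_eq, h.weq_iff] at hστ
    rw [h.weq_iff] at hτ ⊢
    have h₁ := hστ.2
    rw [← Category.assoc, (WA X).cancel_right_of_respectsIso] at h₁
    exact ⟨(Function.Bijective.of_comp_iff' hτ.1 f).1 hστ.1,
      (WA X).of_postcomp _ _ (h.weq_pull f ψ hτ.2) h₁⟩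
  have hr {e e' e'' : E} (σ : e ⟶ e') (τ : e' ⟶ e'') (hσ : W σ) (hστ : W (σ ≫ τ)) : W τ := by
    obtain ⟨X, F, rfl⟩ := S.exists_inc_eq e
    obtain ⟨Y, G, rfl⟩ := S.exists_inc_eq e'
    obtain ⟨Z, H, rfl⟩ := S.exists_inc_eq e''
    obtain ⟨f, φ, rfl⟩ := S.exists_eq σ
    obtain ⟨g, ψ, rfl⟩ := S.exists_eq τ
    rw [comp_eq, h.weq_iff] at hστ
    rw [h.weq_iff] at hσ ⊢
    have h₁ := (WA X).of_precomp _ _ hσ.2 hστ.2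
    rw [(WA X).cancel_right_of_respectsIso] at h₁
    exact ⟨(Function.Bijective.of_comp_iff g hσ.1).1 hστ.1, h.weq_of_pull hσ.1 ψ h₁⟩
  exact { comp_mem σ τ := hc σ τ, of_postcomp σ τ := hl σ τ, of_precomp σ τ := hr σ τ }

lemma llp_trivialFib_inc (h : S.IsFibredModel WA FA W Fib) {F G : A X} (j : F ⟶ G)
    (hj : (FA X ⊓ WA X).llp j) : (Fib ⊓ W).llp ((S.inc X).map j) := by
  rw [h.trivialFib_eq_rlp]
  exact MorphismProperty.le_llp_rlp _ _ (Or.inr ⟨j, hj⟩)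

lemma llp_fib_inc (h : S.IsFibredModel WA FA W Fib) {F G : A X} (j : F ⟶ G)
    (hj : (FA X).llp j) : Fib.llp ((S.inc X).map j) := by
  rw [h.fib_eq_rlp]
  exact MorphismProperty.le_llp_rlp _ _ ⟨j, hj⟩

lemma llp_trivialFib_opcart (h : S.IsFibredModel WA FA W Fib) (f : X → Y) (F : A X) :
    (Fib ⊓ W).llp (S.opcart f F) := by
  intro e e' σ hσ
  obtain ⟨X', F', rfl⟩ := S.exists_inc_eq e
  obtain ⟨Y', G', rfl⟩ := S.exists_inc_eq e'
  obtain ⟨g, ψ, rfl⟩ := S.exists_eq σ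
  rw [h.trivialFib_iff] at hσ
  exact S.hasLiftingProperty_opcart f F ⟨_, rfl⟩ hσ.1

lemma hasFactorization_fib (h : S.IsFibredModel WA FA W Fib) :
    Fib.llp.HasFactorization Fib where
  nonempty_mapFactorizationData {e e'} σ := by
    obtain ⟨X, F, rfl⟩ := S.exists_inc_eq e
    obtain ⟨Y, G, rfl⟩ := S.exists_inc_eq e'
    obtain ⟨f, φ, rfl⟩ := S.exists_eq σ
    have := (h.isModelStructure X).hasFactorization_fib
    have d := MorphismProperty.factorizationData (FA X).llp (FA X) φ
    exact ⟨⟨_, (S.inc X).map d.i, (S.inc X).map d.p ≫ S.cart f G, by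
      rw [← Category.assoc, ← Functor.map_comp, d.fac], h.llp_fib_inc _ d.hi,
      (h.fib_iff _ _).2 d.hp⟩⟩

lemma trivialFib_inc (h : S.IsFibredModel WA FA W Fib) {F G : A X} (q : F ⟶ G)
    (hq : (FA X ⊓ WA X) q) : (Fib ⊓ W) ((S.inc X).map q) := by
  have := (h.isModelStructure X).respectsIso
  have : (FA X ⊓ WA X).RespectsIso := by
    rw [← (h.isModelStructure X).rlp_llp_trivialFib]
    infer_instance
  rw [inc_map_eq, h.trivialFib_iff]
  exact ⟨Function.bijective_id, ((FA X ⊓ WA X).cancel_right_of_respectsIso _ _).2 hq⟩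

lemma fib_inc (h : S.IsFibredModel WA FA W Fib) {F G : A X} (q : F ⟶ G)
    (hq : FA X q) : Fib ((S.inc X).map q) := by
  have : (FA X).RespectsIso := by
    rw [← (h.isModelStructure X).rlp_llp_fib]
    infer_instance
  rw [inc_map_eq, h.fib_iff]
  exact ((FA X).cancel_right_of_respectsIso _ _).2 hq

lemma hasFactorization_trivialFib (h : S.IsFibredModel WA FA W Fib) :
    (Fib ⊓ W).llp.HasFactorization (Fib ⊓ W) where
  nonempty_mapFactorizationData {e e'} σ := by
    obtain ⟨X, F, rfl⟩ := S.exists_inc_eq e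
    obtain ⟨Y, G, rfl⟩ := S.exists_inc_eq e'
    obtain ⟨f, hf⟩ := IsOver.exists_base σ
    obtain ⟨θ, rfl⟩ := hf.exists_opcart_fiber
    have := (h.isModelStructure Y).hasFactorization_trivialFib
    have d := MorphismProperty.factorizationData (FA Y ⊓ WA Y).llp (FA Y ⊓ WA Y) θ
    exact ⟨⟨_, S.opcart f F ≫ (S.inc Y).map d.i, (S.inc Y).map d.p, by
      rw [Category.assoc, ← Functor.map_comp, d.fac],
      (Fib ⊓ W).llp.comp_mem _ _ (h.llp_trivialFib_opcart f F) (h.llp_trivialFib_inc _ d.hi),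
      h.trivialFib_inc _ d.hp⟩⟩

/-- A map with the left lifting property against the fibrations lifts against the cartesian map
over its function, so that it lies over a bijection. -/
lemma llp_fib_le (h : S.IsFibredModel WA FA W Fib) : Fib.llp ≤ W := by
  intro e e' σ hσ
  obtain ⟨X, F, rfl⟩ := S.exists_inc_eq e
  obtain ⟨Y, G, rfl⟩ := S.exists_inc_eq e'
  obtain ⟨f, φ, rfl⟩ := S.exists_eq σ
  have hσ' : S.IsOver ((S.inc X).map φ ≫ S.cart f G) f := ⟨_, rfl⟩
  -- the cartesian map is a fibration, since its component in the fibre is an identity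
  have hc : Fib (S.cart f G) := by
    have : S.cart f G = (S.inc X).map (𝟙 _) ≫ S.cart f G := by
      rw [CategoryTheory.Functor.map_id, Category.id_comp]
    rw [this, h.fib_iff, ← (h.isModelStructure X).rlp_llp_fib]
    intro _ _ _ _
    infer_instance
  have sq : CommSq ((S.inc X).map φ) ((S.inc X).map φ ≫ S.cart f G) (S.cart f G) (𝟙 _) :=
    ⟨by rw [Category.comp_id]⟩
  have := hσ _ hc
  -- the function `k` under the lift is inverse to `f`, and the lift is inverse to the cartesian map
  obtain ⟨k, hk⟩ := IsOver.exists_base sq.lift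
  have h₁ : k ∘ f = id := (hσ'.comp hk).unique (sq.fac_left.symm ▸ IsOver.of_fiber φ)
  have h₂ : f ∘ k = id :=
    (hk.comp (IsOver.of_cart f G)).unique (sq.fac_right.symm ▸ IsOver.id G)
  have h₃ : S.cart f G ≫ sq.lift = 𝟙 _ := by
    refine IsOver.cart_ext (g := f) (f := id) (h₁ ▸ (IsOver.of_cart f G).comp hk)
      (IsOver.id _) ?_
    rw [Category.assoc, sq.fac_right, Category.comp_id, Category.id_comp]
  rw [h.weq_iff]
  refine ⟨Function.bijective_iff_has_inverse.2 ⟨k, congrFun h₁, congrFun h₂⟩,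
    (h.isModelStructure X).llp_fib_le _ fun B C q hq => ⟨fun {a b} sq₂ => ?_⟩⟩
  have hφ : Fib.llp ((S.inc X).map φ) := by
    have : IsIso (S.cart f G) := ⟨sq.lift, h₃, sq.fac_right⟩
    exact (Fib.llp.cancel_right_of_respectsIso _ (S.cart f G)).1 hσ
  have := hφ _ (h.fib_inc q hq)
  have sq₃ : CommSq ((S.inc X).map a) ((S.inc X).map φ) ((S.inc X).map q) ((S.inc X).map b) :=
    sq₂.map (S.inc X)
  obtain ⟨g, hg⟩ := IsOver.exists_base sq₃.lift
  obtain rfl : g = id := (hg.comp (IsOver.of_fiber q)).unique (sq₃.fac_right.symm ▸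
    IsOver.of_fiber b)
  obtain ⟨d, hd⟩ := hg.exists_fiber
  refine ⟨⟨⟨d, inc_injective (S := S) ?_, inc_injective (S := S) ?_⟩⟩⟩
  · rw [Functor.map_comp, ← hd, sq₃.fac_left]
  · rw [Functor.map_comp, ← hd, sq₃.fac_right]

/-- The cofibrations are the maps whose adjoint is a cofibration of the fibre. -/
lemma llp_trivialFib_iff (h : S.IsFibredModel WA FA W Fib) {F : A X} {G : A Y} (f : X → Y)
    (φ : F ⟶ (S.pull f).obj G) : (Fib ⊓ W).llp ((S.inc X).map φ ≫ S.cart f G) ↔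
      (FA Y ⊓ WA Y).llp
        (((Adjunction.ofIsRightAdjoint (S.pull f)).homEquiv F G).symm φ) := by
  rw [← IsOver.opcart_comp_homEquiv_symm]
  refine ⟨fun hσ B C q hq => ⟨fun {a b} sq => ?_⟩, fun hφ => (Fib ⊓ W).llp.comp_mem _ _
    (h.llp_trivialFib_opcart f F) (h.llp_trivialFib_inc _ hφ)⟩
  have := hσ _ (h.trivialFib_inc q hq)
  have sq' : CommSq (S.opcart f F ≫ (S.inc Y).map a) (S.opcart f F ≫ (S.inc Y).map
      (((Adjunction.ofIsRightAdjoint (S.pull f)).homEquiv F G).symm φ)) ((S.inc Y).map q)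
      ((S.inc Y).map b) := ⟨by
    rw [Category.assoc, Category.assoc, ← Functor.map_comp, ← Functor.map_comp, sq.w]⟩
  obtain ⟨g, hg⟩ := IsOver.exists_base sq'.lift
  obtain rfl : g = id := (hg.comp (IsOver.of_fiber q)).unique (sq'.fac_right.symm ▸
    IsOver.of_fiber b)
  obtain ⟨d, hd⟩ := hg.exists_fiber
  refine ⟨⟨⟨d, inc_injective (S := S) (IsOver.opcart_ext (IsOver.of_fiber _)
    (IsOver.of_fiber _) ?_), inc_injective (S := S) ?_⟩⟩⟩
  · rw [Functor.map_comp, ← hd, ← Category.assoc, sq'.fac_left]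
  · rw [Functor.map_comp, ← hd, sq'.fac_right]

/-- The model structure on a category fibred over sets. -/
theorem isModelStructure_total (h : S.IsFibredModel WA FA W Fib) :
    IsModelStructure W (Fib ⊓ W).llp Fib := by
  have h₁ (X) := (h.isModelStructure X).hasLimits
  have h₂ (X) := (h.isModelStructure X).hasColimits
  have := S.hasLimits
  have := S.hasColimits
  have := h.hasTwoOutOfThreeProperty
  have := h.hasFactorization_fib
  have := h.hasFactorization_trivialFib
  have : Fib.IsStableUnderRetracts := by
    rw [h.fib_eq_rlp]
    infer_instance
  have : (Fib ⊓ W).IsStableUnderRetracts := by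
    rw [h.trivialFib_eq_rlp]
    infer_instance
  exact .of_factorizations _ _ h.llp_fib_le

end IsFibredModel

end Model

end SetFibration

/-! ### The model structures on `𝒦_Set` and `M_𝒮(Set)` -/

variable (M : Type u) [Category.{v} M]

namespace KSet

variable {M}

/-- The cartesian map over a function. -/
def cart {X Y : Type v} (f : X → Y) (G : KDiag M Y) :
    (kFiberInclusion M X).obj ((kPullback M f).obj G) ⟶ (kFiberInclusion M Y).obj G :=
  Hom.mk f (𝟙 _)

lemma map_comp_cart {X Y : Type v} {f : X → Y} {F : KDiag M X} {G : KDiag M Y}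
    (φ : F ⟶ (kPullback M f).obj G) :
    (kFiberInclusion M X).map φ ≫ cart f G = Hom.mk f φ := by
  change Hom.mk _ _ = Hom.mk _ _
  congr 1
  exact Category.comp_id φ

end KSet

/-- `𝒦_Set` as a category fibred over sets. -/
abbrev kSetFibration : SetFibration (KSet M) (KDiag M) where
  inc := kFiberInclusion M
  exists_inc_eq e := ⟨e.base, e.fiber, rfl⟩
  pull f := kPullback M f
  cart := KSet.cart
  cart_naturality f G G' ψ := by
    rw [KSet.map_comp_cart]
    change _ = KSet.Hom.mk _ _
    congr 1
    exact (Category.id_comp _).symm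
  exists_eq σ := ⟨KSet.Hom.base σ, KSet.Hom.fiber σ, (KSet.map_comp_cart _).symm⟩
  base_eq φ ψ h := by
    rw [KSet.map_comp_cart, KSet.map_comp_cart] at h
    exact congrArg KSet.Hom.base h
  eq_of_cart h := by
    rw [KSet.map_comp_cart, KSet.map_comp_cart] at h
    injection h
  pullId F := Iso.refl F
  pullId_cart {X} F := KSet.map_comp_cart (f := (id : X → X)) (F := F) (G := F) (𝟙 F)
  pullComp f g H := Iso.refl ((kPullback M f).obj ((kPullback M g).obj H))
  pullComp_cart f g H := by
    refine (KSet.map_comp_cart (f := g ∘ f) (F := (kPullback M f).obj ((kPullback M g).obj H))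
      (G := H) (𝟙 _)).trans ?_
    change _ = KSet.Hom.mk _ _
    congr 1
    exact (Category.id_comp _).symm

lemma kSetFibration_map_comp_cart {X Y : Type v} {f : X → Y} {F : KDiag M X} {G : KDiag M Y}
    (φ : F ⟶ ((kSetFibration M).pull f).obj G) :
    ((kSetFibration M).inc X).map φ ≫ (kSetFibration M).cart f G = KSet.Hom.mk f φ :=
  KSet.map_comp_cart φ

instance [HasColimits M] {X Y : Type v} (f : X → Y) :
    ((kSetFibration M).pull f).IsRightAdjoint :=
  inferInstanceAs (kPullback M f).IsRightAdjoint

section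

variable [MonoidalCategory M]

namespace MSet

variable {M}

/-- The cartesian map over a function. -/
def cart {X Y : Type v} (f : X → Y) (G : PreCat M Y) :
    (fiberInclusion M X).obj ((pullback M f).obj G) ⟶ (fiberInclusion M Y).obj G :=
  Hom.mk f (𝟙 _)

lemma map_comp_cart {X Y : Type v} {f : X → Y} {F : PreCat M X} {G : PreCat M Y}
    (φ : F ⟶ (pullback M f).obj G) :
    (fiberInclusion M X).map φ ≫ cart f G = Hom.mk f φ := by
  change Hom.mk _ _ = Hom.mk _ _
  congr 1
  exact Category.comp_id φ

end MSet

/-- `M_𝒮(Set)` as a category fibred over sets. -/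
abbrev setFibration : SetFibration (MSet M) (PreCat M) where
  inc := fiberInclusion M
  exists_inc_eq e := ⟨e.base, e.fiber, rfl⟩
  pull f := pullback M f
  cart := MSet.cart
  cart_naturality f G G' ψ := by
    rw [MSet.map_comp_cart]
    change _ = MSet.Hom.mk _ _
    congr 1
    exact (Category.id_comp _).symm
  exists_eq σ := ⟨MSet.Hom.base σ, MSet.Hom.fiber σ, (MSet.map_comp_cart _).symm⟩
  base_eq φ ψ h := by
    rw [MSet.map_comp_cart, MSet.map_comp_cart] at h
    exact congrArg MSet.Hom.base h
  eq_of_cart h := by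
    rw [MSet.map_comp_cart, MSet.map_comp_cart] at h
    injection h
  pullId F := Iso.refl F
  pullId_cart {X} F := MSet.map_comp_cart (f := (id : X → X)) (F := F) (G := F) (𝟙 F)
  pullComp f g H := Iso.refl ((pullback M f).obj ((pullback M g).obj H))
  pullComp_cart f g H := by
    refine (MSet.map_comp_cart (f := g ∘ f) (F := (pullback M f).obj ((pullback M g).obj H))
      (G := H) (𝟙 _)).trans ?_
    change _ = MSet.Hom.mk _ _
    congr 1
    exact (Category.id_comp _).symm

lemma setFibration_map_comp_cart {X Y : Type v} {f : X → Y} {F : PreCat M X} {G : PreCat M Y}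
    (φ : F ⟶ ((setFibration M).pull f).obj G) :
    ((setFibration M).inc X).map φ ≫ (setFibration M).cart f G = MSet.Hom.mk f φ :=
  MSet.map_comp_cart φ

end

section

variable [ModelCategory M] [HasLimits M] [HasColimits M]

lemma isFibredModel_kSet : (kSetFibration M).IsFibredModel (kWeq M) (kFib M) (kSetWeq M)
    (kSetFib M) where
  fib_iff f φ := by
    rw [kSetFibration_map_comp_cart]
    rfl
  weq_iff f φ := by
    rw [kSetFibration_map_comp_cart]
    rfl
  fib_pull f φ h s := h ((Chain.map f).op.obj s)
  weq_pull f φ h s := h ((Chain.map f).op.obj s)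
  isModelStructure X := isModelStructure_kDiag M X

/-- The fibred projective model structure on `𝒦_Set`. -/
theorem isModelStructure_kSet [∀ {X Y : Type v} (f : X → Y), (kPullback M f).IsRightAdjoint] :
    IsModelStructure (kSetWeq M) (kSetCof M) (kSetFib M) := by
  have e : kSetCof M = (kSetFib M ⊓ kSetWeq M).llp := by
    ext F G σ
    have := (isFibredModel_kSet M).llp_trivialFib_iff (F := F.fiber) (G := G.fiber)
      (KSet.Hom.base σ) (KSet.Hom.fiber σ)
    rw [kSetFibration_map_comp_cart] at this
    exact this.symm
  rw [e]
  exact (isFibredModel_kSet M).isModelStructure_total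

end

section

variable [MonoidalCategory M] [SymmetricCategory M] [MonoidalClosed M] [ModelCategory M]
  [HasLimits M] [HasColimits M]

instance {X Y : Type v} (f : X → Y) : ((setFibration M).pull f).IsRightAdjoint :=
  inferInstanceAs (pullback M f).IsRightAdjoint

variable {M}

lemma isFibredModel_set (hM : IsMonoidalModelCategory M) (hcof : ∀ A : M, IsCofibrant A) :
    (setFibration M).IsFibredModel (weq M) (fib M) (setWeq M) (setFib M) where
  fib_iff f φ := by
    rw [setFibration_map_comp_cart]
    rfl
  weq_iff f φ := by
    rw [setFibration_map_comp_cart]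
    rfl
  fib_pull f φ h s := h ((Chain.map f).op.obj s)
  weq_pull f φ h s := h ((Chain.map f).op.obj s)
  isModelStructure X := isModelStructure_preCat hM hcof

/-- The fibred projective model structure on `M_𝒮(Set)`. -/
theorem isModelStructure_set (hM : IsMonoidalModelCategory M) (hcof : ∀ A : M, IsCofibrant A)
    [∀ {X Y : Type v} (f : X → Y), (pullback M f).IsRightAdjoint] :
    IsModelStructure (setWeq M) (setCof M) (setFib M) := by
  have e : setCof M = (setFib M ⊓ setWeq M).llp := by
    ext F G σ
    have := (isFibredModel_set hM hcof).llp_trivialFib_iff (F := F.fiber) (G := G.fiber)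
      (MSet.Hom.base σ) (MSet.Hom.fiber σ)
    rw [setFibration_map_comp_cart] at this
    exact this.symm
  rw [e]
  exact (isFibredModel_set hM hcof).isModelStructure_total

end

/-! ### The generating sets -/

section Small

variable {C : Type*} [Category C] {D : Type*} [Category D]

lemma isSmall_strictMap (I : MorphismProperty C) [MorphismProperty.IsSmall.{v} I] (F : C ⥤ D) :
    MorphismProperty.IsSmall.{v} (I.strictMap F) := by
  obtain ⟨ι, A, B, f, rfl⟩ := (MorphismProperty.isSmall_iff_eq_ofHoms.{v} I).1 inferInstance
  have : (MorphismProperty.ofHoms f).strictMap F = .ofHoms fun i => F.map (f i) := by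
    ext X Y g
    constructor
    · rintro ⟨⟨i⟩⟩
      exact ⟨i⟩
    · rintro ⟨i⟩
      exact ⟨⟨i⟩⟩
  rw [this]
  infer_instance

lemma isSmall_sup (I J : MorphismProperty C) [MorphismProperty.IsSmall.{v} I]
    [MorphismProperty.IsSmall.{v} J] : MorphismProperty.IsSmall.{v} (I ⊔ J) := by
  have : I ⊔ J = ⨆ b : Bool, cond b I J := by rw [iSup_bool_eq]; rfl
  have (b : Bool) : MorphismProperty.IsSmall.{v} (cond b I J) := by
    cases b <;> assumption
  simp only [*]
  infer_instance

lemma rlp_sup (I J : MorphismProperty C) : (I ⊔ J).rlp = I.rlp ⊓ J.rlp := by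
  ext X Y f
  exact ⟨fun h => ⟨fun _ _ g hg => h g (Or.inl hg), fun _ _ g hg => h g (Or.inr hg)⟩,
    fun h _ _ g hg => hg.elim (h.1 g) (h.2 g)⟩

lemma rlp_iSup_iff {ι : Type*} (I : ι → MorphismProperty C) {X Y : C} (f : X ⟶ Y) :
    (⨆ i, I i).rlp f ↔ ∀ i, (I i).rlp f := by
  refine ⟨fun h i _ _ g hg => h g ((MorphismProperty.iSup_iff _ _).2 ⟨i, hg⟩), fun h _ _ g hg => ?_⟩
  obtain ⟨i, hi⟩ := (MorphismProperty.iSup_iff _ _).1 hg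
  exact h i g hi

end Small

variable (M : Type u) [Category.{v} M] [HasColimits M]

section

variable {M}

lemma hasLiftingProperty_kFiberInclusion_iff {Z : Type v} {B C : KDiag M Z} (j : B ⟶ C)
    {F G : KSet M} (σ : F ⟶ G) : HasLiftingProperty ((kFiberInclusion M Z).map j) σ ↔
      ∀ g : Z → F.base, HasLiftingProperty j ((kPullback M g).map (KSet.Hom.fiber σ)) := by
  have h := SetFibration.hasLiftingProperty_inc_iff (S := kSetFibration M) j (F := F.fiber)
    (G := G.fiber) (f := KSet.Hom.base σ) (KSet.Hom.fiber σ)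
  rwa [kSetFibration_map_comp_cart] at h

/-- The maps with the right lifting property against the `δ(s_n, q)` are detected levelwise, since
every chain is the image of a chain `s_n`. -/
lemma rlp_deltaGen_iff (I : MorphismProperty M) {F G : KSet M} (σ : F ⟶ G) :
    (deltaGen M I).rlp σ ↔ ∀ s : (Chain F.base)ᵒᵖ, I.rlp ((KSet.Hom.fiber σ).app s) := by
  have key (n : ℕ) (hn : 0 < n) {A B : M} (q : A ⟶ B) :
      HasLiftingProperty ((delta M n hn ⋙ kFiberInclusion M _).map q) σ ↔
        ∀ g : ULift.{v} (Fin (n + 1)) → F.base,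
          HasLiftingProperty q ((KSet.Hom.fiber σ).app (op ((Chain.map g).obj (.std n hn)))) :=
    (hasLiftingProperty_kFiberInclusion_iff _ σ).trans (forall_congr' fun g =>
      (evaluationAdjunctionRight M (op (Chain.std n hn))).hasLiftingProperty_iff q
        ((kPullback M g).map (KSet.Hom.fiber σ)))
  rw [deltaGen, rlp_iSup_iff]
  refine ⟨fun h s A B q hq => ?_, fun h n => ?_⟩
  · exact (key s.unop.deg s.unop.deg_pos q).1 (h ⟨_, s.unop.deg_pos⟩ _ ⟨hq⟩)
      (fun i => s.unop.pt i.down)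
  · rintro _ _ _ ⟨hq⟩
    exact (key _ n.2 _).2 fun g => h _ _ hq

lemma isSmall_deltaGen (I : MorphismProperty M) [MorphismProperty.IsSmall.{v} I] :
    MorphismProperty.IsSmall.{v} (deltaGen M I) :=
  have (n : { n : ℕ // 0 < n }) := isSmall_strictMap I (delta M n.1 n.2 ⋙ kFiberInclusion M _)
  MorphismProperty.isSmall_iSup _

end

instance : MorphismProperty.IsSmall.{v} (kObjGen M) := by
  let φ (b : Bool) : (kObjGen M).toSet :=
    cond b ⟨Arrow.mk _, kObjGen.zero⟩ ⟨Arrow.mk _, kObjGen.two⟩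
  have hφ : Function.Surjective φ := by
    rintro ⟨⟨_, _, _⟩, _ | _⟩
    · exact ⟨true, rfl⟩
    · exact ⟨false, rfl⟩
  exact ⟨small_of_surjective hφ⟩

/-- Lifting against `∅ ⟶ {∗}` is surjectivity on objects, and lifting against `{0, 1} ⟶ {∗}` is
injectivity. -/
lemma rlp_kObjGen_iff {F G : KSet M} (σ : F ⟶ G) :
    (kObjGen M).rlp σ ↔ Function.Bijective (KSet.Hom.base σ) := by
  have h : (kSetFibration M).IsOver (F := F.fiber) (G := G.fiber) σ (KSet.Hom.base σ) :=
    ⟨KSet.Hom.fiber σ, (kSetFibration_map_comp_cart (M := M) (KSet.Hom.fiber σ)).symm⟩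
  refine ⟨fun hσ => ⟨?_, ?_⟩, fun hσ => ?_⟩
  · exact h.injective initialIsInitial initialIsInitial (hσ _ kObjGen.two)
  · exact h.surjective initialIsInitial initialIsInitial (hσ _ kObjGen.zero)
  · rintro _ _ _ (_ | _) <;>
    exact h.hasLiftingProperty_of_isInitial hσ initialIsInitial initialIsInitial _

/-- The generating sets of the model structure on `𝒦_Set`. -/
theorem areGenerating_kSet [ModelCategory M] {I J : MorphismProperty M}
    (h : AreGenerating (weakEquivalences M) (fibrations M) I J) :
    AreGenerating (kSetWeq M) (kSetFib M) (deltaGen M I ⊔ kObjGen M) (deltaGen M J) where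
  isSmall_I :=
    have := h.isSmall_I
    have := isSmall_deltaGen I
    isSmall_sup _ _
  isSmall_J :=
    have := h.isSmall_J
    isSmall_deltaGen J
  trivialFib_eq := by
    ext F G σ
    rw [rlp_sup]
    change _ ∧ _ ∧ _ ↔ _ ∧ _
    rw [rlp_deltaGen_iff, rlp_kObjGen_iff, ← h.trivialFib_eq, and_left_comm, and_comm]
    exact and_congr_left' forall_and.symm
  fib_eq := by
    ext F G σ
    rw [rlp_deltaGen_iff, ← h.fib_eq]
    rfl

section

variable [MonoidalCategory M] [∀ X : Type v, (forgetLax M X).IsRightAdjoint]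

variable {M} in
/-- By adjunction, lifting against the maps `h(C_n; q)` is lifting of the underlying map of diagrams
against the maps `δ(s_n, q)`. -/
lemma rlp_hGen_iff (I : MorphismProperty M) {F G : MSet M} (σ : F ⟶ G) :
    (hGen M I).rlp σ ↔ (deltaGen M I).rlp ((forgetLaxSet M).map σ) := by
  have key (n : ℕ) (hn : 0 < n) {A B : M} (q : A ⟶ B) :
      HasLiftingProperty ((h M n hn).map q) σ ↔
        HasLiftingProperty ((delta M n hn ⋙ kFiberInclusion M _).map q)
          ((forgetLaxSet M).map σ) := by
    have h₁ := SetFibration.hasLiftingProperty_inc_iff (S := setFibration M)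
      ((free M _).map ((delta M n hn).map q)) (F := F.fiber) (G := G.fiber) (f := MSet.Hom.base σ)
      (MSet.Hom.fiber σ)
    rw [setFibration_map_comp_cart] at h₁
    refine h₁.trans (Iff.trans (forall_congr' fun g => ?_)
      (hasLiftingProperty_kFiberInclusion_iff ((delta M n hn).map q) ((forgetLaxSet M).map σ)).symm)
    exact (Adjunction.ofIsRightAdjoint (forgetLax M _)).hasLiftingProperty_iff
      ((delta M n hn).map q) ((pullback M g).map (MSet.Hom.fiber σ))
  rw [hGen, deltaGen, rlp_iSup_iff, rlp_iSup_iff]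
  refine forall_congr' fun n => ⟨fun h => ?_, fun h => ?_⟩
  · rintro _ _ _ ⟨hq⟩
    exact (key _ n.2 _).1 (h _ ⟨hq⟩)
  · rintro _ _ _ ⟨hq⟩
    exact (key _ n.2 _).2 (h _ ⟨hq⟩)

variable {M} in
lemma isSmall_hGen (I : MorphismProperty M) [MorphismProperty.IsSmall.{v} I] :
    MorphismProperty.IsSmall.{v} (hGen M I) :=
  have (n : { n : ℕ // 0 < n }) := isSmall_strictMap I (h M n.1 n.2)
  MorphismProperty.isSmall_iSup _

instance : MorphismProperty.IsSmall.{v} (objGen M) := by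
  let φ (b : Bool) : (objGen M).toSet :=
    cond b ⟨Arrow.mk _, objGen.zero⟩ ⟨Arrow.mk _, objGen.two⟩
  have hφ : Function.Surjective φ := by
    rintro ⟨⟨_, _, _⟩, _ | _⟩
    · exact ⟨true, rfl⟩
    · exact ⟨false, rfl⟩
  exact ⟨small_of_surjective hφ⟩

lemma rlp_objGen_iff {F G : MSet M} (σ : F ⟶ G) :
    (objGen M).rlp σ ↔ Function.Bijective (MSet.Hom.base σ) := by
  have h : (setFibration M).IsOver (F := F.fiber) (G := G.fiber) σ (MSet.Hom.base σ) :=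
    ⟨MSet.Hom.fiber σ, (setFibration_map_comp_cart (M := M) (MSet.Hom.fiber σ)).symm⟩
  have hI (X : Type v) : IsInitial ((free M X).obj (⊥_ (KDiag M X))) :=
    initialIsInitial.isInitialObj (free M X)
  refine ⟨fun hσ => ⟨?_, ?_⟩, fun hσ => ?_⟩
  · exact h.injective (hI _) (hI _) (hσ _ objGen.two)
  · exact h.surjective (hI _) (hI _) (hσ _ objGen.zero)
  · rintro _ _ _ (_ | _) <;>
    exact h.hasLiftingProperty_of_isInitial hσ (hI _) (hI _) _

/-- The generating sets of the model structure on `M_𝒮(Set)`. -/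
theorem areGenerating_set [ModelCategory M] {I J : MorphismProperty M}
    (h : AreGenerating (weakEquivalences M) (fibrations M) I J) :
    AreGenerating (setWeq M) (setFib M) (hGen M I ⊔ objGen M) (hGen M J) where
  isSmall_I :=
    have := h.isSmall_I
    have := isSmall_hGen I
    isSmall_sup _ _
  isSmall_J :=
    have := h.isSmall_J
    isSmall_hGen J
  trivialFib_eq := by
    ext F G σ
    rw [rlp_sup]
    change _ ∧ _ ∧ _ ↔ _ ∧ _
    rw [rlp_hGen_iff, rlp_deltaGen_iff, rlp_objGen_iff, ← h.trivialFib_eq, and_left_comm,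
      and_comm]
    exact and_congr_left' forall_and.symm
  fib_eq := by
    ext F G σ
    rw [rlp_hGen_iff, rlp_deltaGen_iff, ← h.fib_eq]
    rfl

end

/-! ### Colimits of diagrams of varying sets as left Kan extensions -/

namespace Chain

variable {X Y Z : Type v}

/-- The positions kept by a 2-morphism to the image of a chain. -/
def posOver {f : X → Y} {w : Chain X} {w' : Chain Y} (e : w' ⟶ (map f).obj w) :
    Fin (w.deg + 1) → Fin (w'.deg + 1) :=
  Hom.pos (t := w') (s := (map f).obj w) e

lemma pt_posOver {f : X → Y} {w : Chain X} {w' : Chain Y} (e : w' ⟶ (map f).obj w)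
    (i : Fin (w.deg + 1)) : w'.pt (posOver e i) = f (w.pt i) :=
  Hom.pt_pos (t := w') (s := (map f).obj w) e i

lemma hom_over_ext {f : X → Y} {w : Chain X} {w' : Chain Y} {e e' : w' ⟶ (map f).obj w}
    (h : ∀ i, posOver e i = posOver e' i) : e = e' :=
  Hom.ext (funext h)

/-- A chain as a 2-morphism to its image under the identity. -/
def idOver {f : X → X} (h : f = id) (w : Chain X) : w ⟶ (map f).obj w :=
  h ▸ 𝟙 w

lemma posOver_idOver {f : X → X} (h : f = id) (w : Chain X) (i : Fin (w.deg + 1)) :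
    posOver (idOver h w) i = i := by
  subst h
  rfl

/-- The composition of 2-morphisms over functions. -/
def compOver {f : X → Y} {g : Y → Z} {k : X → Z} (h : g ∘ f = k) {w : Chain X} {w' : Chain Y}
    {w'' : Chain Z} (e : w' ⟶ (map f).obj w) (e' : w'' ⟶ (map g).obj w') :
    w'' ⟶ (map k).obj w :=
  h ▸ (e' ≫ (map g).map e)

lemma posOver_compOver {f : X → Y} {g : Y → Z} {k : X → Z} (h : g ∘ f = k) {w : Chain X}
    {w' : Chain Y} {w'' : Chain Z} (e : w' ⟶ (map f).obj w) (e' : w'' ⟶ (map g).obj w')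
    (i : Fin (w.deg + 1)) : posOver (compOver h e e') i = posOver e' (posOver e i) := by
  subst h
  rfl

/-- A 2-morphism to the image of a chain, given by its positions. -/
def mkOver {f : X → Y} {w : Chain X} {w' : Chain Y} (p : Fin (w.deg + 1) → Fin (w'.deg + 1))
    (hp : StrictMono p) (h₀ : p 0 = 0) (h₁ : p (Fin.last _) = Fin.last _)
    (h : ∀ i, w'.pt (p i) = f (w.pt i)) : w' ⟶ (map f).obj w :=
  Hom.mk (t := w') (s := (map f).obj w) p hp h₀ h₁ h

end Chain

variable {M : Type u} [Category.{v} M]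

namespace KSet

variable {F G H : KSet M}

/-- The map `F w ⟶ G w'` given by a map `σ : F ⟶ G` and a 2-morphism from `w'` to the image
of `w`. -/
def eval (σ : F ⟶ G) {w : Chain F.base} {w' : Chain G.base}
    (e : w' ⟶ (Chain.map (Hom.base σ)).obj w) : F.fiber.obj (op w) ⟶ G.fiber.obj (op w') :=
  (Hom.fiber σ).app (op w) ≫ G.fiber.map e.op

lemma eval_congr {σ τ : F ⟶ G} (h : σ = τ) {w : Chain F.base} {w' : Chain G.base}
    {e : w' ⟶ (Chain.map (Hom.base σ)).obj w} {e' : w' ⟶ (Chain.map (Hom.base τ)).obj w}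
    (h' : ∀ i, Chain.posOver e i = Chain.posOver e' i) : eval σ e = eval τ e' := by
  subst h
  obtain rfl : e = e' := Chain.hom_over_ext h'
  rfl

lemma eval_eq_app (σ : F ⟶ G) {w : Chain F.base}
    (e : (Chain.map (Hom.base σ)).obj w ⟶ (Chain.map (Hom.base σ)).obj w) :
    eval σ e = (Hom.fiber σ).app (op w) := by
  obtain rfl := Chain.eq_id e
  refine (congrArg ((Hom.fiber σ).app (op w) ≫ ·) ?_).trans (Category.comp_id _)
  exact G.fiber.map_id _

lemma eval_eq_id {σ : F ⟶ F} (h : σ = 𝟙 F) {w : Chain F.base}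
    (e : w ⟶ (Chain.map (Hom.base σ)).obj w) : eval σ e = 𝟙 _ := by
  subst h
  exact eval_eq_app (𝟙 F) e

lemma eval_comp {σ : F ⟶ G} {τ : G ⟶ H} {ρ : F ⟶ H} (h : σ ≫ τ = ρ) {w : Chain F.base}
    {w' : Chain G.base} {w'' : Chain H.base} {e : w' ⟶ (Chain.map (Hom.base σ)).obj w}
    {e' : w'' ⟶ (Chain.map (Hom.base τ)).obj w'} {e'' : w'' ⟶ (Chain.map (Hom.base ρ)).obj w}
    (h' : ∀ i, Chain.posOver e'' i = Chain.posOver e' (Chain.posOver e i)) :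
    eval σ e ≫ eval τ e' = eval ρ e'' := by
  subst h
  have h'' : e' ≫ (Chain.map (Hom.base τ)).map e = e'' :=
    Chain.hom_over_ext (f := Hom.base τ ∘ Hom.base σ) fun i => (h' i).symm
  have hn : G.fiber.map e.op ≫ (Hom.fiber τ).app (op w') =
    (Hom.fiber τ).app (op ((Chain.map (Hom.base σ)).obj w)) ≫
      H.fiber.map ((Chain.map (Hom.base τ)).map e).op := (Hom.fiber τ).naturality e.op
  have hc : eval σ e ≫ eval τ e' = ((Hom.fiber σ).app (op w) ≫
      (Hom.fiber τ).app (op ((Chain.map (Hom.base σ)).obj w))) ≫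
        H.fiber.map (e' ≫ (Chain.map (Hom.base τ)).map e).op := by
    rw [eval, eval, Category.assoc, ← Category.assoc (G.fiber.map _), hn, op_comp,
      Functor.map_comp, Category.assoc, Category.assoc]
  exact hc.trans (congrArg (fun z => ((Hom.fiber σ).app (op w) ≫
      (Hom.fiber τ).app (op ((Chain.map (Hom.base σ)).obj w))) ≫ H.fiber.map z.op) h'')

lemma eval_map (σ : F ⟶ G) {w : Chain F.base} {w' w'' : Chain G.base}
    (e : w' ⟶ (Chain.map (Hom.base σ)).obj w) (a : w'' ⟶ w') :
    eval σ e ≫ G.fiber.map a.op = eval σ (a ≫ e) := by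
  rw [eval, eval, Category.assoc, ← Functor.map_comp, ← op_comp]

variable (M) in
/-- The functor that sends an object to its set of objects. -/
def baseFunctor : KSet M ⥤ Type v where
  obj F := F.base
  map σ := TypeCat.ofHom (Hom.base σ)
  map_id _ := rfl
  map_comp _ _ := rfl

variable (M) in
/-- The right adjoint of the base functor: all values are terminal. -/
noncomputable def codisc [HasTerminal M] : Type v ⥤ KSet M where
  obj X := ⟨X, (Functor.const _).obj (⊤_ M)⟩
  map f := Hom.mk f (𝟙 _)
  map_id _ := rfl
  map_comp f g := by
    change _ = Hom.mk _ _
    congr 1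
    ext s
    exact terminal.hom_ext _ _

instance [HasTerminal M] : (baseFunctor M).IsLeftAdjoint :=
  (Adjunction.mkOfHomEquiv (F := baseFunctor M) (G := codisc M)
    { homEquiv := fun F X =>
        { toFun := fun f => Hom.mk f
            { app := fun s => terminal.from _
              naturality := fun _ _ _ => terminal.hom_ext _ _ }
          invFun := fun σ => TypeCat.ofHom (Hom.base σ)
          left_inv := fun f => rfl
          right_inv := fun σ => by
            change Hom.mk _ _ = Hom.mk (Hom.base σ) (Hom.fiber σ)
            congr 1
            ext s
            exact terminal.hom_ext _ _ }
      homEquiv_naturality_left_symm := fun _ _ => rfl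
      homEquiv_naturality_right := fun f g => by
        change Hom.mk _ _ = Hom.mk _ _
        congr 1
        ext s
        exact terminal.hom_ext _ _ }).isLeftAdjoint

end KSet

section

variable {J : Type v} [SmallCategory J]

/-- The total category of the chains on the sets of objects in a diagram `K`: a map consists of a
map `g` of the index category and a 2-morphism to the image of the source under `K g`. -/
structure Tot (K : J ⥤ KSet M) : Type v where
  idx : J
  chain : Chain (K.obj idx).base

namespace Tot

variable {K : J ⥤ KSet M}

/-- The maps of the total category. -/
structure Hom (a b : Tot K) : Type v where
  map : a.idx ⟶ b.idx
  chain : b.chain ⟶ (Chain.map (KSet.Hom.base (K.map map))).obj a.chain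

lemma Hom.ext {a b : Tot K} {f g : Hom a b} (h : f.map = g.map)
    (h' : ∀ i, Chain.posOver f.chain i = Chain.posOver g.chain i) : f = g := by
  obtain ⟨f, c⟩ := f
  obtain ⟨g, d⟩ := g
  obtain rfl : f = g := h
  congr 1
  exact Chain.hom_over_ext h'

lemma base_map_id (K : J ⥤ KSet M) (j : J) : KSet.Hom.base (K.map (𝟙 j)) = id := by
  rw [K.map_id]
  rfl

lemma base_map_comp (K : J ⥤ KSet M) {i j k : J} (f : i ⟶ j) (g : j ⟶ k) :
    KSet.Hom.base (K.map g) ∘ KSet.Hom.base (K.map f) = KSet.Hom.base (K.map (f ≫ g)) := by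
  rw [K.map_comp]
  rfl

/-- The legs of a cocone. -/
abbrev leg (c : Cocone K) (j : J) : K.obj j ⟶ c.pt := c.ι.app j

lemma leg_w (c : Cocone K) {j k : J} (f : j ⟶ k) : K.map f ≫ leg c k = leg c j := c.w f

lemma base_w (c : Cocone K) {j k : J} (f : j ⟶ k) :
    KSet.Hom.base (leg c k) ∘ KSet.Hom.base (K.map f) = KSet.Hom.base (leg c j) := by
  rw [← leg_w c f]
  rfl

instance : Category (Tot K) where
  Hom := Hom
  id a := ⟨𝟙 _, Chain.idOver (base_map_id K _) a.chain⟩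
  comp {a b c} f g := ⟨f.map ≫ g.map, Chain.compOver (base_map_comp K _ _) f.chain g.chain⟩
  id_comp f := Hom.ext (Category.id_comp _) fun i => by
    rw [Chain.posOver_compOver, Chain.posOver_idOver]
  comp_id f := Hom.ext (Category.comp_id _) fun i => by
    rw [Chain.posOver_compOver, Chain.posOver_idOver]
  assoc f g h := Hom.ext (Category.assoc _ _ _) fun i => by
    simp only [Chain.posOver_compOver]

/-- The map of indices. -/
def idxMap {a b : Tot K} (f : a ⟶ b) : a.idx ⟶ b.idx := Hom.map f

/-- The 2-morphism of a map of the total category. -/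
def chainMap {a b : Tot K} (f : a ⟶ b) :
    b.chain ⟶ (Chain.map (KSet.Hom.base (K.map (idxMap f)))).obj a.chain := Hom.chain f

/-- Maps of the total category. -/
def homMk {a b : Tot K} (f : a.idx ⟶ b.idx)
    (e : b.chain ⟶ (Chain.map (KSet.Hom.base (K.map f))).obj a.chain) : a ⟶ b := Hom.mk f e

lemma posOver_chainMap_comp {a b c : Tot K} (f : a ⟶ b) (g : b ⟶ c) (i) :
    Chain.posOver (chainMap (f ≫ g)) i =
      Chain.posOver (chainMap g) (Chain.posOver (chainMap f) i) :=
  Chain.posOver_compOver _ _ _ i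

variable (K) in
/-- The values of the diagrams. -/
def val : Tot K ⥤ M where
  obj a := (K.obj a.idx).fiber.obj (op a.chain)
  map f := KSet.eval (K.map (idxMap f)) (chainMap f)
  map_id a := KSet.eval_eq_id (K.map_id a.idx) _
  map_comp f g := (KSet.eval_comp (K.map_comp _ _).symm (posOver_chainMap_comp f g)).symm

variable (c : Cocone K)

/-- The image in the point of a cocone of a map of the total category. -/
def projMap {a b : Tot K} (f : a ⟶ b) :
    (Chain.map (KSet.Hom.base (leg c b.idx))).obj b.chain ⟶
      (Chain.map (KSet.Hom.base (leg c a.idx))).obj a.chain :=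
  Chain.compOver (base_w c (idxMap f)) (chainMap f) (𝟙 _)

lemma posOver_projMap {a b : Tot K} (f : a ⟶ b) (i : Fin (a.chain.deg + 1)) :
    Chain.posOver (f := KSet.Hom.base (leg c a.idx)) (w := a.chain)
      (w' := (Chain.map (KSet.Hom.base (leg c b.idx))).obj b.chain) (projMap c f) i =
      Chain.posOver (chainMap f) i :=
  Chain.posOver_compOver _ _ _ i

/-- The functor that sends a chain of the diagram to its image in the point of a cocone. -/
def proj : Tot K ⥤ (Chain c.pt.base)ᵒᵖ where
  obj a := op ((Chain.map (KSet.Hom.base (leg c a.idx))).obj a.chain)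
  map f := (projMap c f).op
  map_id a := congrArg Quiver.Hom.op (Chain.hom_over_ext fun i =>
    (posOver_projMap c (𝟙 a) i).trans (Chain.posOver_idOver (base_map_id K a.idx) _ i))
  map_comp f g := congrArg Quiver.Hom.op (Chain.hom_over_ext fun i =>
    (posOver_projMap c (f ≫ g) i).trans ((posOver_chainMap_comp f g i).trans
      ((posOver_projMap c g _).symm.trans
        (congrArg (Chain.posOver (projMap c g)) (posOver_projMap c f i).symm))))

/-- The structure maps of a cocone, as a map of diagrams on the total category. -/
def unit : val K ⟶ proj c ⋙ c.pt.fiber where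
  app a := (KSet.Hom.fiber (leg c a.idx)).app (op a.chain)
  naturality a b f := by
    have h := KSet.eval_comp (leg_w c (idxMap f)) (e := chainMap f) (e' := 𝟙 _) (e'' := projMap c f)
      fun i => posOver_projMap c f i
    rw [KSet.eval_eq_app] at h
    exact h

end Tot

end

/-! ### The universal property of the Kan extension -/

variable {M : Type u} [Category.{v} M]

namespace KSet

lemma ext_eval {F G : KSet M} {σ τ : F ⟶ G} (h : Hom.base σ = Hom.base τ)
    (h' : ∀ (w : Chain F.base)
      (e : (Chain.map (Hom.base τ)).obj w ⟶ (Chain.map (Hom.base σ)).obj w),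
      eval σ e = (Hom.fiber τ).app (op w)) : σ = τ := by
  obtain ⟨f, φ⟩ := σ
  obtain ⟨g, ψ⟩ := τ
  obtain rfl : f = g := h
  congr 1
  ext w
  have := h' w.unop (𝟙 _)
  rw [eval_eq_app] at this
  exact this

/-- The map over a function given by a map of diagrams. -/
def homMk {F : KSet M} {Y : Type v} {G : KDiag M Y} (f : F.base → Y)
    (φ : F.fiber ⟶ (kPullback M f).obj G) : F ⟶ ⟨Y, G⟩ := Hom.mk f φ

/-- The map over the identity given by a map of diagrams. -/
def ofFiber {F : KSet M} {G : KDiag M F.base} (φ : F.fiber ⟶ G) : F ⟶ ⟨F.base, G⟩ :=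
  homMk id φ

lemma ofFiber_injective {F : KSet M} {G : KDiag M F.base} {φ ψ : F.fiber ⟶ G}
    (h : ofFiber φ = ofFiber ψ) : φ = ψ := by
  injection h

lemma homMk_injective {F : KSet M} {Y : Type v} {G : KDiag M Y} {f : F.base → Y}
    {φ ψ : F.fiber ⟶ (kPullback M f).obj G} (h : homMk f φ = homMk f ψ) : φ = ψ := by
  injection h

lemma comp_ofFiber {E F : KSet M} {G : KDiag M F.base} (σ : E ⟶ F) (φ : F.fiber ⟶ G) :
    σ ≫ ofFiber φ = homMk (Hom.base σ) (Hom.fiber σ ≫ (kPullback M (Hom.base σ)).map φ) := rfl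

lemma exists_fiber {F : KSet M} {G : KDiag M F.base} (σ : F ⟶ ⟨F.base, G⟩)
    (h : Hom.base σ = id) : ∃ φ : F.fiber ⟶ G, σ = ofFiber φ := by
  obtain ⟨f, φ⟩ := σ
  obtain rfl : f = id := h
  exact ⟨φ, rfl⟩

end KSet

namespace Tot

variable {J : Type v} [SmallCategory J] {K : J ⥤ KSet M} {c : Cocone K}

lemma exists_base_eq [HasTerminal M] (hc : IsColimit c) (x : c.pt.base) :
    ∃ (j : J) (y : (K.obj j).base), KSet.Hom.base (leg c j) y = x :=
  Types.jointly_surjective_of_isColimit (isColimitOfPreserves (KSet.baseFunctor M) hc) x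

lemma exists_base_map_eq [HasTerminal M] [IsFiltered J] (hc : IsColimit c) {j : J}
    (x y : (K.obj j).base) (h : KSet.Hom.base (leg c j) x = KSet.Hom.base (leg c j) y) :
    ∃ (k : J) (g : j ⟶ k), KSet.Hom.base (K.map g) x = KSet.Hom.base (K.map g) y :=
  (Types.FilteredColimit.isColimit_eq_iff'
    (isColimitOfPreserves (KSet.baseFunctor M) hc) x y).1 h

/-- The map of the total category given by a 2-morphism between chains of the same diagram. -/
def vert {j : J} {w w' : Chain (K.obj j).base} (a : w' ⟶ w) :
    (⟨j, w⟩ : Tot K) ⟶ ⟨j, w'⟩ :=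
  homMk (𝟙 j) (a ≫ Chain.idOver (base_map_id K j) w)

lemma val_map_vert {j : J} {w w' : Chain (K.obj j).base} (a : w' ⟶ w) :
    (val K).map (vert a) = (K.obj j).fiber.map a.op := by
  have h := KSet.eval_map (K.map (𝟙 j)) (Chain.idOver (base_map_id K j) w) a
  rw [KSet.eval_eq_id (K.map_id j), Category.id_comp] at h
  exact h.symm

lemma proj_map_vert {j : J} {w w' : Chain (K.obj j).base} (a : w' ⟶ w) :
    (proj c).map (vert a) = ((Chain.map (KSet.Hom.base (leg c j))).map a).op :=
  congrArg Quiver.Hom.op (Chain.hom_over_ext fun i => (posOver_projMap c (vert a) i).trans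
    (congrArg (Chain.Hom.pos a) (Chain.posOver_idOver (base_map_id K j) _ i)))

/-- The map of the total category from a chain to its image. -/
def cart {j k : J} (g : j ⟶ k) (w : Chain (K.obj j).base) :
    (⟨j, w⟩ : Tot K) ⟶ ⟨k, (Chain.map (KSet.Hom.base (K.map g))).obj w⟩ :=
  homMk g (𝟙 _)

lemma val_map_cart {j k : J} (g : j ⟶ k) (w : Chain (K.obj j).base) :
    (val K).map (cart g w) = (KSet.Hom.fiber (K.map g)).app (op w) :=
  KSet.eval_eq_app (K.map g) _

section

variable {G : KDiag M c.pt.base} (β : val K ⟶ proj c ⋙ G)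

/-- The value of a transformation at a chain. -/
def compApp (j : J) (w : Chain (K.obj j).base) : (K.obj j).fiber.obj (op w) ⟶
    G.obj (op ((Chain.map (KSet.Hom.base (leg c j))).obj w)) :=
  β.app ⟨j, w⟩

lemma compApp_vert {j : J} {w w' : Chain (K.obj j).base} (a : w' ⟶ w) :
    (K.obj j).fiber.map a.op ≫ compApp β j w' =
      compApp β j w ≫ G.map ((Chain.map (KSet.Hom.base (leg c j))).map a).op := by
  have h := β.naturality (vert a)
  rw [val_map_vert, Functor.comp_map, proj_map_vert] at h
  exact h

/-- The legs of the cocone given by a map of diagrams on the total category. -/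
def legOf (j : J) : K.obj j ⟶ (⟨c.pt.base, G⟩ : KSet M) :=
  KSet.homMk (KSet.Hom.base (leg c j))
    { app := fun w => compApp β j w.unop
      naturality := fun _ _ a => compApp_vert β a.unop }

lemma map_legOf {i j : J} (g : i ⟶ j) : K.map g ≫ legOf β j = legOf β i := by
  refine KSet.ext_eval (base_w c g) fun w e => ?_
  refine (KSet.eval_comp (σ := K.map g) (τ := legOf β j) rfl (e := 𝟙 _) (e' := e)
    (fun _ => rfl)).symm.trans ?_
  rw [KSet.eval_eq_app]
  have h := β.naturality (cart g w)
  rw [val_map_cart] at h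
  refine (Category.assoc _ _ _).symm.trans ((congrArg (· ≫ G.map e.op) h).trans ?_)
  refine (Category.assoc (β.app ⟨i, w⟩) _ _).trans
    ((congrArg (β.app ⟨i, w⟩ ≫ ·) ?_).trans (Category.comp_id _))
  refine (G.map_comp _ _).symm.trans (Eq.trans (congrArg G.map ?_) (G.map_id _))
  exact congrArg Quiver.Hom.op (Chain.eq_id (e ≫ ((proj c).map (cart g w)).unop))

/-- The cocone given by a map of diagrams on the total category. -/
def coconeOf : Cocone K where
  pt := ⟨c.pt.base, G⟩
  ι :=
    { app := legOf β
      naturality := fun _ _ g => (map_legOf β g).trans (Category.comp_id _).symm }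

lemma unit_comp_iff (φ : c.pt.fiber ⟶ G) :
    unit c ≫ Functor.whiskerLeft (proj c) φ = β ↔
      ∀ j, leg c j ≫ KSet.ofFiber φ = (coconeOf β).ι.app j := by
  refine ⟨fun h j => ?_, fun h => ?_⟩
  · rw [KSet.comp_ofFiber]
    refine congrArg (KSet.homMk (KSet.Hom.base (leg c j))) ?_
    ext w
    exact congrArg (fun γ => NatTrans.app γ (⟨j, w.unop⟩ : Tot K)) h
  · ext a
    have := h a.idx
    rw [KSet.comp_ofFiber] at this
    exact congrArg (fun γ => NatTrans.app γ (op a.chain)) (KSet.homMk_injective this)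

end

/-- The diagram part of a colimit is a left Kan extension from the total category. -/
lemma isLeftKanExtension [HasTerminal M] (hc : IsColimit c) :
    c.pt.fiber.IsLeftKanExtension (unit c) where
  nonempty_isUniversal := by
    have h (E : (proj c).LeftExtension (val K)) : ∃ φ : c.pt.fiber ⟶ E.right,
        unit c ≫ Functor.whiskerLeft (proj c) φ = E.hom := by
      let β : val K ⟶ proj c ⋙ E.right := E.hom
      have hb : KSet.Hom.base (hc.desc (coconeOf β)) = id := funext fun x => by
        obtain ⟨j, y, rfl⟩ := exists_base_eq hc x
        exact congrFun (congrArg KSet.Hom.base (hc.fac (coconeOf β) j)) y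
      obtain ⟨φ, hφ⟩ := KSet.exists_fiber (hc.desc (coconeOf β)) hb
      refine ⟨φ, (unit_comp_iff β φ).2 fun j => ?_⟩
      rw [← hφ]
      exact hc.fac (coconeOf β) j
    choose d hd using h
    refine ⟨IsInitial.ofUniqueHom (fun E => StructuredArrow.homMk (d E) (hd E)) fun E m => ?_⟩
    let β : val K ⟶ proj c ⋙ E.right := E.hom
    refine StructuredArrow.hom_ext _ _ ?_
    have h₁ := (unit_comp_iff β m.right).1 (StructuredArrow.w m)
    have h₂ := (unit_comp_iff β (d E)).1 (hd E)
    have h₃ : KSet.ofFiber m.right = KSet.ofFiber (d E) :=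
      hc.hom_ext fun j => (h₁ j).trans (h₂ j).symm
    exact KSet.ofFiber_injective h₃

/-- The formula for the values of a colimit. -/
noncomputable def isColimitCoconeAt [HasTerminal M] [HasColimits M] (hc : IsColimit c)
    (s : (Chain c.pt.base)ᵒᵖ) :
    IsColimit ((Functor.LeftExtension.mk _ (unit c)).coconeAt s) :=
  have := isLeftKanExtension hc
  Functor.isPointwiseLeftKanExtensionOfIsLeftKanExtension _ (unit c) s

end Tot

/-! ### Filtered colimits of diagrams of varying sets -/

variable {M : Type u} [Category.{v} M] {J : Type v} [SmallCategory J] {K : J ⥤ KSet M}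

namespace Tot

variable {c : Cocone K}

lemma base_map_comp_apply {i j k : J} (f : i ⟶ j) (g : j ⟶ k) (x : (K.obj i).base) :
    KSet.Hom.base (K.map (f ≫ g)) x = KSet.Hom.base (K.map g) (KSet.Hom.base (K.map f) x) :=
  (congrFun (base_map_comp K f g) x).symm

lemma base_leg_map {j k : J} (f : j ⟶ k) (x : (K.obj j).base) :
    KSet.Hom.base (leg c k) (KSet.Hom.base (K.map f) x) = KSet.Hom.base (leg c j) x :=
  congrFun (base_w c f) x

lemma exists_fun_map_eq [HasTerminal M] (κ : Cardinal.{v}) [Fact κ.IsRegular]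
    [IsCardinalFiltered J κ] (hc : IsColimit c) {I : Type} [Finite I] {j : J}
    (x y : I → (K.obj j).base)
    (h : ∀ i, KSet.Hom.base (leg c j) (x i) = KSet.Hom.base (leg c j) (y i)) :
    ∃ (k : J) (g : j ⟶ k), ∀ i, KSet.Hom.base (K.map g) (x i) = KSet.Hom.base (K.map g) (y i) := by
  have := isFiltered_of_isCardinalFiltered J κ
  choose k g hg using fun i => exists_base_map_eq hc (x i) (y i) (h i)
  obtain ⟨m, a, b, hab⟩ := IsCardinalFiltered.wideSpan g
    (hasCardinalLT_of_finite I κ (Cardinal.IsRegular.aleph0_le Fact.out))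
  refine ⟨m, b, fun i => ?_⟩
  rw [← hab i, base_map_comp_apply, base_map_comp_apply, hg]

end Tot

open Tot

/-- The lifts of a family `q` of elements of the colimit to the stages of a diagram. -/
structure Lift (c : Cocone K) {I : Type} (q : I → c.pt.base) : Type v where
  idx : J
  fn : I → (K.obj idx).base
  fac (i : I) : KSet.Hom.base (leg c idx) (fn i) = q i

namespace Lift

variable {c : Cocone K} {I : Type} {q : I → c.pt.base}

instance : Category (Lift c q) where
  Hom a b := { g : a.idx ⟶ b.idx // ∀ i, KSet.Hom.base (K.map g) (a.fn i) = b.fn i }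
  id a := ⟨𝟙 _, fun i => congrFun (base_map_id K a.idx) _⟩
  comp f g := ⟨f.1 ≫ g.1, fun i => by rw [base_map_comp_apply, f.2, g.2]⟩

/-- The image of a lift at a later stage. -/
abbrev push (a : Lift c q) {k : J} (g : a.idx ⟶ k) : Lift c q where
  idx := k
  fn i := KSet.Hom.base (K.map g) (a.fn i)
  fac i := by rw [base_leg_map, a.fac]

/-- The map from a lift to its image at a later stage. -/
def toPush (a : Lift c q) {k : J} (g : a.idx ⟶ k) : a ⟶ a.push g := ⟨g, fun _ => rfl⟩

variable [HasTerminal M] [Finite I]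

variable (q) in
lemma nonempty (κ : Cardinal.{v}) [Fact κ.IsRegular] [IsCardinalFiltered J κ] (hc : IsColimit c) :
    Nonempty (Lift c q) := by
  choose j y hy using fun i => exists_base_eq hc (q i)
  have hI : HasCardinalLT I κ :=
    hasCardinalLT_of_finite I κ (Cardinal.IsRegular.aleph0_le Fact.out)
  exact ⟨⟨IsCardinalFiltered.max j hI,
    fun i => KSet.Hom.base (K.map (IsCardinalFiltered.toMax j hI i)) (y i),
    fun i => (base_leg_map _ _).trans (hy i)⟩⟩

variable (κ : Cardinal.{v}) [Fact κ.IsRegular] [IsCardinalFiltered J κ]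

lemma exists_cone (hc : IsColimit c) {ι : Type v} (a : ι → Lift c q) (hι : HasCardinalLT ι κ) :
    ∃ b : Lift c q, ∀ i, Nonempty (a i ⟶ b) := by
  have := isFiltered_of_isCardinalFiltered J κ
  obtain ⟨b⟩ := nonempty q κ hc
  obtain ⟨m, α, β, -⟩ : ∃ (m : J) (α : ∀ i, (a i).idx ⟶ m) (_ : b.idx ⟶ m), True :=
    ⟨_, fun i => IsCardinalFiltered.toMax (fun i => (a i).idx) hι i ≫
      IsFiltered.rightToMax b.idx _, IsFiltered.leftToMax b.idx _, trivial⟩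
  choose k g hg using fun i => exists_fun_map_eq κ hc ((a i).push (α i)).fn (b.push β).fn
    fun x => (((a i).push (α i)).fac x).trans ((b.push β).fac x).symm
  obtain ⟨l, γ, δ, h⟩ := IsCardinalFiltered.wideSpan g hι
  refine ⟨b.push (β ≫ δ), fun i => ⟨⟨α i ≫ δ, fun x => ?_⟩⟩⟩
  change _ = KSet.Hom.base (K.map (β ≫ δ)) (b.fn x)
  rw [base_map_comp_apply, base_map_comp_apply, ← h i]
  exact (base_map_comp_apply _ _ _).trans ((congrArg _ (hg i x)).trans
    (base_map_comp_apply _ _ _).symm)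

variable (q) in
lemma isCardinalFiltered (hc : IsColimit c) : IsCardinalFiltered (Lift c q) κ := by
  rw [isCardinalFiltered_iff]
  refine ⟨fun ι a hι => exists_cone κ hc a hι, fun ι a b f hι => ?_⟩
  rcases isEmpty_or_nonempty ι with h | ⟨⟨i₀⟩⟩
  · have := isFiltered_of_isCardinalFiltered J κ
    obtain ⟨l, hl⟩ := exists_cone κ hc (fun i : ULift.{v} Bool => cond i.down a b)
      (hasCardinalLT_of_finite _ κ (Cardinal.IsRegular.aleph0_le Fact.out))
    exact ⟨l, (hl ⟨false⟩).some, (hl ⟨true⟩).some, fun i => isEmptyElim i⟩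
  · let g := IsCardinalFiltered.coeqHom (fun i => (f i).1) hι
    exact ⟨b.push g, b.toPush g, f i₀ ≫ b.toPush g, fun i => Subtype.ext
      ((IsCardinalFiltered.coeq_condition (fun i => (f i).1) hι i).trans
        (IsCardinalFiltered.coeq_condition (fun i => (f i).1) hι i₀).symm)⟩

variable {s : Chain c.pt.base} {r : Fin (s.deg + 1) → I}

/-- The chain of letters of a lift. -/
abbrev chain (a : Lift c q) (s : Chain c.pt.base) (r : Fin (s.deg + 1) → I) :
    Chain (K.obj a.idx).base :=
  ⟨s.deg, s.deg_pos, fun i => a.fn (r i)⟩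

/-- A chain as a 2-morphism to the image of its lift. -/
def overHom (hr : ∀ i, q (r i) = s.pt i) (a : Lift c q) :
    s ⟶ (Chain.map (KSet.Hom.base (leg c a.idx))).obj (a.chain s r) :=
  Chain.mkOver id strictMono_id rfl rfl fun i => ((a.fac (r i)).trans (hr i)).symm

/-- The map of the total category given by a map of lifts. -/
def totMap {a b : Lift c q} (g : a ⟶ b) :
    (⟨a.idx, a.chain s r⟩ : Tot K) ⟶ ⟨b.idx, b.chain s r⟩ :=
  homMk g.1 (Chain.mkOver id strictMono_id rfl rfl fun i => (g.2 (r i)).symm)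

/-- The functor from lifts of a family to chains over a chain with letters in the family. -/
def toTot (hr : ∀ i, q (r i) = s.pt i) : Lift c q ⥤ CostructuredArrow (proj c) (op s) where
  obj a := CostructuredArrow.mk (Y := (⟨a.idx, a.chain s r⟩ : Tot K)) (Quiver.Hom.op (overHom hr a))
  map {a b} g := CostructuredArrow.homMk (totMap g) (congrArg Quiver.Hom.op
    (Chain.hom_over_ext (f := KSet.Hom.base (leg c a.idx)) (w := a.chain s r) fun i =>
      posOver_projMap c (totMap g) i))
  map_id a := by
    ext
    exact Hom.ext rfl fun i => (Chain.posOver_idOver (base_map_id K a.idx) _ i).symm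
  map_comp {a b d} f g := by
    ext
    exact Hom.ext rfl fun i => (posOver_chainMap_comp (totMap f) (totMap g) i).symm

lemma posOver_chainMap_left {hr : ∀ i, q (r i) = s.pt i} {d : CostructuredArrow (proj c) (op s)}
    {a : Lift c q} (f : d ⟶ (toTot hr).obj a) (i : Fin (d.left.chain.deg + 1)) :
    Chain.posOver (w' := a.chain s r) (chainMap f.left) i =
      Chain.posOver (f := KSet.Hom.base (leg c d.left.idx)) (w := d.left.chain) d.hom.unop i := by
  have h := congrArg Quiver.Hom.unop (CostructuredArrow.w f)
  rw [← h]
  exact (posOver_projMap c f.left i).symm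

/-- The lifts of a chain are final among the chains over it: a chain has finitely many letters, so
the letters of any chain over `s` agree, at a later stage, with letters of a lift. -/
lemma final_toTot (κ : Cardinal.{v}) [Fact κ.IsRegular] [IsCardinalFiltered J κ]
    (hc : IsColimit c) (hr : ∀ i, q (r i) = s.pt i) :
    (toTot hr : Lift c q ⥤ _).Final := by
  have := isFiltered_of_isCardinalFiltered J κ
  have := isCardinalFiltered q κ hc
  have := isFiltered_of_isCardinalFiltered (Lift c q) κ
  refine Functor.final_of_exists_of_isFiltered _ (fun d => ?_) fun {d a} f f' => ?_
  · obtain ⟨b⟩ := nonempty q κ hc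
    let t := d.left
    let e : s ⟶ (Chain.map (KSet.Hom.base (leg c t.idx))).obj t.chain := d.hom.unop
    obtain ⟨m, α, β, -⟩ : ∃ (m : J) (_ : t.idx ⟶ m) (_ : b.idx ⟶ m), True :=
      ⟨_, IsFiltered.leftToMax _ _, IsFiltered.rightToMax _ _, trivial⟩
    obtain ⟨k, g, hg⟩ := exists_fun_map_eq κ hc
      (fun i => KSet.Hom.base (K.map α) (t.chain.pt i))
      (fun i => (b.push β).fn (r (Chain.posOver e i))) fun i => by
        rw [(b.push β).fac, hr, base_leg_map, Chain.pt_posOver]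
    let p : Fin (t.chain.deg + 1) → Fin (s.deg + 1) := Chain.posOver e
    let e' : (b.push (β ≫ g)).chain s r ⟶
        (Chain.map (KSet.Hom.base (K.map (α ≫ g)))).obj t.chain :=
      Chain.mkOver p (Chain.Hom.strictMono (t := s) e)
        (Chain.Hom.pos_zero (t := s) e) (Chain.Hom.pos_last (t := s) e) fun i =>
          (base_map_comp_apply _ _ _).trans
            ((hg i).symm.trans (base_map_comp_apply _ _ _).symm)
    let φ : t ⟶ ⟨(b.push (β ≫ g)).idx, (b.push (β ≫ g)).chain s r⟩ := homMk (α ≫ g) e'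
    exact ⟨b.push (β ≫ g), ⟨CostructuredArrow.homMk φ (congrArg Quiver.Hom.op
      (Chain.hom_over_ext (f := KSet.Hom.base (leg c t.idx)) (w := t.chain) fun i =>
        posOver_projMap c φ i))⟩⟩
  · let t := d.left
    let f₀ : t.idx ⟶ a.idx := idxMap f.left
    let f₁ : t.idx ⟶ a.idx := idxMap f'.left
    refine ⟨a.push (IsFiltered.coeqHom f₀ f₁), a.toPush _, ?_⟩
    ext
    refine Hom.ext (IsFiltered.coeq_condition f₀ f₁) fun i => ?_
    refine (posOver_chainMap_left (f ≫ (toTot hr).map _) i).trans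
      (posOver_chainMap_left (f' ≫ (toTot hr).map _) i).symm

end Lift

/-! ### Presentability of the objects `δ(s_n, A)` -/

variable {M : Type u} [Category.{v} M] {J : Type v} [SmallCategory J] {K : J ⥤ KSet M}

open Tot

namespace Lift

variable {c : Cocone K} {I : Type} {q : I → c.pt.base} {s : Chain c.pt.base}
  {r : Fin (s.deg + 1) → I}

/-- The values at the lifts of a chain, for lifts of a family of elements containing the letters
of the chain. -/
abbrev diag (hr : ∀ i, q (r i) = s.pt i) : Lift c q ⥤ M :=
  toTot hr ⋙ CostructuredArrow.proj (proj c) (op s) ⋙ val K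

/-- The cocone of the values at the lifts of a chain. -/
abbrev cocone (hr : ∀ i, q (r i) = s.pt i) : Cocone (diag hr) :=
  ((Functor.LeftExtension.mk _ (unit c)).coconeAt (op s)).whisker (toTot hr)

lemma diag_map (hr : ∀ i, q (r i) = s.pt i) {a b : Lift c q} (g : a ⟶ b) :
    (diag hr).map g = KSet.eval (K.map g.1) (chainMap (totMap (s := s) (r := r) g)) := rfl

lemma cocone_ι_app (hr : ∀ i, q (r i) = s.pt i) (a : Lift c q) :
    (cocone hr).ι.app a = KSet.eval (leg c a.idx) (overHom hr a) := rfl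

/-- The value of a filtered colimit at a chain is the colimit of the values at the lifts of the
chain. -/
noncomputable def isColimitCocone [HasTerminal M] [HasColimits M] [Finite I] (κ : Cardinal.{v})
    [Fact κ.IsRegular] [IsCardinalFiltered J κ] (hc : IsColimit c)
    (hr : ∀ i, q (r i) = s.pt i) : IsColimit (cocone hr) :=
  have := final_toTot κ hc hr
  (Functor.Final.isColimitWhiskerEquiv (toTot hr) _).symm (isColimitCoconeAt hc (op s))

end Lift

section

variable (M) in
/-- The object `δ(s_n, A)` of `𝒦_Set`. -/
noncomputable abbrev deltaObj [HasColimits M] (n : ℕ) (hn : 0 < n) (A : M) : KSet M :=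
  (delta M n hn ⋙ kFiberInclusion M _).obj A

namespace deltaObj

variable [HasColimits M] {n : ℕ} {hn : 0 < n} {A : M}

variable (n hn A) in
/-- The chain `s_n` on the set of objects of `δ(s_n, A)`. -/
def gen : Chain (deltaObj M n hn A).base := Chain.std n hn

variable (n hn A) in
/-- The universal element of `δ(s_n, A)`. -/
noncomputable def elt : A ⟶ (deltaObj M n hn A).fiber.obj (op (gen n hn A)) :=
  (evaluationAdjunctionRight M (op (Chain.std n hn))).unit.app A

variable (hn) in
/-- The map from `δ(s_n, A)` given by an element. -/
noncomputable def homMk {F : KSet M} (f : ULift.{v} (Fin (n + 1)) → F.base)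
    (a : A ⟶ F.fiber.obj (op ((Chain.map f).obj (gen n hn A)))) : deltaObj M n hn A ⟶ F :=
  KSet.Hom.mk f (((evaluationAdjunctionRight M (op (Chain.std n hn))).homEquiv A
    ((kPullback M f).obj F.fiber)).symm a)

lemma elt_eval_homMk {F : KSet M} (f : ULift.{v} (Fin (n + 1)) → F.base)
    (a : A ⟶ F.fiber.obj (op ((Chain.map f).obj (gen n hn A)))) :
    elt n hn A ≫ (KSet.Hom.fiber (homMk hn f a)).app (op (gen n hn A)) = a := by
  have := ((evaluationAdjunctionRight M (op (Chain.std n hn))).homEquiv A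
    ((kPullback M f).obj F.fiber)).apply_symm_apply a
  rw [Adjunction.homEquiv_unit] at this
  exact this

lemma hom_ext {F : KSet M} {σ τ : deltaObj M n hn A ⟶ F}
    (h : KSet.Hom.base σ = KSet.Hom.base τ) {s : Chain F.base} (hs : n = s.deg)
    (e : s ⟶ (Chain.map (KSet.Hom.base σ)).obj (gen n hn A))
    (e' : s ⟶ (Chain.map (KSet.Hom.base τ)).obj (gen n hn A))
    (h' : elt n hn A ≫ KSet.eval σ e = elt n hn A ≫ KSet.eval τ e') : σ = τ := by
  obtain ⟨f, φ⟩ := σ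
  obtain ⟨g, ψ⟩ := τ
  obtain rfl : f = g := h
  change n = s.deg at hs
  obtain rfl : s = (Chain.map f).obj (gen n hn A) := Chain.eq_of_deg_eq e hs.symm
  rw [KSet.eval_eq_app, KSet.eval_eq_app] at h'
  congr 1
  apply ((evaluationAdjunctionRight M (op (Chain.std n hn))).homEquiv A
    ((kPullback M f).obj F.fiber)).injective
  exact (Adjunction.homEquiv_unit (evaluationAdjunctionRight M (op (Chain.std n hn))) _ _ φ).trans
    (h'.trans (Adjunction.homEquiv_unit (evaluationAdjunctionRight M (op (Chain.std n hn)))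
      _ _ ψ).symm)

variable [HasTerminal M] {c : Cocone K}

lemma exists_lift (κ : Cardinal.{v}) [Fact κ.IsRegular] [IsCardinalPresentable A κ]
    [IsCardinalFiltered J κ] (hc : IsColimit c) (f : deltaObj M n hn A ⟶ c.pt) :
    ∃ (j : J) (g : deltaObj M n hn A ⟶ K.obj j), f = g ≫ leg c j := by
  let s : Chain c.pt.base := (Chain.map (KSet.Hom.base f)).obj (gen n hn A)
  have hr (i : Fin (s.deg + 1)) : s.pt (id i) = s.pt i := rfl
  have := Lift.isCardinalFiltered s.pt κ hc
  obtain ⟨a, g, hg⟩ := IsCardinalPresentable.exists_hom_of_isColimit κ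
    (Lift.isColimitCocone κ hc hr) (elt n hn A ≫ (KSet.Hom.fiber f).app (op (gen n hn A)))
  rw [Lift.cocone_ι_app] at hg
  let f₁ : ULift.{v} (Fin (n + 1)) → (K.obj a.idx).base := fun i => a.fn i.down
  let g' : deltaObj M n hn A ⟶ K.obj a.idx := homMk hn f₁ g
  let e : a.chain s id ⟶ (Chain.map (KSet.Hom.base g')).obj (gen n hn A) := 𝟙 _
  have he : elt n hn A ≫ KSet.eval g' e = g :=
    (congrArg (elt n hn A ≫ ·) (KSet.eval_eq_app g' _)).trans
      (elt_eval_homMk (n := n) (hn := hn) f₁ g)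
  refine ⟨a.idx, g', hom_ext (funext fun i => (a.fac i.down).symm) (s := s) rfl (𝟙 _)
    (Chain.compOver (f := KSet.Hom.base g') rfl e (Lift.overHom hr a)) ?_⟩
  rw [← KSet.eval_comp (σ := g') (τ := leg c a.idx) rfl (e := e) (e' := Lift.overHom hr a)
    fun i => Chain.posOver_compOver rfl e _ i, ← Category.assoc, he]
  exact (congrArg (elt n hn A ≫ ·) (KSet.eval_eq_app f _)).trans hg.symm

lemma exists_map_eq (κ : Cardinal.{v}) [Fact κ.IsRegular] [IsCardinalPresentable A κ]
    [IsCardinalFiltered J κ] (hc : IsColimit c) {k : J} (F G : deltaObj M n hn A ⟶ K.obj k)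
    (hb : KSet.Hom.base F = KSet.Hom.base G) (hl : F ≫ leg c k = G ≫ leg c k) :
    ∃ (l : J) (u : k ⟶ l), F ≫ K.map u = G ≫ K.map u := by
  let s : Chain c.pt.base := (Chain.map (KSet.Hom.base (F ≫ leg c k))).obj (gen n hn A)
  have hr (i : Fin (s.deg + 1)) : s.pt (id i) = s.pt i := rfl
  have := Lift.isCardinalFiltered s.pt κ hc
  let a : Lift c s.pt := ⟨k, fun i => KSet.Hom.base F ⟨i⟩, fun i => rfl⟩
  let e₁ : a.chain s id ⟶ (Chain.map (KSet.Hom.base F)).obj (gen n hn A) := 𝟙 _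
  let e₂ : a.chain s id ⟶ (Chain.map (KSet.Hom.base G)).obj (gen n hn A) :=
    Chain.mkOver id strictMono_id rfl rfl fun i => congrFun hb ⟨i⟩
  obtain ⟨b, u, hu⟩ := IsCardinalPresentable.exists_eq_of_isColimit' κ
    (Lift.isColimitCocone κ hc hr) (i := a) (elt n hn A ≫ KSet.eval F e₁)
    (elt n hn A ≫ KSet.eval G e₂) (by
      rw [Lift.cocone_ι_app]
      refine (Category.assoc (elt n hn A) (KSet.eval F e₁) _).trans (Eq.trans ?_
        (Category.assoc (elt n hn A) (KSet.eval G e₂) _).symm)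
      refine congrArg (elt n hn A ≫ ·) ?_
      refine (KSet.eval_comp (σ := F) (τ := leg c k) (e := e₁) (e' := Lift.overHom hr a)
        (e'' := 𝟙 _) rfl fun _ => rfl).trans (KSet.eval_comp (σ := G) (τ := leg c k) (e := e₂)
          (e' := Lift.overHom hr a) (e'' := 𝟙 _) hl.symm fun _ => rfl).symm)
  let e : b.chain s id ⟶ (Chain.map (KSet.Hom.base (K.map u.1))).obj (a.chain s id) :=
    chainMap (Lift.totMap (s := s) (r := id) u)
  refine ⟨b.idx, u.1, hom_ext (σ := F ≫ K.map u.1) (τ := G ≫ K.map u.1)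
    (congrArg (KSet.Hom.base (K.map u.1) ∘ ·) hb) (s := b.chain s id) rfl
    (Chain.compOver (f := KSet.Hom.base F) rfl e₁ e)
    (Chain.compOver (f := KSet.Hom.base G) rfl e₂ e) ?_⟩
  rw [Lift.diag_map] at hu
  rw [← KSet.eval_comp (σ := F) (τ := K.map u.1) rfl (e := e₁) (e' := e)
      (fun i => Chain.posOver_compOver rfl e₁ e i),
    ← KSet.eval_comp (σ := G) (τ := K.map u.1) rfl (e := e₂) (e' := e)
      (fun i => Chain.posOver_compOver rfl e₂ e i), ← Category.assoc, ← Category.assoc]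
  exact hu

/-- The object `δ(s_n, A)` is presentable when `A` is: a map to a filtered colimit consists of
finitely many elements of the colimit of the sets of objects and of an element of the value at a
chain, which is the colimit of the values at the lifts of this chain. -/
lemma isCardinalPresentable (κ : Cardinal.{v}) [Fact κ.IsRegular] [IsCardinalPresentable A κ] :
    IsCardinalPresentable (deltaObj M n hn A) κ where
  preservesColimitOfShape J _ _ := ⟨fun {K} => ⟨fun {c} hc => ⟨by
    have := isFiltered_of_isCardinalFiltered J κ
    refine Types.FilteredColimit.isColimitOf' _ _ (fun f => exists_lift κ hc f) fun j f g h => ?_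
    let f' : deltaObj M n hn A ⟶ K.obj j := f
    let g' : deltaObj M n hn A ⟶ K.obj j := g
    have h' : f' ≫ leg c j = g' ≫ leg c j := h
    obtain ⟨k, γ, hγ⟩ := exists_fun_map_eq κ hc (I := Fin (n + 1))
      (fun i => KSet.Hom.base f' ⟨i⟩) (fun i => KSet.Hom.base g' ⟨i⟩)
      fun i => congrFun (congrArg KSet.Hom.base h') ⟨i⟩
    obtain ⟨l, u, hu⟩ := exists_map_eq κ hc (f' ≫ K.map γ) (g' ≫ K.map γ)
      (funext fun i => hγ i.down) (by rw [Category.assoc, Category.assoc, leg_w, h'])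
    refine ⟨l, γ ≫ u, ?_⟩
    change f' ≫ K.map (γ ≫ u) = g' ≫ K.map (γ ≫ u)
    rw [K.map_comp, ← Category.assoc, ← Category.assoc, hu]⟩⟩⟩

end deltaObj

end

/-! ### Strong generators and local presentability of `𝒦_Set` -/

section

variable {C : Type*} [Category* C] {D : Type*} [Category* D]

/-- The image of a strong generator under the left adjoint of a faithful and conservative functor
is a strong generator. -/
lemma isStrongGenerator_strictMap {P : ObjectProperty C} (hP : P.IsStrongGenerator) {L : C ⥤ D}
    {R : D ⥤ C} (adj : L ⊣ R) [R.Faithful] [R.ReflectsIsomorphisms] :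
    (P.strictMap L).IsStrongGenerator := by
  refine ObjectProperty.isStrongGenerator_iff.2 ⟨fun X Y f g h => ?_, fun X Y i _ h => ?_⟩
  · refine R.map_injective (hP.isSeparating _ _ fun G hG k => ?_)
    have := h (L.obj G) ⟨_, hG⟩ ((adj.homEquiv _ _).symm k)
    rw [← Adjunction.homEquiv_naturality_right_symm, ← Adjunction.homEquiv_naturality_right_symm]
      at this
    exact (adj.homEquiv _ _).symm.injective this
  · have : IsIso (R.map i) := by
      have := adj.rightAdjoint_preservesLimits
      refine hP.isIso_of_mono (R.map i) fun G hG k => ?_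
      obtain ⟨l, hl⟩ := h (L.obj G) ⟨_, hG⟩ ((adj.homEquiv _ _).symm k)
      refine ⟨adj.homEquiv _ _ l, ?_⟩
      dsimp only at hl ⊢
      rw [← Adjunction.homEquiv_naturality_right, hl, Equiv.apply_symm_apply]
    exact isIso_of_reflects_iso i R

end

namespace SetFibration

variable {E : Type*} [Category.{v} E] {A : Type v → Type*} [∀ X, Category.{v} (A X)]
  {S : SetFibration E A} {X Y : Type v}

lemma isIso_map_comp_cart {F : A X} {G : A Y} {f : X → Y} (hf : Function.Bijective f)
    (φ : F ⟶ (S.pull f).obj G) [IsIso φ] : IsIso ((S.inc X).map φ ≫ S.cart f G) := by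
  obtain ⟨g, hg, hg'⟩ := Function.bijective_iff_has_inverse.1 hf
  have : IsIso (S.cart f G) := by
    have hid : S.IsOver (𝟙 ((S.inc Y).obj G)) (f ∘ g) := by
      rw [show f ∘ g = id from funext hg']
      exact .id G
    obtain ⟨τ, hτ, hτ'⟩ := IsOver.exists_cart_fac hid
    refine ⟨τ, IsOver.cart_ext (f := id) (g := f) ?_ (.id _) ?_, hτ'⟩
    · have := (IsOver.of_cart f G).comp hτ
      rwa [show g ∘ f = id from funext hg] at this
    · rw [Category.assoc, hτ', Category.comp_id, Category.id_comp]
  infer_instance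

end SetFibration

variable {M : Type u} [Category.{v} M]

lemma isIso_kSet {F G : KSet M} (σ : F ⟶ G) (hf : Function.Bijective (KSet.Hom.base σ))
    [IsIso (KSet.Hom.fiber σ)] : IsIso σ := by
  have := (kSetFibration M).isIso_map_comp_cart (F := F.fiber) (G := G.fiber) hf
    (KSet.Hom.fiber σ)
  rwa [kSetFibration_map_comp_cart] at this

variable [HasColimits M]

namespace deltaObj

variable {A : M} {F : KSet M} {s : Chain F.base}

/-- The map from `δ(s_n, A)` given by an element of the value at a chain of length `n`. -/
noncomputable def ofElt (a : A ⟶ F.fiber.obj (op s)) : deltaObj M s.deg s.deg_pos A ⟶ F :=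
  homMk s.deg_pos (fun i => s.pt i.down) a

/-- A chain as a 2-morphism to the image of the chain `s_n`. -/
def toImage {σ : deltaObj M s.deg s.deg_pos A ⟶ F} (h : ∀ i, s.pt i = KSet.Hom.base σ ⟨i⟩) :
    s ⟶ (Chain.map (KSet.Hom.base σ)).obj (gen s.deg s.deg_pos A) :=
  Chain.mkOver id strictMono_id rfl rfl h

lemma elt_eval_ofElt (a : A ⟶ F.fiber.obj (op s))
    (e : s ⟶ (Chain.map (KSet.Hom.base (ofElt a))).obj (gen s.deg s.deg_pos A)) :
    elt s.deg s.deg_pos A ≫ KSet.eval (ofElt a) e = a :=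
  (congrArg (elt s.deg s.deg_pos A ≫ ·) (KSet.eval_eq_app (ofElt a) (w := gen _ _ A) e)).trans
    (elt_eval_homMk (n := s.deg) (hn := s.deg_pos) (fun i => s.pt i.down) a)

/-- The compatibility of elements with maps. -/
lemma elt_eval_ofElt_comp {G : KSet M} (a : A ⟶ F.fiber.obj (op s)) (σ : F ⟶ G)
    {w : Chain G.base} (e : w ⟶ (Chain.map (KSet.Hom.base σ)).obj s)
    (e' : w ⟶ (Chain.map (KSet.Hom.base (ofElt a ≫ σ))).obj (gen s.deg s.deg_pos A))
    (h : ∀ i, Chain.posOver e' i = Chain.posOver e i) :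
    elt s.deg s.deg_pos A ≫ KSet.eval (ofElt a ≫ σ) e' = a ≫ KSet.eval σ e := by
  let e₀ : s ⟶ (Chain.map (KSet.Hom.base (ofElt a))).obj (gen s.deg s.deg_pos A) := 𝟙 _
  rw [← KSet.eval_comp (σ := ofElt a) (τ := σ) rfl (e := e₀) (e' := e) h, ← Category.assoc,
    elt_eval_ofElt]

lemma ofElt_comp_eq_iff {G : KSet M} (a b : A ⟶ F.fiber.obj (op s)) (σ τ : F ⟶ G)
    (e : (Chain.map (KSet.Hom.base σ)).obj s ⟶ (Chain.map (KSet.Hom.base τ)).obj s)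
    (hb : KSet.Hom.base σ = KSet.Hom.base τ) :
    ofElt a ≫ σ = ofElt b ≫ τ ↔ a ≫ (KSet.Hom.fiber σ).app (op s) = b ≫ KSet.eval τ e := by
  obtain ⟨e₁, h₁⟩ : ∃ e₁ : (Chain.map (KSet.Hom.base σ)).obj s ⟶
      (Chain.map (KSet.Hom.base (ofElt a ≫ σ))).obj (gen s.deg s.deg_pos A),
        ∀ i, Chain.posOver e₁ i = i := ⟨𝟙 _, fun _ => rfl⟩
  let e₂ : (Chain.map (KSet.Hom.base σ)).obj s ⟶
      (Chain.map (KSet.Hom.base (ofElt b ≫ τ))).obj (gen s.deg s.deg_pos A) := e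
  have h₂ := elt_eval_ofElt_comp b τ e e₂ fun _ => rfl
  have h₃ := elt_eval_ofElt_comp a σ (𝟙 _) e₁ h₁
  rw [KSet.eval_eq_app] at h₃
  rw [← h₂, ← h₃]
  refine ⟨fun h => congrArg (elt s.deg s.deg_pos A ≫ ·) (KSet.eval_congr h fun i => ?_),
    fun h => hom_ext ?_ rfl e₁ e₂ h⟩
  · refine (h₁ i).trans (Fin.ext ?_)
    exact (Chain.pos_eq_of_deg_eq e rfl i).symm
  · exact congrArg (· ∘ _) hb

end deltaObj

variable (M) in
/-- The discrete object on a point. -/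
noncomputable abbrev kPt : KSet M := kDisc M PUnit.{v + 1}

namespace kPt

/-- The map from the discrete object on a point given by an element. -/
noncomputable def homMk {F : KSet M} (x : F.base) : kPt M ⟶ F :=
  KSet.Hom.mk (fun _ => x) (initial.to _)

lemma hom_ext {F : KSet M} {σ τ : kPt M ⟶ F} (h : KSet.Hom.base σ ⟨⟩ = KSet.Hom.base τ ⟨⟩) :
    σ = τ := by
  obtain ⟨f, φ⟩ := σ
  obtain ⟨g, ψ⟩ := τ
  obtain rfl : f = g := funext fun _ => h
  congr 1
  exact initial.hom_ext _ _

lemma isCardinalPresentable [HasTerminal M] (κ : Cardinal.{v}) [Fact κ.IsRegular] :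
    IsCardinalPresentable (kPt M) κ where
  preservesColimitOfShape J _ _ := ⟨fun {K} => ⟨fun {c} hc => ⟨by
    have := isFiltered_of_isCardinalFiltered J κ
    refine Types.FilteredColimit.isColimitOf' _ _ (fun f => ?_) fun j f g h => ?_
    · let f' : kPt M ⟶ c.pt := f
      obtain ⟨j, y, hy⟩ := Tot.exists_base_eq hc (KSet.Hom.base f' ⟨⟩)
      refine ⟨j, homMk y, ?_⟩
      change f' = homMk y ≫ Tot.leg c j
      exact hom_ext hy.symm
    · let f' : kPt M ⟶ K.obj j := f
      let g' : kPt M ⟶ K.obj j := g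
      have h' : f' ≫ Tot.leg c j = g' ≫ Tot.leg c j := h
      obtain ⟨k, u, hu⟩ := Tot.exists_base_map_eq hc (KSet.Hom.base f' ⟨⟩) (KSet.Hom.base g' ⟨⟩)
        (congrFun (congrArg KSet.Hom.base h') ⟨⟩)
      refine ⟨k, u, ?_⟩
      change f' ≫ K.map u = g' ≫ K.map u
      exact hom_ext hu⟩⟩⟩

end kPt

/-- The discrete object on a point and the objects `δ(s_n, A)`, for `A` in a given class. -/
noncomputable def kSetGenerator (P : ObjectProperty M) : ObjectProperty (KSet M) :=
  .ofObj (fun _ : PUnit.{1} => kPt M) ⊔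
    ⨆ n : { n : ℕ // 0 < n }, P.strictMap (delta M n.1 n.2 ⋙ kFiberInclusion M _)

lemma kSetGenerator_kPt (P : ObjectProperty M) : kSetGenerator P (kPt M) :=
  Or.inl (ObjectProperty.ofObj_apply _ PUnit.unit)

lemma kSetGenerator_deltaObj {P : ObjectProperty M} {A : M} (hA : P A) (n : ℕ) (hn : 0 < n) :
    kSetGenerator P (deltaObj M n hn A) :=
  Or.inr ((ObjectProperty.prop_iSup_iff _ _).2 ⟨⟨n, hn⟩, ⟨_, hA⟩⟩)

lemma isStrongGenerator_kSetGenerator {P : ObjectProperty M} (hP : P.IsStrongGenerator) :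
    (kSetGenerator P).IsStrongGenerator := by
  refine ObjectProperty.isStrongGenerator_iff.2 ⟨fun F G σ τ h => ?_, fun F G i _ h => ?_⟩
  · have hb : KSet.Hom.base σ = KSet.Hom.base τ := funext fun x =>
      congrFun (congrArg KSet.Hom.base (h _ (kSetGenerator_kPt P) (kPt.homMk x))) ⟨⟩
    refine (KSet.ext_eval hb.symm fun w e => hP.isSeparating _ _ fun A hA a => ?_).symm
    exact ((deltaObj.ofElt_comp_eq_iff a a σ τ e hb).1
      (h _ (kSetGenerator_deltaObj hA _ _) (deltaObj.ofElt a))).symm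
  · have hinj : Function.Injective (KSet.Hom.base i) := fun x y hxy => by
      have : kPt.homMk x = kPt.homMk y := (cancel_mono i).1 (kPt.hom_ext hxy)
      exact congrFun (congrArg KSet.Hom.base this) ⟨⟩
    have hsurj : Function.Surjective (KSet.Hom.base i) := fun y => by
      obtain ⟨f, hf⟩ := h _ (kSetGenerator_kPt P) (kPt.homMk y)
      exact ⟨_, congrFun (congrArg KSet.Hom.base hf) ⟨⟩⟩
    have (w : (Chain F.base)ᵒᵖ) : IsIso ((KSet.Hom.fiber i).app w) := by
      induction w using Opposite.rec with | _ w
      have : Mono ((KSet.Hom.fiber i).app (op w)) := ⟨fun {A} a b hab => by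
        have := (deltaObj.ofElt_comp_eq_iff a b i i (𝟙 _) rfl).2
          (hab.trans (congrArg (b ≫ ·) (KSet.eval_eq_app i _).symm))
        have := (cancel_mono i).1 this
        have h' := (deltaObj.ofElt_comp_eq_iff a b (𝟙 F) (𝟙 F) (𝟙 _) rfl).1 
          (by rw [this])
        rw [KSet.eval_eq_app] at h'
        exact (Category.comp_id a).symm.trans (h'.trans (Category.comp_id b))⟩
      refine hP.isIso_of_mono _ fun A hA a => ?_
      let w' : Chain G.base := (Chain.map (KSet.Hom.base i)).obj w
      let a' : A ⟶ G.fiber.obj (op w') := a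
      obtain ⟨f, hf⟩ := h _ (kSetGenerator_deltaObj hA w.deg w.deg_pos) (deltaObj.ofElt a')
      change f ≫ i = deltaObj.ofElt a' at hf
      let e : w ⟶ (Chain.map (KSet.Hom.base f)).obj (deltaObj.gen w.deg w.deg_pos A) :=
        deltaObj.toImage fun k => (hinj (congrFun (congrArg KSet.Hom.base hf) ⟨k⟩)).symm
      refine ⟨deltaObj.elt _ _ A ≫ KSet.eval f e, ?_⟩
      change (deltaObj.elt _ _ A ≫ KSet.eval f e) ≫ (KSet.Hom.fiber i).app (op w) = a'
      rw [← KSet.eval_eq_app i (𝟙 _), Category.assoc]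
      refine Eq.trans (congrArg (deltaObj.elt _ _ A ≫ ·) ?_)
        (deltaObj.elt_eval_ofElt a' (deltaObj.toImage fun _ => rfl))
      exact KSet.eval_comp hf fun _ => rfl
    have : IsIso (KSet.Hom.fiber i) := NatIso.isIso_of_isIso_app _
    exact isIso_kSet i ⟨hinj, hsurj⟩

/-- The category `𝒦_Set` is locally presentable when `M` is. -/
theorem isCardinalLocallyPresentable_kSet [HasTerminal M] (κ : Cardinal.{v}) [Fact κ.IsRegular]
    (hκ : IsCardinalLocallyPresentable M κ) : IsCardinalLocallyPresentable (KSet M) κ := by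
  have : HasColimits (KSet M) := (kSetFibration M).hasColimits
  obtain ⟨P, _, hP, hP'⟩ := (IsCardinalLocallyPresentable.iff_exists_isStrongGenerator M κ).1
    inferInstance
  refine (IsCardinalLocallyPresentable.iff_exists_isStrongGenerator _ κ).2
    ⟨kSetGenerator P, ?_, isStrongGenerator_kSetGenerator hP, ?_⟩
  · unfold kSetGenerator
    infer_instance
  · refine sup_le ?_ (iSup_le fun n => ?_)
    · rintro _ ⟨⟩
      exact kPt.isCardinalPresentable κ
    · rintro _ ⟨A, hA⟩
      have : IsCardinalPresentable A κ := hP' _ hA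
      exact deltaObj.isCardinalPresentable κ

/-! ### Filtered colimits of pre-Co-Segal categories with varying sets of objects -/

variable {M : Type u} [Category.{v} M] [MonoidalCategory M]

/-- Natural and associative laxity maps on an object of `𝒦_Set`. -/
structure Laxity (F : KSet M) where
  lax {s t u : Chain F.base} (h : Chain.IsConcat s t u) :
    F.fiber.obj (op s) ⊗ F.fiber.obj (op t) ⟶ F.fiber.obj (op u)
  natural {s t u s' t' u' : Chain F.base} (h : Chain.IsConcat s t u)
    (h' : Chain.IsConcat s' t' u') (a : s ⟶ s') (b : t ⟶ t') (c : u ⟶ u')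
    (H : Chain.IsHComp a b c) :
    (F.fiber.map a.op ⊗ₘ F.fiber.map b.op) ≫ lax h = lax h' ≫ F.fiber.map c.op
  assoc {r s t rs st u : Chain F.base} (h₁ : Chain.IsConcat r s rs) (h₂ : Chain.IsConcat rs t u)
    (h₃ : Chain.IsConcat s t st) (h₄ : Chain.IsConcat r st u) :
    (lax h₁ ▷ F.fiber.obj (op t)) ≫ lax h₂ =
      (α_ (F.fiber.obj (op r)) (F.fiber.obj (op s)) (F.fiber.obj (op t))).hom ≫
        (F.fiber.obj (op r) ◁ lax h₃) ≫ lax h₄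

namespace Laxity

variable {F G H : KSet M}

/-- The compatibility of a map with laxity maps. -/
structure Compat (ℓ : Laxity F) (ℓ' : Laxity G) (σ : F ⟶ G) : Prop where
  comm {s t u : Chain F.base} (h : Chain.IsConcat s t u) :
    ℓ.lax h ≫ (KSet.Hom.fiber σ).app (op u) =
      ((KSet.Hom.fiber σ).app (op s) ⊗ₘ (KSet.Hom.fiber σ).app (op t)) ≫
        ℓ'.lax (h.map (KSet.Hom.base σ))

lemma Compat.eval {ℓ : Laxity F} {ℓ' : Laxity G} {σ : F ⟶ G} (hσ : ℓ.Compat ℓ' σ)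
    {s t u : Chain F.base} (h : Chain.IsConcat s t u) {s' t' u' : Chain G.base}
    (h' : Chain.IsConcat s' t' u') (a : s' ⟶ (Chain.map (KSet.Hom.base σ)).obj s)
    (b : t' ⟶ (Chain.map (KSet.Hom.base σ)).obj t) (c : u' ⟶ (Chain.map (KSet.Hom.base σ)).obj u)
    (H : Chain.IsHComp a b c) :
    (KSet.eval σ a ⊗ₘ KSet.eval σ b) ≫ ℓ'.lax h' = ℓ.lax h ≫ KSet.eval σ c := by
  refine ((tensorHom_comp_tensorHom_assoc _ _ _ _ _).symm.trans ?_)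
  refine (congrArg (_ ≫ ·) (ℓ'.natural h' (h.map (KSet.Hom.base σ)) a b c H)).trans ?_
  refine (Category.assoc _ _ _).symm.trans ?_
  refine (congrArg (· ≫ G.fiber.map c.op) (hσ.comm h).symm).trans (Category.assoc _ _ _)

/-- The pre-Co-Segal category given by an object of `𝒦_Set` with laxity maps. -/
def toMSet {F : KSet M} (ℓ : Laxity F) : MSet M where
  base := F.base
  fiber :=
    { diag := F.fiber
      lax := ℓ.lax
      lax_natural := ℓ.natural
      lax_assoc := ℓ.assoc }

end Laxity

/-- The laxity maps of a pre-Co-Segal category. -/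
def MSet.laxity (F : MSet M) : Laxity ((forgetLaxSet M).obj F) where
  lax := F.fiber.lax
  natural := F.fiber.lax_natural
  assoc := F.fiber.lax_assoc

lemma MSet.compat {F G : MSet M} (σ : F ⟶ G) :
    F.laxity.Compat G.laxity ((forgetLaxSet M).map σ) :=
  ⟨fun h => (MSet.Hom.fiber σ).comm h⟩

/-- The morphism of pre-Co-Segal categories given by a compatible map of diagrams. -/
def MSet.homMk {F G : MSet M} (σ : (forgetLaxSet M).obj F ⟶ (forgetLaxSet M).obj G)
    (hσ : F.laxity.Compat G.laxity σ) : F ⟶ G :=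
  MSet.Hom.mk (KSet.Hom.base σ) ⟨KSet.Hom.fiber σ, fun h => hσ.comm h⟩

lemma MSet.forgetLaxSet_map_injective {F G : MSet M} {σ τ : F ⟶ G}
    (h : (forgetLaxSet M).map σ = (forgetLaxSet M).map τ) : σ = τ := by
  obtain ⟨f, φ⟩ := σ
  obtain ⟨g, ψ⟩ := τ
  obtain rfl : f = g := congrArg KSet.Hom.base h
  congr 1
  refine PreCat.Hom.ext (KSet.homMk_injective (F := (forgetLaxSet M).obj F) (G := G.fiber.diag)
    (f := f) (φ := φ.trans) (ψ := ψ.trans) h)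

instance : (forgetLaxSet M).Faithful := ⟨fun h => MSet.forgetLaxSet_map_injective h⟩

variable [SymmetricCategory M] [MonoidalClosed M]

section

variable {J : Type v} [SmallCategory J] {K : J ⥤ KSet M} {c : Cocone K}

open Tot

/-- The laxity maps of the members of a diagram. -/
structure DiagLaxity (K : J ⥤ KSet M) where
  lax (j : J) : Laxity (K.obj j)
  compat {i j : J} (g : i ⟶ j) : (lax i).Compat (lax j) (K.map g)

namespace Lift

variable {s t u : Chain c.pt.base}

/-- The positions of the letters of the first factor of a concatenation. -/
def leftPos (h : Chain.IsConcat s t u) (i : Fin (s.deg + 1)) : Fin (u.deg + 1) :=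
  ⟨i, by have := h.deg_eq; omega⟩

/-- The positions of the letters of the second factor of a concatenation. -/
def rightPos (h : Chain.IsConcat s t u) (i : Fin (t.deg + 1)) : Fin (u.deg + 1) :=
  ⟨s.deg + i, by have := h.deg_eq; omega⟩

lemma pt_leftPos (h : Chain.IsConcat s t u) (i : Fin (s.deg + 1)) :
    u.pt (leftPos h i) = s.pt i := h.left i _ rfl

lemma pt_rightPos (h : Chain.IsConcat s t u) (i : Fin (t.deg + 1)) :
    u.pt (rightPos h i) = t.pt i := h.right i _ rfl

lemma isConcat_chain (h : Chain.IsConcat s t u) (a : Lift c u.pt) :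
    Chain.IsConcat (a.chain s (leftPos h)) (a.chain t (rightPos h)) (a.chain u id) where
  deg_eq := h.deg_eq
  left _ _ e := congrArg a.fn (Fin.ext e)
  right _ _ e := congrArg a.fn (Fin.ext e)

lemma pt_id (u : Chain c.pt.base) (i : Fin (u.deg + 1)) : u.pt (id i) = u.pt i := rfl

/-- The 2-morphism on chains of letters given by a map of lifts. -/
abbrev chainHom {a b : Lift c u.pt} (g : a ⟶ b) (w : Chain c.pt.base)
    (r : Fin (w.deg + 1) → Fin (u.deg + 1)) :
    b.chain w r ⟶ (Chain.map (KSet.Hom.base (K.map g.1))).obj (a.chain w r) :=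
  chainMap (totMap (s := w) (r := r) g)

end Lift

open Lift

namespace DiagLaxity

variable (ℓ : DiagLaxity K) {s t u : Chain c.pt.base}

lemma lax_diag_map (h : Chain.IsConcat s t u) {a b : Lift c u.pt} (g : a ⟶ b) :
    (KSet.eval (K.map g.1) (chainHom g s (leftPos h)) ⊗ₘ
      KSet.eval (K.map g.1) (chainHom g t (rightPos h))) ≫ (ℓ.lax b.idx).lax (isConcat_chain h b) =
      (ℓ.lax a.idx).lax (isConcat_chain h a) ≫ KSet.eval (K.map g.1) (chainHom g u id) :=
  (ℓ.compat g.1).eval (isConcat_chain h a) (isConcat_chain h b) _ _ _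
    ⟨fun _ _ e => e, fun _ _ e => e⟩

/-- The cocone that defines the laxity maps of a colimit. -/
noncomputable def laxCocone (c : Cocone K) {s t u : Chain c.pt.base} (h : Chain.IsConcat s t u) :
    Cocone (tensorDiag (Lift.diag (c := c) (pt_leftPos h)) (Lift.diag (pt_rightPos h))) where
  pt := c.pt.fiber.obj (op u)
  ι :=
    { app := fun a => (ℓ.lax a.idx).lax (isConcat_chain h a) ≫
        KSet.eval (leg c a.idx) (overHom (pt_id u) a)
      naturality := fun a b g => by
        refine Eq.trans ?_ (Category.comp_id _).symm
        refine (Category.assoc _ _ _).symm.trans ?_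
        refine (congrArg (· ≫ KSet.eval (leg c b.idx) (overHom (pt_id u) b))
          (ℓ.lax_diag_map h g)).trans ?_
        refine (Category.assoc _ _ _).trans (congrArg (_ ≫ ·) ?_)
        exact KSet.eval_comp (leg_w c g.1) fun _ => rfl }

variable [HasTerminal M] [HasColimits M] (κ : Cardinal.{v}) [Fact κ.IsRegular]
  [IsCardinalFiltered J κ] (hc : IsColimit c)

/-- The laxity maps of a filtered colimit. -/
noncomputable def colimLax (h : Chain.IsConcat s t u) :
    c.pt.fiber.obj (op s) ⊗ c.pt.fiber.obj (op t) ⟶ c.pt.fiber.obj (op u) :=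
  have := isCardinalFiltered u.pt κ hc
  have := isFiltered_of_isCardinalFiltered (Lift c u.pt) κ
  have := IsFiltered.isSifted (C := Lift c u.pt)
  (isColimitTensorCocone (isColimitCocone κ hc (pt_leftPos h))
    (isColimitCocone κ hc (pt_rightPos h))).desc (ℓ.laxCocone c h)

lemma eval_overHom_colimLax (h : Chain.IsConcat s t u) (a : Lift c u.pt) :
    (KSet.eval (leg c a.idx) (overHom (pt_leftPos h) a) ⊗ₘ
      KSet.eval (leg c a.idx) (overHom (pt_rightPos h) a)) ≫ ℓ.colimLax κ hc h =
    (ℓ.lax a.idx).lax (isConcat_chain h a) ≫ KSet.eval (leg c a.idx) (overHom (pt_id u) a) :=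
  have := isCardinalFiltered u.pt κ hc
  have := isFiltered_of_isCardinalFiltered (Lift c u.pt) κ
  have := IsFiltered.isSifted (C := Lift c u.pt)
  (isColimitTensorCocone (isColimitCocone κ hc (pt_leftPos h))
    (isColimitCocone κ hc (pt_rightPos h))).fac (ℓ.laxCocone c h) a

/-- The compatibility of the laxity maps of a filtered colimit with those of the members of the
diagram: it holds for all chains of the members, since every such chain is dominated by the
lifts of a chain of the colimit. -/
lemma eval_colimLax (h : Chain.IsConcat s t u) {j : J} {s' t' u' : Chain (K.obj j).base}
    (h' : Chain.IsConcat s' t' u') (a : s ⟶ (Chain.map (KSet.Hom.base (leg c j))).obj s')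
    (b : t ⟶ (Chain.map (KSet.Hom.base (leg c j))).obj t')
    (d : u ⟶ (Chain.map (KSet.Hom.base (leg c j))).obj u') (H : Chain.IsHComp a b d) :
    (KSet.eval (leg c j) a ⊗ₘ KSet.eval (leg c j) b) ≫ ℓ.colimLax κ hc h =
      (ℓ.lax j).lax h' ≫ KSet.eval (leg c j) d := by
  obtain ⟨⟨l, φ⟩⟩ : Nonempty ((l : Lift c u.pt) × ((CostructuredArrow.mk (Y := (⟨j, u'⟩ : Tot K))
      d.op : CostructuredArrow (proj c) (op u)) ⟶ (toTot (pt_id u)).obj l)) := by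
    have := final_toTot κ hc (pt_id u)
    have hne : Nonempty (StructuredArrow (CostructuredArrow.mk (Y := (⟨j, u'⟩ : Tot K))
      d.op : CostructuredArrow (proj c) (op u)) (toTot (pt_id u))) := inferInstance
    exact hne.map fun x => ⟨x.right, x.hom⟩
  let g : j ⟶ l.idx := idxMap φ.left
  let d' : l.chain u id ⟶ (Chain.map (KSet.Hom.base (K.map g))).obj u' := chainMap φ.left
  have hd (k : Fin (u'.deg + 1)) : Chain.posOver d' k = Chain.posOver d k :=
    posOver_chainMap_left φ k
  have hl (k : Fin (u'.deg + 1)) : l.fn (Chain.posOver d k) =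
      KSet.Hom.base (K.map g) (u'.pt k) := by
    rw [← hd]
    exact Chain.pt_posOver d' k
  let p : Fin (s'.deg + 1) → Fin (s.deg + 1) := Chain.posOver a
  let q : Fin (t'.deg + 1) → Fin (t.deg + 1) := Chain.posOver b
  let m (i : Fin (s'.deg + 1)) : Fin (u'.deg + 1) := ⟨i, by have := h'.deg_eq; omega⟩
  let n (i : Fin (t'.deg + 1)) : Fin (u'.deg + 1) := ⟨s'.deg + i, by have := h'.deg_eq; omega⟩
  let a' : l.chain s (leftPos h) ⟶ (Chain.map (KSet.Hom.base (K.map g))).obj s' :=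
    Chain.mkOver p (Chain.Hom.strictMono (t := s) a)
      (Chain.Hom.pos_zero (t := s) a) (Chain.Hom.pos_last (t := s) a) fun i => by
        rw [← h'.left i (m i) rfl, ← hl]
        exact congrArg l.fn (Fin.ext (H.left i (m i) rfl).symm)
  let b' : l.chain t (rightPos h) ⟶ (Chain.map (KSet.Hom.base (K.map g))).obj t' :=
    Chain.mkOver q (Chain.Hom.strictMono (t := t) b)
      (Chain.Hom.pos_zero (t := t) b) (Chain.Hom.pos_last (t := t) b) fun i => by
        rw [← h'.right i (n i) rfl, ← hl]
        exact congrArg l.fn (Fin.ext (H.right i (n i) rfl).symm)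
  have H' : Chain.IsHComp a' b' d' :=
    ⟨fun i k e => (congrArg Fin.val (hd k)).trans (H.left i k e),
      fun i k e => (congrArg Fin.val (hd k)).trans (H.right i k e)⟩
  rw [← KSet.eval_comp (leg_w c g) (e := a') (e' := overHom (pt_leftPos h) l) (e'' := a)
      fun _ => rfl, ← KSet.eval_comp (leg_w c g) (e := b') (e' := overHom (pt_rightPos h) l)
      (e'' := b) fun _ => rfl, ← KSet.eval_comp (leg_w c g) (e := d')
      (e' := overHom (pt_id u) l) (e'' := d) fun k => (hd k).symm,
    ← tensorHom_comp_tensorHom_assoc, ℓ.eval_overHom_colimLax κ hc h l,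
    reassoc_of% (ℓ.compat g).eval h' (isConcat_chain h l) a' b' d' H']

lemma colimLax_hom_ext (κ : Cardinal.{v}) [Fact κ.IsRegular] [IsCardinalFiltered J κ]
    (hc : IsColimit c) {Z : M} (hst : Chain.IsConcat s t u)
    {f g : c.pt.fiber.obj (op s) ⊗ c.pt.fiber.obj (op t) ⟶ Z}
    (h : ∀ a : Lift c u.pt, (KSet.eval (leg c a.idx) (overHom (pt_leftPos hst) a) ⊗ₘ
      KSet.eval (leg c a.idx) (overHom (pt_rightPos hst) a)) ≫ f =
        (KSet.eval (leg c a.idx) (overHom (pt_leftPos hst) a) ⊗ₘ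
          KSet.eval (leg c a.idx) (overHom (pt_rightPos hst) a)) ≫ g) : f = g :=
  have := isCardinalFiltered u.pt κ hc
  have := isFiltered_of_isCardinalFiltered (Lift c u.pt) κ
  have := IsFiltered.isSifted (C := Lift c u.pt)
  (isColimitTensorCocone (isColimitCocone κ hc (pt_leftPos hst))
    (isColimitCocone κ hc (pt_rightPos hst))).hom_ext h

/-- A filtered colimit of pre-Co-Segal categories is a pre-Co-Segal category. -/
noncomputable def colimLaxity : Laxity c.pt where
  lax h := ℓ.colimLax κ hc h
  natural {s t u s' t' u'} h h' a b d H := by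
    refine colimLax_hom_ext κ hc h' fun l => ?_
    rw [tensorHom_comp_tensorHom_assoc, KSet.eval_map, KSet.eval_map,
      reassoc_of% ℓ.eval_overHom_colimLax κ hc h' l, KSet.eval_map]
    exact ℓ.eval_colimLax κ hc h (isConcat_chain h' l) _ _ _ ⟨H.left, H.right⟩
  assoc {r s t rs st u} h₁ h₂ h₃ h₄ := by
    have := isCardinalFiltered u.pt κ hc
    have := isFiltered_of_isCardinalFiltered (Lift c u.pt) κ
    have := IsFiltered.isSifted (C := Lift c u.pt)
    have hr (i) : u.pt (leftPos h₄ i) = r.pt i := pt_leftPos h₄ i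
    have hs (i) : u.pt (rightPos h₄ (leftPos h₃ i)) = s.pt i :=
      (pt_rightPos h₄ _).trans (pt_leftPos h₃ i)
    have ht (i) : u.pt (rightPos h₂ i) = t.pt i := pt_rightPos h₂ i
    refine (isColimitTensorCocone (isColimitTensorCocone (isColimitCocone κ hc hr)
      (isColimitCocone κ hc hs)) (isColimitCocone κ hc ht)).hom_ext fun l => ?_
    have k₁ : Chain.IsConcat (l.chain r (leftPos h₄)) (l.chain s (rightPos h₄ ∘ leftPos h₃))
        (l.chain rs (leftPos h₂)) :=
      ⟨h₁.deg_eq, fun _ _ e => congrArg l.fn (Fin.ext e), fun _ _ e => congrArg l.fn (Fin.ext e)⟩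
    have k₃ : Chain.IsConcat (l.chain s (rightPos h₄ ∘ leftPos h₃)) (l.chain t (rightPos h₂))
        (l.chain st (rightPos h₄)) :=
      ⟨h₃.deg_eq, fun _ _ e => congrArg l.fn (Fin.ext (congrArg (r.deg + ·) e)),
        fun j k e => congrArg l.fn (Fin.ext (by
          have := h₁.deg_eq
          change r.deg + (k : ℕ) = rs.deg + j
          change (k : ℕ) = s.deg + j at e
          omega))⟩
    exact comp_assoc
      (ℓ.eval_colimLax κ hc h₁ k₁ (overHom hr l) (overHom hs l) (overHom (pt_leftPos h₂) l)
        ⟨fun _ _ e => e, fun _ _ e => e⟩)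
      (ℓ.eval_colimLax κ hc h₂ (isConcat_chain h₂ l) (overHom (pt_leftPos h₂) l) (overHom ht l)
        (overHom (pt_id u) l) ⟨fun _ _ e => e, fun _ _ e => e⟩)
      (ℓ.eval_colimLax κ hc h₃ k₃ (overHom hs l) (overHom ht l) (overHom (pt_rightPos h₄) l)
        ⟨fun _ _ e => e, fun _ _ e => e⟩)
      (ℓ.eval_colimLax κ hc h₄ (isConcat_chain h₄ l) (overHom hr l) (overHom (pt_rightPos h₄) l)
        (overHom (pt_id u) l) ⟨fun _ _ e => e, fun _ _ e => e⟩)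
      ((ℓ.lax l.idx).assoc k₁ (isConcat_chain h₂ l) k₃ (isConcat_chain h₄ l))

lemma compat_leg (j : J) : (ℓ.lax j).Compat (ℓ.colimLaxity κ hc) (leg c j) := ⟨fun {s t u} h => by
  have := ℓ.eval_colimLax κ hc (h.map (KSet.Hom.base (leg c j))) h (𝟙 _) (𝟙 _) (𝟙 _)
    ⟨fun _ _ e => e, fun _ _ e => e⟩
  rw [KSet.eval_eq_app, KSet.eval_eq_app, KSet.eval_eq_app] at this
  exact this.symm⟩

lemma compat_desc {G : KSet M} (ℓ' : Laxity G) (σ : c.pt ⟶ G)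
    (hσ : ∀ j, (ℓ.lax j).Compat ℓ' (leg c j ≫ σ)) : (ℓ.colimLaxity κ hc).Compat ℓ' σ :=
  ⟨fun {s t u} h => by
    refine colimLax_hom_ext κ hc h fun l => ?_
    have key {w : Chain c.pt.base} {r : Fin (w.deg + 1) → Fin (u.deg + 1)}
        (hr : ∀ i, u.pt (r i) = w.pt i) :
        KSet.eval (leg c l.idx) (overHom hr l) ≫ (KSet.Hom.fiber σ).app (op w) =
          KSet.eval (leg c l.idx ≫ σ) ((Chain.map (KSet.Hom.base σ)).map (overHom hr l)) := by
      rw [← KSet.eval_eq_app σ (𝟙 _)]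
      exact KSet.eval_comp rfl fun _ => rfl
    change _ ≫ ℓ.colimLax κ hc h ≫ _ = _
    rw [reassoc_of% ℓ.eval_overHom_colimLax κ hc h l, tensorHom_comp_tensorHom_assoc, key, key, key]
    exact ((hσ l.idx).eval (isConcat_chain h l) (h.map _) _ _ _
      ⟨fun _ _ e => e, fun _ _ e => e⟩).symm⟩

end DiagLaxity

end

section

variable {J : Type v} [SmallCategory J]

/-- The laxity maps of the members of a diagram of pre-Co-Segal categories. -/
def MSet.diagLaxity (K : J ⥤ MSet M) : DiagLaxity (K ⋙ forgetLaxSet M) where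
  lax j := (K.obj j).laxity
  compat g := MSet.compat (K.map g)

variable [HasTerminal M] [HasColimits M]

/-- The forgetful functor preserves filtered colimits. -/
lemma preservesColimit_forgetLaxSet (κ : Cardinal.{v}) [Fact κ.IsRegular] [IsCardinalFiltered J κ]
    (K : J ⥤ MSet M) [HasColimit (K ⋙ forgetLaxSet M)] : PreservesColimit K (forgetLaxSet M) := by
  let c : Cocone (K ⋙ forgetLaxSet M) := colimit.cocone _
  have hc : IsColimit c := colimit.isColimit _
  let ℓ := MSet.diagLaxity K
  let t : Cocone K :=
    { pt := (ℓ.colimLaxity κ hc).toMSet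
      ι :=
        { app := fun j => MSet.homMk (Tot.leg c j) (ℓ.compat_leg κ hc j)
          naturality := fun i j g => MSet.forgetLaxSet_map_injective
            (((forgetLaxSet M).map_comp _ _).trans (c.ι.naturality g)) } }
  have ht : IsColimit t :=
    { desc := fun s => MSet.homMk (F := t.pt) (hc.desc ((forgetLaxSet M).mapCocone s))
        (ℓ.compat_desc κ hc s.pt.laxity (hc.desc ((forgetLaxSet M).mapCocone s)) fun j => by
          have h := hc.fac ((forgetLaxSet M).mapCocone s) j
          rw [h]
          exact MSet.compat (s.ι.app j))
      fac := fun s j => MSet.forgetLaxSet_map_injective (((forgetLaxSet M).map_comp _ _).trans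
        (hc.fac ((forgetLaxSet M).mapCocone s) j))
      uniq := fun s m hm => MSet.forgetLaxSet_map_injective
        (hc.uniq ((forgetLaxSet M).mapCocone s) ((forgetLaxSet M).map m) fun j =>
          ((forgetLaxSet M).map_comp (t.ι.app j) m).symm.trans
            (congrArg (forgetLaxSet M).map (hm j))) }
  exact preservesColimit_of_preserves_colimit_cocone ht hc

end

/-! ### Local presentability of `M_𝒮(Set)` and cofibrant generation -/

variable {M : Type u} [Category.{v} M]

lemma KSet.bijective_of_isIso {F G : KSet M} (σ : F ⟶ G) [IsIso σ] :
    Function.Bijective (KSet.Hom.base σ) :=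
  Function.bijective_iff_has_inverse.2 ⟨KSet.Hom.base (inv σ),
    fun x => congrFun (congrArg KSet.Hom.base (IsIso.hom_inv_id σ)) x,
    fun x => congrFun (congrArg KSet.Hom.base (IsIso.inv_hom_id σ)) x⟩

lemma KSet.isIso_fiber {F G : KSet M} (σ : F ⟶ G) [IsIso σ] : IsIso (KSet.Hom.fiber σ) := by
  have (w : (Chain F.base)ᵒᵖ) : IsIso ((KSet.Hom.fiber σ).app w) := by
    induction w using Opposite.rec with | _ w
    let e : w ⟶ (Chain.map (KSet.Hom.base (inv σ))).obj ((Chain.map (KSet.Hom.base σ)).obj w) :=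
      Chain.mkOver id strictMono_id rfl rfl fun i =>
        (congrFun (congrArg KSet.Hom.base (IsIso.hom_inv_id σ)) (w.pt i)).symm
    refine ⟨KSet.eval (inv σ) e, ?_, ?_⟩
    · exact (congrArg (· ≫ KSet.eval (inv σ) e) (KSet.eval_eq_app σ (𝟙 _)).symm).trans
        ((KSet.eval_comp (IsIso.hom_inv_id σ) (e := 𝟙 _) (e' := e) (e'' := Chain.idOver rfl w)
          fun i => Chain.posOver_idOver (f := id) rfl w i).trans (KSet.eval_eq_id rfl _))
    · exact (congrArg (KSet.eval (inv σ) e ≫ ·) (KSet.eval_eq_app σ (𝟙 _)).symm).trans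
        ((KSet.eval_comp (IsIso.inv_hom_id σ) (e := e) (e' := 𝟙 _) (e'' := Chain.idOver rfl _)
          fun i => Chain.posOver_idOver (f := id) rfl _ i).trans (KSet.eval_eq_id rfl _))
  exact NatIso.isIso_of_isIso_app _

variable [MonoidalCategory M]

lemma isIso_set {F G : MSet M} (σ : F ⟶ G) (hf : Function.Bijective (MSet.Hom.base σ))
    [IsIso (MSet.Hom.fiber σ)] : IsIso σ := by
  have := (setFibration M).isIso_map_comp_cart (F := F.fiber) (G := G.fiber) hf
    (MSet.Hom.fiber σ)
  rwa [setFibration_map_comp_cart] at this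

section

variable (M) [∀ X : Type v, (forgetLax M X).IsRightAdjoint]

/-- Morphisms from a free object. -/
noncomputable def freeSetEquiv (F : KSet M) (G : MSet M) :
    ((⟨F.base, (forgetLax M F.base).leftAdjoint.obj F.fiber⟩ : MSet M) ⟶ G) ≃
      (F ⟶ (forgetLaxSet M).obj G) where
  toFun σ := KSet.Hom.mk (MSet.Hom.base σ)
    ((Adjunction.ofIsRightAdjoint (forgetLax M F.base)).homEquiv _ _ (MSet.Hom.fiber σ))
  invFun τ := MSet.Hom.mk (KSet.Hom.base τ)
    (((Adjunction.ofIsRightAdjoint (forgetLax M F.base)).homEquiv F.fiber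
      ((pullback M (KSet.Hom.base τ)).obj G.fiber)).symm (KSet.Hom.fiber τ))
  left_inv σ := by
    obtain ⟨f, φ⟩ := σ
    exact congrArg (MSet.Hom.mk f) (Equiv.symm_apply_apply
      ((Adjunction.ofIsRightAdjoint (forgetLax M F.base)).homEquiv F.fiber
        ((pullback M f).obj G.fiber)) φ)
  right_inv τ := by
    obtain ⟨f, φ⟩ := τ
    exact congrArg (KSet.Hom.mk f) (Equiv.apply_symm_apply
      ((Adjunction.ofIsRightAdjoint (forgetLax M F.base)).homEquiv F.fiber
        ((pullback M f).obj G.fiber)) φ)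

/-- The left adjoint of the forgetful functor: the free functor in each fibre. -/
noncomputable def freeSetAdjunction :
    Adjunction.leftAdjointOfEquiv (freeSetEquiv M) (fun F G G' g σ => by
      change KSet.Hom.mk _ _ = KSet.Hom.mk _ _
      congr 1
      exact Adjunction.homEquiv_naturality_right _ _ _) ⊣ forgetLaxSet M :=
  Adjunction.adjunctionOfEquivLeft _ _

end

variable [SymmetricCategory M] [MonoidalClosed M]

instance : (forgetLaxSet M).ReflectsIsomorphisms where
  reflects {F G} σ _ := by
    have h₁ := KSet.bijective_of_isIso ((forgetLaxSet M).map σ)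
    have h₂ : IsIso ((forgetLax M F.base).map (MSet.Hom.fiber σ)) :=
      KSet.isIso_fiber ((forgetLaxSet M).map σ)
    have := isIso_of_reflects_iso (MSet.Hom.fiber σ) (forgetLax M F.base)
    exact isIso_set σ h₁

variable [HasColimits M] [HasTerminal M]

lemma isCardinalAccessible_forgetLaxSet (κ : Cardinal.{v}) [Fact κ.IsRegular] :
    (forgetLaxSet M).IsCardinalAccessible κ where
  preservesColimitOfShape _ _ _ := ⟨fun {K} =>
    have : HasColimits (KSet M) := (kSetFibration M).hasColimits
    preservesColimit_forgetLaxSet κ K⟩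

/-- The category `M_𝒮(Set)` is locally presentable when `M` is: since the forgetful functor to
`𝒦_Set` is accessible and conservative, the free functor sends a strong generator of presentable
objects to another one. -/
theorem isCardinalLocallyPresentable_set (κ : Cardinal.{v}) [Fact κ.IsRegular]
    (hκ : IsCardinalLocallyPresentable M κ) : IsCardinalLocallyPresentable (MSet M) κ := by
  have : HasColimits (MSet M) := (setFibration M).hasColimits
  have := isCardinalLocallyPresentable_kSet κ hκ
  have := isCardinalAccessible_forgetLaxSet (M := M) κ
  obtain ⟨P, _, hP, hP'⟩ := (IsCardinalLocallyPresentable.iff_exists_isStrongGenerator (KSet M) κ).1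
    inferInstance
  refine (IsCardinalLocallyPresentable.iff_exists_isStrongGenerator _ κ).2
    ⟨_, inferInstance, isStrongGenerator_strictMap hP (freeSetAdjunction M), ?_⟩
  rintro _ ⟨A, hA⟩
  have : IsCardinalPresentable A κ := hP' _ hA
  exact (freeSetAdjunction M).isCardinalPresentable_leftAdjoint_obj κ A

theorem isLocallyPresentable_kSet (hM : IsLocallyPresentable.{v} M) :
    IsLocallyPresentable.{v} (KSet M) :=
  have ⟨κ, hκ, h⟩ := hM.exists_cardinal
  ⟨κ, hκ, isCardinalLocallyPresentable_kSet κ h⟩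

theorem isLocallyPresentable_set (hM : IsLocallyPresentable.{v} M) :
    IsLocallyPresentable.{v} (MSet M) :=
  have ⟨κ, hκ, h⟩ := hM.exists_cardinal
  ⟨κ, hκ, isCardinalLocallyPresentable_set κ h⟩

lemma AreGenerating.isCofibrantlyGeneratedBy {C : Type*} [Category.{v} C]
    [IsLocallyPresentable.{v} C] {W Fib I J : MorphismProperty C} (h : AreGenerating W Fib I J) :
    IsCofibrantlyGeneratedBy W Fib I J where
  toAreGenerating := h
  smallObject_I :=
    have := h.isSmall_I
    hasSmallObjectArgument_of_isLocallyPresentable I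
  smallObject_J :=
    have := h.isSmall_J
    hasSmallObjectArgument_of_isLocallyPresentable J

end CoSegal

theorem mainTheorem8 {M : Type u} [Category.{v} M] [MonoidalCategory M] [SymmetricCategory M]
    [MonoidalClosed M] [ModelCategory M] [HasLimits M] [HasColimits M]
    (hM : CoSegal.IsMonoidalModelCategory M) (hcof : ∀ A : M, IsCofibrant A) :
    ∃ (_ : ∀ X : Type v, (CoSegal.forgetLax M X).IsRightAdjoint)
      (_ : ∀ {X Y : Type v} (f : X → Y), (CoSegal.pullback M f).IsRightAdjoint)
      (_ : ∀ {X Y : Type v} (f : X → Y), (CoSegal.kPullback M f).IsRightAdjoint),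
      -- the projective model structures on the fibres
      (∀ X : Type v, CoSegal.IsModelStructure (CoSegal.weq M X) (CoSegal.cof M X)
        (CoSegal.fib M X)) ∧
      (∀ X : Type v, CoSegal.IsModelStructure (CoSegal.kWeq M X) (CoSegal.kCof M X)
        (CoSegal.kFib M X)) ∧
      -- the fibered projective model structures
      CoSegal.IsModelStructure (CoSegal.setWeq M) (CoSegal.setCof M) (CoSegal.setFib M) ∧
      CoSegal.IsModelStructure (CoSegal.kSetWeq M) (CoSegal.kSetCof M) (CoSegal.kSetFib M) ∧
      -- the generating sets
      (∀ I J : MorphismProperty M,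
        CoSegal.AreGenerating (weakEquivalences M) (fibrations M) I J →
        CoSegal.AreGenerating (CoSegal.setWeq M) (CoSegal.setFib M)
          (CoSegal.hGen M I ⊔ CoSegal.objGen M) (CoSegal.hGen M J) ∧
        CoSegal.AreGenerating (CoSegal.kSetWeq M) (CoSegal.kSetFib M)
          (CoSegal.deltaGen M I ⊔ CoSegal.kObjGen M) (CoSegal.deltaGen M J) ∧
        (∀ {F G : CoSegal.MSet M} (σ : F ⟶ G), (CoSegal.hGen M I).rlp σ ↔
          (CoSegal.fib M F.base ⊓ CoSegal.weq M F.base) (CoSegal.MSet.Hom.fiber σ)) ∧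
        (∀ {F G : CoSegal.KSet M} (σ : F ⟶ G), (CoSegal.deltaGen M I).rlp σ ↔
          (CoSegal.kFib M F.base ⊓ CoSegal.kWeq M F.base) (CoSegal.KSet.Hom.fiber σ))) ∧
      -- the combinatorial case
      (IsLocallyPresentable.{v} M →
        IsLocallyPresentable.{v} (CoSegal.MSet M) ∧ IsLocallyPresentable.{v} (CoSegal.KSet M) ∧
        ∀ I J : MorphismProperty M,
          CoSegal.IsCofibrantlyGeneratedBy (weakEquivalences M) (fibrations M) I J →
          CoSegal.IsCofibrantlyGeneratedBy (CoSegal.setWeq M) (CoSegal.setFib M)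
            (CoSegal.hGen M I ⊔ CoSegal.objGen M) (CoSegal.hGen M J) ∧
          CoSegal.IsCofibrantlyGeneratedBy (CoSegal.kSetWeq M) (CoSegal.kSetFib M)
            (CoSegal.deltaGen M I ⊔ CoSegal.kObjGen M) (CoSegal.deltaGen M J)) := by
  refine ⟨fun X => CoSegal.isRightAdjoint_forgetLax X, fun f => CoSegal.isRightAdjoint_pullback f,
    fun f => CoSegal.isRightAdjoint_kPullback f, fun X => CoSegal.isModelStructure_preCat hM hcof,
    fun X => CoSegal.isModelStructure_kDiag M X, CoSegal.isModelStructure_set hM hcof,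
    CoSegal.isModelStructure_kSet M, fun I J h => ⟨CoSegal.areGenerating_set M h,
      CoSegal.areGenerating_kSet M h, fun σ => ?_, fun σ => ?_⟩, fun hLP => ?_⟩
  · rw [CoSegal.rlp_hGen_iff, CoSegal.rlp_deltaGen_iff, ← h.trivialFib_eq]
    exact forall_and
  · rw [CoSegal.rlp_deltaGen_iff, ← h.trivialFib_eq]
    exact forall_and
  · have h₁ := CoSegal.isLocallyPresentable_set hLP
    have h₂ := CoSegal.isLocallyPresentable_kSet hLP
    exact ⟨h₁, h₂, fun I J h =>
      ⟨(CoSegal.areGenerating_set M h.toAreGenerating).isCofibrantlyGeneratedBy,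
        (CoSegal.areGenerating_kSet M h.toAreGenerating).isCofibrantlyGeneratedBy⟩⟩
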